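/- Let $k$ be a nonzero commutative ring and $A$ a Hopf algebra over $k$ that is flat as a $k$-module. Write $\otimes=\otimes_k$, $*$ for convolution, and use Sweedler notation. **Lazy cohomology.** $\mathrm{Reg}^1(A)$ is the group of convolution invertible linear maps $\mu:A\to k$ with $\mu(1)=1$; $\mathrm{Reg}^2(A)$ is the group of convolution invertible linear maps $\sigma:A\otimes A\to k$ with $\sigma(a,1)=\varepsilon(a)=\sigma(1,a)$. The element $\mu$ is lazy if $\mu*\mathrm{id}_A=\mathrm{id}_A*\mu$, and $\sigma$ is lazy if $\sigma(a_1,b_1)a_2b_2=\sigma(a_2,b_2)a_1b_1$; the lazy elements form subgroups $\mathrm{Reg}^1_L(A)$, $\mathrm{Reg}^2_L(A)$. $Z^2_L(A)$ is the group of lazy $\sigma$ with $\sigma(a_1,b_1)\sigma(a_2b_2,c)=\sigma(b_1,c_1)\sigma(a,b_2c_2)$. Put $\partial\mu(a,b)=\mu(a_1)\mu(b_1)\mu^{-1}(a_2b_2)$ and $H^2_L(A)=Z^2_L(A)/\partial(\mathrm{Reg}^1_L(A))$. **Automorphisms.** For $\gamma\in\mathrm{Reg}^1(A)$ put $\mathrm{ad}(\gamma)=\gamma^{-1}*\mathrm{id}_A*\gamma$.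 Let $\mathrm{Reg}^1_{aL}(A)=\{\gamma\in\mathrm{Reg}^1(A):\partial\gamma\in\mathrm{Reg}^2_L(A)\}$; for such $\gamma$ the map $\mathrm{ad}(\gamma)$ is a Hopf algebra automorphism. $\mathrm{CoInn}(A)$ is the normal subgroup of $\mathrm{Aut}_{\rm Hopf}(A)$ of all automorphisms $(\phi\circ S)*\mathrm{id}_A*\phi$ with $\phi:A\to k$ an algebra map; $\mathrm{CoOut}(A)=\mathrm{Aut}_{\rm Hopf}(A)/\mathrm{CoInn}(A)$ and $\mathrm{CoOut}^-(A)=\mathrm{Reg}^1_{aL}(A)/\mathrm{ad}^{-1}(\mathrm{CoInn}(A))$. $\mathrm{CoOut}(A)$ acts on the right on $H^2_L(A)$ by $\bar\sigma\leftarrow\bar\alpha=\overline{\sigma\circ(\alpha\otimes\alpha)}$, and $\mathrm{CoOut}(A)\ltimes H^2_L(A)$ has the product $(\bar\alpha,\bar\sigma)(\bar\beta,\bar\omega)=(\bar\alpha\bar\beta,(\bar\sigma\leftarrow\bar\beta)\,\bar\omega)$. **BiGalois objects.** An $A$-biGalois object is a nonzero $A$-bicomodule algebra $Z$ whose left and right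 coinvariants are both $k$ and for which the maps $Z\otimes Z\to A\otimes Z$, $x\otimes y\mapsto x_{(-1)}\otimes x_{(0)}y$, and $Z\otimes Z\to Z\otimes A$, $x\otimes y\mapsto xy_{(0)}\otimes y_{(1)}$, are bijective. $\mathrm{BiGal}(A)$ is the set of isomorphism classes (for bicolinear algebra isomorphisms) of $k$-faithfully flat $A$-biGalois objects. For $\alpha\in\mathrm{Aut}_{\rm Hopf}(A)$ and $\sigma\in Z^2_L(A)$, ${}^\alpha A(\sigma)$ is the module $A$ with product $a\cdot b=\sigma(a_1,b_1)a_2b_2$, right coaction $\Delta$ and left coaction $(\alpha\otimes\mathrm{id})\circ\Delta$. **Theorem.** The cotensor product $[Z][T]=[Z\,\square_A\,T]$ makes $\mathrm{BiGal}(A)$ a group. Every ${}^\alpha A(\sigma)$ is a $k$-faithfully flat $A$-biGalois object, and there is an exact sequence of groups $$1\longrightarrow \mathrm{CoOut}^-(A)\xrightarrow{\ \iota\ }\mathrm{CoOut}(A)\ltimes H^2_L(A)\xrightarrow{\ \Upsilon\ }\mathrm{BiGal}(A)$$ with $\iota(\bar\gamma)=(\overline{\mathrm{ad}(\gamma)},\overline{\partial(\gamma^{-1})})$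 for $\gamma\in\mathrm{Reg}^1_{aL}(A)$ and $\Upsilon(\bar\alpha,\bar\sigma)=[{}^\alpha A(\sigma)]$ for $\alpha\in\mathrm{Aut}_{\rm Hopf}(A)$, $\sigma\in Z^2_L(A)$. -/

import Mathlib

open TensorProduct WithConv

noncomputable section

namespace LazyCoh

section Convolution

variable {k : Type*} [CommRing k]
variable {C D : Type*} [AddCommGroup C] [Module k C] [Coalgebra k C]
  [AddCommGroup D] [Module k D] [Coalgebra k D]
variable {B B' : Type*} [Ring B] [Algebra k B] [Ring B'] [Algebra k B']

/-- Precomposition with a coalgebra map `θ : C → D`, a morphism of convolution monoids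
`Hom(D, B) → Hom(C, B)`. -/
def pull (θ : C →ₗc[k] D) : WithConv (D →ₗ[k] B) →* WithConv (C →ₗ[k] B) where
  toFun f := toConv (f.ofConv ∘ₗ θ.toLinearMap)
  map_one' := by
    ext c
    simp
  map_mul' f g := by
    have := LinearMap.convMul_comp_coalgHom_distrib f g θ
    exact WithConv.ext this

@[simp] theorem pull_apply (θ : C →ₗc[k] D) (f : WithConv (D →ₗ[k] B)) (c : C) :
    pull θ f c = f (θ c) := rfl

/-- Postcomposition with an algebra map `h : B → B'`, a morphism of convolution monoids
`Hom(C, B) → Hom(C, B')`. -/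
def push (h : B →ₐ[k] B') : WithConv (C →ₗ[k] B) →* WithConv (C →ₗ[k] B') where
  toFun f := toConv (h.toLinearMap ∘ₗ f.ofConv)
  map_one' := by
    ext c
    simp
  map_mul' f g := by
    have := LinearMap.algHom_comp_convMul_distrib h f g
    exact WithConv.ext this

@[simp] theorem push_apply (h : B →ₐ[k] B') (f : WithConv (C →ₗ[k] B)) (c : C) :
    push h f c = h (f c) := rfl

variable (B) in
/-- A linear form `f : C → k`, seen as the map `c ↦ f(c) 1` with values in the algebra `B`. -/
def sc : WithConv (C →ₗ[k] k) →* WithConv (C →ₗ[k] B) := push (Algebra.ofId k B)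

@[simp] theorem sc_apply (f : WithConv (C →ₗ[k] k)) (c : C) :
    sc B f c = algebraMap k B (f c) := rfl

theorem pull_sc (θ : C →ₗc[k] D) (f : WithConv (D →ₗ[k] k)) :
    pull θ (sc B f) = sc B (pull θ f) := rfl

theorem push_sc (h : B →ₐ[k] B') (f : WithConv (C →ₗ[k] k)) : push h (sc B f) = sc B' f := by
  ext c
  simp

theorem pull_push (θ : C →ₗc[k] D) (h : B →ₐ[k] B') (f : WithConv (D →ₗ[k] B)) :
    pull θ (push h f) = push h (pull θ f) := rfl

theorem comp_sc_mul (h : B →ₗ[k] B') (f : WithConv (C →ₗ[k] k)) (g : WithConv (C →ₗ[k] B)) :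
    toConv (h ∘ₗ (sc B f * g).ofConv) = sc B' f * toConv (h ∘ₗ g.ofConv) := by
  ext c
  change h ((sc B f * g) c) = (sc B' f * toConv (h ∘ₗ g.ofConv)) c
  rw [(Coalgebra.Repr.arbitrary k c).convMul_apply, (Coalgebra.Repr.arbitrary k c).convMul_apply]
  simp [← Algebra.smul_def]

theorem comp_mul_sc (h : B →ₗ[k] B') (f : WithConv (C →ₗ[k] k)) (g : WithConv (C →ₗ[k] B)) :
    toConv (h ∘ₗ (g * sc B f).ofConv) = toConv (h ∘ₗ g.ofConv) * sc B' f := by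
  ext c
  change h ((g * sc B f) c) = (toConv (h ∘ₗ g.ofConv) * sc B' f) c
  rw [(Coalgebra.Repr.arbitrary k c).convMul_apply, (Coalgebra.Repr.arbitrary k c).convMul_apply]
  simp [← Algebra.commutes, ← Algebra.smul_def]

theorem sc_self (f : WithConv (C →ₗ[k] k)) : sc k f = f := rfl

theorem commute_comp (h : B →ₗ[k] B') {f : WithConv (C →ₗ[k] k)} {g : WithConv (C →ₗ[k] B)}
    (H : Commute (sc B f) g) : Commute (sc B' f) (toConv (h ∘ₗ g.ofConv)) := by
  have : sc B f * g = g * sc B f := H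
  change _ * _ = _ * _
  rw [← comp_sc_mul, ← comp_mul_sc, this]

variable (k C D) in
/-- The coalgebra map `c ⊗ d ↦ ε(d) c`. -/
def fst : C ⊗[k] D →ₗc[k] C :=
  (Coalgebra.TensorProduct.rid k k C : C ⊗[k] k →ₗc[k] C).comp
    (Coalgebra.TensorProduct.map (CoalgHom.id k C) (Coalgebra.counitCoalgHom k D))

variable (k C D) in
/-- The coalgebra map `c ⊗ d ↦ ε(c) d`. -/
def snd : C ⊗[k] D →ₗc[k] D :=
  (Coalgebra.TensorProduct.lid k D : k ⊗[k] D →ₗc[k] D).comp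
    (Coalgebra.TensorProduct.map (Coalgebra.counitCoalgHom k C) (CoalgHom.id k D))

@[simp] theorem fst_tmul (c : C) (d : D) :
    fst k C D (c ⊗ₜ d) = Coalgebra.counit (R := k) d • c := rfl

@[simp] theorem snd_tmul (c : C) (d : D) :
    snd k C D (c ⊗ₜ d) = Coalgebra.counit (R := k) c • d := rfl

theorem fst_mul_snd (f : WithConv (C →ₗ[k] B)) (g : WithConv (D →ₗ[k] B)) (c : C) (d : D) :
    (pull (fst k C D) f * pull (snd k C D) g) (c ⊗ₜ d) = f c * g d := by
  have key : ∀ (x : C ⊗[k] C) (y : D ⊗[k] D),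
      LinearMap.mul' k B (TensorProduct.map (pull (fst k C D) f).ofConv (pull (snd k C D) g).ofConv
        (AlgebraTensorModule.tensorTensorTensorComm k k k k C C D D (x ⊗ₜ y))) =
      f (TensorProduct.rid k C (LinearMap.lTensor C Coalgebra.counit x)) *
        g (TensorProduct.lid k D (LinearMap.rTensor D Coalgebra.counit y)) := by
    intro x y
    induction x with
    | zero => simp
    | add x x' hx hx' => simp only [add_tmul, map_add, hx, hx', add_mul]
    | tmul c₁ c₂ =>
      induction y with
      | zero => simp
      | add y y' hy hy' => simp only [tmul_add, map_add, hy, hy', mul_add]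
      | tmul d₁ d₂ => simp [smul_smul, mul_comm]
  have := key (Coalgebra.comul c) (Coalgebra.comul d)
  rw [Coalgebra.lTensor_counit_comul, Coalgebra.rTensor_counit_comul] at this
  simpa using this

theorem snd_mul_fst (f : WithConv (C →ₗ[k] B)) (g : WithConv (D →ₗ[k] B)) (c : C) (d : D) :
    (pull (snd k C D) g * pull (fst k C D) f) (c ⊗ₜ d) = g d * f c := by
  have key : ∀ (x : C ⊗[k] C) (y : D ⊗[k] D),
      LinearMap.mul' k B (TensorProduct.map (pull (snd k C D) g).ofConv (pull (fst k C D) f).ofConv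
        (AlgebraTensorModule.tensorTensorTensorComm k k k k C C D D (x ⊗ₜ y))) =
      g (TensorProduct.rid k D (LinearMap.lTensor D Coalgebra.counit y)) *
        f (TensorProduct.lid k C (LinearMap.rTensor C Coalgebra.counit x)) := by
    intro x y
    induction x with
    | zero => simp
    | add x x' hx hx' => simp only [add_tmul, map_add, hx, hx', mul_add]
    | tmul c₁ c₂ =>
      induction y with
      | zero => simp
      | add y y' hy hy' => simp only [tmul_add, map_add, hy, hy', add_mul]
      | tmul d₁ d₂ => simp [smul_smul, mul_comm]
  have := key (Coalgebra.comul c) (Coalgebra.comul d)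
  rw [Coalgebra.lTensor_counit_comul, Coalgebra.rTensor_counit_comul] at this
  simpa using this

theorem conv_ext {C D B : Type*} [AddCommGroup C] [Module k C] [AddCommGroup D] [Module k D]
    [AddCommGroup B] [Module k B] {f g : WithConv (C ⊗[k] D →ₗ[k] B)} (h : ∀ c d, f (c ⊗ₜ d) = g (c ⊗ₜ d)) :
    f = g :=
  WithConv.ext (TensorProduct.ext' h)

theorem commute_legs (f : WithConv (C →ₗ[k] B)) (g : WithConv (D →ₗ[k] B))
    (h : ∀ c d, Commute (f c) (g d)) :
    Commute (pull (fst k C D) f) (pull (snd k C D) g) := by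
  refine conv_ext fun c d => ?_
  rw [fst_mul_snd, snd_mul_fst]
  exact h c d

theorem commute_legs_left (f : WithConv (C →ₗ[k] k)) (g : WithConv (D →ₗ[k] B)) :
    Commute (pull (fst k C D) (sc B f)) (pull (snd k C D) g) :=
  commute_legs _ _ fun _ _ => Algebra.commutes _ _

theorem commute_legs_right (f : WithConv (C →ₗ[k] B)) (g : WithConv (D →ₗ[k] k)) :
    Commute (pull (fst k C D) f) (pull (snd k C D) (sc B g)) :=
  commute_legs _ _ fun _ _ => (Algebra.commutes _ _).symm

theorem map_eq_legs (f : C →ₗ[k] B) (g : D →ₗ[k] B') :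
    toConv (TensorProduct.map f g) =
      pull (fst k C D) (push Algebra.TensorProduct.includeLeft (toConv f)) *
        pull (snd k C D) (push Algebra.TensorProduct.includeRight (toConv g)) := by
  refine conv_ext fun c d => ?_
  rw [fst_mul_snd]
  simp

theorem map_comp_comul (f : C →ₗ[k] B) (g : C →ₗ[k] B') :
    toConv (TensorProduct.map f g ∘ₗ Coalgebra.comul) =
      push Algebra.TensorProduct.includeLeft (toConv f) *
        push Algebra.TensorProduct.includeRight (toConv g) := by
  ext c
  rw [LinearMap.convMul_apply]
  simp only [LinearMap.comp_apply]
  induction Coalgebra.comul (R := k) c with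
  | zero => simp
  | add x y hx hy => simp only [map_add, hx, hy]
  | tmul x y => simp

theorem commute_comp_map_left (ω : B ⊗[k] B' →ₗ[k] k) {f : WithConv (C →ₗ[k] k)}
    {g : C →ₗ[k] B} (H : Commute (sc B f) (toConv g)) (h : D →ₗ[k] B') :
    Commute (pull (fst k C D) f) (toConv (ω ∘ₗ TensorProduct.map g h)) := by
  refine commute_comp (g := toConv (TensorProduct.map g h)) ω (f := pull (fst k C D) f) ?_
  rw [map_eq_legs]
  refine Commute.mul_right ?_ (commute_legs_left _ _)
  have := (H.map (push (Algebra.TensorProduct.includeLeft : B →ₐ[k] B ⊗[k] B'))).map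
    (pull (fst k C D))
  rwa [push_sc, pull_sc] at this

theorem commute_comp_map_right (ω : B ⊗[k] B' →ₗ[k] k) {f : WithConv (D →ₗ[k] k)}
    (g : C →ₗ[k] B) {h : D →ₗ[k] B'} (H : Commute (sc B' f) (toConv h)) :
    Commute (pull (snd k C D) f) (toConv (ω ∘ₗ TensorProduct.map g h)) := by
  refine commute_comp (g := toConv (TensorProduct.map g h)) ω (f := pull (snd k C D) f) ?_
  rw [map_eq_legs]
  refine Commute.mul_right (commute_legs_right _ _).symm ?_
  have := (H.map (push (Algebra.TensorProduct.includeRight : B' →ₐ[k] B ⊗[k] B'))).map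
    (pull (snd k C D))
  rwa [push_sc, pull_sc] at this

theorem map_sc_mul_left (f : WithConv (C →ₗ[k] k)) (g : WithConv (C →ₗ[k] B))
    (h : D →ₗ[k] B') :
    toConv (TensorProduct.map (sc B f * g).ofConv h) =
      sc (B ⊗[k] B') (pull (fst k C D) f) * toConv (TensorProduct.map g.ofConv h) := by
  rw [map_eq_legs, map_eq_legs, toConv_ofConv, toConv_ofConv, map_mul, map_mul, push_sc, pull_sc,
    mul_assoc]

theorem map_sc_mul_right (f : WithConv (D →ₗ[k] k)) (g : C →ₗ[k] B)
    (h : WithConv (D →ₗ[k] B')) :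
    toConv (TensorProduct.map g (sc B' f * h).ofConv) =
      sc (B ⊗[k] B') (pull (snd k C D) f) * toConv (TensorProduct.map g h.ofConv) := by
  rw [map_eq_legs, map_eq_legs, toConv_ofConv, toConv_ofConv, map_mul, map_mul, push_sc,
    ← mul_assoc, (commute_legs_right _ _).eq, pull_sc, mul_assoc]

end Convolution

section Cochains

variable (k A : Type*) [CommRing k] [Ring A] [HopfAlgebra k A]

/-- The group of convolution invertible linear forms on a coalgebra. -/
abbrev InvForm (C : Type*) [AddCommGroup C] [Module k C] [Coalgebra k C] : Type _ :=
  (WithConv (C →ₗ[k] k))ˣ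

variable {k} in
/-- Composition of invertible linear forms with a coalgebra map. -/
def upull {C D : Type*} [AddCommGroup C] [Module k C] [Coalgebra k C]
    [AddCommGroup D] [Module k D] [Coalgebra k D] (θ : C →ₗc[k] D) :
    InvForm k D →* InvForm k C :=
  Units.map (pull θ)

/-- The identity map, as an element of the convolution algebra `Hom(A, A)`. -/
def idm : WithConv (A →ₗ[k] A) := toConv LinearMap.id

/-- The product, as an element of the convolution algebra `Hom(A ⊗ A, A)`. -/
def mulm : WithConv (A ⊗[k] A →ₗ[k] A) := toConv (LinearMap.mul' k A)

/-- The product, as a coalgebra map. -/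
abbrev mulC : A ⊗[k] A →ₗc[k] A := Bialgebra.mulCoalgHom k A

theorem mulC_tmul (a b : A) : mulC k A (a ⊗ₜ b) = a * b := by
  simp

/-- The coalgebra map `a ↦ a ⊗ 1`. -/
def inl : A →ₗc[k] A ⊗[k] A where
  toLinearMap := (TensorProduct.mk k A A).flip 1
  counit_comp := by
    ext a
    simp
  map_comp_comul := by
    ext a
    simp only [LinearMap.comp_apply, LinearMap.flip_apply, TensorProduct.mk_apply,
      TensorProduct.comul_tmul, Bialgebra.comul_one]
    induction Coalgebra.comul (R := k) a with
    | zero => simp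
    | add x y hx hy => simp only [map_add, hx, hy, add_tmul]
    | tmul x y => simp [Algebra.TensorProduct.one_def]

/-- The coalgebra map `a ↦ 1 ⊗ a`. -/
def inr : A →ₗc[k] A ⊗[k] A where
  toLinearMap := TensorProduct.mk k A A 1
  counit_comp := by
    ext a
    simp
  map_comp_comul := by
    ext a
    simp only [LinearMap.comp_apply, TensorProduct.mk_apply,
      TensorProduct.comul_tmul, Bialgebra.comul_one]
    induction Coalgebra.comul (R := k) a with
    | zero => simp
    | add x y hx hy => simp only [map_add, hx, hy, tmul_add]
    | tmul x y => simp [Algebra.TensorProduct.one_def]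

/-- `Reg¹(A)`: the convolution invertible `μ : A → k` with `μ(1) = 1`. -/
def Reg1 : Subgroup (InvForm k A) where
  carrier := {μ | (μ : WithConv (A →ₗ[k] k)) 1 = 1}
  one_mem' := by
    simp
  mul_mem' := by
    intro μ ν hμ hν
    simp only [Set.mem_ofPred_eq] at hμ hν ⊢
    rw [Units.val_mul, LinearMap.convMul_apply, Bialgebra.comul_one, Algebra.TensorProduct.one_def]
    simp [hμ, hν]
  inv_mem' := by
    intro μ hμ
    simp only [Set.mem_ofPred_eq] at hμ ⊢
    have h : ((μ : WithConv (A →ₗ[k] k)) * (μ⁻¹ : InvForm k A)) 1 = 1 := by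
      rw [Units.mul_inv]
      simp
    rw [LinearMap.convMul_apply, Bialgebra.comul_one, Algebra.TensorProduct.one_def] at h
    simpa [hμ] using h

variable {k A} in
theorem mem_Reg1 {μ : InvForm k A} :
    μ ∈ Reg1 k A ↔ (μ : WithConv (A →ₗ[k] k)) 1 = 1 := Iff.rfl

variable {k A} in
theorem normalized_iff (σ : InvForm k (A ⊗[k] A)) :
    (∀ a : A, (σ : WithConv (A ⊗[k] A →ₗ[k] k)) (a ⊗ₜ 1) = Coalgebra.counit (R := k) a ∧
      (σ : WithConv (A ⊗[k] A →ₗ[k] k)) (1 ⊗ₜ a) = Coalgebra.counit (R := k) a) ↔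
    upull (inl k A) σ = 1 ∧ upull (inr k A) σ = 1 := by
  constructor
  · intro h
    exact ⟨Units.ext (WithConv.ext (LinearMap.ext fun a => (h a).1)),
      Units.ext (WithConv.ext (LinearMap.ext fun a => (h a).2))⟩
  · rintro ⟨h1, h2⟩ a
    exact ⟨congrArg (fun f : InvForm k A => (f : WithConv (A →ₗ[k] k)) a) h1,
      congrArg (fun f : InvForm k A => (f : WithConv (A →ₗ[k] k)) a) h2⟩

/-- `Reg²(A)`: the convolution invertible `σ : A ⊗ A → k` with
`σ(a, 1) = ε(a) = σ(1, a)` for all `a`. -/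
def Reg2 : Subgroup (InvForm k (A ⊗[k] A)) where
  carrier := {σ | ∀ a : A,
    (σ : WithConv (A ⊗[k] A →ₗ[k] k)) (a ⊗ₜ 1) = Coalgebra.counit (R := k) a ∧
    (σ : WithConv (A ⊗[k] A →ₗ[k] k)) (1 ⊗ₜ a) = Coalgebra.counit (R := k) a}
  one_mem' := by
    refine (normalized_iff _).2 ⟨map_one _, map_one _⟩
  mul_mem' := by
    intro σ ω hσ hω
    have h1 := (normalized_iff _).1 hσ
    have h2 := (normalized_iff _).1 hω
    refine (normalized_iff _).2 ⟨?_, ?_⟩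
    · rw [map_mul, h1.1, h2.1, one_mul]
    · rw [map_mul, h1.2, h2.2, one_mul]
  inv_mem' := by
    intro σ hσ
    have h1 := (normalized_iff _).1 hσ
    refine (normalized_iff _).2 ⟨?_, ?_⟩
    · rw [map_inv, h1.1, inv_one]
    · rw [map_inv, h1.2, inv_one]

variable {k A}

/-- `μ` is lazy: `μ * id = id * μ`. -/
def IsLazy1 (μ : InvForm k A) : Prop :=
  sc A (μ : WithConv (A →ₗ[k] k)) * idm k A = idm k A * sc A (μ : WithConv (A →ₗ[k] k))

/-- `σ` is lazy: `σ * m = m * σ`, i.e. `σ(a₁, b₁) a₂b₂ = σ(a₂, b₂) a₁b₁`. -/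
def IsLazy2 (σ : InvForm k (A ⊗[k] A)) : Prop :=
  sc A (σ : WithConv (A ⊗[k] A →ₗ[k] k)) * mulm k A =
    mulm k A * sc A (σ : WithConv (A ⊗[k] A →ₗ[k] k))

variable (k A)

/-- `Reg¹_L(A)`, the group of lazy elements of `Reg¹(A)`. -/
def Reg1L : Subgroup (InvForm k A) where
  carrier := {μ | μ ∈ Reg1 k A ∧ IsLazy1 μ}
  one_mem' := ⟨one_mem _, by simp [IsLazy1]⟩
  mul_mem' := by
    intro μ ν hμ hν
    refine ⟨mul_mem hμ.1 hν.1, ?_⟩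
    have h1 : Commute _ _ := hμ.2
    have h2 : Commute _ _ := hν.2
    have := h1.mul_left h2
    rwa [← map_mul, ← Units.val_mul] at this
  inv_mem' := by
    intro μ hμ
    refine ⟨inv_mem hμ.1, ?_⟩
    have h1 : Commute ((Units.map (sc A) μ : (WithConv (A →ₗ[k] A))ˣ) : WithConv (A →ₗ[k] A))
      (idm k A) := hμ.2
    have := h1.units_inv_left
    rwa [← map_inv] at this

/-- `Reg²_L(A)`, the group of lazy elements of `Reg²(A)`. -/
def Reg2L : Subgroup (InvForm k (A ⊗[k] A)) where
  carrier := {σ | σ ∈ Reg2 k A ∧ IsLazy2 σ}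
  one_mem' := ⟨one_mem _, by simp [IsLazy2]⟩
  mul_mem' := by
    intro μ ν hμ hν
    refine ⟨mul_mem hμ.1 hν.1, ?_⟩
    have h1 : Commute _ _ := hμ.2
    have h2 : Commute _ _ := hν.2
    have := h1.mul_left h2
    rwa [← map_mul, ← Units.val_mul] at this
  inv_mem' := by
    intro μ hμ
    refine ⟨inv_mem hμ.1, ?_⟩
    have h1 : Commute ((Units.map (sc A) μ : (WithConv (A ⊗[k] A →ₗ[k] A))ˣ) :
      WithConv (A ⊗[k] A →ₗ[k] A)) (mulm k A) := hμ.2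
    have := h1.units_inv_left
    rwa [← map_inv] at this

/-- `(a ⊗ b) ⊗ c ↦ ε(c) a ⊗ b`. -/
def leg12 : (A ⊗[k] A) ⊗[k] A →ₗc[k] A ⊗[k] A := fst k (A ⊗[k] A) A

/-- `(a ⊗ b) ⊗ c ↦ ε(a) b ⊗ c`. -/
def leg23 : (A ⊗[k] A) ⊗[k] A →ₗc[k] A ⊗[k] A :=
  (snd k A (A ⊗[k] A)).comp (Coalgebra.TensorProduct.assoc k k A A A).toCoalgHom

/-- `(a ⊗ b) ⊗ c ↦ ab ⊗ c`. -/
def mul12 : (A ⊗[k] A) ⊗[k] A →ₗc[k] A ⊗[k] A :=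
  Coalgebra.TensorProduct.map (mulC k A) (CoalgHom.id k A)

/-- `(a ⊗ b) ⊗ c ↦ a ⊗ bc`. -/
def mul23 : (A ⊗[k] A) ⊗[k] A →ₗc[k] A ⊗[k] A :=
  (Coalgebra.TensorProduct.map (CoalgHom.id k A) (mulC k A)).comp
    (Coalgebra.TensorProduct.assoc k k A A A).toCoalgHom

variable {k A}

/-- The left 2-cocycle identity `σ(a₁, b₁) σ(a₂b₂, c) = σ(b₁, c₁) σ(a, b₂c₂)`, written as
`(σ ⊗ ε) * σ(m ⊗ id) = (ε ⊗ σ) * σ(id ⊗ m)` in the convolution algebra of `A ⊗ A ⊗ A`. -/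
def IsLeftCocycle (σ : InvForm k (A ⊗[k] A)) : Prop :=
  upull (leg12 k A) σ * upull (mul12 k A) σ = upull (leg23 k A) σ * upull (mul23 k A) σ

/-- The differential `∂μ = (μ ⊗ μ) * (μ⁻¹ ∘ m)`, i.e.
`∂μ(a, b) = μ(a₁) μ(b₁) μ⁻¹(a₂b₂)`. -/
def del (μ : InvForm k A) : InvForm k (A ⊗[k] A) :=
  upull (fst k A A) μ * upull (snd k A A) μ * upull (mulC k A) μ⁻¹

/-- `ad(γ) = γ⁻¹ * id * γ`, i.e. `a ↦ γ⁻¹(a₁) a₂ γ(a₃)`. -/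
def ad (γ : InvForm k A) : A →ₗ[k] A :=
  (sc A ((γ⁻¹ : InvForm k A) : WithConv (A →ₗ[k] k)) * idm k A *
    sc A (γ : WithConv (A →ₗ[k] k))).ofConv

/-! ### Commutation rules -/

theorem val_upull {C D : Type*} [AddCommGroup C] [Module k C] [Coalgebra k C]
    [AddCommGroup D] [Module k D] [Coalgebra k D] (θ : C →ₗc[k] D) (f : InvForm k D) :
    ((upull θ f : InvForm k C) : WithConv (C →ₗ[k] k)) = pull θ (f : WithConv (D →ₗ[k] k)) := rfl

theorem commute_units {C : Type*} [AddCommGroup C] [Module k C] [Coalgebra k C]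
    {f g : InvForm k C} (h : Commute (f : WithConv (C →ₗ[k] k)) (g : WithConv (C →ₗ[k] k))) :
    Commute f g := Units.ext h

theorem mulm_eq : mulm k A = pull (fst k A A) (idm k A) * pull (snd k A A) (idm k A) := by
  refine conv_ext fun a b => ?_
  rw [fst_mul_snd]
  rfl

theorem pull_mulC_idm : pull (mulC k A) (idm k A) = mulm k A := rfl

theorem ucommute_legs {C D : Type*} [AddCommGroup C] [Module k C] [Coalgebra k C]
    [AddCommGroup D] [Module k D] [Coalgebra k D] (f : InvForm k C) (g : InvForm k D) :
    Commute (upull (fst k C D) f) (upull (snd k C D) g) :=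
  commute_units (commute_legs_left (B := k) _ _)

theorem IsLazy2.commute_leg12 {σ : InvForm k (A ⊗[k] A)} (h : IsLazy2 σ)
    (ω : InvForm k (A ⊗[k] A)) : Commute (upull (leg12 k A) σ) (upull (mul12 k A) ω) :=
  commute_units (commute_comp_map_left (ω : WithConv (A ⊗[k] A →ₗ[k] k)).ofConv h LinearMap.id)

theorem IsLazy2.commute_leg23 {σ : InvForm k (A ⊗[k] A)} (h : IsLazy2 σ)
    (ω : InvForm k (A ⊗[k] A)) : Commute (upull (leg23 k A) σ) (upull (mul23 k A) ω) := by
  have h2 : Commute (upull (snd k A (A ⊗[k] A)) σ)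
      (upull (Coalgebra.TensorProduct.map (CoalgHom.id k A) (mulC k A)) ω) :=
    commute_units
      (commute_comp_map_right (ω : WithConv (A ⊗[k] A →ₗ[k] k)).ofConv LinearMap.id h)
  exact h2.map (upull (Coalgebra.TensorProduct.assoc k k A A A).toCoalgHom)

theorem IsLazy2.commute_mulC {σ : InvForm k (A ⊗[k] A)} (h : IsLazy2 σ)
    (μ : InvForm k A) : Commute σ (upull (mulC k A) μ) :=
  commute_units (commute_comp (μ : WithConv (A →ₗ[k] k)).ofConv h)

theorem IsLazy1.commute_fst {μ : InvForm k A} (h : IsLazy1 μ) (σ : InvForm k (A ⊗[k] A)) :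
    Commute (upull (fst k A A) μ) σ := by
  have := commute_comp_map_left (σ : WithConv (A ⊗[k] A →ₗ[k] k)).ofConv h
    (LinearMap.id : A →ₗ[k] A)
  rw [TensorProduct.map_id] at this
  exact commute_units this

theorem IsLazy1.commute_snd {μ : InvForm k A} (h : IsLazy1 μ) (σ : InvForm k (A ⊗[k] A)) :
    Commute (upull (snd k A A) μ) σ := by
  have := commute_comp_map_right (σ : WithConv (A ⊗[k] A →ₗ[k] k)).ofConv
    (LinearMap.id : A →ₗ[k] A) h
  rw [TensorProduct.map_id] at this
  exact commute_units this

variable (k A) in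
/-- `Z²_L(A)`, the group of lazy 2-cocycles. -/
def Z2L : Subgroup (InvForm k (A ⊗[k] A)) where
  carrier := {σ | σ ∈ Reg2L k A ∧ IsLeftCocycle σ}
  one_mem' := ⟨one_mem _, by simp [IsLeftCocycle]⟩
  mul_mem' := by
    rintro σ ω ⟨hσ, cσ⟩ ⟨hω, cω⟩
    refine ⟨mul_mem hσ hω, ?_⟩
    unfold IsLeftCocycle at *
    simp only [map_mul]
    rw [(hω.2.commute_leg12 σ).mul_mul_mul_comm, cσ, cω, (hω.2.commute_leg23 σ).symm.mul_mul_mul_comm]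
  inv_mem' := by
    rintro σ ⟨hσ, cσ⟩
    refine ⟨inv_mem hσ, ?_⟩
    unfold IsLeftCocycle at *
    simp only [map_inv]
    rw [← mul_inv_rev, ← mul_inv_rev, ← (hσ.2.commute_leg12 σ).eq, ← (hσ.2.commute_leg23 σ).eq, cσ]

/-! ### Coboundaries -/

theorem del_mem_Reg2 {μ : InvForm k A} (hμ : μ ∈ Reg1 k A) : del μ ∈ Reg2 k A := by
  have h1 : upull (inl k A) (upull (fst k A A) μ) = μ := by
    refine Units.ext (WithConv.ext (LinearMap.ext fun a => ?_))
    change (μ : WithConv (A →ₗ[k] k)) (fst k A A (a ⊗ₜ 1)) = _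
    simp
  have h2 : upull (inl k A) (upull (snd k A A) μ) = 1 := by
    refine Units.ext (WithConv.ext (LinearMap.ext fun a => ?_))
    change (μ : WithConv (A →ₗ[k] k)) (snd k A A (a ⊗ₜ 1)) = Coalgebra.counit a
    simp [mem_Reg1.1 hμ]
  have h3 : upull (inl k A) (upull (mulC k A) μ⁻¹) = μ⁻¹ := by
    refine Units.ext (WithConv.ext (LinearMap.ext fun a => ?_))
    change ((μ⁻¹ : InvForm k A) : WithConv (A →ₗ[k] k)) (mulC k A (a ⊗ₜ 1)) = _
    rw [mulC_tmul, mul_one]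
  have h4 : upull (inr k A) (upull (fst k A A) μ) = 1 := by
    refine Units.ext (WithConv.ext (LinearMap.ext fun a => ?_))
    change (μ : WithConv (A →ₗ[k] k)) (fst k A A (1 ⊗ₜ a)) = Coalgebra.counit a
    simp [mem_Reg1.1 hμ]
  have h5 : upull (inr k A) (upull (snd k A A) μ) = μ := by
    refine Units.ext (WithConv.ext (LinearMap.ext fun a => ?_))
    change (μ : WithConv (A →ₗ[k] k)) (snd k A A (1 ⊗ₜ a)) = _
    simp
  have h6 : upull (inr k A) (upull (mulC k A) μ⁻¹) = μ⁻¹ := by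
    refine Units.ext (WithConv.ext (LinearMap.ext fun a => ?_))
    change ((μ⁻¹ : InvForm k A) : WithConv (A →ₗ[k] k)) (mulC k A (1 ⊗ₜ a)) = _
    rw [mulC_tmul, one_mul]
  refine (normalized_iff _).2 ⟨?_, ?_⟩
  · simp only [del, map_mul, h1, h2, h3]
    group
  · simp only [del, map_mul, h4, h5, h6]
    group

theorem upull_congr {C D E F : Type*} [AddCommGroup C] [Module k C] [Coalgebra k C]
    [AddCommGroup D] [Module k D] [Coalgebra k D] [AddCommGroup E] [Module k E] [Coalgebra k E]
    [AddCommGroup F] [Module k F] [Coalgebra k F]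
    (θ : C →ₗc[k] D) (φ : D →ₗc[k] F) (θ' : C →ₗc[k] E) (φ' : E →ₗc[k] F)
    (h : φ.toLinearMap ∘ₗ θ.toLinearMap = φ'.toLinearMap ∘ₗ θ'.toLinearMap) (f : InvForm k F) :
    upull θ (upull φ f) = upull θ' (upull φ' f) :=
  Units.ext (WithConv.ext (congrArg (fun g => (f : WithConv (F →ₗ[k] k)).ofConv ∘ₗ g) h))

theorem upull_e1 (μ : InvForm k A) :
    upull (leg12 k A) (upull (snd k A A) μ) = upull (leg23 k A) (upull (fst k A A) μ) := by
  refine upull_congr _ _ _ _ (TensorProduct.ext_threefold fun a b c => ?_) μ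
  simp [leg12, leg23, smul_smul, mul_comm]

theorem upull_e2 (μ : InvForm k A) :
    upull (leg12 k A) (upull (mulC k A) μ) = upull (mul12 k A) (upull (fst k A A) μ) := by
  refine upull_congr _ _ _ _ (TensorProduct.ext_threefold fun a b c => ?_) μ
  simp [leg12, mul12]

theorem upull_e3 (μ : InvForm k A) :
    upull (mul12 k A) (upull (snd k A A) μ) = upull (leg23 k A) (upull (snd k A A) μ) := by
  refine upull_congr _ _ _ _ (TensorProduct.ext_threefold fun a b c => ?_) μ
  simp [leg23, mul12, smul_smul]

theorem upull_e4 (μ : InvForm k A) :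
    upull (mul12 k A) (upull (mulC k A) μ) = upull (mul23 k A) (upull (mulC k A) μ) := by
  refine upull_congr _ _ _ _ (TensorProduct.ext_threefold fun a b c => ?_) μ
  simp [mul23, mul12, mul_assoc]

theorem upull_e5 (μ : InvForm k A) :
    upull (leg23 k A) (upull (mulC k A) μ) = upull (mul23 k A) (upull (snd k A A) μ) := by
  refine upull_congr _ _ _ _ (TensorProduct.ext_threefold fun a b c => ?_) μ
  simp [mul23, leg23]

theorem upull_e6 (μ : InvForm k A) :
    upull (mul23 k A) (upull (fst k A A) μ) = upull (leg12 k A) (upull (fst k A A) μ) := by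
  refine upull_congr _ _ _ _ (TensorProduct.ext_threefold fun a b c => ?_) μ
  simp [mul23, leg12, smul_smul, mul_comm]

theorem upull_e7 (μ : InvForm k A) :
    upull (leg12 k A) (upull (fst k A A) μ) =
    upull (Coalgebra.TensorProduct.assoc k k A A A).toCoalgHom
      (upull (fst k A (A ⊗[k] A)) μ) := by
  refine upull_congr _ _ _ _ (TensorProduct.ext_threefold fun a b c => ?_) μ
  simp [leg12, smul_smul]

theorem isLeftCocycle_del (μ : InvForm k A) : IsLeftCocycle (del μ) := by
  have e1 := upull_e1 μ
  have e2 := upull_e2 μ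
  have e3 := upull_e3 μ
  have e4 := upull_e4 μ
  have e5 := upull_e5 μ
  have e6 := upull_e6 μ
  have e7 := upull_e7 μ
  have hc : ∀ σ : InvForm k (A ⊗[k] A),
      Commute (upull (leg12 k A) (upull (fst k A A) μ)) (upull (leg23 k A) σ) := by
    intro σ
    rw [e7]
    exact (ucommute_legs μ σ).map (upull (Coalgebra.TensorProduct.assoc k k A A A).toCoalgHom)
  unfold IsLeftCocycle del
  simp only [map_mul, map_inv, e1, e2, e3, e4, e5, e6]
  have c1 := hc (upull (fst k A A) μ)
  have c2 := hc (upull (snd k A A) μ)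
  have c3 := hc (upull (mulC k A) μ)
  rw [e5] at c3
  generalize upull (leg12 k A) (upull (fst k A A) μ) = X at *
  generalize upull (leg23 k A) (upull (fst k A A) μ) = Y at *
  generalize upull (leg23 k A) (upull (snd k A A) μ) = Z at *
  generalize upull (mul23 k A) (upull (snd k A A) μ) = M at *
  generalize upull (mul23 k A) (upull (mulC k A) μ) = N at *
  have : Y * Z * M⁻¹ * (X * M * N⁻¹) = (Y * Z) * (M⁻¹ * X) * M * N⁻¹ := by group
  rw [this, ← c3.inv_right.eq]
  have : Y * Z * (X * M⁻¹) * M * N⁻¹ = (Y * Z) * X * N⁻¹ := by group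
  rw [this, ← (c1.mul_right c2).eq]
  group

theorem isLazy2_del_of_isLazy1 {μ : InvForm k A} (h : IsLazy1 μ) : IsLazy2 (del μ) := by
  have h' : Commute (sc A (μ : WithConv (A →ₗ[k] k))) (idm k A) := h
  have h1 : Commute (sc A (upull (fst k A A) μ : InvForm k _).1) (mulm k A) := by
    rw [mulm_eq]
    exact (h'.map (pull (fst k A A))).mul_right (commute_legs_left _ _)
  have h2 : Commute (sc A (upull (snd k A A) μ : InvForm k _).1) (mulm k A) := by
    rw [mulm_eq]
    exact (commute_legs_right _ _).symm.mul_right (h'.map (pull (snd k A A)))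
  have h3 : Commute (sc A (upull (mulC k A) μ : InvForm k _).1) (mulm k A) :=
    h'.map (pull (mulC k A))
  have h4 : Commute (sc A ((upull (mulC k A) μ)⁻¹ : InvForm k _).1) (mulm k A) := by
    have : Commute ((Units.map (sc A) (upull (mulC k A) μ) : (WithConv (A ⊗[k] A →ₗ[k] A))ˣ) :
      WithConv (A ⊗[k] A →ₗ[k] A)) (mulm k A) := h3
    have := this.units_inv_left
    rwa [← map_inv] at this
  have := (h1.mul_left h2).mul_left h4
  rwa [← map_mul, ← map_mul, ← map_inv] at this

theorem del_mem_Z2L {μ : InvForm k A} (h : μ ∈ Reg1L k A) : del μ ∈ Z2L k A :=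
  ⟨⟨del_mem_Reg2 h.1, isLazy2_del_of_isLazy1 h.2⟩, isLeftCocycle_del μ⟩

theorem commute_del {μ : InvForm k A} (hμ : IsLazy1 μ) {σ : InvForm k (A ⊗[k] A)}
    (hσ : IsLazy2 σ) : Commute (del μ) σ :=
  ((hμ.commute_fst σ).mul_left (hμ.commute_snd σ)).mul_left (hσ.commute_mulC _).symm

theorem del_mul_of_lazy (μ : InvForm k A) {φ : InvForm k A} (hφ : IsLazy2 (del φ)) :
    del (μ * φ) = del μ * del φ := by
  have h1 := ucommute_legs φ μ
  have h2 := hφ.commute_mulC μ⁻¹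
  have : del μ * del φ = upull (fst k A A) μ * upull (snd k A A) μ *
    (upull (mulC k A) μ⁻¹ * del φ) := by simp only [del, mul_assoc]
  rw [this, ← h2.eq]
  simp only [del, mul_inv_rev, map_mul]
  simp only [← mul_assoc]
  congr 2
  simp only [mul_assoc]
  congr 1
  simp only [← mul_assoc]
  rw [h1.eq]

variable (k A) in
/-- `B²_L(A) = ∂(Reg¹_L(A))`, as a subgroup of `Z²_L(A)`. -/
def B2L : Subgroup (Z2L k A) where
  carrier := {σ | ∃ μ ∈ Reg1L k A, (σ : InvForm k (A ⊗[k] A)) = del μ}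
  one_mem' := ⟨1, one_mem _, by simp [del]⟩
  mul_mem' := by
    rintro _ _ ⟨μ, hμ, h⟩ ⟨ν, hν, h'⟩
    refine ⟨μ * ν, mul_mem hμ hν, ?_⟩
    rw [Subgroup.coe_mul, h, h', del_mul_of_lazy _ (isLazy2_del_of_isLazy1 hν.2)]
  inv_mem' := by
    rintro _ ⟨μ, hμ, h⟩
    refine ⟨μ⁻¹, inv_mem hμ, ?_⟩
    rw [Subgroup.coe_inv, h, inv_eq_iff_mul_eq_one,
      ← del_mul_of_lazy _ (isLazy2_del_of_isLazy1 (inv_mem hμ).2)]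
    simp [del]

instance : (B2L k A).Normal where
  conj_mem := by
    rintro σ ⟨μ, hμ, h⟩ ω
    refine ⟨μ, hμ, ?_⟩
    rw [Subgroup.coe_mul, Subgroup.coe_mul, Subgroup.coe_inv, h,
      ← (commute_del hμ.2 ω.2.1.2).eq, mul_inv_cancel_right]

variable (k A) in
/-- The second lazy cohomology group `H²_L(A) = Z²_L(A) / B²_L(A)`. -/
abbrev H2L : Type _ := Z2L k A ⧸ B2L k A

/-! ### Cointernal and coinner automorphisms -/

/-- Hopf algebra automorphisms of `A`, with composition as group law. -/
instance : Group (A ≃ₐc[k] A) where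
  mul f g := g.trans f
  one := BialgEquiv.refl k A
  inv f := f.symm
  mul_assoc _ _ _ := rfl
  one_mul _ := rfl
  mul_one _ := rfl
  inv_mul_cancel f := BialgEquiv.ext f.symm_apply_apply

@[simp] theorem aut_mul_apply (f g : A ≃ₐc[k] A) (a : A) : (f * g) a = f (g a) := rfl

@[simp] theorem aut_one_apply (a : A) : (1 : A ≃ₐc[k] A) a = a := rfl

theorem aut_inv_apply (f : A ≃ₐc[k] A) (a : A) : f⁻¹ a = f.symm a := rfl

theorem comp_ad {B : Type*} [Ring B] [Algebra k B] (h : A →ₗ[k] B) (γ : InvForm k A) :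
    toConv (h ∘ₗ ad γ) = sc B ((γ⁻¹ : InvForm k A) : WithConv (A →ₗ[k] k)) * toConv h *
      sc B (γ : WithConv (A →ₗ[k] k)) := by
  rw [ad, comp_mul_sc, comp_sc_mul]
  rfl

theorem ad_mul (γ θ : InvForm k A) : ad (γ * θ) = ad γ ∘ₗ ad θ := by
  apply toConv_injective
  rw [comp_ad]
  simp only [ad, toConv_ofConv, mul_inv_rev, Units.val_mul, map_mul, mul_assoc]

theorem ad_one : ad (1 : InvForm k A) = LinearMap.id := by
  apply toConv_injective
  simp [ad, idm]

theorem counit_comp_ad (γ : InvForm k A) :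
    (Coalgebra.counit : A →ₗ[k] k) ∘ₗ ad γ = Coalgebra.counit := by
  apply toConv_injective
  rw [comp_ad]
  have : toConv (Coalgebra.counit : A →ₗ[k] k) = 1 := rfl
  rw [this, mul_one, sc_self, sc_self, Units.inv_mul]

theorem comul_comp_ad (γ : InvForm k A) :
    TensorProduct.map (ad γ) (ad γ) ∘ₗ Coalgebra.comul = Coalgebra.comul ∘ₗ ad γ := by
  apply toConv_injective
  rw [comp_ad, map_comp_comul]
  have h : toConv (Coalgebra.comul : A →ₗ[k] A ⊗[k] A) =
      push Algebra.TensorProduct.includeLeft (idm k A) *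
        push Algebra.TensorProduct.includeRight (idm k A) := by
    rw [idm, ← map_comp_comul, TensorProduct.map_id, LinearMap.id_comp]
  rw [h]
  simp only [ad, toConv_ofConv, map_mul, push_sc]
  have h2 : sc (A ⊗[k] A) (γ : WithConv (A →ₗ[k] k)) *
      sc (A ⊗[k] A) ((γ⁻¹ : InvForm k A) : WithConv (A →ₗ[k] k)) = 1 := by
    rw [← map_mul, Units.mul_inv, map_one]
  simp only [mul_assoc]
  rw [← mul_assoc (sc (A ⊗[k] A) (γ : WithConv (A →ₗ[k] k)))
    (sc (A ⊗[k] A) ((γ⁻¹ : InvForm k A) : WithConv (A →ₗ[k] k))), h2, one_mul]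

theorem conj_mul_conj {R : Type*} [Monoid R] (F S : Rˣ) {x y : R} (hFS : Commute F S)
    (hF : Commute (F : R) y) (hS : Commute (S : R) x) :
    ((F⁻¹ : Rˣ) : R) * x * F * (((S⁻¹ : Rˣ) : R) * y * S) =
      (((F * S)⁻¹ : Rˣ) : R) * (x * y) * ((F * S : Rˣ) : R) := by
  have h1 : (F : R) * ((S⁻¹ : Rˣ) : R) = ((S⁻¹ : Rˣ) : R) * F :=
    congrArg Units.val hFS.inv_right.eq
  have h2 : x * ((S⁻¹ : Rˣ) : R) = ((S⁻¹ : Rˣ) : R) * x := hS.units_inv_left.symm.eq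
  have h3 : (F : R) * y = y * F := hF.eq
  have h4 : (((F * S)⁻¹ : Rˣ) : R) = ((F⁻¹ : Rˣ) : R) * ((S⁻¹ : Rˣ) : R) := by
    rw [hFS.eq, mul_inv_rev, Units.val_mul]
  calc ((F⁻¹ : Rˣ) : R) * x * F * (((S⁻¹ : Rˣ) : R) * y * S)
      = ((F⁻¹ : Rˣ) : R) * x * (F * ((S⁻¹ : Rˣ) : R)) * y * S := by simp only [mul_assoc]
    _ = ((F⁻¹ : Rˣ) : R) * (x * ((S⁻¹ : Rˣ) : R)) * (F * y) * S := by
        rw [h1]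
        simp only [mul_assoc]
    _ = _ := by
        rw [h2, h3, h4, Units.val_mul]
        simp only [mul_assoc]

theorem conj_eq_conj_iff {R : Type*} [Monoid R] (M P : Rˣ) (x : R) :
    ((M⁻¹ : Rˣ) : R) * x * M = ((P⁻¹ : Rˣ) : R) * x * P ↔
      ((P * M⁻¹ : Rˣ) : R) * x = x * ((P * M⁻¹ : Rˣ) : R) := by
  rw [Units.val_mul]
  constructor
  · intro h
    calc (P : R) * ((M⁻¹ : Rˣ) : R) * x
        = P * (((M⁻¹ : Rˣ) : R) * x * M) * ((M⁻¹ : Rˣ) : R) := by simp [mul_assoc]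
      _ = _ := by
        rw [h]
        simp [mul_assoc]
  · intro h
    calc ((M⁻¹ : Rˣ) : R) * x * M
        = ((P⁻¹ : Rˣ) : R) * (P * ((M⁻¹ : Rˣ) : R) * x) * M := by simp [mul_assoc]
      _ = _ := by
        rw [h]
        simp [mul_assoc]

theorem pull_mulC_ad (γ : InvForm k A) :
    pull (mulC k A) (toConv (ad γ)) =
      (((Units.map (sc A) (upull (mulC k A) γ))⁻¹ : (WithConv (A ⊗[k] A →ₗ[k] A))ˣ) :
        WithConv (A ⊗[k] A →ₗ[k] A)) * mulm k A *
        ((Units.map (sc A) (upull (mulC k A) γ) : (WithConv (A ⊗[k] A →ₗ[k] A))ˣ) :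
        WithConv (A ⊗[k] A →ₗ[k] A)) := by
  rw [ad, toConv_ofConv, map_mul, map_mul, pull_mulC_idm]
  rfl

theorem legs_ad (γ : InvForm k A) :
    pull (fst k A A) (toConv (ad γ)) * pull (snd k A A) (toConv (ad γ)) =
      (((Units.map (sc A) (upull (fst k A A) γ * upull (snd k A A) γ))⁻¹ :
        (WithConv (A ⊗[k] A →ₗ[k] A))ˣ) : WithConv (A ⊗[k] A →ₗ[k] A)) * mulm k A *
        ((Units.map (sc A) (upull (fst k A A) γ * upull (snd k A A) γ) :
        (WithConv (A ⊗[k] A →ₗ[k] A))ˣ) : WithConv (A ⊗[k] A →ₗ[k] A)) := by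
  rw [map_mul, mulm_eq, ← conj_mul_conj _ _ ((ucommute_legs γ γ).map (Units.map (sc A)))
    (commute_legs_left _ _) (commute_legs_right _ _).symm, ad, toConv_ofConv]
  simp only [map_mul]
  rfl

theorem ad_map_mul_iff (γ : InvForm k A) :
    (∀ a b, ad γ (a * b) = ad γ a * ad γ b) ↔ IsLazy2 (del γ) := by
  have h1 : (∀ a b, ad γ (a * b) = ad γ a * ad γ b) ↔
      pull (mulC k A) (toConv (ad γ)) =
        pull (fst k A A) (toConv (ad γ)) * pull (snd k A A) (toConv (ad γ)) := by
    constructor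
    · intro h
      refine conv_ext fun a b => ?_
      rw [fst_mul_snd, pull_apply, mulC_tmul]
      exact h a b
    · intro h a b
      have := congrArg (fun f : WithConv (A ⊗[k] A →ₗ[k] A) => f (a ⊗ₜ b)) h
      simp only [fst_mul_snd, pull_apply, mulC_tmul] at this
      exact this
  rw [h1, pull_mulC_ad, legs_ad, conj_eq_conj_iff, ← map_inv, ← map_mul, ← map_inv]
  rfl

/-- `ad γ` as a Hopf algebra automorphism, when `∂γ` is lazy. -/
def adEquiv (γ : InvForm k A) (h2 : IsLazy2 (del γ)) : A ≃ₐc[k] A where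
  toFun := ad γ
  invFun := ad γ⁻¹
  map_add' := map_add _
  map_smul' := map_smul _
  counit_comp := counit_comp_ad γ
  map_comp_comul := comul_comp_ad γ
  left_inv a := by
    have := ad_mul γ⁻¹ γ
    rw [inv_mul_cancel, ad_one] at this
    exact (LinearMap.congr_fun this a).symm
  right_inv a := by
    have := ad_mul γ γ⁻¹
    rw [mul_inv_cancel, ad_one] at this
    exact (LinearMap.congr_fun this a).symm
  map_mul' := (ad_map_mul_iff γ).2 h2

@[simp] theorem adEquiv_apply (γ : InvForm k A) (h2 : IsLazy2 (del γ))
    (a : A) : adEquiv γ h2 a = ad γ a := rfl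

theorem adEquiv_mul (γ θ : InvForm k A) (h : IsLazy2 (del γ)) (h' : IsLazy2 (del θ))
    (h'' : IsLazy2 (del (γ * θ))) : adEquiv (γ * θ) h'' = adEquiv γ h * adEquiv θ h' :=
  BialgEquiv.ext fun a => LinearMap.congr_fun (ad_mul γ θ) a

variable (k A) in
/-- The group `Reg¹_aL(A)` of almost lazy elements: `γ ∈ Reg¹(A)` with `∂γ ∈ Reg²_L(A)`. -/
def RegAL : Subgroup (InvForm k A) where
  carrier := {γ | γ ∈ Reg1 k A ∧ del γ ∈ Reg2L k A}
  one_mem' := ⟨one_mem _, by simp [del]⟩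
  mul_mem' := by
    rintro γ θ ⟨h1, h2⟩ ⟨h3, h4⟩
    refine ⟨mul_mem h1 h3, ?_⟩
    rw [del_mul_of_lazy _ h4.2]
    exact mul_mem h2 h4
  inv_mem' := by
    rintro γ ⟨h1, h2⟩
    refine ⟨inv_mem h1, del_mem_Reg2 (inv_mem h1), ?_⟩
    rw [← ad_map_mul_iff]
    intro a b
    have e1 : ∀ x, ad γ (ad γ⁻¹ x) = x := fun x => (adEquiv γ h2.2).right_inv x
    have e2 : ∀ x, ad γ⁻¹ (ad γ x) = x := fun x => (adEquiv γ h2.2).left_inv x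
    rw [← e2 (ad γ⁻¹ a * ad γ⁻¹ b), (ad_map_mul_iff γ).2 h2.2, e1, e1]

variable (k A) in
/-- The group morphism `ad : Reg¹_aL(A) → Aut_Hopf(A)`. -/
def adHom : RegAL k A →* (A ≃ₐc[k] A) where
  toFun γ := adEquiv (γ : InvForm k A) γ.2.2.2
  map_one' := BialgEquiv.ext fun a => LinearMap.congr_fun ad_one a
  map_mul' γ θ := adEquiv_mul _ _ γ.2.2.2 θ.2.2.2 (γ * θ).2.2.2

/-- The lazy 2-cocycle `∂γ`, for an almost lazy `γ`. -/
def delAL (γ : RegAL k A) : Z2L k A := ⟨del (γ : InvForm k A), γ.2.2, isLeftCocycle_del _⟩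

/-- An algebra map `φ : A → k` as a convolution invertible form, with inverse `φ ∘ S`. -/
def algUnit (φ : A →ₐ[k] k) : InvForm k A where
  val := toConv φ.toLinearMap
  inv := toConv (φ.toLinearMap ∘ₗ HopfAlgebra.antipode k)
  val_inv := by
    have := congrArg (push φ) (LinearMap.id_mul_antipode (R := k) (C := A))
    rw [map_mul, map_one] at this
    exact this
  inv_val := by
    have := congrArg (push φ) (LinearMap.antipode_mul_id (R := k) (C := A))
    rw [map_mul, map_one] at this
    exact this

theorem exists_algUnit_mul (φ ψ : A →ₐ[k] k) :
    ∃ χ : A →ₐ[k] k, algUnit φ * algUnit ψ = algUnit χ :=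
  ⟨(toConv φ * toConv ψ : WithConv (A →ₐ[k] k)).ofConv, Units.ext rfl⟩

theorem exists_algUnit_inv (φ : A →ₐ[k] k) :
    ∃ χ : A →ₐ[k] k, (algUnit φ)⁻¹ = algUnit χ :=
  ⟨AlgHom.ofLinearMap (φ.toLinearMap ∘ₗ HopfAlgebra.antipode k) (by simp)
    (fun a b => by simp [HopfAlgebra.antipode_mul_antidistrib, mul_comm]), Units.ext rfl⟩

theorem exists_algUnit_upull (φ : A →ₐ[k] k) (f : A ≃ₐc[k] A) :
    ∃ χ : A →ₐ[k] k, upull (f : A →ₗc[k] A) (algUnit φ) = algUnit χ :=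
  ⟨φ.comp (f : A →ₐ[k] A), Units.ext rfl⟩

theorem conj_ad (f : A ≃ₐc[k] A) (γ : InvForm k A) (a : A) :
    f (ad γ (f⁻¹ a)) = ad (upull ((f⁻¹ : A ≃ₐc[k] A) : A →ₗc[k] A) γ) a := by
  have h2 : pull ((f⁻¹ : A ≃ₐc[k] A) : A →ₗc[k] A) (push (f : A →ₐ[k] A) (idm k A)) =
      idm k A := by
    ext a
    exact f.apply_symm_apply a
  have h3 : pull ((f⁻¹ : A ≃ₐc[k] A) : A →ₗc[k] A) (push (f : A →ₐ[k] A) (toConv (ad γ))) =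
      toConv (ad (upull ((f⁻¹ : A ≃ₐc[k] A) : A →ₗc[k] A) γ)) := by
    simp only [ad, toConv_ofConv, map_mul, push_sc, pull_sc, h2]
    rfl
  exact congrArg (fun g : WithConv (A →ₗ[k] A) => g a) h3

variable (k A) in
/-- The group `CoInn(A)` of coinner automorphisms: those of the form `(φ ∘ S) * id * φ` for an
algebra map `φ : A → k`. -/
def CoInn : Subgroup (A ≃ₐc[k] A) where
  carrier := {f | ∃ φ : A →ₐ[k] k, toConv (f : A →ₗc[k] A).toLinearMap =
    sc A (toConv (φ.toLinearMap ∘ₗ HopfAlgebra.antipode k)) * idm k A *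
      sc A (toConv φ.toLinearMap)}
  one_mem' := by
    refine ⟨Bialgebra.counitAlgHom k A, ?_⟩
    have h1 : toConv (Bialgebra.counitAlgHom k A).toLinearMap =
      (1 : WithConv (A →ₗ[k] k)) := rfl
    have h2 : toConv ((Bialgebra.counitAlgHom k A).toLinearMap ∘ₗ HopfAlgebra.antipode k) =
        (1 : WithConv (A →ₗ[k] k)) := by
      ext a
      simp
    rw [h1, h2, map_one, mul_one, one_mul]
    rfl
  mul_mem' := by
    rintro f g ⟨φ, hφ⟩ ⟨ψ, hψ⟩
    obtain ⟨χ, hχ⟩ := exists_algUnit_mul φ ψ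
    refine ⟨χ, ?_⟩
    have h1 : (f : A →ₗc[k] A).toLinearMap = ad (algUnit φ) := congrArg ofConv hφ
    have h2 : (g : A →ₗc[k] A).toLinearMap = ad (algUnit ψ) := congrArg ofConv hψ
    change _ = toConv (ad (algUnit χ))
    rw [← hχ, ad_mul, ← h1, ← h2]
    rfl
  inv_mem' := by
    rintro f ⟨φ, hφ⟩
    obtain ⟨χ, hχ⟩ := exists_algUnit_inv φ
    refine ⟨χ, ?_⟩
    have h1 : (f : A →ₗc[k] A).toLinearMap = ad (algUnit φ) := congrArg ofConv hφ
    change _ = toConv (ad (algUnit χ))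
    rw [← hχ]
    refine congrArg toConv (LinearMap.ext fun a => ?_)
    have h2 := LinearMap.congr_fun (ad_mul (algUnit φ)⁻¹ (algUnit φ)) (f⁻¹ a)
    rw [inv_mul_cancel, ad_one, ← h1] at h2
    have h3 : f (f⁻¹ a) = a := f.apply_symm_apply a
    change f⁻¹ a = ad (algUnit φ)⁻¹ (f (f⁻¹ a)) at h2
    rw [h3] at h2
    exact h2

theorem mem_CoInn_iff {f : A ≃ₐc[k] A} :
    f ∈ CoInn k A ↔ ∃ φ : A →ₐ[k] k, (f : A →ₗc[k] A).toLinearMap = ad (algUnit φ) :=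
  exists_congr fun _ => toConv_injective.eq_iff

instance : (CoInn k A).Normal where
  conj_mem := by
    intro g hg f
    obtain ⟨φ, hφ⟩ := mem_CoInn_iff.1 hg
    obtain ⟨χ, hχ⟩ := exists_algUnit_upull φ f⁻¹
    refine mem_CoInn_iff.2 ⟨χ, ?_⟩
    rw [← hχ]
    ext a
    rw [← conj_ad, ← hφ]
    rfl

variable (k A) in
/-- The group `CoOut(A) = Aut_Hopf(A) / CoInn(A)` of co-outer automorphisms. -/
abbrev CoOut : Type _ := (A ≃ₐc[k] A) ⧸ CoInn k A

variable (k A) in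
/-- The group `CoOut⁻(A) = Reg¹_aL(A) / ad⁻¹(CoInn(A))`. -/
abbrev CoOutMinus : Type _ := RegAL k A ⧸ (CoInn k A).comap (adHom k A)

/-! ### The action of `CoOut(A)` on `H²_L(A)` -/

/-- `α ⊗ α` as a coalgebra map. -/
def sq (α : A ≃ₐc[k] A) : A ⊗[k] A →ₗc[k] A ⊗[k] A :=
  Coalgebra.TensorProduct.map (α : A →ₗc[k] A) (α : A →ₗc[k] A)

@[simp] theorem sq_tmul (α : A ≃ₐc[k] A) (a b : A) : sq α (a ⊗ₜ b) = α a ⊗ₜ α b := rfl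

/-- `σ ← α = σ ∘ (α ⊗ α)`. -/
def gets (σ : InvForm k (A ⊗[k] A)) (α : A ≃ₐc[k] A) : InvForm k (A ⊗[k] A) := upull (sq α) σ

theorem gets_apply (σ : InvForm k (A ⊗[k] A)) (α : A ≃ₐc[k] A) (a b : A) :
    (gets σ α : WithConv (A ⊗[k] A →ₗ[k] k)) (a ⊗ₜ b) =
      (σ : WithConv (A ⊗[k] A →ₗ[k] k)) (α a ⊗ₜ α b) := rfl

theorem gets_mem_Reg2 {σ : InvForm k (A ⊗[k] A)} (h : σ ∈ Reg2 k A) (α : A ≃ₐc[k] A) :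
    gets σ α ∈ Reg2 k A := by
  intro a
  rw [gets_apply, gets_apply, map_one, (h (α a)).1, (h (α a)).2]
  exact ⟨CoalgHomClass.counit_comp_apply α a, CoalgHomClass.counit_comp_apply α a⟩

theorem gets_isLazy2 {σ : InvForm k (A ⊗[k] A)} (h : IsLazy2 σ) (α : A ≃ₐc[k] A) :
    IsLazy2 (gets σ α) := by
  have h0 : Commute (sc A (σ : WithConv (A ⊗[k] A →ₗ[k] k))) (mulm k A) := h
  have h1 := (h0.map (pull (sq α))).map (push ((α⁻¹ : A ≃ₐc[k] A) : A →ₐ[k] A))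
  rw [pull_sc, push_sc] at h1
  have h2 : push ((α⁻¹ : A ≃ₐc[k] A) : A →ₐ[k] A) (pull (sq α) (mulm k A)) = mulm k A := by
    refine conv_ext fun a b => ?_
    change α.symm (α a * α b) = a * b
    rw [← map_mul, α.symm_apply_apply]
  rw [h2] at h1
  exact h1

/-- `α ⊗ α ⊗ α` as a coalgebra map. -/
def cube (α : A ≃ₐc[k] A) : (A ⊗[k] A) ⊗[k] A →ₗc[k] (A ⊗[k] A) ⊗[k] A :=
  Coalgebra.TensorProduct.map (sq α) (α : A →ₗc[k] A)

theorem gets_leg12 (σ : InvForm k (A ⊗[k] A)) (α : A ≃ₐc[k] A) :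
    upull (leg12 k A) (upull (sq α) σ) = upull (cube α) (upull (leg12 k A) σ) := by
  refine upull_congr _ _ _ _ (TensorProduct.ext_threefold fun a b c => ?_) σ
  simp [leg12, cube]

theorem gets_leg23 (σ : InvForm k (A ⊗[k] A)) (α : A ≃ₐc[k] A) :
    upull (leg23 k A) (upull (sq α) σ) = upull (cube α) (upull (leg23 k A) σ) := by
  refine upull_congr _ _ _ _ (TensorProduct.ext_threefold fun a b c => ?_) σ
  simp [leg23, cube]

theorem gets_mul12 (σ : InvForm k (A ⊗[k] A)) (α : A ≃ₐc[k] A) :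
    upull (mul12 k A) (upull (sq α) σ) = upull (cube α) (upull (mul12 k A) σ) := by
  refine upull_congr _ _ _ _ (TensorProduct.ext_threefold fun a b c => ?_) σ
  simp [mul12, cube]

theorem gets_mul23 (σ : InvForm k (A ⊗[k] A)) (α : A ≃ₐc[k] A) :
    upull (mul23 k A) (upull (sq α) σ) = upull (cube α) (upull (mul23 k A) σ) := by
  refine upull_congr _ _ _ _ (TensorProduct.ext_threefold fun a b c => ?_) σ
  simp [mul23, cube]

theorem gets_isLeftCocycle {σ : InvForm k (A ⊗[k] A)} (h : IsLeftCocycle σ) (α : A ≃ₐc[k] A) :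
    IsLeftCocycle (gets σ α) := by
  unfold IsLeftCocycle gets at *
  rw [gets_leg12, gets_leg23, gets_mul12, gets_mul23, ← map_mul, ← map_mul, h]

theorem gets_del (μ : InvForm k A) (α : A ≃ₐc[k] A) :
    gets (del μ) α = del (upull (α : A →ₗc[k] A) μ) := by
  have e1 : upull (sq α) (upull (fst k A A) μ) = upull (fst k A A) (upull (α : A →ₗc[k] A) μ) := by
    refine upull_congr _ _ _ _ (TensorProduct.ext' fun a b => ?_) μ
    simp
  have e2 : upull (sq α) (upull (snd k A A) μ) = upull (snd k A A) (upull (α : A →ₗc[k] A) μ) := by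
    refine upull_congr _ _ _ _ (TensorProduct.ext' fun a b => ?_) μ
    simp
  have e3 : upull (sq α) (upull (mulC k A) μ) =
      upull (mulC k A) (upull (α : A →ₗc[k] A) μ) := by
    refine upull_congr _ _ _ _ (TensorProduct.ext' fun a b => ?_) μ
    simp
  simp only [gets, del, map_mul, map_inv, e1, e2, e3]

theorem upull_mem_Reg1L {μ : InvForm k A} (h : μ ∈ Reg1L k A) (α : A ≃ₐc[k] A) :
    upull (α : A →ₗc[k] A) μ ∈ Reg1L k A := by
  constructor
  · change (μ : WithConv (A →ₗ[k] k)) (α 1) = 1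
    rw [map_one]
    exact h.1
  · have h0 : Commute (sc A (μ : WithConv (A →ₗ[k] k))) (idm k A) := h.2
    have h1 := (h0.map (pull (α : A →ₗc[k] A))).map (push ((α⁻¹ : A ≃ₐc[k] A) : A →ₐ[k] A))
    rw [pull_sc, push_sc] at h1
    have h2 : push ((α⁻¹ : A ≃ₐc[k] A) : A →ₐ[k] A) (pull (α : A →ₗc[k] A) (idm k A)) =
        idm k A := by
      ext a
      exact α.symm_apply_apply a
    rw [h2] at h1
    exact h1

/-- The automorphism `σ ↦ σ ← α` of `Z²_L(A)`. -/
def getsZ (α : A ≃ₐc[k] A) : Z2L k A →* Z2L k A where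
  toFun σ := ⟨gets σ α, ⟨gets_mem_Reg2 σ.2.1.1 α, gets_isLazy2 σ.2.1.2 α⟩,
    gets_isLeftCocycle σ.2.2 α⟩
  map_one' := Subtype.ext (map_one (upull (sq α)))
  map_mul' σ ω := Subtype.ext (map_mul (upull (sq α)) σ.1 ω.1)

/-- The morphism of `H²_L(A)` induced by `σ ↦ σ ← α`. -/
def getsH (α : A ≃ₐc[k] A) : H2L k A →* H2L k A :=
  QuotientGroup.map _ _ (getsZ α) (by
    rintro σ ⟨μ, hμ, h⟩
    refine ⟨upull (α : A →ₗc[k] A) μ, upull_mem_Reg1L hμ α, ?_⟩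
    rw [← gets_del, ← h]
    rfl)

theorem gets_mul_aut (σ : InvForm k (A ⊗[k] A)) (α β : A ≃ₐc[k] A) :
    gets σ (α * β) = gets (gets σ α) β :=
  Units.ext (conv_ext fun _ _ => rfl)

theorem map_ad_map_ad (γ : InvForm k A) :
    toConv (TensorProduct.map (ad γ) (ad γ)) =
      sc (A ⊗[k] A) ((upull (fst k A A) γ * upull (snd k A A) γ)⁻¹ : InvForm k _).1 *
        toConv LinearMap.id *
        sc (A ⊗[k] A) (upull (fst k A A) γ * upull (snd k A A) γ : InvForm k _).1 := by
  have h := conj_mul_conj (Units.map (sc (A ⊗[k] A)) (upull (fst k A A) γ))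
    (Units.map (sc (A ⊗[k] A)) (upull (snd k A A) γ))
    (x := pull (fst k A A) (push Algebra.TensorProduct.includeLeft (idm k A)))
    (y := pull (snd k A A) (push Algebra.TensorProduct.includeRight (idm k A)))
    ((ucommute_legs γ γ).map (Units.map (sc (A ⊗[k] A))))
    (commute_legs_left _ _) (commute_legs_right _ _).symm
  rw [← TensorProduct.map_id, map_eq_legs, map_eq_legs]
  refine Eq.trans ?_ (h.trans ?_)
  · simp only [ad, toConv_ofConv, map_mul, push_sc]
    rfl
  · rw [← map_mul, ← map_inv]
    rfl

theorem gets_of_mem_CoInn {σ : InvForm k (A ⊗[k] A)} (h : IsLazy2 σ) {f : A ≃ₐc[k] A}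
    (hf : f ∈ CoInn k A) : gets σ f = σ := by
  obtain ⟨φ, hφ⟩ := mem_CoInn_iff.1 hf
  have h1 : upull (fst k A A) (algUnit φ) * upull (snd k A A) (algUnit φ) =
      upull (mulC k A) (algUnit φ) := by
    refine Units.ext (conv_ext fun a b => ?_)
    rw [Units.val_mul, val_upull, val_upull, fst_mul_snd]
    change φ a * φ b = φ (mulC k A (a ⊗ₜ b))
    rw [mulC_tmul, map_mul]
  have h2 := map_ad_map_ad (algUnit φ)
  rw [h1] at h2
  have h3 : toConv ((σ : WithConv (A ⊗[k] A →ₗ[k] k)).ofConv ∘ₗ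
      (TensorProduct.map (ad (algUnit φ)) (ad (algUnit φ)))) =
      ((upull (mulC k A) (algUnit φ))⁻¹ * σ * upull (mulC k A) (algUnit φ) : InvForm k _).1 := by
    have h4 := congrArg ofConv h2
    rw [ofConv_toConv] at h4
    rw [h4, comp_mul_sc, comp_sc_mul]
    rfl
  have h5 : gets σ f = (upull (mulC k A) (algUnit φ))⁻¹ * σ * upull (mulC k A) (algUnit φ) := by
    refine Units.ext ?_
    rw [← h3, ← hφ]
    rfl
  rw [h5, mul_assoc, (h.commute_mulC _).eq, inv_mul_cancel_left]

theorem getsH_mul_aut (α β : A ≃ₐc[k] A) : getsH (α * β) = (getsH β).comp (getsH α) := by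
  refine MonoidHom.ext fun x => ?_
  induction x using QuotientGroup.induction_on with
  | H σ => exact congrArg _ (Subtype.ext (gets_mul_aut σ.1 α β))

variable (k A) in
theorem getsH_one : getsH (1 : A ≃ₐc[k] A) = MonoidHom.id _ := by
  refine MonoidHom.ext fun x => ?_
  induction x using QuotientGroup.induction_on with
  | H σ =>
    have h : getsZ 1 σ = σ := Subtype.ext (Units.ext (conv_ext (k := k) fun _ _ => rfl))
    exact congrArg QuotientGroup.mk h

theorem getsH_of_mem_CoInn {f : A ≃ₐc[k] A} (hf : f ∈ CoInn k A) :
    getsH f = MonoidHom.id _ := by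
  refine MonoidHom.ext fun x => ?_
  induction x using QuotientGroup.induction_on with
  | H σ => exact congrArg _ (Subtype.ext (gets_of_mem_CoInn σ.2.1.2 hf))

/-- The right action by automorphisms of `CoOut(A)` on `H²_L(A)`, with
`act ᾱ σ̄` the class of `σ ← α`. -/
def act (c : CoOut k A) : H2L k A →* H2L k A :=
  Quotient.liftOn' c getsH (by
    intro α β h
    have h' := QuotientGroup.leftRel_apply.1 h
    rw [show β = α * (α⁻¹ * β) by group, getsH_mul_aut, getsH_of_mem_CoInn h']
    rfl)

theorem act_mk (α : A ≃ₐc[k] A) (σ : Z2L k A) :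
    act (QuotientGroup.mk α) (QuotientGroup.mk σ) = QuotientGroup.mk (getsZ α σ) := rfl

theorem act_one (x : H2L k A) : act 1 x = x :=
  DFunLike.congr_fun (getsH_one k A) x

theorem act_mul (c d : CoOut k A) (x : H2L k A) : act (c * d) x = act d (act c x) := by
  induction c using QuotientGroup.induction_on with
  | H α =>
    induction d using QuotientGroup.induction_on with
    | H β => exact DFunLike.congr_fun (getsH_mul_aut α β) x

variable (k A) in
/-- The semidirect product `CoOut(A) ⋉ H²_L(A)` for the right action of `CoOut(A)`:
pairs with the product `(α, σ)(β, ω) = (αβ, (σ ← β) ω)`. -/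
@[ext] structure CoOutH2L where
  /-- the component in `CoOut(A)` -/
  out : CoOut k A
  /-- the component in `H²_L(A)` -/
  coh : H2L k A

instance : Group (CoOutH2L k A) where
  mul x y := ⟨x.out * y.out, act y.out x.coh * y.coh⟩
  one := ⟨1, 1⟩
  inv x := ⟨x.out⁻¹, act x.out⁻¹ x.coh⁻¹⟩
  mul_assoc x y z := by
    refine CoOutH2L.ext (mul_assoc _ _ _) ?_
    change act z.out (act y.out x.coh * y.coh) * z.coh =
      act (y.out * z.out) x.coh * (act z.out y.coh * z.coh)
    rw [map_mul, act_mul, mul_assoc]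
  one_mul x := by
    refine CoOutH2L.ext (one_mul _) ?_
    change act x.out 1 * x.coh = x.coh
    rw [map_one, one_mul]
  mul_one x := by
    refine CoOutH2L.ext (mul_one _) ?_
    change act 1 x.coh * 1 = x.coh
    rw [act_one, mul_one]
  inv_mul_cancel x := by
    refine CoOutH2L.ext (inv_mul_cancel _) ?_
    change act x.out (act x.out⁻¹ x.coh⁻¹) * x.coh = 1
    rw [← act_mul, inv_mul_cancel, act_one, inv_mul_cancel]

end Cochains

/-! ### Bicomodule algebras and biGalois objects -/

universe u v

/-- An `A`-bicomodule algebra: a `k`-algebra `Z` with commuting coassociative and counital left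
and right coactions `Z → A ⊗ Z` and `Z → Z ⊗ A` that are algebra maps. -/
structure BicomodAlg (k : Type u) (A : Type v) [CommRing k] [Ring A] [HopfAlgebra k A] :
    Type (max u (v + 1)) where
  /-- the underlying algebra -/
  carrier : Type v
  [ring : Ring carrier]
  [algebra : Algebra k carrier]
  /-- the left coaction -/
  lcoact : carrier →ₐ[k] A ⊗[k] carrier
  /-- the right coaction -/
  rcoact : carrier →ₐ[k] carrier ⊗[k] A
  lcoassoc : ∀ z, TensorProduct.assoc k A A carrier
      (LinearMap.rTensor carrier (Coalgebra.comul : A →ₗ[k] A ⊗[k] A) (lcoact z)) =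
    LinearMap.lTensor A lcoact.toLinearMap (lcoact z)
  lcounit : ∀ z, LinearMap.rTensor carrier (Coalgebra.counit : A →ₗ[k] k) (lcoact z) = 1 ⊗ₜ z
  rcoassoc : ∀ z, TensorProduct.assoc k carrier A A
      (LinearMap.rTensor A rcoact.toLinearMap (rcoact z)) =
    LinearMap.lTensor carrier (Coalgebra.comul : A →ₗ[k] A ⊗[k] A) (rcoact z)
  rcounit : ∀ z, LinearMap.lTensor carrier (Coalgebra.counit : A →ₗ[k] k) (rcoact z) = z ⊗ₜ 1
  bicomod : ∀ z, TensorProduct.assoc k A carrier A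
      (LinearMap.rTensor A lcoact.toLinearMap (rcoact z)) =
    LinearMap.lTensor A rcoact.toLinearMap (lcoact z)

attribute [instance] BicomodAlg.ring BicomodAlg.algebra

section BiGalois

variable {k : Type u} {A : Type v} [CommRing k] [Ring A] [HopfAlgebra k A]

namespace BicomodAlg

/-- `κ_l : Z ⊗ Z → A ⊗ Z`, `x ⊗ y ↦ x₍₋₁₎ ⊗ x₍₀₎ y`. -/
def galL (Z : BicomodAlg k A) : Z.carrier ⊗[k] Z.carrier →ₗ[k] A ⊗[k] Z.carrier :=
  LinearMap.lTensor A (LinearMap.mul' k Z.carrier) ∘ₗ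
    (TensorProduct.assoc k A Z.carrier Z.carrier).toLinearMap ∘ₗ
      LinearMap.rTensor Z.carrier Z.lcoact.toLinearMap

/-- `κ_r : Z ⊗ Z → Z ⊗ A`, `x ⊗ y ↦ x y₍₀₎ ⊗ y₍₁₎`. -/
def galR (Z : BicomodAlg k A) : Z.carrier ⊗[k] Z.carrier →ₗ[k] Z.carrier ⊗[k] A :=
  LinearMap.rTensor A (LinearMap.mul' k Z.carrier) ∘ₗ
    (TensorProduct.assoc k Z.carrier Z.carrier A).symm.toLinearMap ∘ₗ
      LinearMap.lTensor Z.carrier Z.rcoact.toLinearMap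

/-- `Z` is an `A`-biGalois object: it is non-zero, both its left and its right coinvariants are
`k` (that is, `k → Z` is injective and its image is the set of coinvariants), and both Galois maps
are bijective. -/
structure IsBiGalois (Z : BicomodAlg k A) : Prop where
  nontrivial : Nontrivial Z.carrier
  injective : Function.Injective (algebraMap k Z.carrier)
  left_coinv : ∀ z, Z.lcoact z = 1 ⊗ₜ z ↔ z ∈ Set.range (algebraMap k Z.carrier)
  right_coinv : ∀ z, Z.rcoact z = z ⊗ₜ 1 ↔ z ∈ Set.range (algebraMap k Z.carrier)
  left_galois : Function.Bijective Z.galL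
  right_galois : Function.Bijective Z.galR

/-- Isomorphism of bicomodule algebras: a bijective algebra map that is left and right
colinear. -/
def Iso (Z T : BicomodAlg k A) : Prop :=
  ∃ e : Z.carrier ≃ₐ[k] T.carrier,
    (∀ z, T.lcoact (e z) = LinearMap.lTensor A e.toLinearMap (Z.lcoact z)) ∧
    (∀ z, T.rcoact (e z) = LinearMap.rTensor A e.toLinearMap (Z.rcoact z))

theorem Iso.refl (Z : BicomodAlg k A) : Iso Z Z := by
  refine ⟨AlgEquiv.refl, fun z => ?_, fun z => ?_⟩
  · exact (LinearMap.congr_fun (LinearMap.lTensor_id A Z.carrier) _).symm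
  · exact (LinearMap.congr_fun (LinearMap.rTensor_id A Z.carrier) _).symm

theorem Iso.symm {Z T : BicomodAlg k A} (h : Iso Z T) : Iso T Z := by
  obtain ⟨e, hl, hr⟩ := h
  have he : e.symm.toLinearMap ∘ₗ e.toLinearMap = LinearMap.id :=
    LinearMap.ext e.symm_apply_apply
  refine ⟨e.symm, fun z => ?_, fun z => ?_⟩
  · have := hl (e.symm z)
    rw [e.apply_symm_apply] at this
    rw [this, ← LinearMap.comp_apply, ← LinearMap.lTensor_comp, he, LinearMap.lTensor_id]
    rfl
  · have := hr (e.symm z)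
    rw [e.apply_symm_apply] at this
    rw [this, ← LinearMap.comp_apply, ← LinearMap.rTensor_comp, he, LinearMap.rTensor_id]
    rfl

theorem Iso.trans {Z T U : BicomodAlg k A} (h : Iso Z T) (h' : Iso T U) : Iso Z U := by
  obtain ⟨e, hl, hr⟩ := h
  obtain ⟨f, hl', hr'⟩ := h'
  refine ⟨e.trans f, fun z => ?_, fun z => ?_⟩
  · rw [AlgEquiv.trans_apply, hl', hl, ← LinearMap.comp_apply, ← LinearMap.lTensor_comp]
    rfl
  · rw [AlgEquiv.trans_apply, hr', hr, ← LinearMap.comp_apply, ← LinearMap.rTensor_comp]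
    rfl

/-- The cotensor product `Z □_A T`: the subalgebra of those `x ∈ Z ⊗ T` with
`(ρ_Z ⊗ id)(x) = (id ⊗ λ_T)(x)` in `Z ⊗ A ⊗ T`. -/
def cotensor (Z T : BicomodAlg k A) : Subalgebra k (Z.carrier ⊗[k] T.carrier) :=
  AlgHom.equalizer
    ((Algebra.TensorProduct.assoc k k k Z.carrier A T.carrier).toAlgHom.comp
      (Algebra.TensorProduct.map Z.rcoact (AlgHom.id k T.carrier)))
    (Algebra.TensorProduct.map (AlgHom.id k Z.carrier) T.lcoact)

/-- The bicomodule algebra `U` is isomorphic to the cotensor product `Z □_A T`: there is an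
algebra isomorphism `e : U ≃ Z □_A T` that intertwines the left coaction of `U` with that of `Z`
and the right coaction of `U` with that of `T`. -/
def IsCotensor (Z T U : BicomodAlg k A) : Prop :=
  ∃ e : U.carrier ≃ₐ[k] cotensor Z T,
    (∀ u, TensorProduct.assoc k A Z.carrier T.carrier
        (LinearMap.rTensor T.carrier Z.lcoact.toLinearMap (e u : Z.carrier ⊗[k] T.carrier)) =
      LinearMap.lTensor A ((cotensor Z T).val.toLinearMap ∘ₗ e.toLinearMap) (U.lcoact u)) ∧
    (∀ u, (TensorProduct.assoc k Z.carrier T.carrier A).symm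
        (LinearMap.lTensor Z.carrier T.rcoact.toLinearMap (e u : Z.carrier ⊗[k] T.carrier)) =
      LinearMap.rTensor A ((cotensor Z T).val.toLinearMap ∘ₗ e.toLinearMap) (U.rcoact u))

end BicomodAlg

variable (k A) in
/-- The `k`-faithfully flat `A`-biGalois objects. -/
abbrev BiGalObj : Type (max u (v + 1)) :=
  {Z : BicomodAlg k A // Z.IsBiGalois ∧ Module.FaithfullyFlat k Z.carrier}

variable (k A) in
/-- Isomorphism of biGalois objects, as an equivalence relation. -/
def isoSetoid : Setoid (BiGalObj k A) where
  r Z T := BicomodAlg.Iso Z.1 T.1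
  iseqv := ⟨fun Z => .refl Z.1, fun h => h.symm, fun h h' => h.trans h'⟩

variable (k A) in
/-- `BiGal(A)`: isomorphism classes of `k`-faithfully flat `A`-biGalois objects. -/
def BiGal : Type (max u (v + 1)) := Quotient (isoSetoid k A)

/-- The class `[Z]` of a biGalois object. -/
def BiGal.mk (Z : BiGalObj k A) : BiGal k A := Quotient.mk (isoSetoid k A) Z

variable (k A) in
/-- A group structure on `BiGal(A)` is the one induced by the cotensor product if `[Z][T] = [U]`
holds exactly when `U` is isomorphic to `Z □_A T` as a bicomodule algebra. There is at most one
such group structure, and it makes every `Z □_A T` a biGalois object up to isomorphism. -/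
def IsCotensorGroup (G : Group (BiGal k A)) : Prop :=
  ∀ Z T U : BiGalObj k A,
    G.mul (BiGal.mk Z) (BiGal.mk T) = BiGal.mk U ↔ BicomodAlg.IsCotensor Z.1 T.1 U.1

/-! ### The biGalois objects attached to automorphisms and lazy cocycles -/

/-- The product `a ⊗ b ↦ σ(a₁, b₁) a₂ b₂`, that is `σ * m`. -/
def twMul (σ : InvForm k (A ⊗[k] A)) : A ⊗[k] A →ₗ[k] A :=
  (sc A (σ : WithConv (A ⊗[k] A →ₗ[k] k)) * mulm k A).ofConv

theorem twMul_one_left {σ : InvForm k (A ⊗[k] A)} (h : σ ∈ Reg2 k A) (a : A) :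
    twMul σ (1 ⊗ₜ a) = a := by
  have h1 : pull (inr k A) (toConv (twMul σ)) = idm k A := by
    have e1 : pull (inr k A) (σ : WithConv (A ⊗[k] A →ₗ[k] k)) = 1 :=
      congrArg Units.val ((normalized_iff σ).1 h).2
    have e2 : pull (inr k A) (mulm k A) = idm k A := by
      ext a
      change LinearMap.mul' k A (1 ⊗ₜ a) = a
      simp
    rw [twMul, toConv_ofConv, map_mul, pull_sc, e1, e2, map_one, one_mul]
  exact congrArg (fun g : WithConv (A →ₗ[k] A) => g a) h1

theorem twMul_one_right {σ : InvForm k (A ⊗[k] A)} (h : σ ∈ Reg2 k A) (a : A) :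
    twMul σ (a ⊗ₜ 1) = a := by
  have h1 : pull (inl k A) (toConv (twMul σ)) = idm k A := by
    have e1 : pull (inl k A) (σ : WithConv (A ⊗[k] A →ₗ[k] k)) = 1 :=
      congrArg Units.val ((normalized_iff σ).1 h).1
    have e2 : pull (inl k A) (mulm k A) = idm k A := by
      ext a
      change LinearMap.mul' k A (a ⊗ₜ 1) = a
      simp
    rw [twMul, toConv_ofConv, map_mul, pull_sc, e1, e2, map_one, one_mul]
  exact congrArg (fun g : WithConv (A →ₗ[k] A) => g a) h1

theorem twMul_assoc {σ : InvForm k (A ⊗[k] A)} (h : IsLeftCocycle σ) (a b c : A) :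
    twMul σ (twMul σ (a ⊗ₜ b) ⊗ₜ c) = twMul σ (a ⊗ₜ twMul σ (b ⊗ₜ c)) := by
  have h1 : toConv (twMul σ ∘ₗ TensorProduct.map (twMul σ) LinearMap.id) =
      sc A (upull (leg12 k A) σ * upull (mul12 k A) σ : InvForm k _).1 *
        pull (mul12 k A) (mulm k A) := by
    have e := map_sc_mul_left (σ : WithConv (A ⊗[k] A →ₗ[k] k)) (mulm k A)
      (LinearMap.id : A →ₗ[k] A)
    have e' := comp_sc_mul (twMul σ)
      (pull (fst k (A ⊗[k] A) A) (σ : WithConv (A ⊗[k] A →ₗ[k] k)))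
      (toConv (TensorProduct.map (mulm k A).ofConv (LinearMap.id : A →ₗ[k] A)))
    rw [← e] at e'
    refine Eq.trans e' ?_
    have e2 : toConv (twMul σ ∘ₗ TensorProduct.map (mulm k A).ofConv LinearMap.id) =
        pull (mul12 k A) (sc A (σ : WithConv (A ⊗[k] A →ₗ[k] k)) * mulm k A) := rfl
    rw [Units.val_mul, map_mul, mul_assoc]
    refine congrArg _ (Eq.trans e2 ?_)
    rw [map_mul]
    rfl
  have h2 : toConv (twMul σ ∘ₗ TensorProduct.map LinearMap.id (twMul σ) ∘ₗ
      (TensorProduct.assoc k A A A).toLinearMap) =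
      sc A (upull (leg23 k A) σ * upull (mul23 k A) σ : InvForm k _).1 *
        pull (mul23 k A) (mulm k A) := by
    have e := map_sc_mul_right (σ : WithConv (A ⊗[k] A →ₗ[k] k))
      (LinearMap.id : A →ₗ[k] A) (mulm k A)
    have e' := comp_sc_mul (twMul σ)
      (pull (snd k A (A ⊗[k] A)) (σ : WithConv (A ⊗[k] A →ₗ[k] k)))
      (toConv (TensorProduct.map (LinearMap.id : A →ₗ[k] A) (mulm k A).ofConv))
    rw [← e] at e'
    have e2 : toConv (twMul σ ∘ₗ TensorProduct.map LinearMap.id (mulm k A).ofConv) =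
        pull (Coalgebra.TensorProduct.map (CoalgHom.id k A) (mulC k A))
          (sc A (σ : WithConv (A ⊗[k] A →ₗ[k] k)) * mulm k A) := rfl
    have e3 := congrArg (pull (Coalgebra.TensorProduct.assoc k k A A A).toCoalgHom)
      (e'.trans (congrArg _ e2))
    refine Eq.trans e3 ?_
    rw [Units.val_mul, map_mul, map_mul, map_mul, map_mul, mul_assoc]
    rfl
  have h3 : pull (mul12 k A) (mulm k A) = pull (mul23 k A) (mulm k A) := by
    refine WithConv.ext (TensorProduct.ext_threefold fun a b c => ?_)
    simp [mul12, mul23, mulm, mul_assoc]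
  rw [h3, h, ← h2] at h1
  exact congrArg (fun g : WithConv ((A ⊗[k] A) ⊗[k] A →ₗ[k] A) => g ((a ⊗ₜ b) ⊗ₜ c)) h1

theorem comul_comp_mul : (Coalgebra.comul : A →ₗ[k] A ⊗[k] A) ∘ₗ LinearMap.mul' k A =
    TensorProduct.map (LinearMap.mul' k A) (LinearMap.mul' k A) ∘ₗ Coalgebra.comul :=
  (mulC k A).map_comp_comul.symm

theorem comul_comp_twMul (σ : InvForm k (A ⊗[k] A)) :
    toConv (Coalgebra.comul ∘ₗ twMul σ) = sc (A ⊗[k] A) (σ : WithConv (A ⊗[k] A →ₗ[k] k)) *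
      (push Algebra.TensorProduct.includeLeft (mulm k A) *
        push Algebra.TensorProduct.includeRight (mulm k A)) := by
  rw [twMul, comp_sc_mul]
  refine congrArg _ ?_
  rw [mulm, ofConv_toConv, comul_comp_mul, map_comp_comul]

theorem comul_twMul_right (σ : InvForm k (A ⊗[k] A)) (x : A ⊗[k] A) :
    Coalgebra.comul (R := k) (twMul σ x) =
      TensorProduct.map (twMul σ) (LinearMap.mul' k A) (Coalgebra.comul (R := k) x) := by
  have h : toConv (Coalgebra.comul ∘ₗ twMul σ) =
      toConv (TensorProduct.map (twMul σ) (LinearMap.mul' k A) ∘ₗ Coalgebra.comul) := by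
    rw [comul_comp_twMul, map_comp_comul, twMul, toConv_ofConv, map_mul, push_sc, mul_assoc]
    rfl
  exact congrArg (fun g : WithConv (A ⊗[k] A →ₗ[k] A ⊗[k] A) => g x) h

theorem comul_twMul_left {σ : InvForm k (A ⊗[k] A)} (hσ : IsLazy2 σ) (x : A ⊗[k] A) :
    Coalgebra.comul (R := k) (twMul σ x) =
      TensorProduct.map (LinearMap.mul' k A) (twMul σ) (Coalgebra.comul (R := k) x) := by
  have h0 : Commute (sc A (σ : WithConv (A ⊗[k] A →ₗ[k] k))) (mulm k A) := hσ
  have h1 := h0.map (push (Algebra.TensorProduct.includeLeft : A →ₐ[k] A ⊗[k] A))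
  rw [push_sc] at h1
  have h : toConv (Coalgebra.comul ∘ₗ twMul σ) =
      toConv (TensorProduct.map (LinearMap.mul' k A) (twMul σ) ∘ₗ Coalgebra.comul) := by
    rw [comul_comp_twMul, map_comp_comul, twMul, toConv_ofConv, map_mul, push_sc, ← mul_assoc,
      ← mul_assoc, h1.eq]
    rfl
  exact congrArg (fun g : WithConv (A ⊗[k] A →ₗ[k] A ⊗[k] A) => g x) h

/-- The underlying module of `A(σ)`, which is that of `A`. -/
def Tw (_ : Z2L k A) : Type v := A

variable (σ : Z2L k A)

instance : AddCommGroup (Tw σ) := inferInstanceAs (AddCommGroup A)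
instance : Module k (Tw σ) := inferInstanceAs (Module k A)

/-- The identification of the modules `A` and `A(σ)`. -/
def toTw : A ≃ₗ[k] Tw σ := LinearEquiv.refl k A

/-- The algebra `A(σ)`: the product is `a · b = σ(a₁, b₁) a₂ b₂`, the unit is that of `A`. -/
instance : Ring (Tw σ) where
  __ := (inferInstance : AddCommGroup (Tw σ))
  mul a b := toTw σ (twMul σ.1 ((toTw σ).symm a ⊗ₜ (toTw σ).symm b))
  one := toTw σ 1
  left_distrib a b c := by
    change toTw σ (twMul σ.1 (_ ⊗ₜ (toTw σ).symm (b + c))) = toTw σ _ + toTw σ _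
    rw [map_add, tmul_add, map_add, map_add]
  right_distrib a b c := by
    change toTw σ (twMul σ.1 ((toTw σ).symm (a + b) ⊗ₜ _)) = toTw σ _ + toTw σ _
    rw [map_add, add_tmul, map_add, map_add]
  zero_mul a := by
    change toTw σ (twMul σ.1 ((toTw σ).symm 0 ⊗ₜ _)) = 0
    rw [map_zero, zero_tmul, map_zero, map_zero]
  mul_zero a := by
    change toTw σ (twMul σ.1 (_ ⊗ₜ (toTw σ).symm 0)) = 0
    rw [map_zero, tmul_zero, map_zero, map_zero]
  mul_assoc a b c := twMul_assoc σ.2.2 a b c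
  one_mul a := twMul_one_left σ.2.1.1 a
  mul_one a := twMul_one_right σ.2.1.1 a

theorem toTw_mul (a b : A) : toTw σ a * toTw σ b = toTw σ (twMul σ.1 (a ⊗ₜ b)) := rfl

theorem toTw_one : toTw σ 1 = 1 := rfl

instance : Algebra k (Tw σ) :=
  Algebra.ofModule
    (fun r x y => by
      obtain ⟨a, rfl⟩ := (toTw σ).surjective x
      obtain ⟨b, rfl⟩ := (toTw σ).surjective y
      rw [← map_smul, toTw_mul, toTw_mul, ← map_smul, ← map_smul, smul_tmul'])
    (fun r x y => by
      obtain ⟨a, rfl⟩ := (toTw σ).surjective x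
      obtain ⟨b, rfl⟩ := (toTw σ).surjective y
      rw [← map_smul, toTw_mul, toTw_mul, ← map_smul, ← map_smul, tmul_smul])

/-- The right coaction `Δ : A(σ) → A(σ) ⊗ A`. -/
def twRight : Tw σ →ₐ[k] Tw σ ⊗[k] A :=
  AlgHom.ofLinearMap
    (LinearMap.rTensor A (toTw σ).toLinearMap ∘ₗ Coalgebra.comul ∘ₗ (toTw σ).symm.toLinearMap)
    (by
      change LinearMap.rTensor A (toTw σ).toLinearMap (Coalgebra.comul (R := k) (1 : A)) = _
      rw [Bialgebra.comul_one, Algebra.TensorProduct.one_def]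
      rfl)
    (fun x y => by
      obtain ⟨a, rfl⟩ := (toTw σ).surjective x
      obtain ⟨b, rfl⟩ := (toTw σ).surjective y
      rw [toTw_mul]
      simp only [LinearMap.comp_apply, LinearEquiv.coe_coe, LinearEquiv.symm_apply_apply]
      rw [comul_twMul_right, TensorProduct.comul_tmul]
      induction Coalgebra.comul (R := k) a with
      | zero => simp
      | add x x' hx hx' => simp only [add_tmul, map_add, hx, hx', add_mul]
      | tmul a₁ a₂ =>
        induction Coalgebra.comul (R := k) b with
        | zero => simp
        | add y y' hy hy' => simp only [tmul_add, map_add, hy, hy', mul_add]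
        | tmul b₁ b₂ => simp [toTw_mul])

/-- The map `Δ : A(σ) → A ⊗ A(σ)`, an algebra map because `σ` is lazy. -/
def twLeft : Tw σ →ₐ[k] A ⊗[k] Tw σ :=
  AlgHom.ofLinearMap
    (LinearMap.lTensor A (toTw σ).toLinearMap ∘ₗ Coalgebra.comul ∘ₗ (toTw σ).symm.toLinearMap)
    (by
      change LinearMap.lTensor A (toTw σ).toLinearMap (Coalgebra.comul (R := k) (1 : A)) = _
      rw [Bialgebra.comul_one, Algebra.TensorProduct.one_def]
      rfl)
    (fun x y => by
      obtain ⟨a, rfl⟩ := (toTw σ).surjective x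
      obtain ⟨b, rfl⟩ := (toTw σ).surjective y
      rw [toTw_mul]
      simp only [LinearMap.comp_apply, LinearEquiv.coe_coe, LinearEquiv.symm_apply_apply]
      rw [comul_twMul_left σ.2.1.2, TensorProduct.comul_tmul]
      induction Coalgebra.comul (R := k) a with
      | zero => simp
      | add x x' hx hx' => simp only [add_tmul, map_add, hx, hx', add_mul]
      | tmul a₁ a₂ =>
        induction Coalgebra.comul (R := k) b with
        | zero => simp
        | add y y' hy hy' => simp only [tmul_add, map_add, hy, hy', mul_add]
        | tmul b₁ b₂ => simp [toTw_mul])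

theorem twRight_toTw (a : A) :
    twRight σ (toTw σ a) = LinearMap.rTensor A (toTw σ).toLinearMap (Coalgebra.comul a) := rfl

theorem twLeft_toTw (a : A) :
    twLeft σ (toTw σ a) = LinearMap.lTensor A (toTw σ).toLinearMap (Coalgebra.comul a) := rfl

/-- The left coaction `(α ⊗ id) ∘ Δ : A(σ) → A ⊗ A(σ)`. -/
def twLeftAut (α : A ≃ₐc[k] A) : Tw σ →ₐ[k] A ⊗[k] Tw σ :=
  (Algebra.TensorProduct.map (α : A →ₐ[k] A) (AlgHom.id k (Tw σ))).comp (twLeft σ)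

theorem twLeftAut_toTw (α : A ≃ₐc[k] A) (a : A) : twLeftAut σ α (toTw σ a) =
    TensorProduct.map (α : A →ₗc[k] A).toLinearMap (toTw σ).toLinearMap (Coalgebra.comul a) := by
  change Algebra.TensorProduct.map (α : A →ₐ[k] A) (AlgHom.id k (Tw σ))
    (twLeft σ (toTw σ a)) = _
  rw [twLeft_toTw]
  induction Coalgebra.comul (R := k) a with
  | zero => simp
  | add x y hx hy => simp only [map_add, hx, hy]
  | tmul x y => simp

theorem twisted_lcoassoc (α : A ≃ₐc[k] A) (a : A) :
    TensorProduct.assoc k A A (Tw σ)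
      (LinearMap.rTensor (Tw σ) (Coalgebra.comul : A →ₗ[k] A ⊗[k] A)
        (twLeftAut σ α (toTw σ a))) =
    LinearMap.lTensor A (twLeftAut σ α).toLinearMap (twLeftAut σ α (toTw σ a)) := by
  rw [twLeftAut_toTw]
  have h1 : ∀ x : A ⊗[k] A, TensorProduct.assoc k A A (Tw σ)
      (LinearMap.rTensor (Tw σ) (Coalgebra.comul : A →ₗ[k] A ⊗[k] A)
        (TensorProduct.map (α : A →ₗc[k] A).toLinearMap (toTw σ).toLinearMap x)) =
      TensorProduct.map (α : A →ₗc[k] A).toLinearMap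
        (TensorProduct.map (α : A →ₗc[k] A).toLinearMap (toTw σ).toLinearMap)
        (TensorProduct.assoc k A A A (LinearMap.rTensor A Coalgebra.comul x)) := by
    intro x
    induction x with
    | zero => simp
    | add x y hx hy => simp only [map_add, hx, hy]
    | tmul x y =>
      have := (CoalgHomClass.map_comp_comul_apply (α : A →ₗc[k] A) x).symm
      simp only [map_tmul, LinearMap.rTensor_tmul]
      change TensorProduct.assoc k A A (Tw σ) (Coalgebra.comul ((α : A →ₗc[k] A) x) ⊗ₜ _) = _
      rw [this]
      induction Coalgebra.comul (R := k) x with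
      | zero => simp
      | add x y hx hy => simp only [map_add, add_tmul, hx, hy]
      | tmul x y => simp
  have h2 : ∀ x : A ⊗[k] A, LinearMap.lTensor A (twLeftAut σ α).toLinearMap
      (TensorProduct.map (α : A →ₗc[k] A).toLinearMap (toTw σ).toLinearMap x) =
      TensorProduct.map (α : A →ₗc[k] A).toLinearMap
        (TensorProduct.map (α : A →ₗc[k] A).toLinearMap (toTw σ).toLinearMap)
        (LinearMap.lTensor A Coalgebra.comul x) := by
    intro x
    induction x with
    | zero => simp
    | add x y hx hy => simp only [map_add, hx, hy]
    | tmul x y =>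
      simp only [map_tmul, LinearMap.lTensor_tmul]
      exact congrArg _ (twLeftAut_toTw σ α y)
  rw [h1, h2, Coalgebra.coassoc_apply]

theorem twisted_lcounit (α : A ≃ₐc[k] A) (a : A) :
    LinearMap.rTensor (Tw σ) (Coalgebra.counit : A →ₗ[k] k) (twLeftAut σ α (toTw σ a)) =
      1 ⊗ₜ toTw σ a := by
  rw [twLeftAut_toTw]
  have h1 : ∀ x : A ⊗[k] A, LinearMap.rTensor (Tw σ) (Coalgebra.counit : A →ₗ[k] k)
        (TensorProduct.map (α : A →ₗc[k] A).toLinearMap (toTw σ).toLinearMap x) =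
      LinearMap.lTensor k (toTw σ).toLinearMap (LinearMap.rTensor A Coalgebra.counit x) := by
    intro x
    induction x with
    | zero => simp
    | add x y hx hy => simp only [map_add, hx, hy]
    | tmul x y => simp
  rw [h1, Coalgebra.rTensor_counit_comul]
  rfl

theorem twisted_rcoassoc (a : A) :
    TensorProduct.assoc k (Tw σ) A A
      (LinearMap.rTensor A (twRight σ).toLinearMap (twRight σ (toTw σ a))) =
    LinearMap.lTensor (Tw σ) (Coalgebra.comul : A →ₗ[k] A ⊗[k] A) (twRight σ (toTw σ a)) := by
  rw [twRight_toTw]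
  have h1 : ∀ x : A ⊗[k] A, TensorProduct.assoc k (Tw σ) A A
      (LinearMap.rTensor A (twRight σ).toLinearMap
        (LinearMap.rTensor A (toTw σ).toLinearMap x)) =
      LinearMap.rTensor (A ⊗[k] A) (toTw σ).toLinearMap
        (TensorProduct.assoc k A A A (LinearMap.rTensor A Coalgebra.comul x)) := by
    intro x
    induction x with
    | zero => simp
    | add x y hx hy => simp only [map_add, hx, hy]
    | tmul x y =>
      simp only [LinearMap.rTensor_tmul]
      change TensorProduct.assoc k (Tw σ) A A (twRight σ (toTw σ x) ⊗ₜ _) = _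
      rw [twRight_toTw]
      induction Coalgebra.comul (R := k) x with
      | zero => simp
      | add x y hx hy => simp only [map_add, add_tmul, hx, hy]
      | tmul x y => simp
  rw [h1, Coalgebra.coassoc_apply]
  induction Coalgebra.comul (R := k) a with
  | zero => simp
  | add x y hx hy => simp only [map_add, hx, hy]
  | tmul x y => simp

theorem twisted_rcounit (a : A) :
    LinearMap.lTensor (Tw σ) (Coalgebra.counit : A →ₗ[k] k) (twRight σ (toTw σ a)) =
      toTw σ a ⊗ₜ 1 := by
  rw [twRight_toTw]
  have h1 : ∀ x : A ⊗[k] A, LinearMap.lTensor (Tw σ) (Coalgebra.counit : A →ₗ[k] k)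
        (LinearMap.rTensor A (toTw σ).toLinearMap x) =
      LinearMap.rTensor k (toTw σ).toLinearMap (LinearMap.lTensor A Coalgebra.counit x) := by
    intro x
    induction x with
    | zero => simp
    | add x y hx hy => simp only [map_add, hx, hy]
    | tmul x y => simp
  rw [h1, Coalgebra.lTensor_counit_comul]
  rfl

theorem twisted_bicomod (α : A ≃ₐc[k] A) (a : A) :
    TensorProduct.assoc k A (Tw σ) A
      (LinearMap.rTensor A (twLeftAut σ α).toLinearMap (twRight σ (toTw σ a))) =
    LinearMap.lTensor A (twRight σ).toLinearMap (twLeftAut σ α (toTw σ a)) := by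
  rw [twRight_toTw, twLeftAut_toTw]
  have h1 : ∀ x : A ⊗[k] A, TensorProduct.assoc k A (Tw σ) A
      (LinearMap.rTensor A (twLeftAut σ α).toLinearMap
        (LinearMap.rTensor A (toTw σ).toLinearMap x)) =
      TensorProduct.map (α : A →ₗc[k] A).toLinearMap
        (LinearMap.rTensor A (toTw σ).toLinearMap)
        (TensorProduct.assoc k A A A (LinearMap.rTensor A Coalgebra.comul x)) := by
    intro x
    induction x with
    | zero => simp
    | add x y hx hy => simp only [map_add, hx, hy]
    | tmul x y =>
      simp only [LinearMap.rTensor_tmul]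
      change TensorProduct.assoc k A (Tw σ) A (twLeftAut σ α (toTw σ x) ⊗ₜ _) = _
      rw [twLeftAut_toTw]
      induction Coalgebra.comul (R := k) x with
      | zero => simp
      | add x y hx hy => simp only [map_add, add_tmul, hx, hy]
      | tmul x y => simp
  have h2 : ∀ x : A ⊗[k] A, LinearMap.lTensor A (twRight σ).toLinearMap
      (TensorProduct.map (α : A →ₗc[k] A).toLinearMap (toTw σ).toLinearMap x) =
      TensorProduct.map (α : A →ₗc[k] A).toLinearMap
        (LinearMap.rTensor A (toTw σ).toLinearMap)
        (LinearMap.lTensor A Coalgebra.comul x) := by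
    intro x
    induction x with
    | zero => simp
    | add x y hx hy => simp only [map_add, hx, hy]
    | tmul x y =>
      simp only [map_tmul, LinearMap.lTensor_tmul]
      exact congrArg _ (twRight_toTw σ y)
  rw [h1, h2, Coalgebra.coassoc_apply]

/-- The bicomodule algebra `^αA(σ)`: it is the algebra `A(σ)`, with right coaction `Δ` and left
coaction `(α ⊗ id) ∘ Δ`. -/
def twisted (α : A ≃ₐc[k] A) : BicomodAlg k A where
  carrier := Tw σ
  lcoact := twLeftAut σ α
  rcoact := twRight σ
  lcoassoc := twisted_lcoassoc σ α
  lcounit := twisted_lcounit σ α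
  rcoassoc := twisted_rcoassoc σ
  rcounit := twisted_rcounit σ
  bicomod := twisted_bicomod σ α

end BiGalois

end LazyCoh

end

open LazyCoh

open TensorProduct WithConv

noncomputable section

namespace LazyCoh

/-! ### Flat and faithfully flat modules -/

section Flatness

variable {k : Type*} [CommRing k]

/-! Notation: λ(z) = z₋₁ ⊗ z₀ and ρ(z) = z₀ ⊗ z₁ are the coactions, κ_l and κ_r the Galois maps, Δ,
ε and S belong to `A`, and φ, ψ stand for `phi`, `psi`.

The group. Everything rests on faithful flatness over `k`. For a faithfully flat bicomodule algebra
the condition on coinvariants follows from the injectivity of the Galois maps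
(`isBiGalois_of_bijective`), and bijectivity of a Galois map may be tested after tensoring with a
faithfully flat module. The cotensor product `Z □ T` is the equalizer of two algebra maps on `Z ⊗
T`; since `A` is flat, it inherits both coactions. The Galois isomorphism of `T` gives `(Z □ T) ⊗ T
≃ Z ⊗ T`, and that of `Z` gives `Z ⊗ (Z □ T) ≃ Z ⊗ T` (`phi_bijective`, `psi_bijective`). Along
these isomorphisms faithful flatness and the Galois property pass from `Z` and `T` to `Z □ T`. The
two triple cotensor products have the same image in `Z ⊗ T ⊗ U`, hence associativity, and λ
identifies `Z` with `A □ Z`.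

A left inverse of `Z` is built from the translation maps, the algebra maps τᵣ : A → Zᵒᵖ ⊗ Z and τₗ :
A → Z ⊗ Zᵒᵖ with κ_r(τᵣ(a)) = 1 ⊗ a and κ_l(τₗ(a)) = a ⊗ 1. It consists of the elements of `A ⊗ Zᵒᵖ`
which τᵣ ⊗ id sends into the image of id ⊗ τₗ inside `Zᵒᵖ ⊗ Z ⊗ Zᵒᵖ`; for `Z = A` the elements a₁ ⊗
S(a₂) are of this kind, with image S(a₁) ⊗ a₂ ⊗ S(a₃). The identity z₀ ⊗ τᵣ(z₁) = τₗ(z₋₁) ⊗ z₀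
(`lTensor_r_rcoact`) gives this pullback `T` its coactions, together with maps `A → T ⊗ Z` and `A →
Z ⊗ T`. These induce `A ⊗ Z ≃ T ⊗ Z` and `Z ⊗ A ≃ Z ⊗ T`, which carry faithful flatness and the
Galois property from `A` to `T`; descent along `Z` then identifies `A` with `T □ Z`. A left unit and
left inverses make a group.

The sequence. The map a ↦ β(a₁) ⊗ a₂ identifies `^{αβ}A((σ ← β) * ω)` with `^αA(σ) □ ^βA(ω)`: it is
the left coaction of `^βA(ω)` once the modules `A` and `A(σ)` are identified, so its image is known
from the unit law, and laziness of ω makes it multiplicative. On the other hand a right colinear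
bijection from `A(σ)` to `A(ω)` has the form a ↦ γ(a₁) a₂. It respects products exactly when σ = ∂γ
* ω (`slideL_twMul_iff`), and left coactions exactly when α = β ∘ ad(γ⁻¹) (`comul_slideL_iff`). With
γ an algebra map to `k`, or γ lazy, this shows that Υ is well defined on classes; with β = id and ω
= 1 it computes the kernel of Υ, and replacing γ by γ⁻¹ gives the image of ι. -/

/-- The factorization of an algebra map through an injective one. -/
theorem exists_algHom_lift {T C D : Type*} [Semiring T] [Algebra k T] [Semiring C] [Algebra k C]
    [Semiring D] [Algebra k D] (f : T →ₐ[k] C) (g : D →ₐ[k] C) (hg : Function.Injective g)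
    (h : ∀ t, f t ∈ LinearMap.range g.toLinearMap) : ∃ l : T →ₐ[k] D, ∀ t, g (l t) = f t := by
  refine ⟨((AlgEquiv.ofInjective g hg).symm : g.range →ₐ[k] D).comp
    (f.codRestrict g.range fun t => h t), fun t => ?_⟩
  exact congrArg Subtype.val ((AlgEquiv.ofInjective g hg).apply_symm_apply
    (f.codRestrict g.range (fun t => h t) t))

variable {M N P Q : Type*} [AddCommGroup M] [Module k M] [AddCommGroup N] [Module k N]
  [AddCommGroup P] [Module k P] [AddCommGroup Q] [Module k Q]

theorem lTensor_inj [Module.Flat k M] {f : N →ₗ[k] P} (hf : Function.Injective f) :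
    Function.Injective (f.lTensor M) :=
  Module.Flat.lTensor_preserves_injective_linearMap f hf

theorem rTensor_inj [Module.Flat k M] {f : N →ₗ[k] P} (hf : Function.Injective f) :
    Function.Injective (f.rTensor M) :=
  Module.Flat.rTensor_preserves_injective_linearMap f hf

theorem lTensor_bij {f : N →ₗ[k] P} (hf : Function.Bijective f) :
    Function.Bijective (f.lTensor M) :=
  (LinearEquiv.lTensor M (LinearEquiv.ofBijective f hf)).bijective

theorem rTensor_bij {f : N →ₗ[k] P} (hf : Function.Bijective f) :
    Function.Bijective (f.rTensor M) :=
  (LinearEquiv.rTensor M (LinearEquiv.ofBijective f hf)).bijective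

theorem mem_range_lTensor_of_exact [Module.Flat k M] {j : N →ₗ[k] P} {h : P →ₗ[k] Q}
    (H : Function.Exact j h) {x : M ⊗[k] P} (hx : h.lTensor M x = 0) :
    x ∈ LinearMap.range (j.lTensor M) :=
  (Module.Flat.lTensor_exact M H x).1 hx

theorem mem_range_rTensor_of_exact [Module.Flat k M] {j : N →ₗ[k] P} {h : P →ₗ[k] Q}
    (H : Function.Exact j h) {x : P ⊗[k] M} (hx : h.rTensor M x = 0) :
    x ∈ LinearMap.range (j.rTensor M) :=
  (Module.Flat.rTensor_exact M H x).1 hx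

theorem exact_sub_of_range {j : N →ₗ[k] P} {f g : P →ₗ[k] Q}
    (H : ∀ x, x ∈ LinearMap.range j ↔ f x = g x) : Function.Exact j (f - g) := fun x => by
  rw [LinearMap.sub_apply, sub_eq_zero]
  exact (H x).symm

/-- An equalizer is the kernel of the difference `f - g`, and tensoring with a flat module preserves
kernels. -/
theorem mem_range_lTensor_of_eq [Module.Flat k M] {j : N →ₗ[k] P} {f g : P →ₗ[k] Q}
    (H : ∀ x, x ∈ LinearMap.range j ↔ f x = g x) {x : M ⊗[k] P}
    (hx : f.lTensor M x = g.lTensor M x) : x ∈ LinearMap.range (j.lTensor M) :=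
  mem_range_lTensor_of_exact (exact_sub_of_range H) (by
    rw [LinearMap.lTensor_sub, LinearMap.sub_apply, hx, sub_self])

theorem mem_range_rTensor_of_eq [Module.Flat k M] {j : N →ₗ[k] P} {f g : P →ₗ[k] Q}
    (H : ∀ x, x ∈ LinearMap.range j ↔ f x = g x) {x : P ⊗[k] M}
    (hx : f.rTensor M x = g.rTensor M x) : x ∈ LinearMap.range (j.rTensor M) :=
  mem_range_rTensor_of_exact (exact_sub_of_range H) (by
    rw [LinearMap.rTensor_sub, LinearMap.sub_apply, hx, sub_self])

/-- If `P` is the preimage under `f` of the range of `g`, so is `M ⊗ P`, for `M` flat. -/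
theorem mem_range_lTensor_of_mem_range {R : Type*} [AddCommGroup R] [Module k R]
    [Module.Flat k M] {j : N →ₗ[k] P} {f : P →ₗ[k] Q} {g : R →ₗ[k] Q}
    (H : ∀ x, x ∈ LinearMap.range j ↔ f x ∈ LinearMap.range g) {x : M ⊗[k] P}
    (hx : f.lTensor M x ∈ LinearMap.range (g.lTensor M)) : x ∈ LinearMap.range (j.lTensor M) := by
  -- The preimage of a range is the kernel of the map to the quotient `Q ⧸ range g`, so flatness
  -- applies again.
  have e : Function.Exact j ((LinearMap.range g).mkQ ∘ₗ f) := fun x => by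
    rw [LinearMap.comp_apply, Submodule.mkQ_apply, Submodule.Quotient.mk_eq_zero]
    exact (H x).symm
  refine mem_range_lTensor_of_exact e ?_
  obtain ⟨y, hy⟩ := hx
  have h0 : (LinearMap.range g).mkQ ∘ₗ g = 0 := LinearMap.range_mkQ_comp g
  rw [LinearMap.lTensor_comp_apply, ← hy, ← LinearMap.lTensor_comp_apply, h0,
    LinearMap.lTensor_zero, LinearMap.zero_apply]

/-- If `P` is the preimage under `f` of the range of `g`, so is `P ⊗ M`, for `M` flat. -/
theorem mem_range_rTensor_of_mem_range {R : Type*} [AddCommGroup R] [Module k R]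
    [Module.Flat k M] {j : N →ₗ[k] P} {f : P →ₗ[k] Q} {g : R →ₗ[k] Q}
    (H : ∀ x, x ∈ LinearMap.range j ↔ f x ∈ LinearMap.range g) {x : P ⊗[k] M}
    (hx : f.rTensor M x ∈ LinearMap.range (g.rTensor M)) : x ∈ LinearMap.range (j.rTensor M) := by
  have e : Function.Exact j ((LinearMap.range g).mkQ ∘ₗ f) := fun x => by
    rw [LinearMap.comp_apply, Submodule.mkQ_apply, Submodule.Quotient.mk_eq_zero]
    exact (H x).symm
  refine mem_range_rTensor_of_exact e ?_
  obtain ⟨y, hy⟩ := hx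
  have h0 : (LinearMap.range g).mkQ ∘ₗ g = 0 := LinearMap.range_mkQ_comp g
  rw [LinearMap.rTensor_comp_apply, ← hy, ← LinearMap.rTensor_comp_apply, h0,
    LinearMap.rTensor_zero, LinearMap.zero_apply]

/-- Images under `g` are detected after applying `f ⊗ id`, if `f ⊗ C` is injective for all `C`. -/
theorem mem_range_of_rTensor {R : Type*} [AddCommGroup R] [Module k R] {f : N →ₗ[k] P}
    {g : R →ₗ[k] Q} (hf : Function.Injective (f.rTensor (Q ⧸ LinearMap.range g))) {y : N ⊗[k] Q}
    (hy : f.rTensor Q y ∈ LinearMap.range (g.lTensor P)) : y ∈ LinearMap.range (g.lTensor N) := by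
  have h0 : (LinearMap.range g).mkQ ∘ₗ g = 0 := LinearMap.range_mkQ_comp g
  have e : Function.Exact (g.lTensor N) ((LinearMap.range g).mkQ.lTensor N) :=
    lTensor_exact N (LinearMap.exact_map_mkQ_range g) (Submodule.mkQ_surjective _)
  -- By right exactness, lying in the range of `g.lTensor N` means vanishing in `N ⊗ (Q ⧸ range g)`.
  -- There `f` acts injectively by hypothesis, and after `f` the element does come from `g`.
  refine (e y).1 (hf ?_)
  obtain ⟨z, hz⟩ := hy
  rw [map_zero, ← LinearMap.comp_apply, LinearMap.rTensor_comp_lTensor,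
    ← LinearMap.lTensor_comp_rTensor, LinearMap.comp_apply, ← hz, ← LinearMap.lTensor_comp_apply,
    h0, LinearMap.lTensor_zero, LinearMap.zero_apply]

end Flatness

section FaithfullyFlat

universe u v w

variable {k : Type u} [CommRing k] {M : Type v} {N : Type w} [AddCommGroup M] [Module k M]
  [AddCommGroup N] [Module k N]

/-- The associator turns `(M ⊗ N) ⊗ -` into `M ⊗ -` applied to `N ⊗ -`, and `M` both preserves and
reflects exactness. Read in the two directions, this shows that faithfully flat modules are stable
under tensor products and that a faithfully flat factor can be cancelled. -/
theorem exact_lTensor_tensor_iff [Module.FaithfullyFlat k M]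
    {N1 N2 N3 : Type*} [AddCommGroup N1] [Module k N1] [AddCommGroup N2] [Module k N2]
    [AddCommGroup N3] [Module k N3] (f : N1 →ₗ[k] N2) (g : N2 →ₗ[k] N3) :
    Function.Exact (f.lTensor (M ⊗[k] N)) (g.lTensor (M ⊗[k] N)) ↔
      Function.Exact (f.lTensor N) (g.lTensor N) := by
  rw [← Module.FaithfullyFlat.lTensor_exact_iff_exact k M (f.lTensor N) (g.lTensor N)]
  refine (Function.Exact.iff_of_ladder_linearEquiv (e₁ := TensorProduct.assoc k M N N1)
    (e₂ := TensorProduct.assoc k M N N2) (e₃ := TensorProduct.assoc k M N N3) ?_ ?_).symm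
  · exact TensorProduct.ext_threefold fun _ _ _ => rfl
  · exact TensorProduct.ext_threefold fun _ _ _ => rfl

theorem faithfullyFlat_tensor [Module.FaithfullyFlat k M] [Module.FaithfullyFlat k N] :
    Module.FaithfullyFlat k (M ⊗[k] N) := by
  rw [Module.FaithfullyFlat.iff_exact_iff_lTensor_exact]
  intro N1 _ _ N2 _ _ N3 _ _ f g
  rw [exact_lTensor_tensor_iff, Module.FaithfullyFlat.lTensor_exact_iff_exact]

theorem faithfullyFlat_of_tensor [Module.FaithfullyFlat k M]
    [Module.FaithfullyFlat k (M ⊗[k] N)] : Module.FaithfullyFlat k N := by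
  rw [Module.FaithfullyFlat.iff_exact_iff_lTensor_exact]
  intro N1 _ _ N2 _ _ N3 _ _ f g
  rw [← exact_lTensor_tensor_iff (M := M), Module.FaithfullyFlat.lTensor_exact_iff_exact]

theorem bijective_of_lTensor [Module.FaithfullyFlat k M] {P : Type*} [AddCommGroup P] [Module k P]
    {f : N →ₗ[k] P} (h : Function.Bijective (f.lTensor M)) : Function.Bijective f :=
  (Module.FaithfullyFlat.lTensor_bijective_iff_bijective k M f).1 h

theorem bijective_of_rTensor [Module.FaithfullyFlat k M] {P : Type*} [AddCommGroup P] [Module k P]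
    {f : N →ₗ[k] P} (h : Function.Bijective (f.rTensor M)) : Function.Bijective f := by
  refine bijective_of_lTensor (M := M) ?_
  have e : f.lTensor M = (TensorProduct.comm k P M).toLinearMap ∘ₗ f.rTensor M ∘ₗ
      (TensorProduct.comm k M N).toLinearMap := TensorProduct.ext' fun _ _ => rfl
  rw [e]
  exact (TensorProduct.comm k P M).bijective.comp (h.comp (TensorProduct.comm k M N).bijective)

variable {B : Type*} [Ring B] [Algebra k B]

theorem one_tmul_injective [Module.FaithfullyFlat k B] :
    Function.Injective (TensorProduct.mk k B N 1) := by
  rw [injective_iff_map_eq_zero]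
  exact fun x hx => (Module.FaithfullyFlat.one_tmul_eq_zero_iff k N x).1 hx

theorem tmul_one_injective [Module.FaithfullyFlat k B] :
    Function.Injective ((TensorProduct.mk k N B).flip 1) := fun _ _ h =>
  one_tmul_injective (B := B) (congrArg (TensorProduct.comm k N B) h)

theorem algebraMap_injective_of_faithfullyFlat [Module.FaithfullyFlat k B] :
    Function.Injective (algebraMap k B) := fun x y h => by
  refine one_tmul_injective (k := k) (B := B) (N := k) ?_
  refine (TensorProduct.rid k B).injective ?_
  simpa [Algebra.smul_def] using h

/-- Faithfully flat descent for elements. Reduce the second factor modulo `k · 1`: the right-hand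
side dies, because the class of 1 is zero, and what remains is `1 ⊗ x̄ = 0`, which forces `x̄ = 0`.
-/
theorem mem_range_algebraMap_of_tmul_comm [Module.FaithfullyFlat k B] {x : B}
    (h : (1 : B) ⊗ₜ[k] x = x ⊗ₜ 1) : x ∈ Set.range (algebraMap k B) := by
  let q := (LinearMap.range (Algebra.linearMap k B)).mkQ
  have h1 : (1 : B) ⊗ₜ[k] q x = x ⊗ₜ q 1 := congrArg (q.lTensor B) h
  have h2 : q 1 = 0 := by
    rw [Submodule.mkQ_apply, Submodule.Quotient.mk_eq_zero]
    exact ⟨1, map_one (algebraMap k B)⟩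
  rw [h2, tmul_zero, Module.FaithfullyFlat.one_tmul_eq_zero_iff, Submodule.mkQ_apply,
    Submodule.Quotient.mk_eq_zero] at h1
  exact h1

theorem faithfullyFlat_congr (e : M ≃ₗ[k] N) [Module.FaithfullyFlat k M] :
    Module.FaithfullyFlat k N :=
  Module.FaithfullyFlat.of_linearEquiv k M e.symm

/-- A flat module of which the base ring is a direct factor is faithfully flat. -/
theorem faithfullyFlat_of_retract [Module.Flat k M] (i : k →ₗ[k] M) (r : M →ₗ[k] k)
    (h : r ∘ₗ i = LinearMap.id) : Module.FaithfullyFlat k M := by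
  rw [Module.FaithfullyFlat.iff_flat_and_lTensor_reflects_triviality]
  refine ⟨inferInstance, fun N _ _ _ => subsingleton_iff_forall_eq 0 |>.2 fun n => ?_⟩
  have h1 := congrArg (fun x => TensorProduct.lid k N (r.rTensor N x))
    (Subsingleton.elim (i 1 ⊗ₜ[k] n) 0)
  have h2 : r (i 1) = 1 := LinearMap.congr_fun h 1
  simpa [h2] using h1

end FaithfullyFlat

universe u v

variable {k : Type u} {A : Type v} [CommRing k] [Ring A] [HopfAlgebra k A]

theorem algHom_add {B C : Type*} [Semiring B] [Algebra k B] [Semiring C] [Algebra k C]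
    (f : B →ₐ[k] C)
    (x y : B) : f (x + y) = f x + f y := map_add f x y

theorem algHom_zero {B C : Type*} [Semiring B] [Algebra k B] [Semiring C] [Algebra k C]
    (f : B →ₐ[k] C) :
    f 0 = 0 := map_zero f

namespace BicomodAlg

/-! ### Galois maps -/

/-- Expressing the Galois map through the product of the algebra `A ⊗ Z` reduces later identities to
the multiplicativity of the coactions. -/
theorem galL_tmul (Z : BicomodAlg k A) (x y : Z.carrier) :
    Z.galL (x ⊗ₜ y) = Z.lcoact x * (1 ⊗ₜ y) := by
  change LinearMap.lTensor A (LinearMap.mul' k Z.carrier)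
    (TensorProduct.assoc k A Z.carrier Z.carrier (Z.lcoact x ⊗ₜ y)) = _
  induction Z.lcoact x with
  | zero => simp only [LinearMap.map_zero, LinearEquiv.map_zero, zero_tmul, zero_mul]
  | add a b ha hb => simp only [LinearMap.map_add, LinearEquiv.map_add, add_tmul, add_mul, ha, hb]
  | tmul a b => simp

theorem galR_tmul (Z : BicomodAlg k A) (x y : Z.carrier) :
    Z.galR (x ⊗ₜ y) = (x ⊗ₜ 1) * Z.rcoact y := by
  change LinearMap.rTensor A (LinearMap.mul' k Z.carrier)
    ((TensorProduct.assoc k Z.carrier Z.carrier A).symm (x ⊗ₜ Z.rcoact y)) = _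
  induction Z.rcoact y with
  | zero => simp only [LinearMap.map_zero, LinearEquiv.map_zero, tmul_zero, mul_zero]
  | add a b ha hb => simp only [LinearMap.map_add, LinearEquiv.map_add, tmul_add, mul_add, ha, hb]
  | tmul a b => simp

/-- For a faithfully flat bicomodule algebra with bijective Galois maps, the condition on the
coinvariants is automatic. -/
theorem isBiGalois_of_bijective [Nontrivial k] (Z : BicomodAlg k A)
    [Module.FaithfullyFlat k Z.carrier] (hl : Function.Bijective Z.galL)
    (hr : Function.Bijective Z.galR) : Z.IsBiGalois where
  nontrivial := (algebraMap_injective_of_faithfullyFlat (k := k)).nontrivial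
  injective := algebraMap_injective_of_faithfullyFlat
  left_coinv z := by
    -- A coinvariant z satisfies κ_l(z ⊗ 1) = λ(z) = 1 ⊗ z = κ_l(1 ⊗ z). Injectivity gives z ⊗ 1 = 1
    -- ⊗ z, and descent puts z in `k`.
    refine ⟨fun h => mem_range_algebraMap_of_tmul_comm (hl.1 ?_), ?_⟩
    · rw [galL_tmul, galL_tmul, h, map_one, ← Algebra.TensorProduct.one_def, mul_one, one_mul]
    · rintro ⟨r, rfl⟩
      rw [AlgHom.commutes, Algebra.TensorProduct.algebraMap_apply']
  right_coinv z := by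
    refine ⟨fun h => mem_range_algebraMap_of_tmul_comm (hr.1 ?_), ?_⟩
    · rw [galR_tmul, galR_tmul, h, map_one, ← Algebra.TensorProduct.one_def, mul_one, one_mul]
    · rintro ⟨r, rfl⟩
      rw [AlgHom.commutes, Algebra.TensorProduct.algebraMap_apply]
  left_galois := hl
  right_galois := hr

/-- Left colinearity of κ_l, for the coaction λ on the first factor of `Z ⊗ Z` and Δ on the factor
`A` of `A ⊗ Z`. It is the coassociativity of λ, multiplied on the right by the spectator y. -/
theorem galL_colinear (Z : BicomodAlg k A) (x : Z.carrier ⊗[k] Z.carrier) :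
    LinearMap.lTensor A Z.galL (TensorProduct.assoc k A Z.carrier Z.carrier
      (LinearMap.rTensor Z.carrier Z.lcoact.toLinearMap x)) =
    TensorProduct.assoc k A A Z.carrier (LinearMap.rTensor Z.carrier Coalgebra.comul (Z.galL x)) := by
  induction x with
  | zero => simp only [LinearMap.map_zero, LinearEquiv.map_zero]
  | add x y hx hy => simp only [LinearMap.map_add, LinearEquiv.map_add, hx, hy]
  | tmul x y =>
    have h1 : ∀ w : A ⊗[k] Z.carrier, LinearMap.lTensor A Z.galL
        (TensorProduct.assoc k A Z.carrier Z.carrier (w ⊗ₜ y)) =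
        LinearMap.lTensor A Z.lcoact.toLinearMap w * (1 ⊗ₜ (1 ⊗ₜ y)) := by
      intro w
      induction w with
      | zero => simp only [LinearMap.map_zero, LinearEquiv.map_zero, zero_tmul, zero_mul]
      | add a b ha hb =>
        simp only [LinearMap.map_add, LinearEquiv.map_add, add_tmul, add_mul, ha, hb]
      | tmul a b => simp [galL_tmul]
    have h2 : ∀ w : A ⊗[k] Z.carrier, TensorProduct.assoc k A A Z.carrier
        (LinearMap.rTensor Z.carrier Coalgebra.comul (w * (1 ⊗ₜ y))) =
        TensorProduct.assoc k A A Z.carrier (LinearMap.rTensor Z.carrier Coalgebra.comul w) *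
          (1 ⊗ₜ (1 ⊗ₜ y)) := by
      intro w
      induction w with
      | zero => simp only [LinearMap.map_zero, LinearEquiv.map_zero, zero_mul]
      | add a b ha hb => simp only [LinearMap.map_add, LinearEquiv.map_add, add_mul, ha, hb]
      | tmul a b =>
        simp only [Algebra.TensorProduct.tmul_mul_tmul, mul_one, LinearMap.rTensor_tmul]
        induction Coalgebra.comul (R := k) a with
        | zero => simp only [LinearEquiv.map_zero, zero_tmul, zero_mul]
        | add a b ha hb => simp only [LinearEquiv.map_add, add_tmul, add_mul, ha, hb]
        | tmul a b => simp
    rw [galL_tmul, LinearMap.rTensor_tmul, h2, Z.lcoassoc]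
    exact h1 _

theorem galR_colinear (Z : BicomodAlg k A) (x : Z.carrier ⊗[k] Z.carrier) :
    LinearMap.rTensor A Z.galR ((TensorProduct.assoc k Z.carrier Z.carrier A).symm
      (LinearMap.lTensor Z.carrier Z.rcoact.toLinearMap x)) =
    (TensorProduct.assoc k Z.carrier A A).symm
      (LinearMap.lTensor Z.carrier Coalgebra.comul (Z.galR x)) := by
  induction x with
  | zero => simp only [LinearMap.map_zero, LinearEquiv.map_zero]
  | add x y hx hy => simp only [LinearMap.map_add, LinearEquiv.map_add, hx, hy]
  | tmul x y =>
    have h1 : ∀ w : Z.carrier ⊗[k] A, LinearMap.rTensor A Z.galR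
        ((TensorProduct.assoc k Z.carrier Z.carrier A).symm (x ⊗ₜ w)) =
        ((x ⊗ₜ 1) ⊗ₜ 1) * LinearMap.rTensor A Z.rcoact.toLinearMap w := by
      intro w
      induction w with
      | zero => simp only [LinearMap.map_zero, LinearEquiv.map_zero, tmul_zero, mul_zero]
      | add a b ha hb =>
        simp only [LinearMap.map_add, LinearEquiv.map_add, tmul_add, mul_add, ha, hb]
      | tmul a b => simp [galR_tmul]
    have h2 : ∀ w : Z.carrier ⊗[k] A, (TensorProduct.assoc k Z.carrier A A).symm
        (LinearMap.lTensor Z.carrier Coalgebra.comul ((x ⊗ₜ 1) * w)) =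
        ((x ⊗ₜ 1) ⊗ₜ 1) * (TensorProduct.assoc k Z.carrier A A).symm
          (LinearMap.lTensor Z.carrier Coalgebra.comul w) := by
      intro w
      induction w with
      | zero => simp only [LinearMap.map_zero, LinearEquiv.map_zero, mul_zero]
      | add a b ha hb => simp only [LinearMap.map_add, LinearEquiv.map_add, mul_add, ha, hb]
      | tmul a b =>
        simp only [Algebra.TensorProduct.tmul_mul_tmul, one_mul, LinearMap.lTensor_tmul]
        induction Coalgebra.comul (R := k) b with
        | zero => simp only [LinearEquiv.map_zero, tmul_zero, mul_zero]
        | add a b ha hb => simp only [LinearEquiv.map_add, tmul_add, mul_add, ha, hb]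
        | tmul a b => simp
    rw [galR_tmul, LinearMap.lTensor_tmul, h2, ← Z.rcoassoc, LinearEquiv.symm_apply_apply]
    exact h1 _

/-! ### The bicomodule algebra `Z ⊗ T` -/

/-- The left coaction of `Z ⊗ T`, induced by that of `Z`. -/
def ambL (Z T : BicomodAlg k A) :
    Z.carrier ⊗[k] T.carrier →ₐ[k] A ⊗[k] (Z.carrier ⊗[k] T.carrier) :=
  (Algebra.TensorProduct.assoc k k k A Z.carrier T.carrier).toAlgHom.comp
    (Algebra.TensorProduct.map Z.lcoact (AlgHom.id k T.carrier))

/-- The right coaction of `Z ⊗ T`, induced by that of `T`. -/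
def ambR (Z T : BicomodAlg k A) :
    Z.carrier ⊗[k] T.carrier →ₐ[k] (Z.carrier ⊗[k] T.carrier) ⊗[k] A :=
  (Algebra.TensorProduct.assoc k k k Z.carrier T.carrier A).symm.toAlgHom.comp
    (Algebra.TensorProduct.map (AlgHom.id k Z.carrier) T.rcoact)

/-- The map `ρ ⊗ id : Z ⊗ T → Z ⊗ A ⊗ T`. -/
def cotR (Z T : BicomodAlg k A) :
    Z.carrier ⊗[k] T.carrier →ₐ[k] Z.carrier ⊗[k] (A ⊗[k] T.carrier) :=
  (Algebra.TensorProduct.assoc k k k Z.carrier A T.carrier).toAlgHom.comp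
    (Algebra.TensorProduct.map Z.rcoact (AlgHom.id k T.carrier))

/-- The map `id ⊗ λ : Z ⊗ T → Z ⊗ A ⊗ T`. -/
def cotL (Z T : BicomodAlg k A) :
    Z.carrier ⊗[k] T.carrier →ₐ[k] Z.carrier ⊗[k] (A ⊗[k] T.carrier) :=
  Algebra.TensorProduct.map (AlgHom.id k Z.carrier) T.lcoact

variable (Z T : BicomodAlg k A)

theorem ambL_tmul (z : Z.carrier) (t : T.carrier) :
    ambL Z T (z ⊗ₜ t) = TensorProduct.assoc k A Z.carrier T.carrier (Z.lcoact z ⊗ₜ t) := rfl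

theorem ambR_tmul (z : Z.carrier) (t : T.carrier) :
    ambR Z T (z ⊗ₜ t) = (TensorProduct.assoc k Z.carrier T.carrier A).symm (z ⊗ₜ T.rcoact t) := rfl

theorem cotR_tmul (z : Z.carrier) (t : T.carrier) :
    cotR Z T (z ⊗ₜ t) = TensorProduct.assoc k Z.carrier A T.carrier (Z.rcoact z ⊗ₜ t) := rfl

theorem cotL_tmul (z : Z.carrier) (t : T.carrier) : cotL Z T (z ⊗ₜ t) = z ⊗ₜ T.lcoact t := rfl

/-- In each axiom for `Z ⊗ T` concerning a single coaction, one factor contributes its own axiom and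
the other is a spectator. The compatibility `amb_bicomod` needs no axiom at all, since the two
coactions act on different factors. -/
theorem ambL_coassoc (x : Z.carrier ⊗[k] T.carrier) :
    TensorProduct.assoc k A A (Z.carrier ⊗[k] T.carrier)
      (LinearMap.rTensor _ (Coalgebra.comul : A →ₗ[k] A ⊗[k] A) (ambL Z T x)) =
    LinearMap.lTensor A (ambL Z T).toLinearMap (ambL Z T x) := by
  induction x with
  | zero => simp only [LinearMap.map_zero, LinearEquiv.map_zero, algHom_zero]
  | add x y hx hy => simp only [LinearMap.map_add, LinearEquiv.map_add, algHom_add, hx, hy]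
  | tmul z t =>
    rw [ambL_tmul]
    have h1 : ∀ w : A ⊗[k] Z.carrier, TensorProduct.assoc k A A (Z.carrier ⊗[k] T.carrier)
        (LinearMap.rTensor _ Coalgebra.comul (TensorProduct.assoc k A Z.carrier T.carrier
          (w ⊗ₜ t))) =
        LinearMap.lTensor A ((TensorProduct.assoc k A Z.carrier T.carrier).toLinearMap ∘ₗ
          (TensorProduct.mk k _ _).flip t) (TensorProduct.assoc k A A Z.carrier
            (LinearMap.rTensor _ Coalgebra.comul w)) := by
      intro w
      induction w with
      | zero => simp only [LinearMap.map_zero, LinearEquiv.map_zero, zero_tmul]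
      | add x y hx hy => simp only [LinearMap.map_add, LinearEquiv.map_add, add_tmul, hx, hy]
      | tmul a b =>
        simp only [assoc_tmul, LinearMap.rTensor_tmul]
        induction Coalgebra.comul (R := k) a with
        | zero => simp only [LinearMap.map_zero, LinearEquiv.map_zero, zero_tmul]
        | add x y hx hy => simp only [LinearMap.map_add, LinearEquiv.map_add, add_tmul, hx, hy]
        | tmul a b => simp
    have h2 : ∀ w : A ⊗[k] Z.carrier, LinearMap.lTensor A (ambL Z T).toLinearMap
        (TensorProduct.assoc k A Z.carrier T.carrier (w ⊗ₜ t)) =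
        LinearMap.lTensor A ((TensorProduct.assoc k A Z.carrier T.carrier).toLinearMap ∘ₗ
          (TensorProduct.mk k _ _).flip t) (LinearMap.lTensor A Z.lcoact.toLinearMap w) := by
      intro w
      induction w with
      | zero => simp only [LinearMap.map_zero, LinearEquiv.map_zero, zero_tmul]
      | add x y hx hy => simp only [LinearMap.map_add, LinearEquiv.map_add, add_tmul, hx, hy]
      | tmul a b => simp [ambL_tmul]
    rw [h1, h2, Z.lcoassoc]

theorem ambL_counit (x : Z.carrier ⊗[k] T.carrier) :
    LinearMap.rTensor _ (Coalgebra.counit : A →ₗ[k] k) (ambL Z T x) = 1 ⊗ₜ x := by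
  induction x with
  | zero => simp only [LinearMap.map_zero, algHom_zero, tmul_zero]
  | add x y hx hy => simp only [LinearMap.map_add, algHom_add, tmul_add, hx, hy]
  | tmul z t =>
    rw [ambL_tmul]
    have h1 : ∀ w : A ⊗[k] Z.carrier, LinearMap.rTensor (Z.carrier ⊗[k] T.carrier)
        (Coalgebra.counit : A →ₗ[k] k) (TensorProduct.assoc k A Z.carrier T.carrier (w ⊗ₜ t)) =
        TensorProduct.assoc k k Z.carrier T.carrier
          ((LinearMap.rTensor _ (Coalgebra.counit : A →ₗ[k] k) w) ⊗ₜ t) := by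
      intro w
      induction w with
      | zero => simp only [LinearMap.map_zero, LinearEquiv.map_zero, zero_tmul]
      | add x y hx hy => simp only [LinearMap.map_add, LinearEquiv.map_add, add_tmul, hx, hy]
      | tmul a b => simp
    rw [h1, Z.lcounit, assoc_tmul]

theorem ambR_coassoc (x : Z.carrier ⊗[k] T.carrier) :
    TensorProduct.assoc k (Z.carrier ⊗[k] T.carrier) A A
      (LinearMap.rTensor A (ambR Z T).toLinearMap (ambR Z T x)) =
    LinearMap.lTensor _ (Coalgebra.comul : A →ₗ[k] A ⊗[k] A) (ambR Z T x) := by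
  induction x with
  | zero => simp only [LinearMap.map_zero, LinearEquiv.map_zero, algHom_zero]
  | add x y hx hy => simp only [LinearMap.map_add, LinearEquiv.map_add, algHom_add, hx, hy]
  | tmul z t =>
    rw [ambR_tmul]
    have h1 : ∀ w : T.carrier ⊗[k] A, LinearMap.lTensor (Z.carrier ⊗[k] T.carrier)
        Coalgebra.comul ((TensorProduct.assoc k Z.carrier T.carrier A).symm (z ⊗ₜ w)) =
        (TensorProduct.assoc k Z.carrier T.carrier (A ⊗[k] A)).symm
          (z ⊗ₜ LinearMap.lTensor _ Coalgebra.comul w) := by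
      intro w
      induction w with
      | zero => simp only [LinearMap.map_zero, LinearEquiv.map_zero, tmul_zero]
      | add x y hx hy => simp only [LinearMap.map_add, LinearEquiv.map_add, tmul_add, hx, hy]
      | tmul a b => simp
    have h2 : ∀ w : T.carrier ⊗[k] A,
        TensorProduct.assoc k (Z.carrier ⊗[k] T.carrier) A A
        (LinearMap.rTensor A (ambR Z T).toLinearMap
        ((TensorProduct.assoc k Z.carrier T.carrier A).symm (z ⊗ₜ w))) =
        (TensorProduct.assoc k Z.carrier T.carrier (A ⊗[k] A)).symm
          (z ⊗ₜ TensorProduct.assoc k T.carrier A A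
            (LinearMap.rTensor A T.rcoact.toLinearMap w)) := by
      intro w
      induction w with
      | zero => simp only [LinearMap.map_zero, LinearEquiv.map_zero, tmul_zero]
      | add x y hx hy => simp only [LinearMap.map_add, LinearEquiv.map_add, tmul_add, hx, hy]
      | tmul a b =>
        simp only [assoc_symm_tmul, LinearMap.rTensor_tmul, AlgHom.toLinearMap_apply, ambR_tmul]
        induction T.rcoact a with
        | zero => simp only [LinearEquiv.map_zero, zero_tmul, tmul_zero]
        | add x y hx hy => simp only [LinearEquiv.map_add, add_tmul, tmul_add, hx, hy]
        | tmul a b => simp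
    rw [h1, h2, T.rcoassoc]

theorem ambR_counit (x : Z.carrier ⊗[k] T.carrier) :
    LinearMap.lTensor _ (Coalgebra.counit : A →ₗ[k] k) (ambR Z T x) = x ⊗ₜ 1 := by
  induction x with
  | zero => simp only [LinearMap.map_zero, algHom_zero, zero_tmul]
  | add x y hx hy => simp only [LinearMap.map_add, algHom_add, add_tmul, hx, hy]
  | tmul z t =>
    rw [ambR_tmul]
    have h1 : ∀ w : T.carrier ⊗[k] A, LinearMap.lTensor (Z.carrier ⊗[k] T.carrier)
        (Coalgebra.counit : A →ₗ[k] k)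
        ((TensorProduct.assoc k Z.carrier T.carrier A).symm (z ⊗ₜ w)) =
        (TensorProduct.assoc k Z.carrier T.carrier k).symm
          (z ⊗ₜ (LinearMap.lTensor _ (Coalgebra.counit : A →ₗ[k] k) w)) := by
      intro w
      induction w with
      | zero => simp only [LinearMap.map_zero, LinearEquiv.map_zero, tmul_zero]
      | add x y hx hy => simp only [LinearMap.map_add, LinearEquiv.map_add, tmul_add, hx, hy]
      | tmul a b => simp
    rw [h1, T.rcounit, assoc_symm_tmul]

theorem amb_bicomod (x : Z.carrier ⊗[k] T.carrier) :
    TensorProduct.assoc k A (Z.carrier ⊗[k] T.carrier) A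
      (LinearMap.rTensor A (ambL Z T).toLinearMap (ambR Z T x)) =
    LinearMap.lTensor A (ambR Z T).toLinearMap (ambL Z T x) := by
  induction x with
  | zero => simp only [LinearMap.map_zero, LinearEquiv.map_zero, algHom_zero]
  | add x y hx hy => simp only [LinearMap.map_add, LinearEquiv.map_add, algHom_add, hx, hy]
  | tmul z t =>
    have h1 : ∀ w : T.carrier ⊗[k] A, TensorProduct.assoc k A (Z.carrier ⊗[k] T.carrier) A
        (LinearMap.rTensor A (ambL Z T).toLinearMap
          ((TensorProduct.assoc k Z.carrier T.carrier A).symm (z ⊗ₜ w))) =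
        LinearMap.lTensor A (TensorProduct.assoc k Z.carrier T.carrier A).symm.toLinearMap
          (TensorProduct.assoc k A Z.carrier (T.carrier ⊗[k] A) (Z.lcoact z ⊗ₜ w)) := by
      intro w
      induction w with
      | zero => simp only [LinearMap.map_zero, LinearEquiv.map_zero, tmul_zero]
      | add x y hx hy => simp only [LinearMap.map_add, LinearEquiv.map_add, tmul_add, hx, hy]
      | tmul a b =>
        simp only [assoc_symm_tmul, LinearMap.rTensor_tmul, AlgHom.toLinearMap_apply, ambL_tmul]
        induction Z.lcoact z with
        | zero => simp only [LinearMap.map_zero, LinearEquiv.map_zero, zero_tmul]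
        | add x y hx hy => simp only [LinearMap.map_add, LinearEquiv.map_add, add_tmul, hx, hy]
        | tmul c d => simp
    have h2 : ∀ w : A ⊗[k] Z.carrier, LinearMap.lTensor A (ambR Z T).toLinearMap
        (TensorProduct.assoc k A Z.carrier T.carrier (w ⊗ₜ t)) =
        LinearMap.lTensor A (TensorProduct.assoc k Z.carrier T.carrier A).symm.toLinearMap
          (TensorProduct.assoc k A Z.carrier (T.carrier ⊗[k] A) (w ⊗ₜ T.rcoact t)) := by
      intro w
      induction w with
      | zero => simp only [LinearMap.map_zero, LinearEquiv.map_zero, zero_tmul]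
      | add x y hx hy => simp only [LinearMap.map_add, LinearEquiv.map_add, add_tmul, hx, hy]
      | tmul a b =>
        simp only [assoc_tmul, LinearMap.lTensor_tmul, AlgHom.toLinearMap_apply, ambR_tmul,
          LinearEquiv.coe_coe]
    rw [ambR_tmul, ambL_tmul, h1, h2]

/-- The `A`-bicomodule algebra `Z ⊗ T`, with the left coaction of `Z` and the right coaction
of `T`. -/
def ambient : BicomodAlg k A where
  carrier := Z.carrier ⊗[k] T.carrier
  lcoact := ambL Z T
  rcoact := ambR Z T
  lcoassoc := ambL_coassoc Z T
  lcounit := ambL_counit Z T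
  rcoassoc := ambR_coassoc Z T
  rcounit := ambR_counit Z T
  bicomod := amb_bicomod Z T

end BicomodAlg

namespace BicomodAlg

/-! ### Sub-bicomodule algebras -/

section Restrict

variable (B : BicomodAlg k A) {P : Type v} [Ring P] [Algebra k P]
  (j : P →ₐ[k] B.carrier)

/-- An algebra `P` with an injective algebra map `j` to a bicomodule algebra, such that the
coactions map `P` to `A ⊗ P` and `P ⊗ A`, is a bicomodule algebra. -/
theorem exists_restrict [Module.Flat k A] (hj : Function.Injective j)
    (hl : ∀ p, B.lcoact (j p) ∈ LinearMap.range (LinearMap.lTensor A j.toLinearMap))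
    (hr : ∀ p, B.rcoact (j p) ∈ LinearMap.range (LinearMap.rTensor A j.toLinearMap)) :
    ∃ (l : P →ₐ[k] A ⊗[k] P) (r : P →ₐ[k] P ⊗[k] A),
      (∀ p, LinearMap.lTensor A j.toLinearMap (l p) = B.lcoact (j p)) ∧
      (∀ p, LinearMap.rTensor A j.toLinearMap (r p) = B.rcoact (j p)) := by
  have jl : Function.Injective (LinearMap.lTensor A j.toLinearMap) := lTensor_inj hj
  have jr : Function.Injective (LinearMap.rTensor A j.toLinearMap) := rTensor_inj hj
  obtain ⟨l, h1⟩ := exists_algHom_lift (B.lcoact.comp j)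
    (Algebra.TensorProduct.map (AlgHom.id k A) j) jl hl
  obtain ⟨r, h2⟩ := exists_algHom_lift (B.rcoact.comp j)
    (Algebra.TensorProduct.map j (AlgHom.id k A)) jr hr
  exact ⟨l, r, h1, h2⟩

variable {B j}
variable {l : P →ₐ[k] A ⊗[k] P} {r : P →ₐ[k] P ⊗[k] A}

/-- Flatness of `A` embeds `A ⊗ A ⊗ P` into `A ⊗ A ⊗ B`, where the axiom holds. The axioms of the
left and of the right coaction are treated separately because the inverse object takes its two
coactions from two different ambient algebras. -/
theorem restrict_lcoassoc [Module.Flat k A] (hj : Function.Injective j)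
    (hl : ∀ p, LinearMap.lTensor A j.toLinearMap (l p) = B.lcoact (j p)) (p : P) :
    TensorProduct.assoc k A A P (LinearMap.rTensor P (Coalgebra.comul : A →ₗ[k] A ⊗[k] A) (l p)) =
      LinearMap.lTensor A l.toLinearMap (l p) := by
  have j2 : Function.Injective (LinearMap.lTensor A (LinearMap.lTensor A j.toLinearMap)) :=
    lTensor_inj (lTensor_inj hj)
  refine j2 ?_
  have h1 : ∀ x : A ⊗[k] P, LinearMap.lTensor A (LinearMap.lTensor A j.toLinearMap)
      (TensorProduct.assoc k A A P (LinearMap.rTensor P Coalgebra.comul x)) =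
      TensorProduct.assoc k A A B.carrier (LinearMap.rTensor B.carrier Coalgebra.comul
        (LinearMap.lTensor A j.toLinearMap x)) := by
    intro x
    induction x with
    | zero => simp only [LinearMap.map_zero, LinearEquiv.map_zero]
    | add x y hx hy => simp only [LinearMap.map_add, LinearEquiv.map_add, hx, hy]
    | tmul a b =>
      simp only [LinearMap.rTensor_tmul, LinearMap.lTensor_tmul]
      induction Coalgebra.comul (R := k) a with
      | zero => simp only [LinearMap.map_zero, LinearEquiv.map_zero, zero_tmul]
      | add x y hx hy => simp only [LinearMap.map_add, LinearEquiv.map_add, add_tmul, hx, hy]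
      | tmul a b => simp
  have h2 : LinearMap.lTensor A j.toLinearMap ∘ₗ l.toLinearMap =
    B.lcoact.toLinearMap ∘ₗ j.toLinearMap := LinearMap.ext hl
  rw [h1, hl, B.lcoassoc, ← LinearMap.lTensor_comp_apply, h2, LinearMap.lTensor_comp_apply, hl]

theorem restrict_lcounit (hj : Function.Injective j)
    (hl : ∀ p, LinearMap.lTensor A j.toLinearMap (l p) = B.lcoact (j p)) (p : P) :
    LinearMap.rTensor P (Coalgebra.counit : A →ₗ[k] k) (l p) = 1 ⊗ₜ p := by
  have j2 : Function.Injective (LinearMap.lTensor k j.toLinearMap) := lTensor_inj hj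
  refine j2 ?_
  rw [← LinearMap.comp_apply, LinearMap.lTensor_comp_rTensor, ← LinearMap.rTensor_comp_lTensor,
    LinearMap.comp_apply, hl, B.lcounit]
  rfl

theorem restrict_rcoassoc [Module.Flat k A] (hj : Function.Injective j)
    (hr : ∀ p, LinearMap.rTensor A j.toLinearMap (r p) = B.rcoact (j p)) (p : P) :
    TensorProduct.assoc k P A A (LinearMap.rTensor A r.toLinearMap (r p)) =
      LinearMap.lTensor P (Coalgebra.comul : A →ₗ[k] A ⊗[k] A) (r p) := by
  have j2 : Function.Injective (LinearMap.rTensor A (LinearMap.rTensor A j.toLinearMap)) :=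
    rTensor_inj (rTensor_inj hj)
  refine (TensorProduct.assoc k P A A).symm.injective (j2 ?_)
  have h1 : ∀ x : P ⊗[k] A, LinearMap.rTensor A (LinearMap.rTensor A j.toLinearMap)
      ((TensorProduct.assoc k P A A).symm (LinearMap.lTensor P Coalgebra.comul x)) =
      (TensorProduct.assoc k B.carrier A A).symm (LinearMap.lTensor B.carrier Coalgebra.comul
        (LinearMap.rTensor A j.toLinearMap x)) := by
    intro x
    induction x with
    | zero => simp only [LinearMap.map_zero, LinearEquiv.map_zero]
    | add x y hx hy => simp only [LinearMap.map_add, LinearEquiv.map_add, hx, hy]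
    | tmul a b =>
      simp only [LinearMap.rTensor_tmul, LinearMap.lTensor_tmul]
      induction Coalgebra.comul (R := k) b with
      | zero => simp only [LinearMap.map_zero, LinearEquiv.map_zero, tmul_zero]
      | add x y hx hy => simp only [LinearMap.map_add, LinearEquiv.map_add, tmul_add, hx, hy]
      | tmul a b => simp
  have h2 : LinearMap.rTensor A j.toLinearMap ∘ₗ r.toLinearMap =
    B.rcoact.toLinearMap ∘ₗ j.toLinearMap := LinearMap.ext hr
  rw [h1, hr, ← B.rcoassoc, LinearEquiv.symm_apply_apply, LinearEquiv.symm_apply_apply,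
    ← LinearMap.rTensor_comp_apply, h2, LinearMap.rTensor_comp_apply, hr]

theorem restrict_rcounit (hj : Function.Injective j)
    (hr : ∀ p, LinearMap.rTensor A j.toLinearMap (r p) = B.rcoact (j p)) (p : P) :
    LinearMap.lTensor P (Coalgebra.counit : A →ₗ[k] k) (r p) = p ⊗ₜ 1 := by
  have j2 : Function.Injective (LinearMap.rTensor k j.toLinearMap) := rTensor_inj hj
  refine j2 ?_
  rw [← LinearMap.comp_apply, LinearMap.rTensor_comp_lTensor, ← LinearMap.lTensor_comp_rTensor,
    LinearMap.comp_apply, hr, B.rcounit]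
  rfl

theorem restrict_bicomod [Module.Flat k A] (hj : Function.Injective j)
    (hl : ∀ p, LinearMap.lTensor A j.toLinearMap (l p) = B.lcoact (j p))
    (hr : ∀ p, LinearMap.rTensor A j.toLinearMap (r p) = B.rcoact (j p)) (p : P) :
    TensorProduct.assoc k A P A (LinearMap.rTensor A l.toLinearMap (r p)) =
      LinearMap.lTensor A r.toLinearMap (l p) := by
  have j2 : Function.Injective (LinearMap.lTensor A (LinearMap.rTensor A j.toLinearMap)) :=
    lTensor_inj (rTensor_inj hj)
  refine j2 ?_
  have h1 : ∀ x : P ⊗[k] A, LinearMap.lTensor A (LinearMap.rTensor A j.toLinearMap)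
      (TensorProduct.assoc k A P A (LinearMap.rTensor A l.toLinearMap x)) =
      TensorProduct.assoc k A B.carrier A (LinearMap.rTensor A
        (LinearMap.lTensor A j.toLinearMap ∘ₗ l.toLinearMap) x) := by
    intro x
    induction x with
    | zero => simp only [LinearMap.map_zero, LinearEquiv.map_zero]
    | add x y hx hy => simp only [LinearMap.map_add, LinearEquiv.map_add, hx, hy]
    | tmul a b =>
      simp only [LinearMap.rTensor_tmul, LinearMap.comp_apply, AlgHom.toLinearMap_apply]
      induction l a with
      | zero => simp only [LinearMap.map_zero, LinearEquiv.map_zero, zero_tmul]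
      | add x y hx hy => simp only [LinearMap.map_add, LinearEquiv.map_add, add_tmul, hx, hy]
      | tmul a b => simp
  have h2 : LinearMap.lTensor A j.toLinearMap ∘ₗ l.toLinearMap =
    B.lcoact.toLinearMap ∘ₗ j.toLinearMap := LinearMap.ext hl
  have h3 : LinearMap.rTensor A j.toLinearMap ∘ₗ r.toLinearMap =
    B.rcoact.toLinearMap ∘ₗ j.toLinearMap := LinearMap.ext hr
  rw [h1, h2, LinearMap.rTensor_comp_apply, hr, B.bicomod, ← LinearMap.lTensor_comp_apply, h3,
    LinearMap.lTensor_comp_apply, hl]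

end Restrict

/-! ### Cotensor products as equalizers -/

/-- `j : W → Z ⊗ T` identifies the bicomodule algebra `W` with `Z □_A T`. -/
structure IsCotensorMap (Z T W : BicomodAlg k A)
    (j : W.carrier →ₐ[k] Z.carrier ⊗[k] T.carrier) : Prop where
  injective : Function.Injective j
  mem_range_iff : ∀ x, x ∈ LinearMap.range j.toLinearMap ↔ cotR Z T x = cotL Z T x
  left : ∀ w, ambL Z T (j w) = LinearMap.lTensor A j.toLinearMap (W.lcoact w)
  right : ∀ w, ambR Z T (j w) = LinearMap.rTensor A j.toLinearMap (W.rcoact w)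

/-- An injective algebra map with prescribed range replaces the isomorphism onto a subalgebra; in
this form the equalizer property can be tensored with flat modules. -/
theorem isCotensor_iff {Z T W : BicomodAlg k A} :
    IsCotensor Z T W ↔ ∃ j, IsCotensorMap Z T W j := by
  constructor
  · rintro ⟨e, hl, hr⟩
    refine ⟨(cotensor Z T).val.comp e.toAlgHom, ⟨?_, fun x => ⟨?_, fun h => ?_⟩, hl, hr⟩⟩
    · exact Subtype.val_injective.comp e.injective
    · rintro ⟨w, rfl⟩
      exact (e w).2
    · exact ⟨e.symm ⟨x, h⟩, congrArg Subtype.val (e.apply_symm_apply ⟨x, h⟩)⟩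
  · rintro ⟨j, hj⟩
    have h1 : ∀ w, j w ∈ cotensor Z T := fun w => (hj.mem_range_iff _).1 ⟨w, rfl⟩
    have h2 : Function.Bijective (j.codRestrict (cotensor Z T) h1) := by
      refine ⟨fun x y h => hj.injective (congrArg Subtype.val h), fun x => ?_⟩
      obtain ⟨w, hw⟩ := (hj.mem_range_iff x).2 x.2
      exact ⟨w, Subtype.ext hw⟩
    exact ⟨AlgEquiv.ofBijective _ h2, hj.left, hj.right⟩

/-- The maps `cotR` and `cotL` commute with the outer coactions; for `cotR` and the left coaction
this is the bicomodule axiom of `Z`, for `cotL` and the right coaction that of `T`. Hence elements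
on which `cotR` and `cotL` agree are sent by the coactions to elements with the same property. -/
theorem lTensor_cotR_ambL (Z T : BicomodAlg k A) (x : Z.carrier ⊗[k] T.carrier) :
    LinearMap.lTensor A (cotR Z T).toLinearMap (ambL Z T x) =
      TensorProduct.assoc k A Z.carrier (A ⊗[k] T.carrier)
        (LinearMap.rTensor _ Z.lcoact.toLinearMap (cotR Z T x)) := by
  induction x with
  | zero => simp only [LinearMap.map_zero, LinearEquiv.map_zero, algHom_zero]
  | add x y hx hy => simp only [LinearMap.map_add, LinearEquiv.map_add, algHom_add, hx, hy]
  | tmul z t =>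
    have h1 : ∀ w : A ⊗[k] Z.carrier, LinearMap.lTensor A (cotR Z T).toLinearMap
        (TensorProduct.assoc k A Z.carrier T.carrier (w ⊗ₜ t)) =
        LinearMap.lTensor A ((TensorProduct.assoc k Z.carrier A T.carrier).toLinearMap ∘ₗ
          (TensorProduct.mk k _ _).flip t) (LinearMap.lTensor A Z.rcoact.toLinearMap w) := by
      intro w
      induction w with
      | zero => simp only [LinearMap.map_zero, LinearEquiv.map_zero, zero_tmul]
      | add x y hx hy => simp only [LinearMap.map_add, LinearEquiv.map_add, add_tmul, hx, hy]
      | tmul a b => simp [cotR_tmul]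
    have h2 : ∀ w : Z.carrier ⊗[k] A, TensorProduct.assoc k A Z.carrier (A ⊗[k] T.carrier)
        (LinearMap.rTensor _ Z.lcoact.toLinearMap
          (TensorProduct.assoc k Z.carrier A T.carrier (w ⊗ₜ t))) =
        LinearMap.lTensor A ((TensorProduct.assoc k Z.carrier A T.carrier).toLinearMap ∘ₗ
          (TensorProduct.mk k _ _).flip t) (TensorProduct.assoc k A Z.carrier A
            (LinearMap.rTensor A Z.lcoact.toLinearMap w)) := by
      intro w
      induction w with
      | zero => simp only [LinearMap.map_zero, LinearEquiv.map_zero, zero_tmul]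
      | add x y hx hy => simp only [LinearMap.map_add, LinearEquiv.map_add, add_tmul, hx, hy]
      | tmul a b =>
        simp only [assoc_tmul, LinearMap.rTensor_tmul, AlgHom.toLinearMap_apply]
        induction Z.lcoact a with
        | zero => simp only [LinearMap.map_zero, LinearEquiv.map_zero, zero_tmul]
        | add x y hx hy => simp only [LinearMap.map_add, LinearEquiv.map_add, add_tmul, hx, hy]
        | tmul a b => simp
    rw [ambL_tmul, cotR_tmul, h1, h2, Z.bicomod]

theorem lTensor_cotL_ambL (Z T : BicomodAlg k A) (x : Z.carrier ⊗[k] T.carrier) :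
    LinearMap.lTensor A (cotL Z T).toLinearMap (ambL Z T x) =
      TensorProduct.assoc k A Z.carrier (A ⊗[k] T.carrier)
        (LinearMap.rTensor _ Z.lcoact.toLinearMap (cotL Z T x)) := by
  induction x with
  | zero => simp only [LinearMap.map_zero, LinearEquiv.map_zero, algHom_zero]
  | add x y hx hy => simp only [LinearMap.map_add, LinearEquiv.map_add, algHom_add, hx, hy]
  | tmul z t =>
    rw [ambL_tmul, cotL_tmul, LinearMap.rTensor_tmul, AlgHom.toLinearMap_apply]
    induction Z.lcoact z with
    | zero => simp only [LinearMap.map_zero, LinearEquiv.map_zero, zero_tmul]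
    | add x y hx hy => simp only [LinearMap.map_add, LinearEquiv.map_add, add_tmul, hx, hy]
    | tmul a b => simp [cotL_tmul]

theorem rTensor_cotL_ambR (Z T : BicomodAlg k A) (x : Z.carrier ⊗[k] T.carrier) :
    (LinearMap.rTensor A (cotL Z T).toLinearMap (ambR Z T x)) =
      (TensorProduct.assoc k Z.carrier (A ⊗[k] T.carrier) A).symm (LinearMap.lTensor Z.carrier
        ((TensorProduct.assoc k A T.carrier A).symm.toLinearMap ∘ₗ
          LinearMap.lTensor A T.rcoact.toLinearMap) (cotL Z T x)) := by
  induction x with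
  | zero => simp only [LinearMap.map_zero, LinearEquiv.map_zero, algHom_zero]
  | add x y hx hy => simp only [LinearMap.map_add, LinearEquiv.map_add, algHom_add, hx, hy]
  | tmul z t =>
    rw [ambR_tmul, cotL_tmul, LinearMap.lTensor_tmul, LinearMap.comp_apply, ← T.bicomod,
      LinearEquiv.coe_coe, LinearEquiv.symm_apply_apply]
    induction T.rcoact t with
    | zero => simp only [LinearMap.map_zero, LinearEquiv.map_zero, tmul_zero]
    | add x y hx hy => simp only [LinearMap.map_add, LinearEquiv.map_add, tmul_add, hx, hy]
    | tmul a b =>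
      simp [cotL_tmul]

theorem rTensor_cotR_ambR (Z T : BicomodAlg k A) (x : Z.carrier ⊗[k] T.carrier) :
    (LinearMap.rTensor A (cotR Z T).toLinearMap (ambR Z T x)) =
      (TensorProduct.assoc k Z.carrier (A ⊗[k] T.carrier) A).symm (LinearMap.lTensor Z.carrier
        ((TensorProduct.assoc k A T.carrier A).symm.toLinearMap ∘ₗ
          LinearMap.lTensor A T.rcoact.toLinearMap) (cotR Z T x)) := by
  induction x with
  | zero => simp only [LinearMap.map_zero, LinearEquiv.map_zero, algHom_zero]
  | add x y hx hy => simp only [LinearMap.map_add, LinearEquiv.map_add, algHom_add, hx, hy]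
  | tmul z t =>
    have h1 : ∀ w : T.carrier ⊗[k] A, LinearMap.rTensor A (cotR Z T).toLinearMap
        ((TensorProduct.assoc k Z.carrier T.carrier A).symm (z ⊗ₜ w)) =
        (TensorProduct.assoc k Z.carrier (A ⊗[k] T.carrier) A).symm (LinearMap.lTensor Z.carrier
          (TensorProduct.assoc k A T.carrier A).symm.toLinearMap
          (TensorProduct.assoc k Z.carrier A (T.carrier ⊗[k] A) (Z.rcoact z ⊗ₜ w))) := by
      intro w
      induction w with
      | zero => simp only [LinearMap.map_zero, LinearEquiv.map_zero, tmul_zero]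
      | add x y hx hy => simp only [LinearMap.map_add, LinearEquiv.map_add, tmul_add, hx, hy]
      | tmul a b =>
        simp only [assoc_symm_tmul, LinearMap.rTensor_tmul, AlgHom.toLinearMap_apply, cotR_tmul]
        induction Z.rcoact z with
        | zero => simp only [LinearMap.map_zero, LinearEquiv.map_zero, zero_tmul]
        | add x y hx hy => simp only [LinearMap.map_add, LinearEquiv.map_add, add_tmul, hx, hy]
        | tmul a b => simp
    rw [ambR_tmul, cotR_tmul, h1]
    induction Z.rcoact z with
    | zero => simp only [LinearMap.map_zero, LinearEquiv.map_zero, zero_tmul]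
    | add x y hx hy => simp only [LinearMap.map_add, LinearEquiv.map_add, add_tmul, hx, hy]
    | tmul a b => simp

/-- The equalizer is stable under both coactions of the ambient `Z ⊗ T`: as `A` is flat, tensoring
the equalizer with `A` gives the equalizer of the tensored maps, and the four preceding identities
place the coacted element in it. -/
theorem exists_cotensor_structure [Module.Flat k A] (Z T : BicomodAlg k A) :
    ∃ (W : BicomodAlg k A) (j : W.carrier →ₐ[k] Z.carrier ⊗[k] T.carrier),
      IsCotensorMap Z T W j := by
  let j := (cotensor Z T).val
  have hj : Function.Injective j := Subtype.val_injective
  have H : ∀ x, x ∈ LinearMap.range j.toLinearMap ↔ cotR Z T x = cotL Z T x := fun x =>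
    ⟨by rintro ⟨w, rfl⟩; exact w.2, fun h => ⟨⟨x, h⟩, rfl⟩⟩
  obtain ⟨l, r, hl, hr⟩ := exists_restrict (ambient Z T) j hj
    (fun p => mem_range_lTensor_of_eq H ((lTensor_cotR_ambL Z T p.1).trans
      ((congrArg _ (congrArg _ p.2)).trans (lTensor_cotL_ambL Z T p.1).symm)))
    (fun p => mem_range_rTensor_of_eq H ((rTensor_cotR_ambR Z T p.1).trans
      ((congrArg _ (congrArg _ p.2)).trans (rTensor_cotL_ambR Z T p.1).symm)))
  exact ⟨{
    carrier := cotensor Z T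
    lcoact := l
    rcoact := r
    lcoassoc := restrict_lcoassoc hj hl
    lcounit := restrict_lcounit hj hl
    rcoassoc := restrict_rcoassoc hj hr
    rcounit := restrict_rcounit hj hr
    bicomod := restrict_bicomod hj hl hr }, j, hj, H, fun w => (hl w).symm, fun w => (hr w).symm⟩

end BicomodAlg

namespace BicomodAlg

/-! ### The isomorphisms `Z ⊗ (Z □ T) ≃ Z ⊗ T` and `(Z □ T) ⊗ T ≃ Z ⊗ T` -/

section

variable (Z T : BicomodAlg k A)

/-- The map `w ⊗ t ↦ j(w) (1 ⊗ t)`. -/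
def phi {Z T : BicomodAlg k A} {W : Type v} [Ring W] [Algebra k W]
    (j : W →ₐ[k] Z.carrier ⊗[k] T.carrier) :
    W ⊗[k] T.carrier →ₗ[k] Z.carrier ⊗[k] T.carrier :=
  LinearMap.mul' k _ ∘ₗ TensorProduct.map j.toLinearMap (TensorProduct.mk k Z.carrier T.carrier 1)

/-- The map `z ⊗ w ↦ (z ⊗ 1) j(w)`. -/
def psi {Z T : BicomodAlg k A} {W : Type v} [Ring W] [Algebra k W]
    (j : W →ₐ[k] Z.carrier ⊗[k] T.carrier) :
    Z.carrier ⊗[k] W →ₗ[k] Z.carrier ⊗[k] T.carrier :=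
  LinearMap.mul' k _ ∘ₗ
    TensorProduct.map ((TensorProduct.mk k Z.carrier T.carrier).flip 1) j.toLinearMap

variable {Z T}

theorem phi_tmul {W : Type v} [Ring W] [Algebra k W] (j : W →ₐ[k] Z.carrier ⊗[k] T.carrier)
    (w : W) (t : T.carrier) : phi j (w ⊗ₜ t) = j w * (1 ⊗ₜ t) := rfl

theorem psi_tmul {W : Type v} [Ring W] [Algebra k W] (j : W →ₐ[k] Z.carrier ⊗[k] T.carrier)
    (z : Z.carrier) (w : W) : psi j (z ⊗ₜ w) = (z ⊗ₜ 1) * j w := rfl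

variable (Z T)

theorem lTensor_galL_assoc (x : Z.carrier ⊗[k] T.carrier) (t : T.carrier) :
    LinearMap.lTensor Z.carrier T.galL
      (TensorProduct.assoc k Z.carrier T.carrier T.carrier (x ⊗ₜ t)) =
      cotL Z T x * (1 ⊗ₜ (1 ⊗ₜ t)) := by
  induction x with
  | zero => simp only [LinearMap.map_zero, LinearEquiv.map_zero, algHom_zero, zero_tmul, zero_mul]
  | add x y hx hy =>
    simp only [LinearMap.map_add, LinearEquiv.map_add, algHom_add, add_tmul, add_mul, hx, hy]
  | tmul z y =>
    rw [assoc_tmul, LinearMap.lTensor_tmul, galL_tmul, cotL_tmul,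
      Algebra.TensorProduct.tmul_mul_tmul, mul_one]

theorem rTensor_galR_assoc (z : Z.carrier) (x : Z.carrier ⊗[k] T.carrier) :
    TensorProduct.assoc k Z.carrier A T.carrier (LinearMap.rTensor T.carrier Z.galR
      ((TensorProduct.assoc k Z.carrier Z.carrier T.carrier).symm (z ⊗ₜ x))) =
      (z ⊗ₜ 1) * cotR Z T x := by
  induction x with
  | zero => simp only [LinearMap.map_zero, LinearEquiv.map_zero, algHom_zero, tmul_zero, mul_zero]
  | add x y hx hy =>
    simp only [LinearMap.map_add, LinearEquiv.map_add, algHom_add, tmul_add, mul_add, hx, hy]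
  | tmul y t =>
    rw [assoc_symm_tmul, LinearMap.rTensor_tmul, galR_tmul, cotR_tmul]
    induction Z.rcoact y with
    | zero => simp only [LinearEquiv.map_zero, zero_tmul, mul_zero]
    | add x y hx hy => simp only [LinearEquiv.map_add, add_tmul, mul_add, hx, hy]
    | tmul a b =>
      simp only [Algebra.TensorProduct.tmul_mul_tmul, assoc_tmul, one_mul]

/-- By coassociativity of ρ, the image of `cotR` lies in the cotensor product of `Z` with `A ⊗ T`;
`cotR_counit` supplies a retraction. Together they express that cotensoring with the cofree comodule
`A ⊗ T` gives `Z ⊗ T`. -/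
theorem cotR_coassoc (x : Z.carrier ⊗[k] T.carrier) :
    TensorProduct.assoc k Z.carrier A (A ⊗[k] T.carrier)
      (LinearMap.rTensor _ Z.rcoact.toLinearMap (cotR Z T x)) =
    LinearMap.lTensor Z.carrier ((TensorProduct.assoc k A A T.carrier).toLinearMap ∘ₗ
      LinearMap.rTensor T.carrier Coalgebra.comul) (cotR Z T x) := by
  induction x with
  | zero => simp only [LinearMap.map_zero, LinearEquiv.map_zero, algHom_zero]
  | add x y hx hy => simp only [LinearMap.map_add, LinearEquiv.map_add, algHom_add, hx, hy]
  | tmul z t =>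
    let G : Z.carrier ⊗[k] (A ⊗[k] A) →ₗ[k] Z.carrier ⊗[k] (A ⊗[k] (A ⊗[k] T.carrier)) :=
      LinearMap.lTensor Z.carrier ((TensorProduct.assoc k A A T.carrier).toLinearMap ∘ₗ
        (TensorProduct.mk k (A ⊗[k] A) T.carrier).flip t)
    have h1 : ∀ w : Z.carrier ⊗[k] A, TensorProduct.assoc k Z.carrier A (A ⊗[k] T.carrier)
        (LinearMap.rTensor _ Z.rcoact.toLinearMap
          (TensorProduct.assoc k Z.carrier A T.carrier (w ⊗ₜ t))) =
        G (TensorProduct.assoc k Z.carrier A A (LinearMap.rTensor A Z.rcoact.toLinearMap w)) := by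
      intro w
      induction w with
      | zero => simp only [LinearMap.map_zero, LinearEquiv.map_zero, zero_tmul]
      | add x y hx hy => simp only [LinearMap.map_add, LinearEquiv.map_add, add_tmul, hx, hy]
      | tmul a b =>
        simp only [assoc_tmul, LinearMap.rTensor_tmul, AlgHom.toLinearMap_apply]
        induction Z.rcoact a with
        | zero => simp only [LinearMap.map_zero, LinearEquiv.map_zero, zero_tmul]
        | add x y hx hy => simp only [LinearMap.map_add, LinearEquiv.map_add, add_tmul, hx, hy]
        | tmul a b => rfl
    have h2 : ∀ w : Z.carrier ⊗[k] A,
        LinearMap.lTensor Z.carrier ((TensorProduct.assoc k A A T.carrier).toLinearMap ∘ₗ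
          LinearMap.rTensor T.carrier Coalgebra.comul)
          (TensorProduct.assoc k Z.carrier A T.carrier (w ⊗ₜ t)) =
        G (LinearMap.lTensor Z.carrier Coalgebra.comul w) := by
      intro w
      induction w with
      | zero => simp only [LinearMap.map_zero, LinearEquiv.map_zero, zero_tmul]
      | add x y hx hy => simp only [LinearMap.map_add, LinearEquiv.map_add, add_tmul, hx, hy]
      | tmul a b => rfl
    rw [cotR_tmul, h1, h2, Z.rcoassoc]

theorem cotL_coassoc (x : Z.carrier ⊗[k] T.carrier) :
    LinearMap.lTensor Z.carrier ((TensorProduct.assoc k A A T.carrier).toLinearMap ∘ₗ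
      LinearMap.rTensor T.carrier Coalgebra.comul) (cotL Z T x) =
    LinearMap.lTensor Z.carrier (LinearMap.lTensor A T.lcoact.toLinearMap) (cotL Z T x) := by
  induction x with
  | zero => simp only [LinearMap.map_zero, algHom_zero]
  | add x y hx hy => simp only [LinearMap.map_add, algHom_add, hx, hy]
  | tmul z t =>
    rw [cotL_tmul, LinearMap.lTensor_tmul, LinearMap.lTensor_tmul]
    exact congrArg _ (T.lcoassoc t)

theorem cotR_counit (x : Z.carrier ⊗[k] T.carrier) :
    LinearMap.lTensor Z.carrier ((TensorProduct.lid k T.carrier).toLinearMap ∘ₗ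
      LinearMap.rTensor T.carrier Coalgebra.counit) (cotR Z T x) = x := by
  induction x with
  | zero => simp only [LinearMap.map_zero, algHom_zero]
  | add x y hx hy => simp only [LinearMap.map_add, algHom_add, hx, hy]
  | tmul z t =>
    have h2 : ∀ w : Z.carrier ⊗[k] A,
        LinearMap.lTensor Z.carrier ((TensorProduct.lid k T.carrier).toLinearMap ∘ₗ
          LinearMap.rTensor T.carrier Coalgebra.counit)
          (TensorProduct.assoc k Z.carrier A T.carrier (w ⊗ₜ t)) =
        LinearMap.lTensor Z.carrier ((TensorProduct.lid k T.carrier).toLinearMap ∘ₗ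
          (TensorProduct.mk k k T.carrier).flip t)
          (LinearMap.lTensor Z.carrier Coalgebra.counit w) := by
      intro w
      induction w with
      | zero => simp only [LinearMap.map_zero, LinearEquiv.map_zero, zero_tmul]
      | add x y hx hy => simp only [LinearMap.map_add, LinearEquiv.map_add, add_tmul, hx, hy]
      | tmul a b => rfl
    rw [cotR_tmul, h2, Z.rcounit]
    simp

theorem cotL_counit (x : Z.carrier ⊗[k] T.carrier) :
    LinearMap.lTensor Z.carrier ((TensorProduct.lid k T.carrier).toLinearMap ∘ₗ
      LinearMap.rTensor T.carrier Coalgebra.counit) (cotL Z T x) = x := by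
  induction x with
  | zero => simp only [LinearMap.map_zero, algHom_zero]
  | add x y hx hy => simp only [LinearMap.map_add, algHom_add, hx, hy]
  | tmul z t =>
    rw [cotL_tmul, LinearMap.lTensor_tmul, LinearMap.comp_apply, T.lcounit]
    simp

/-- Under the isomorphism `Z ⊗ T ⊗ T ≃ Z ⊗ A ⊗ T` given by κ_l, the two maps that define `(Z □ T) ⊗
T` become ρ ⊗ id and id ⊗ Δ ⊗ id. For `cotR` this is clear, since κ_l does not touch `Z`; for
`cotL`, in the next lemma, it is the colinearity of κ_l. -/
theorem rTensor_cotR_galL (x : (Z.carrier ⊗[k] T.carrier) ⊗[k] T.carrier) :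
    LinearMap.lTensor Z.carrier (LinearMap.lTensor A T.galL ∘ₗ
        (TensorProduct.assoc k A T.carrier T.carrier).toLinearMap)
      (TensorProduct.assoc k Z.carrier (A ⊗[k] T.carrier) T.carrier
        (LinearMap.rTensor T.carrier (cotR Z T).toLinearMap x)) =
    TensorProduct.assoc k Z.carrier A (A ⊗[k] T.carrier)
      (LinearMap.rTensor _ Z.rcoact.toLinearMap (LinearMap.lTensor Z.carrier T.galL
        (TensorProduct.assoc k Z.carrier T.carrier T.carrier x))) := by
  induction x with
  | zero => simp only [LinearMap.map_zero, LinearEquiv.map_zero]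
  | add x y hx hy => simp only [LinearMap.map_add, LinearEquiv.map_add, hx, hy]
  | tmul x t =>
    induction x with
    | zero => simp only [LinearMap.map_zero, LinearEquiv.map_zero, zero_tmul]
    | add x y hx hy => simp only [LinearMap.map_add, LinearEquiv.map_add, add_tmul, hx, hy]
    | tmul z y =>
      rw [LinearMap.rTensor_tmul, AlgHom.toLinearMap_apply, cotR_tmul, assoc_tmul,
        LinearMap.lTensor_tmul, LinearMap.rTensor_tmul, AlgHom.toLinearMap_apply]
      induction Z.rcoact z with
      | zero => simp only [LinearMap.map_zero, LinearEquiv.map_zero, zero_tmul]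
      | add x y hx hy => simp only [LinearMap.map_add, LinearEquiv.map_add, add_tmul, hx, hy]
      | tmul a b => rfl

theorem rTensor_cotL_galL (x : (Z.carrier ⊗[k] T.carrier) ⊗[k] T.carrier) :
    LinearMap.lTensor Z.carrier (LinearMap.lTensor A T.galL ∘ₗ
        (TensorProduct.assoc k A T.carrier T.carrier).toLinearMap)
      (TensorProduct.assoc k Z.carrier (A ⊗[k] T.carrier) T.carrier
        (LinearMap.rTensor T.carrier (cotL Z T).toLinearMap x)) =
    LinearMap.lTensor Z.carrier ((TensorProduct.assoc k A A T.carrier).toLinearMap ∘ₗ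
      LinearMap.rTensor T.carrier Coalgebra.comul) (LinearMap.lTensor Z.carrier T.galL
        (TensorProduct.assoc k Z.carrier T.carrier T.carrier x)) := by
  induction x with
  | zero => simp only [LinearMap.map_zero, LinearEquiv.map_zero]
  | add x y hx hy => simp only [LinearMap.map_add, LinearEquiv.map_add, hx, hy]
  | tmul x t =>
    induction x with
    | zero => simp only [LinearMap.map_zero, LinearEquiv.map_zero, zero_tmul]
    | add x y hx hy => simp only [LinearMap.map_add, LinearEquiv.map_add, add_tmul, hx, hy]
    | tmul z y => exact congrArg (z ⊗ₜ[k] ·) (T.galL_colinear (y ⊗ₜ t))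

/-- Mirror image for κ_r of `Z`. Here `cotR` is the map that needs the colinearity of the Galois map
and produces Δ, while `cotL` only carries along the coaction of `T`. -/
theorem lTensor_cotR_galR (x : Z.carrier ⊗[k] (Z.carrier ⊗[k] T.carrier)) :
    TensorProduct.assoc k Z.carrier A (A ⊗[k] T.carrier)
      (LinearMap.rTensor _ Z.galR ((TensorProduct.assoc k Z.carrier Z.carrier _).symm
        (LinearMap.lTensor Z.carrier (cotR Z T).toLinearMap x))) =
    LinearMap.lTensor Z.carrier ((TensorProduct.assoc k A A T.carrier).toLinearMap ∘ₗ
      LinearMap.rTensor T.carrier Coalgebra.comul) (TensorProduct.assoc k Z.carrier A T.carrier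
        (LinearMap.rTensor T.carrier Z.galR
          ((TensorProduct.assoc k Z.carrier Z.carrier T.carrier).symm x))) := by
  induction x with
  | zero => simp only [LinearMap.map_zero, LinearEquiv.map_zero]
  | add x y hx hy => simp only [LinearMap.map_add, LinearEquiv.map_add, hx, hy]
  | tmul z x =>
    induction x with
    | zero => simp only [LinearMap.map_zero, LinearEquiv.map_zero, tmul_zero]
    | add x y hx hy => simp only [LinearMap.map_add, LinearEquiv.map_add, tmul_add, hx, hy]
    | tmul y t =>
      let G : (Z.carrier ⊗[k] A) ⊗[k] A →ₗ[k] Z.carrier ⊗[k] (A ⊗[k] (A ⊗[k] T.carrier)) :=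
        LinearMap.lTensor Z.carrier ((TensorProduct.assoc k A A T.carrier).toLinearMap ∘ₗ
          (TensorProduct.mk k (A ⊗[k] A) T.carrier).flip t) ∘ₗ
          (TensorProduct.assoc k Z.carrier A A).toLinearMap
      have h := congrArg G (Z.galR_colinear (z ⊗ₜ y))
      refine Eq.trans ?_ (h.trans ?_)
      · rw [LinearMap.lTensor_tmul, LinearMap.lTensor_tmul, AlgHom.toLinearMap_apply,
          AlgHom.toLinearMap_apply, cotR_tmul]
        induction Z.rcoact y with
        | zero => simp only [LinearMap.map_zero, LinearEquiv.map_zero, tmul_zero, zero_tmul]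
        | add x y hx hy =>
          simp only [LinearMap.map_add, LinearEquiv.map_add, tmul_add, add_tmul, hx, hy]
        | tmul a b =>
          rw [assoc_tmul, assoc_symm_tmul, assoc_symm_tmul, LinearMap.rTensor_tmul,
            LinearMap.rTensor_tmul]
          induction Z.galR (z ⊗ₜ a) with
          | zero => simp only [LinearMap.map_zero, LinearEquiv.map_zero, zero_tmul]
          | add x y hx hy => simp only [LinearMap.map_add, LinearEquiv.map_add, add_tmul, hx, hy]
          | tmul a b => rfl
      · rw [assoc_symm_tmul, LinearMap.rTensor_tmul]
        induction Z.galR (z ⊗ₜ y) with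
        | zero => simp only [LinearMap.map_zero, LinearEquiv.map_zero, zero_tmul]
        | add x y hx hy => simp only [LinearMap.map_add, LinearEquiv.map_add, add_tmul, hx, hy]
        | tmul a b =>
          change G ((TensorProduct.assoc k Z.carrier A A).symm (a ⊗ₜ Coalgebra.comul b)) = _
          simp only [G, LinearMap.comp_apply, LinearEquiv.coe_coe, LinearEquiv.apply_symm_apply]
          rfl

theorem lTensor_cotL_galR (x : Z.carrier ⊗[k] (Z.carrier ⊗[k] T.carrier)) :
    TensorProduct.assoc k Z.carrier A (A ⊗[k] T.carrier)
      (LinearMap.rTensor _ Z.galR ((TensorProduct.assoc k Z.carrier Z.carrier _).symm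
        (LinearMap.lTensor Z.carrier (cotL Z T).toLinearMap x))) =
    LinearMap.lTensor Z.carrier (LinearMap.lTensor A T.lcoact.toLinearMap)
      (TensorProduct.assoc k Z.carrier A T.carrier (LinearMap.rTensor T.carrier Z.galR
          ((TensorProduct.assoc k Z.carrier Z.carrier T.carrier).symm x))) := by
  induction x with
  | zero => simp only [LinearMap.map_zero, LinearEquiv.map_zero]
  | add x y hx hy => simp only [LinearMap.map_add, LinearEquiv.map_add, hx, hy]
  | tmul z x =>
    induction x with
    | zero => simp only [LinearMap.map_zero, LinearEquiv.map_zero, tmul_zero]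
    | add x y hx hy => simp only [LinearMap.map_add, LinearEquiv.map_add, tmul_add, hx, hy]
    | tmul y t =>
      rw [LinearMap.lTensor_tmul, AlgHom.toLinearMap_apply, cotL_tmul, assoc_symm_tmul,
        assoc_symm_tmul, LinearMap.rTensor_tmul, LinearMap.rTensor_tmul]
      induction Z.galR (z ⊗ₜ y) with
      | zero => simp only [LinearMap.map_zero, LinearEquiv.map_zero, zero_tmul]
      | add x y hx hy => simp only [LinearMap.map_add, LinearEquiv.map_add, add_tmul, hx, hy]
      | tmul a b => rfl

variable {Z T} {W : BicomodAlg k A} {j : W.carrier →ₐ[k] Z.carrier ⊗[k] T.carrier}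

/-- On the range of j one may replace `cotR` by `cotL`, and κ_l turns j(w) ⊗ t into `cotL` of j(w)
times 1 ⊗ 1 ⊗ t. So φ, followed by the injective map `cotR`, is the inclusion `j ⊗ T` followed by an
isomorphism. -/
theorem cotR_phi (hj : IsCotensorMap Z T W j) (x : W.carrier ⊗[k] T.carrier) :
    cotR Z T (phi j x) = LinearMap.lTensor Z.carrier T.galL
      (TensorProduct.assoc k Z.carrier T.carrier T.carrier
        (LinearMap.rTensor T.carrier j.toLinearMap x)) := by
  induction x with
  | zero => simp only [LinearMap.map_zero, LinearEquiv.map_zero, algHom_zero]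
  | add x y hx hy => simp only [LinearMap.map_add, LinearEquiv.map_add, algHom_add, hx, hy]
  | tmul w t =>
    have h : cotR Z T (j w) = cotL Z T (j w) := (hj.mem_range_iff _).1 ⟨w, rfl⟩
    rw [phi_tmul, map_mul, LinearMap.rTensor_tmul, AlgHom.toLinearMap_apply, lTensor_galL_assoc,
      h, cotR_tmul, map_one]
    rfl

theorem cotL_psi (hj : IsCotensorMap Z T W j) (x : Z.carrier ⊗[k] W.carrier) :
    cotL Z T (psi j x) = TensorProduct.assoc k Z.carrier A T.carrier
      (LinearMap.rTensor T.carrier Z.galR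
        ((TensorProduct.assoc k Z.carrier Z.carrier T.carrier).symm
          (LinearMap.lTensor Z.carrier j.toLinearMap x))) := by
  induction x with
  | zero => simp only [LinearMap.map_zero, LinearEquiv.map_zero, algHom_zero]
  | add x y hx hy => simp only [LinearMap.map_add, LinearEquiv.map_add, algHom_add, hx, hy]
  | tmul z w =>
    have h : cotR Z T (j w) = cotL Z T (j w) := (hj.mem_range_iff _).1 ⟨w, rfl⟩
    rw [psi_tmul, map_mul, LinearMap.lTensor_tmul, AlgHom.toLinearMap_apply, rTensor_galR_assoc,
      h, cotL_tmul, map_one]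

/-- As `T` is flat, `W ⊗ T` is the equalizer of the tensored maps. The Galois isomorphism of `T`
carries it to the cotensor product of `Z` with `A ⊗ T`, which is `Z ⊗ T`. -/
theorem phi_bijective (hj : IsCotensorMap Z T W j) [Module.Flat k T.carrier]
    (hT : Function.Bijective T.galL) : Function.Bijective (phi j) := by
  have jT : Function.Injective (LinearMap.rTensor T.carrier j.toLinearMap) :=
    rTensor_inj hj.injective
  have b1 : Function.Bijective (LinearMap.lTensor Z.carrier T.galL) := lTensor_bij hT
  constructor
  · intro x y h
    refine jT ((TensorProduct.assoc k Z.carrier T.carrier T.carrier).injective (b1.1 ?_))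
    rw [← cotR_phi hj, ← cotR_phi hj, h]
  · intro y
    -- The preimage of y is found inside `Z ⊗ T ⊗ T`: lift `cotR` of y through κ_l; coassociativity
    -- of `cotR` then forces the lift into the equalizer.
    obtain ⟨x', hx'⟩ := b1.2 (cotR Z T y)
    obtain ⟨x, rfl⟩ := (TensorProduct.assoc k Z.carrier T.carrier T.carrier).surjective x'
    have b3 : Function.Bijective (LinearMap.lTensor A T.galL) := lTensor_bij hT
    have b4 : Function.Bijective (LinearMap.lTensor A T.galL ∘ₗ
        (TensorProduct.assoc k A T.carrier T.carrier).toLinearMap) := by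
      rw [LinearMap.coe_comp]
      exact b3.comp (TensorProduct.assoc k A T.carrier T.carrier).bijective
    have b2 : Function.Bijective (LinearMap.lTensor Z.carrier (LinearMap.lTensor A T.galL ∘ₗ
        (TensorProduct.assoc k A T.carrier T.carrier).toLinearMap)) := lTensor_bij b4
    have hx : x ∈ LinearMap.range (LinearMap.rTensor T.carrier j.toLinearMap) := by
      refine mem_range_rTensor_of_eq (f := (cotR Z T).toLinearMap) (g := (cotL Z T).toLinearMap)
        hj.mem_range_iff
        ((TensorProduct.assoc k Z.carrier (A ⊗[k] T.carrier) T.carrier).injective (b2.1 ?_))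
      rw [rTensor_cotR_galL, rTensor_cotL_galL, hx', cotR_coassoc]
    obtain ⟨w, rfl⟩ := hx
    refine ⟨w, ?_⟩
    rw [← cotR_phi hj] at hx'
    -- The counit is a retraction of `cotR`, so equality of the images suffices.
    rw [← cotR_counit Z T y, ← hx', cotR_counit]

theorem psi_bijective (hj : IsCotensorMap Z T W j) [Module.Flat k Z.carrier]
    (hZ : Function.Bijective Z.galR) : Function.Bijective (psi j) := by
  have jT : Function.Injective (LinearMap.lTensor Z.carrier j.toLinearMap) :=
    lTensor_inj hj.injective
  have b1 : Function.Bijective (LinearMap.rTensor T.carrier Z.galR) := rTensor_bij hZ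
  constructor
  · intro x y h
    refine jT ((TensorProduct.assoc k Z.carrier Z.carrier T.carrier).symm.injective (b1.1
      ((TensorProduct.assoc k Z.carrier A T.carrier).injective ?_)))
    rw [← cotL_psi hj, ← cotL_psi hj, h]
  · intro y
    obtain ⟨y', hy'⟩ := (TensorProduct.assoc k Z.carrier A T.carrier).surjective (cotL Z T y)
    obtain ⟨x', rfl⟩ := b1.2 y'
    obtain ⟨x, rfl⟩ := (TensorProduct.assoc k Z.carrier Z.carrier T.carrier).symm.surjective x'
    have b2 : Function.Injective (LinearMap.rTensor (A ⊗[k] T.carrier) Z.galR) :=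
      (rTensor_bij hZ).1
    have hx : x ∈ LinearMap.range (LinearMap.lTensor Z.carrier j.toLinearMap) := by
      refine mem_range_lTensor_of_eq (f := (cotR Z T).toLinearMap) (g := (cotL Z T).toLinearMap)
        hj.mem_range_iff ((TensorProduct.assoc k Z.carrier Z.carrier _).symm.injective (b2
          ((TensorProduct.assoc k Z.carrier A (A ⊗[k] T.carrier)).injective ?_)))
      rw [lTensor_cotR_galR, lTensor_cotL_galR, hy', cotL_coassoc]
    obtain ⟨w, rfl⟩ := hx
    refine ⟨w, ?_⟩
    rw [← cotL_psi hj] at hy'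
    rw [← cotL_counit Z T y, ← hy', cotL_counit]

end

end BicomodAlg

namespace BicomodAlg

/-! ### Cotensor products of biGalois objects -/

section

variable {Z T W : BicomodAlg k A} {j : W.carrier →ₐ[k] Z.carrier ⊗[k] T.carrier}

/-- Transported along ψ, the map `Z ⊗ κ_r` of `W` becomes multiplication by the coaction in the
ambient algebra `Z ⊗ T`, where the Galois map of `T` can be recognized. -/
theorem psi_galR (hj : IsCotensorMap Z T W j) (z : Z.carrier) (w w' : W.carrier) :
    LinearMap.rTensor A (psi j) ((TensorProduct.assoc k Z.carrier W.carrier A).symm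
      (z ⊗ₜ W.galR (w ⊗ₜ w'))) = (psi j (z ⊗ₜ w) ⊗ₜ 1) * ambR Z T (j w') := by
  rw [galR_tmul, hj.right]
  induction W.rcoact w' with
  | zero => simp only [LinearMap.map_zero, LinearEquiv.map_zero, tmul_zero, mul_zero]
  | add x y hx hy => simp only [LinearMap.map_add, LinearEquiv.map_add, tmul_add, mul_add, hx, hy]
  | tmul a b =>
    rw [Algebra.TensorProduct.tmul_mul_tmul, assoc_symm_tmul, LinearMap.rTensor_tmul, psi_tmul,
      psi_tmul, LinearMap.rTensor_tmul, AlgHom.toLinearMap_apply,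
      Algebra.TensorProduct.tmul_mul_tmul, map_mul, mul_assoc]

theorem phi_galL (hj : IsCotensorMap Z T W j) (w w' : W.carrier) (t : T.carrier) :
    LinearMap.lTensor A (phi j) (TensorProduct.assoc k A W.carrier T.carrier
      (W.galL (w ⊗ₜ w') ⊗ₜ t)) = ambL Z T (j w) * (1 ⊗ₜ phi j (w' ⊗ₜ t)) := by
  rw [galL_tmul, hj.left]
  induction W.lcoact w with
  | zero => simp only [LinearMap.map_zero, LinearEquiv.map_zero, zero_tmul, zero_mul]
  | add x y hx hy => simp only [LinearMap.map_add, LinearEquiv.map_add, add_tmul, add_mul, hx, hy]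
  | tmul a b =>
    rw [Algebra.TensorProduct.tmul_mul_tmul, assoc_tmul, LinearMap.lTensor_tmul, phi_tmul,
      phi_tmul, LinearMap.lTensor_tmul, AlgHom.toLinearMap_apply,
      Algebra.TensorProduct.tmul_mul_tmul, map_mul, mul_assoc]

variable (Z T) in
theorem ambR_galR (z : Z.carrier) (t t' : T.carrier) :
    ((1 ⊗ₜ t) ⊗ₜ 1) * ambR Z T (z ⊗ₜ t') =
      (TensorProduct.assoc k Z.carrier T.carrier A).symm (z ⊗ₜ T.galR (t ⊗ₜ t')) := by
  rw [galR_tmul, ambR_tmul]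
  induction T.rcoact t' with
  | zero => simp only [LinearEquiv.map_zero, tmul_zero, mul_zero]
  | add x y hx hy => simp only [LinearEquiv.map_add, tmul_add, mul_add, hx, hy]
  | tmul a b => simp only [Algebra.TensorProduct.tmul_mul_tmul, assoc_symm_tmul, one_mul]

variable (Z T) in
theorem ambL_galL (z z' : Z.carrier) (t : T.carrier) :
    ambL Z T (z ⊗ₜ t) * (1 ⊗ₜ (z' ⊗ₜ 1)) =
      TensorProduct.assoc k A Z.carrier T.carrier (Z.galL (z ⊗ₜ z') ⊗ₜ t) := by
  rw [galL_tmul, ambL_tmul]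
  induction Z.lcoact z with
  | zero => simp only [LinearEquiv.map_zero, zero_tmul, zero_mul]
  | add x y hx hy => simp only [LinearEquiv.map_add, add_tmul, add_mul, hx, hy]
  | tmul a b => simp only [Algebra.TensorProduct.tmul_mul_tmul, assoc_tmul, mul_one]

/-- By faithful flatness it suffices to treat `Z ⊗ κ_r`. Applying ψ twice turns `Z ⊗ W ⊗ W` first
into `(Z ⊗ T) ⊗ W`, then into `T ⊗ (Z ⊗ T)`, and on the latter the map is κ_r of `T` with `Z` as
spectator. The left version uses φ and κ_l of `Z` in the same way. -/
theorem galR_bijective_of_isCotensorMap (hj : IsCotensorMap Z T W j)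
    [Module.FaithfullyFlat k Z.carrier] (hZ : Function.Bijective Z.galR)
    (hT : Function.Bijective T.galR) : Function.Bijective W.galR := by
  have hpsi : Function.Bijective (psi j) := psi_bijective hj hZ
  let M : T.carrier ⊗[k] (Z.carrier ⊗[k] T.carrier) →ₗ[k] (Z.carrier ⊗[k] T.carrier) ⊗[k] A :=
    (TensorProduct.assoc k Z.carrier T.carrier A).symm.toLinearMap ∘ₗ
      LinearMap.lTensor Z.carrier T.galR ∘ₗ
        (TensorProduct.leftComm k T.carrier Z.carrier T.carrier).toLinearMap
  have hM1 : ∀ t y, M (t ⊗ₜ y) = ((1 ⊗ₜ t) ⊗ₜ 1) * ambR Z T y := by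
    intro t y
    induction y with
    | zero => simp only [LinearMap.map_zero, algHom_zero, tmul_zero, mul_zero]
    | add x y hx hy => simp only [LinearMap.map_add, algHom_add, tmul_add, mul_add, hx, hy]
    | tmul z t' => exact (ambR_galR Z T z t t').symm
  have hM2 : Function.Bijective M := by
    have : Function.Bijective (LinearMap.lTensor Z.carrier T.galR) := lTensor_bij hT
    exact (TensorProduct.assoc k Z.carrier T.carrier A).symm.bijective.comp
      (this.comp (TensorProduct.leftComm k T.carrier Z.carrier T.carrier).bijective)
  -- The map x ⊗ w ↦ (x ⊗ 1) ρ(j(w)). Writing z ⊗ t = (1 ⊗ t)(z ⊗ 1), the factor z is absorbed into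
  -- ψ(z ⊗ w) first, and t then enters through `M`.
  let N : (Z.carrier ⊗[k] T.carrier) ⊗[k] W.carrier →ₗ[k] (Z.carrier ⊗[k] T.carrier) ⊗[k] A :=
    M ∘ₗ LinearMap.lTensor T.carrier (psi j) ∘ₗ
      (TensorProduct.assoc k T.carrier Z.carrier W.carrier).toLinearMap ∘ₗ
      LinearMap.rTensor W.carrier (TensorProduct.comm k Z.carrier T.carrier).toLinearMap
  have hN1 : ∀ x w, N (x ⊗ₜ w) = (x ⊗ₜ 1) * ambR Z T (j w) := by
    intro x w
    induction x with
    | zero => simp only [LinearMap.map_zero, zero_tmul, zero_mul]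
    | add x y hx hy => simp only [LinearMap.map_add, add_tmul, add_mul, hx, hy]
    | tmul z t =>
      refine (hM1 t (psi j (z ⊗ₜ w))).trans ?_
      rw [psi_tmul, map_mul, ← mul_assoc, ambR_tmul, map_one, Algebra.TensorProduct.one_def,
        assoc_symm_tmul, Algebra.TensorProduct.tmul_mul_tmul, Algebra.TensorProduct.tmul_mul_tmul,
        one_mul, mul_one, one_mul]
  have hN2 : Function.Bijective N := by
    have h1 : Function.Bijective (LinearMap.lTensor T.carrier (psi j)) := lTensor_bij hpsi
    have h2 : Function.Bijective (LinearMap.rTensor W.carrier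
      (TensorProduct.comm k Z.carrier T.carrier).toLinearMap) :=
      rTensor_bij (TensorProduct.comm k Z.carrier T.carrier).bijective
    exact hM2.comp (h1.comp
      ((TensorProduct.assoc k T.carrier Z.carrier W.carrier).bijective.comp h2))
  refine bijective_of_lTensor (M := Z.carrier) ?_
  have e : (LinearMap.rTensor A (psi j) ∘ₗ
      (TensorProduct.assoc k Z.carrier W.carrier A).symm.toLinearMap) ∘ₗ
        LinearMap.lTensor Z.carrier W.galR =
      N ∘ₗ LinearMap.rTensor W.carrier (psi j) ∘ₗ
        (TensorProduct.assoc k Z.carrier W.carrier W.carrier).symm.toLinearMap :=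
    TensorProduct.ext_threefold' fun z w w' =>
      (psi_galR hj z w w').trans (hN1 (psi j (z ⊗ₜ w)) w').symm
  have h3 : Function.Bijective (LinearMap.rTensor A (psi j)) := rTensor_bij hpsi
  have h4 : Function.Bijective (LinearMap.rTensor W.carrier (psi j)) := rTensor_bij hpsi
  refine (Function.Bijective.of_comp_iff' (h3.comp
    (TensorProduct.assoc k Z.carrier W.carrier A).symm.bijective) _).1 ?_
  exact (congrArg (fun f : _ →ₗ[k] _ => Function.Bijective f) e).mpr (hN2.comp (h4.comp
    (TensorProduct.assoc k Z.carrier W.carrier W.carrier).symm.bijective))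

theorem galL_bijective_of_isCotensorMap (hj : IsCotensorMap Z T W j)
    [Module.FaithfullyFlat k T.carrier] (hZ : Function.Bijective Z.galL)
    (hT : Function.Bijective T.galL) : Function.Bijective W.galL := by
  have hphi : Function.Bijective (phi j) := phi_bijective hj hT
  let M : (Z.carrier ⊗[k] T.carrier) ⊗[k] Z.carrier →ₗ[k] A ⊗[k] (Z.carrier ⊗[k] T.carrier) :=
    (TensorProduct.assoc k A Z.carrier T.carrier).toLinearMap ∘ₗ
      LinearMap.rTensor T.carrier Z.galL ∘ₗ
        (TensorProduct.rightComm k Z.carrier T.carrier Z.carrier).toLinearMap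
  have hM1 : ∀ y z, M (y ⊗ₜ z) = ambL Z T y * (1 ⊗ₜ (z ⊗ₜ 1)) := by
    intro y z
    induction y with
    | zero => simp only [LinearMap.map_zero, algHom_zero, zero_tmul, zero_mul]
    | add x y hx hy => simp only [LinearMap.map_add, algHom_add, add_tmul, add_mul, hx, hy]
    | tmul z' t => exact (ambL_galL Z T z' z t).symm
  have hM2 : Function.Bijective M := by
    have : Function.Bijective (LinearMap.rTensor T.carrier Z.galL) := rTensor_bij hZ
    exact (TensorProduct.assoc k A Z.carrier T.carrier).bijective.comp
      (this.comp (TensorProduct.rightComm k Z.carrier T.carrier Z.carrier).bijective)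
  let N : W.carrier ⊗[k] (Z.carrier ⊗[k] T.carrier) →ₗ[k] A ⊗[k] (Z.carrier ⊗[k] T.carrier) :=
    M ∘ₗ LinearMap.rTensor Z.carrier (phi j) ∘ₗ
      (TensorProduct.assoc k W.carrier T.carrier Z.carrier).symm.toLinearMap ∘ₗ
      LinearMap.lTensor W.carrier (TensorProduct.comm k Z.carrier T.carrier).toLinearMap
  have hN1 : ∀ w x, N (w ⊗ₜ x) = ambL Z T (j w) * (1 ⊗ₜ x) := by
    intro w x
    induction x with
    | zero => simp only [LinearMap.map_zero, tmul_zero, mul_zero]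
    | add x y hx hy => simp only [LinearMap.map_add, tmul_add, mul_add, hx, hy]
    | tmul z t =>
      refine (hM1 (phi j (w ⊗ₜ t)) z).trans ?_
      rw [phi_tmul, map_mul, mul_assoc, ambL_tmul, map_one, Algebra.TensorProduct.one_def,
        assoc_tmul, Algebra.TensorProduct.tmul_mul_tmul, Algebra.TensorProduct.tmul_mul_tmul,
        one_mul, mul_one, one_mul]
  have hN2 : Function.Bijective N := by
    have h1 : Function.Bijective (LinearMap.rTensor Z.carrier (phi j)) := rTensor_bij hphi
    have h2 : Function.Bijective (LinearMap.lTensor W.carrier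
      (TensorProduct.comm k Z.carrier T.carrier).toLinearMap) :=
      lTensor_bij (TensorProduct.comm k Z.carrier T.carrier).bijective
    exact hM2.comp (h1.comp
      ((TensorProduct.assoc k W.carrier T.carrier Z.carrier).symm.bijective.comp h2))
  refine bijective_of_rTensor (M := T.carrier) ?_
  have e : (LinearMap.lTensor A (phi j) ∘ₗ
      (TensorProduct.assoc k A W.carrier T.carrier).toLinearMap) ∘ₗ
        LinearMap.rTensor T.carrier W.galL =
      N ∘ₗ LinearMap.lTensor W.carrier (phi j) ∘ₗ
        (TensorProduct.assoc k W.carrier W.carrier T.carrier).toLinearMap :=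
    TensorProduct.ext_threefold fun w w' t =>
      (phi_galL hj w w' t).trans (hN1 w (phi j (w' ⊗ₜ t))).symm
  have h3 : Function.Bijective (LinearMap.lTensor A (phi j)) := lTensor_bij hphi
  have h4 : Function.Bijective (LinearMap.lTensor W.carrier (phi j)) := lTensor_bij hphi
  refine (Function.Bijective.of_comp_iff' (h3.comp
    (TensorProduct.assoc k A W.carrier T.carrier).bijective) _).1 ?_
  exact (congrArg (fun f : _ →ₗ[k] _ => Function.Bijective f) e).mpr (hN2.comp (h4.comp
    (TensorProduct.assoc k W.carrier W.carrier T.carrier).bijective))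

/-- Through ψ the module `Z ⊗ W` is isomorphic to the faithfully flat `Z ⊗ T`, and the factor `Z`
cancels. -/
theorem faithfullyFlat_of_isCotensorMap (hj : IsCotensorMap Z T W j)
    [Module.FaithfullyFlat k Z.carrier] [Module.FaithfullyFlat k T.carrier]
    (hZ : Function.Bijective Z.galR) : Module.FaithfullyFlat k W.carrier := by
  have h1 : Module.FaithfullyFlat k (Z.carrier ⊗[k] T.carrier) := faithfullyFlat_tensor
  have h2 : Module.FaithfullyFlat k (Z.carrier ⊗[k] W.carrier) :=
    faithfullyFlat_congr (LinearEquiv.ofBijective _ (psi_bijective hj hZ)).symm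
  exact faithfullyFlat_of_tensor (M := Z.carrier)

theorem isBiGalois_of_isCotensorMap [Nontrivial k] (hj : IsCotensorMap Z T W j)
    (hZ : Z.IsBiGalois ∧ Module.FaithfullyFlat k Z.carrier)
    (hT : T.IsBiGalois ∧ Module.FaithfullyFlat k T.carrier) :
    W.IsBiGalois ∧ Module.FaithfullyFlat k W.carrier := by
  have := hZ.2
  have := hT.2
  have h := faithfullyFlat_of_isCotensorMap hj hZ.1.right_galois
  exact ⟨isBiGalois_of_bijective W
    (galL_bijective_of_isCotensorMap hj hZ.1.left_galois hT.1.left_galois)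
    (galR_bijective_of_isCotensorMap hj hZ.1.right_galois hT.1.right_galois), h⟩

end

end BicomodAlg

namespace BicomodAlg

/-! ### Functoriality, uniqueness and associativity of cotensor products -/

section

variable {Z T Z' T' : BicomodAlg k A} (e : Z.carrier →ₐ[k] Z'.carrier)
  (f : T.carrier →ₐ[k] T'.carrier)

theorem ambL_map (he : ∀ z, Z'.lcoact (e z) = LinearMap.lTensor A e.toLinearMap (Z.lcoact z))
    (x : Z.carrier ⊗[k] T.carrier) : ambL Z' T' (TensorProduct.map e.toLinearMap f.toLinearMap x) =
      LinearMap.lTensor A (TensorProduct.map e.toLinearMap f.toLinearMap) (ambL Z T x) := by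
  induction x with
  | zero => simp only [LinearMap.map_zero, algHom_zero]
  | add x y hx hy => simp only [LinearMap.map_add, algHom_add, hx, hy]
  | tmul z t =>
    rw [map_tmul, ambL_tmul, ambL_tmul, AlgHom.toLinearMap_apply, he]
    induction Z.lcoact z with
    | zero => simp only [LinearMap.map_zero, LinearEquiv.map_zero, zero_tmul]
    | add x y hx hy => simp only [LinearMap.map_add, LinearEquiv.map_add, add_tmul, hx, hy]
    | tmul a b => rfl

theorem ambR_map (hf : ∀ t, T'.rcoact (f t) = LinearMap.rTensor A f.toLinearMap (T.rcoact t))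
    (x : Z.carrier ⊗[k] T.carrier) : ambR Z' T' (TensorProduct.map e.toLinearMap f.toLinearMap x) =
      LinearMap.rTensor A (TensorProduct.map e.toLinearMap f.toLinearMap) (ambR Z T x) := by
  induction x with
  | zero => simp only [LinearMap.map_zero, algHom_zero]
  | add x y hx hy => simp only [LinearMap.map_add, algHom_add, hx, hy]
  | tmul z t =>
    rw [map_tmul, ambR_tmul, ambR_tmul, AlgHom.toLinearMap_apply, AlgHom.toLinearMap_apply, hf]
    induction T.rcoact t with
    | zero => simp only [LinearMap.map_zero, LinearEquiv.map_zero, tmul_zero]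
    | add x y hx hy => simp only [LinearMap.map_add, LinearEquiv.map_add, tmul_add, hx, hy]
    | tmul a b => rfl

theorem cotR_map (he : ∀ z, Z'.rcoact (e z) = LinearMap.rTensor A e.toLinearMap (Z.rcoact z))
    (x : Z.carrier ⊗[k] T.carrier) : cotR Z' T' (TensorProduct.map e.toLinearMap f.toLinearMap x) =
      TensorProduct.map e.toLinearMap (LinearMap.lTensor A f.toLinearMap) (cotR Z T x) := by
  induction x with
  | zero => simp only [LinearMap.map_zero, algHom_zero]
  | add x y hx hy => simp only [LinearMap.map_add, algHom_add, hx, hy]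
  | tmul z t =>
    rw [map_tmul, cotR_tmul, cotR_tmul, AlgHom.toLinearMap_apply, he]
    induction Z.rcoact z with
    | zero => simp only [LinearMap.map_zero, LinearEquiv.map_zero, zero_tmul]
    | add x y hx hy => simp only [LinearMap.map_add, LinearEquiv.map_add, add_tmul, hx, hy]
    | tmul a b => rfl

theorem cotL_map (hf : ∀ t, T'.lcoact (f t) = LinearMap.lTensor A f.toLinearMap (T.lcoact t))
    (x : Z.carrier ⊗[k] T.carrier) : cotL Z' T' (TensorProduct.map e.toLinearMap f.toLinearMap x) =
      TensorProduct.map e.toLinearMap (LinearMap.lTensor A f.toLinearMap) (cotL Z T x) := by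
  induction x with
  | zero => simp only [LinearMap.map_zero, algHom_zero]
  | add x y hx hy => simp only [LinearMap.map_add, algHom_add, hx, hy]
  | tmul z t =>
    rw [map_tmul, cotL_tmul, cotL_tmul, AlgHom.toLinearMap_apply, AlgHom.toLinearMap_apply, hf]
    rfl

end

/-- A bicomodule algebra is determined up to isomorphism by its range in another one. -/
theorem iso_of_range_eq [Module.Flat k A] {X Y B : BicomodAlg k A} (i : X.carrier →ₐ[k] B.carrier)
    (j : Y.carrier →ₐ[k] B.carrier) (hi : Function.Injective i) (hj : Function.Injective j)
    (il : ∀ x, B.lcoact (i x) = LinearMap.lTensor A i.toLinearMap (X.lcoact x))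
    (ir : ∀ x, B.rcoact (i x) = LinearMap.rTensor A i.toLinearMap (X.rcoact x))
    (jl : ∀ x, B.lcoact (j x) = LinearMap.lTensor A j.toLinearMap (Y.lcoact x))
    (jr : ∀ x, B.rcoact (j x) = LinearMap.rTensor A j.toLinearMap (Y.rcoact x))
    (h : LinearMap.range i.toLinearMap = LinearMap.range j.toLinearMap) : Iso X Y := by
  obtain ⟨l, hl⟩ := exists_algHom_lift i j hj (fun t => h ▸ ⟨t, rfl⟩)
  have hl' : j.toLinearMap ∘ₗ l.toLinearMap = i.toLinearMap := LinearMap.ext hl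
  have hb : Function.Bijective l := by
    refine ⟨fun x y hxy => hi ?_, fun y => ?_⟩
    · rw [← hl, ← hl, hxy]
    · obtain ⟨x, hx⟩ : j y ∈ LinearMap.range i.toLinearMap := h ▸ ⟨y, rfl⟩
      exact ⟨x, hj ((hl x).trans hx)⟩
  refine ⟨AlgEquiv.ofBijective l hb, fun z => ?_, fun z => ?_⟩
  -- Colinearity of l is checked in `A ⊗ B`, into which `A ⊗ Y` embeds by flatness of `A`.
  · have hj2 : Function.Injective (LinearMap.lTensor A j.toLinearMap) := lTensor_inj hj
    refine hj2 ?_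
    change LinearMap.lTensor A j.toLinearMap (Y.lcoact (l z)) =
      LinearMap.lTensor A j.toLinearMap (LinearMap.lTensor A l.toLinearMap (X.lcoact z))
    rw [← jl, hl, il, ← LinearMap.lTensor_comp_apply, hl']
  · have hj2 : Function.Injective (LinearMap.rTensor A j.toLinearMap) := rTensor_inj hj
    refine hj2 ?_
    change LinearMap.rTensor A j.toLinearMap (Y.rcoact (l z)) =
      LinearMap.rTensor A j.toLinearMap (LinearMap.rTensor A l.toLinearMap (X.rcoact z))
    rw [← jr, hl, ir, ← LinearMap.rTensor_comp_apply, hl']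

theorem IsCotensorMap.iso [Module.Flat k A] {Z T W W' : BicomodAlg k A}
    {j : W.carrier →ₐ[k] Z.carrier ⊗[k] T.carrier} {j' : W'.carrier →ₐ[k] Z.carrier ⊗[k] T.carrier}
    (h : IsCotensorMap Z T W j) (h' : IsCotensorMap Z T W' j') : Iso W W' :=
  iso_of_range_eq (B := ambient Z T) j j' h.injective h'.injective h.left h.right h'.left h'.right
    (Submodule.ext fun x => (h.mem_range_iff x).trans (h'.mem_range_iff x).symm)

/-- This is what makes the product of isomorphism classes independent of the representatives. -/
theorem IsCotensorMap.map {Z T W Z' T' : BicomodAlg k A}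
    {j : W.carrier →ₐ[k] Z.carrier ⊗[k] T.carrier} (h : IsCotensorMap Z T W j)
    (hZ : Iso Z Z') (hT : Iso T T') : ∃ j', IsCotensorMap Z' T' W j' := by
  obtain ⟨e, el, er⟩ := hZ
  obtain ⟨f, fl, fr⟩ := hT
  let E := Algebra.TensorProduct.congr e f
  have hE : E.toLinearMap = TensorProduct.map e.toAlgHom.toLinearMap f.toAlgHom.toLinearMap := rfl
  have inj : Function.Injective (TensorProduct.map e.toAlgHom.toLinearMap
      (LinearMap.lTensor A f.toAlgHom.toLinearMap)) :=
    (TensorProduct.congr e.toLinearEquiv (LinearEquiv.lTensor A f.toLinearEquiv)).injective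
  refine ⟨E.toAlgHom.comp j, E.injective.comp h.injective, fun x => ?_, fun w => ?_, fun w => ?_⟩
  · obtain ⟨x, rfl⟩ := E.surjective x
    have h1 : E x ∈ LinearMap.range (E.toAlgHom.comp j).toLinearMap ↔
        x ∈ LinearMap.range j.toLinearMap :=
      ⟨fun ⟨w, hw⟩ => ⟨w, E.injective hw⟩, fun ⟨w, hw⟩ => ⟨w, congrArg E hw⟩⟩
    have h2 := cotR_map (T := T) (T' := T') e.toAlgHom f.toAlgHom er x
    have h3 := cotL_map (Z := Z) (Z' := Z') e.toAlgHom f.toAlgHom fl x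
    rw [h1, h.mem_range_iff]
    refine ⟨fun hx => ?_, fun hx => inj ?_⟩
    · exact h2.trans ((congrArg _ hx).trans h3.symm)
    · exact h2.symm.trans (hx.trans h3)
  · refine (ambL_map e.toAlgHom f.toAlgHom el (j w)).trans ?_
    rw [h.left, ← LinearMap.lTensor_comp_apply]
    rfl
  · refine (ambR_map e.toAlgHom f.toAlgHom fr (j w)).trans ?_
    rw [h.right, ← LinearMap.rTensor_comp_apply]
    rfl

theorem IsCotensorMap.comp_iso {Z T W W' : BicomodAlg k A}
    {j : W.carrier →ₐ[k] Z.carrier ⊗[k] T.carrier} (h : IsCotensorMap Z T W j)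
    (hW : Iso W' W) : ∃ j', IsCotensorMap Z T W' j' := by
  obtain ⟨e, el, er⟩ := hW
  refine ⟨j.comp e.toAlgHom, h.injective.comp e.injective, fun x => ?_, fun w => ?_, fun w => ?_⟩
  · rw [← h.mem_range_iff]
    exact ⟨fun ⟨w, hw⟩ => ⟨e w, hw⟩, fun ⟨w, hw⟩ => ⟨e.symm w,
      (congrArg j (e.apply_symm_apply w)).trans hw⟩⟩
  · refine (h.left (e w)).trans ?_
    rw [el, ← LinearMap.lTensor_comp_apply]
    rfl
  · refine (h.right (e w)).trans ?_
    rw [er, ← LinearMap.rTensor_comp_apply]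
    rfl

section Assoc

variable (Z T U : BicomodAlg k A)

/-- The six identities from here on move the outer coactions and the maps `cotR` and `cotL` across
the associator of `Z ⊗ T ⊗ U`. Each is a rebracketing on pure tensors and uses no axiom of a
comodule. -/
theorem lTensor_assoc_ambL (x : (Z.carrier ⊗[k] T.carrier) ⊗[k] U.carrier) :
    LinearMap.lTensor A (TensorProduct.assoc k Z.carrier T.carrier U.carrier).toLinearMap
      (TensorProduct.assoc k A (Z.carrier ⊗[k] T.carrier) U.carrier
        (LinearMap.rTensor U.carrier (ambL Z T).toLinearMap x)) =
    TensorProduct.assoc k A Z.carrier (T.carrier ⊗[k] U.carrier)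
      (LinearMap.rTensor (T.carrier ⊗[k] U.carrier) Z.lcoact.toLinearMap
        (TensorProduct.assoc k Z.carrier T.carrier U.carrier x)) := by
  refine LinearMap.congr_fun (f := LinearMap.lTensor A
    (TensorProduct.assoc k Z.carrier T.carrier U.carrier).toLinearMap ∘ₗ
      (TensorProduct.assoc k A (Z.carrier ⊗[k] T.carrier) U.carrier).toLinearMap ∘ₗ
        LinearMap.rTensor U.carrier (ambL Z T).toLinearMap)
    (g := (TensorProduct.assoc k A Z.carrier (T.carrier ⊗[k] U.carrier)).toLinearMap ∘ₗ
      LinearMap.rTensor (T.carrier ⊗[k] U.carrier) Z.lcoact.toLinearMap ∘ₗ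
        (TensorProduct.assoc k Z.carrier T.carrier U.carrier).toLinearMap)
    (TensorProduct.ext_threefold fun z t u => ?_) x
  change LinearMap.lTensor A (TensorProduct.assoc k Z.carrier T.carrier U.carrier).toLinearMap
      (TensorProduct.assoc k A (Z.carrier ⊗[k] T.carrier) U.carrier
        (TensorProduct.assoc k A Z.carrier T.carrier (Z.lcoact z ⊗ₜ t) ⊗ₜ u)) =
    TensorProduct.assoc k A Z.carrier (T.carrier ⊗[k] U.carrier) (Z.lcoact z ⊗ₜ (t ⊗ₜ u))
  induction Z.lcoact z with
  | zero => simp only [LinearMap.map_zero, LinearEquiv.map_zero, zero_tmul]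
  | add x y hx hy => simp only [LinearMap.map_add, LinearEquiv.map_add, add_tmul, hx, hy]
  | tmul a b => rfl

theorem rTensor_assoc_ambR (x : (Z.carrier ⊗[k] T.carrier) ⊗[k] U.carrier) :
    LinearMap.rTensor A (TensorProduct.assoc k Z.carrier T.carrier U.carrier).toLinearMap
      ((TensorProduct.assoc k (Z.carrier ⊗[k] T.carrier) U.carrier A).symm
        (LinearMap.lTensor (Z.carrier ⊗[k] T.carrier) U.rcoact.toLinearMap x)) =
    (TensorProduct.assoc k Z.carrier (T.carrier ⊗[k] U.carrier) A).symm
      (LinearMap.lTensor Z.carrier (ambR T U).toLinearMap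
        (TensorProduct.assoc k Z.carrier T.carrier U.carrier x)) := by
  refine LinearMap.congr_fun (f := LinearMap.rTensor A
    (TensorProduct.assoc k Z.carrier T.carrier U.carrier).toLinearMap ∘ₗ
      (TensorProduct.assoc k (Z.carrier ⊗[k] T.carrier) U.carrier A).symm.toLinearMap ∘ₗ
        LinearMap.lTensor (Z.carrier ⊗[k] T.carrier) U.rcoact.toLinearMap)
    (g := (TensorProduct.assoc k Z.carrier (T.carrier ⊗[k] U.carrier) A).symm.toLinearMap ∘ₗ
      LinearMap.lTensor Z.carrier (ambR T U).toLinearMap ∘ₗ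
        (TensorProduct.assoc k Z.carrier T.carrier U.carrier).toLinearMap)
    (TensorProduct.ext_threefold fun z t u => ?_) x
  change LinearMap.rTensor A (TensorProduct.assoc k Z.carrier T.carrier U.carrier).toLinearMap
      ((TensorProduct.assoc k (Z.carrier ⊗[k] T.carrier) U.carrier A).symm
        ((z ⊗ₜ t) ⊗ₜ U.rcoact u)) =
    (TensorProduct.assoc k Z.carrier (T.carrier ⊗[k] U.carrier) A).symm
      (z ⊗ₜ (TensorProduct.assoc k T.carrier U.carrier A).symm (t ⊗ₜ U.rcoact u))
  induction U.rcoact u with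
  | zero => simp only [LinearMap.map_zero, LinearEquiv.map_zero, tmul_zero]
  | add x y hx hy => simp only [LinearMap.map_add, LinearEquiv.map_add, tmul_add, hx, hy]
  | tmul a b => rfl

theorem assoc_rTensor_ambR (x : (Z.carrier ⊗[k] T.carrier) ⊗[k] U.carrier) :
    TensorProduct.assoc k Z.carrier T.carrier (A ⊗[k] U.carrier)
      (TensorProduct.assoc k (Z.carrier ⊗[k] T.carrier) A U.carrier
        (LinearMap.rTensor U.carrier (ambR Z T).toLinearMap x)) =
    LinearMap.lTensor Z.carrier (cotR T U).toLinearMap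
      (TensorProduct.assoc k Z.carrier T.carrier U.carrier x) := by
  refine LinearMap.congr_fun (f :=
    (TensorProduct.assoc k Z.carrier T.carrier (A ⊗[k] U.carrier)).toLinearMap ∘ₗ
      (TensorProduct.assoc k (Z.carrier ⊗[k] T.carrier) A U.carrier).toLinearMap ∘ₗ
        LinearMap.rTensor U.carrier (ambR Z T).toLinearMap)
    (g := LinearMap.lTensor Z.carrier (cotR T U).toLinearMap ∘ₗ
      (TensorProduct.assoc k Z.carrier T.carrier U.carrier).toLinearMap)
    (TensorProduct.ext_threefold fun z t u => ?_) x
  change TensorProduct.assoc k Z.carrier T.carrier (A ⊗[k] U.carrier)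
      (TensorProduct.assoc k (Z.carrier ⊗[k] T.carrier) A U.carrier
        ((TensorProduct.assoc k Z.carrier T.carrier A).symm (z ⊗ₜ T.rcoact t) ⊗ₜ u)) =
    z ⊗ₜ TensorProduct.assoc k T.carrier A U.carrier (T.rcoact t ⊗ₜ u)
  induction T.rcoact t with
  | zero => simp only [LinearEquiv.map_zero, tmul_zero, zero_tmul]
  | add x y hx hy => simp only [LinearEquiv.map_add, tmul_add, add_tmul, hx, hy]
  | tmul a b => rfl

theorem assoc_lTensor_lcoact (x : (Z.carrier ⊗[k] T.carrier) ⊗[k] U.carrier) :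
    TensorProduct.assoc k Z.carrier T.carrier (A ⊗[k] U.carrier)
      (LinearMap.lTensor (Z.carrier ⊗[k] T.carrier) U.lcoact.toLinearMap x) =
    LinearMap.lTensor Z.carrier (cotL T U).toLinearMap
      (TensorProduct.assoc k Z.carrier T.carrier U.carrier x) :=
  LinearMap.congr_fun (f :=
    (TensorProduct.assoc k Z.carrier T.carrier (A ⊗[k] U.carrier)).toLinearMap ∘ₗ
      LinearMap.lTensor (Z.carrier ⊗[k] T.carrier) U.lcoact.toLinearMap)
    (g := LinearMap.lTensor Z.carrier (cotL T U).toLinearMap ∘ₗ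
      (TensorProduct.assoc k Z.carrier T.carrier U.carrier).toLinearMap)
    (TensorProduct.ext_threefold fun _ _ _ => rfl) x

theorem assoc_rTensor_rcoact (x : (Z.carrier ⊗[k] T.carrier) ⊗[k] U.carrier) :
    LinearMap.lTensor Z.carrier (TensorProduct.assoc k A T.carrier U.carrier).toLinearMap
      (TensorProduct.assoc k Z.carrier (A ⊗[k] T.carrier) U.carrier
        (LinearMap.rTensor U.carrier (cotR Z T).toLinearMap x)) =
    TensorProduct.assoc k Z.carrier A (T.carrier ⊗[k] U.carrier)
      (LinearMap.rTensor (T.carrier ⊗[k] U.carrier) Z.rcoact.toLinearMap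
        (TensorProduct.assoc k Z.carrier T.carrier U.carrier x)) := by
  refine LinearMap.congr_fun (f := LinearMap.lTensor Z.carrier
      (TensorProduct.assoc k A T.carrier U.carrier).toLinearMap ∘ₗ
      (TensorProduct.assoc k Z.carrier (A ⊗[k] T.carrier) U.carrier).toLinearMap ∘ₗ
        LinearMap.rTensor U.carrier (cotR Z T).toLinearMap)
    (g := (TensorProduct.assoc k Z.carrier A (T.carrier ⊗[k] U.carrier)).toLinearMap ∘ₗ
      LinearMap.rTensor (T.carrier ⊗[k] U.carrier) Z.rcoact.toLinearMap ∘ₗ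
      (TensorProduct.assoc k Z.carrier T.carrier U.carrier).toLinearMap)
    (TensorProduct.ext_threefold fun z t u => ?_) x
  change LinearMap.lTensor Z.carrier (TensorProduct.assoc k A T.carrier U.carrier).toLinearMap
      (TensorProduct.assoc k Z.carrier (A ⊗[k] T.carrier) U.carrier
        (TensorProduct.assoc k Z.carrier A T.carrier (Z.rcoact z ⊗ₜ t) ⊗ₜ u)) =
    TensorProduct.assoc k Z.carrier A (T.carrier ⊗[k] U.carrier) (Z.rcoact z ⊗ₜ (t ⊗ₜ u))
  induction Z.rcoact z with
  | zero => simp only [LinearMap.map_zero, LinearEquiv.map_zero, zero_tmul]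
  | add x y hx hy => simp only [LinearMap.map_add, LinearEquiv.map_add, add_tmul, hx, hy]
  | tmul a b => rfl

theorem assoc_lTensor_ambL (x : (Z.carrier ⊗[k] T.carrier) ⊗[k] U.carrier) :
    LinearMap.lTensor Z.carrier (TensorProduct.assoc k A T.carrier U.carrier).toLinearMap
      (TensorProduct.assoc k Z.carrier (A ⊗[k] T.carrier) U.carrier
        (LinearMap.rTensor U.carrier (cotL Z T).toLinearMap x)) =
    LinearMap.lTensor Z.carrier (ambL T U).toLinearMap
      (TensorProduct.assoc k Z.carrier T.carrier U.carrier x) :=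
  LinearMap.congr_fun (f := LinearMap.lTensor Z.carrier
      (TensorProduct.assoc k A T.carrier U.carrier).toLinearMap ∘ₗ
      (TensorProduct.assoc k Z.carrier (A ⊗[k] T.carrier) U.carrier).toLinearMap ∘ₗ
        LinearMap.rTensor U.carrier (cotL Z T).toLinearMap)
    (g := LinearMap.lTensor Z.carrier (ambL T U).toLinearMap ∘ₗ
      (TensorProduct.assoc k Z.carrier T.carrier U.carrier).toLinearMap)
    (TensorProduct.ext_threefold fun _ _ _ => rfl) x

variable {Z T U}

/-- Associativity of the cotensor product. -/
theorem IsCotensorMap.assoc [Module.Flat k A] [Module.Flat k Z.carrier] [Module.Flat k U.carrier]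
    {W V X Y : BicomodAlg k A} {j : W.carrier →ₐ[k] Z.carrier ⊗[k] T.carrier}
    {j' : V.carrier →ₐ[k] T.carrier ⊗[k] U.carrier}
    {i : X.carrier →ₐ[k] W.carrier ⊗[k] U.carrier} {i' : Y.carrier →ₐ[k] Z.carrier ⊗[k] V.carrier}
    (hW : IsCotensorMap Z T W j) (hV : IsCotensorMap T U V j') (hX : IsCotensorMap W U X i)
    (hY : IsCotensorMap Z V Y i') : Iso X Y := by
  let aₗ := TensorProduct.assoc k Z.carrier T.carrier U.carrier
  let a := Algebra.TensorProduct.assoc k k k Z.carrier T.carrier U.carrier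
  let jU := Algebra.TensorProduct.map j (AlgHom.id k U.carrier)
  let jZ := Algebra.TensorProduct.map (AlgHom.id k Z.carrier) j'
  have jU_inj : Function.Injective (LinearMap.rTensor U.carrier j.toLinearMap) :=
    rTensor_inj hW.injective
  have jZ_inj : Function.Injective (LinearMap.lTensor Z.carrier j'.toLinearMap) :=
    lTensor_inj hV.injective
  have jU_inj2 : Function.Injective (LinearMap.rTensor (A ⊗[k] U.carrier) j.toLinearMap) :=
    rTensor_inj hW.injective
  have jZ_inj2 : Function.Injective
      (LinearMap.lTensor Z.carrier (LinearMap.lTensor A j'.toLinearMap)) :=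
    lTensor_inj (lTensor_inj hV.injective)
  have idl : ∀ (B : BicomodAlg k A) (z : B.carrier), B.lcoact (AlgHom.id k B.carrier z) =
      LinearMap.lTensor A (AlgHom.id k B.carrier).toLinearMap (B.lcoact z) := fun B z =>
    (LinearMap.congr_fun (LinearMap.lTensor_id A B.carrier) _).symm
  have idr : ∀ (B : BicomodAlg k A) (z : B.carrier), B.rcoact (AlgHom.id k B.carrier z) =
      LinearMap.rTensor A (AlgHom.id k B.carrier).toLinearMap (B.rcoact z) := fun B z =>
    (LinearMap.congr_fun (LinearMap.rTensor_id A B.carrier) _).symm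
  -- The condition that cuts out `(Z □ T) ⊗ U` is the same as the one for the cotensor product of
  -- `Z` with the ambient algebra `T ⊗ U`.
  have key1 : ∀ x, LinearMap.rTensor U.carrier (cotR Z T).toLinearMap (aₗ.symm x) =
        LinearMap.rTensor U.carrier (cotL Z T).toLinearMap (aₗ.symm x) ↔
      cotR Z (ambient T U) x = cotL Z (ambient T U) x := by
    intro x
    have h1 := assoc_rTensor_rcoact Z T U (aₗ.symm x)
    have h2 := assoc_lTensor_ambL Z T U (aₗ.symm x)
    rw [aₗ.apply_symm_apply] at h1 h2
    have inj : Function.Injective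
        (LinearMap.lTensor Z.carrier (TensorProduct.assoc k A T.carrier U.carrier).toLinearMap) :=
      (lTensor_bij (TensorProduct.assoc k A T.carrier U.carrier).bijective).1
    exact ⟨fun h => h1.symm.trans ((congrArg _ (congrArg _ h)).trans h2), fun h =>
      (TensorProduct.assoc k Z.carrier (A ⊗[k] T.carrier) U.carrier).injective
        (inj (h1.trans (Eq.trans h h2.symm)))⟩
  -- Likewise the condition for `Z ⊗ (T □ U)` is the one for the cotensor product of the ambient `Z
  -- ⊗ T` with `U`.
  have key2 : ∀ x, LinearMap.lTensor Z.carrier (cotR T U).toLinearMap x =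
        LinearMap.lTensor Z.carrier (cotL T U).toLinearMap x ↔
      cotR (ambient Z T) U (aₗ.symm x) = cotL (ambient Z T) U (aₗ.symm x) := by
    intro x
    have h1 := assoc_rTensor_ambR Z T U (aₗ.symm x)
    have h2 := assoc_lTensor_lcoact Z T U (aₗ.symm x)
    rw [aₗ.apply_symm_apply] at h1 h2
    exact ⟨fun h => (TensorProduct.assoc k Z.carrier T.carrier (A ⊗[k] U.carrier)).injective
      (h1.trans (h.trans h2.symm)), fun h => h1.symm.trans ((congrArg _ h).trans h2)⟩
  have hcW : (cotR Z T).toLinearMap ∘ₗ j.toLinearMap = (cotL Z T).toLinearMap ∘ₗ j.toLinearMap :=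
    LinearMap.ext fun w => (hW.mem_range_iff _).1 ⟨w, rfl⟩
  have hcV : (cotR T U).toLinearMap ∘ₗ j'.toLinearMap = (cotL T U).toLinearMap ∘ₗ j'.toLinearMap :=
    LinearMap.ext fun w => (hV.mem_range_iff _).1 ⟨w, rfl⟩
  -- The image of `Z □ (T □ U)` is cut out by both conditions: flatness of `Z` turns the second into
  -- membership in `Z ⊗ V`, and the first, tested in the ambient `T ⊗ U`, then gives membership in
  -- `Z □ V`.
  have hJ : ∀ x, x ∈ LinearMap.range ((jZ.comp i').toLinearMap) ↔
      LinearMap.rTensor U.carrier (cotR Z T).toLinearMap (aₗ.symm x) =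
        LinearMap.rTensor U.carrier (cotL Z T).toLinearMap (aₗ.symm x) ∧
      LinearMap.lTensor Z.carrier (cotR T U).toLinearMap x =
        LinearMap.lTensor Z.carrier (cotL T U).toLinearMap x := by
    intro x
    rw [key1]
    have e1 : ∀ v, cotR Z V v = cotL Z V v ↔
        cotR Z (ambient T U) (LinearMap.lTensor Z.carrier j'.toLinearMap v) =
          cotL Z (ambient T U) (LinearMap.lTensor Z.carrier j'.toLinearMap v) := fun v => by
      have h1 := cotR_map (T' := ambient T U) (AlgHom.id k Z.carrier) j' (idr Z) v
      have h2 := cotL_map (T' := ambient T U) (AlgHom.id k Z.carrier) j' hV.left v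
      exact ⟨fun h => h1.trans ((congrArg _ h).trans h2.symm),
        fun h => jZ_inj2 (h1.symm.trans (Eq.trans h h2))⟩
    constructor
    · rintro ⟨y, rfl⟩
      refine ⟨(e1 (i' y)).1 ((hY.mem_range_iff _).1 ⟨y, rfl⟩), ?_⟩
      change LinearMap.lTensor Z.carrier (cotR T U).toLinearMap
        (LinearMap.lTensor Z.carrier j'.toLinearMap (i' y)) =
        LinearMap.lTensor Z.carrier (cotL T U).toLinearMap
        (LinearMap.lTensor Z.carrier j'.toLinearMap (i' y))
      rw [← LinearMap.lTensor_comp_apply, hcV, LinearMap.lTensor_comp_apply]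
    · rintro ⟨h1, h2⟩
      obtain ⟨v, rfl⟩ := mem_range_lTensor_of_eq (f := (cotR T U).toLinearMap)
        (g := (cotL T U).toLinearMap) hV.mem_range_iff h2
      obtain ⟨y, hy⟩ := (hY.mem_range_iff v).2 ((e1 v).2 h1)
      exact ⟨y, congrArg (LinearMap.lTensor Z.carrier j'.toLinearMap) hy⟩
  -- The image of `(Z □ T) □ U` is cut out by the same two conditions, used in the opposite order
  -- and with flatness of `U`.
  have hI : ∀ x, x ∈ LinearMap.range (((a.toAlgHom.comp jU).comp i).toLinearMap) ↔
      LinearMap.rTensor U.carrier (cotR Z T).toLinearMap (aₗ.symm x) =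
        LinearMap.rTensor U.carrier (cotL Z T).toLinearMap (aₗ.symm x) ∧
      LinearMap.lTensor Z.carrier (cotR T U).toLinearMap x =
        LinearMap.lTensor Z.carrier (cotL T U).toLinearMap x := by
    intro x
    obtain ⟨x, rfl⟩ := aₗ.surjective x
    rw [key2, aₗ.symm_apply_apply]
    have e1 : ∀ v, cotR W U v = cotL W U v ↔
        cotR (ambient Z T) U (LinearMap.rTensor U.carrier j.toLinearMap v) =
          cotL (ambient Z T) U (LinearMap.rTensor U.carrier j.toLinearMap v) := fun v => by
      have h1 := cotR_map (Z' := ambient Z T) j (AlgHom.id k U.carrier) hW.right v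
      have h2 := cotL_map (Z' := ambient Z T) j (AlgHom.id k U.carrier) (idl U) v
      have inj : Function.Injective (TensorProduct.map j.toLinearMap
          (LinearMap.lTensor A (AlgHom.id k U.carrier).toLinearMap)) := by
        have : LinearMap.lTensor A (AlgHom.id k U.carrier).toLinearMap = LinearMap.id :=
          LinearMap.lTensor_id A U.carrier
        rw [this]
        exact jU_inj2
      exact ⟨fun h => h1.trans ((congrArg _ h).trans h2.symm),
        fun h => inj (h1.symm.trans (Eq.trans h h2))⟩
    constructor
    · rintro ⟨y, hy⟩
      obtain rfl : LinearMap.rTensor U.carrier j.toLinearMap (i y) = x := aₗ.injective hy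
      refine ⟨?_, (e1 (i y)).1 ((hX.mem_range_iff _).1 ⟨y, rfl⟩)⟩
      rw [← LinearMap.rTensor_comp_apply, hcW, LinearMap.rTensor_comp_apply]
    · rintro ⟨h1, h2⟩
      obtain ⟨v, rfl⟩ := mem_range_rTensor_of_eq (f := (cotR Z T).toLinearMap)
        (g := (cotL Z T).toLinearMap) hW.mem_range_iff h1
      obtain ⟨y, hy⟩ := (hX.mem_range_iff v).2 ((e1 v).2 h2)
      exact ⟨y, congrArg (fun v => aₗ (LinearMap.rTensor U.carrier j.toLinearMap v)) hy⟩
  refine iso_of_range_eq (B := ambient Z (ambient T U)) ((a.toAlgHom.comp jU).comp i) (jZ.comp i')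
    (a.injective.comp (jU_inj.comp hX.injective)) (jZ_inj.comp hY.injective) (fun x => ?_)
    (fun x => ?_) (fun x => ?_) (fun x => ?_)
    (Submodule.ext fun x => (hI x).trans (hJ x).symm)
  · have h1 := ambL_map (Z' := ambient Z T) (T := U) j (AlgHom.id k U.carrier)
      (fun z => hW.left z) (i x)
    rw [hX.left] at h1
    refine (lTensor_assoc_ambL Z T U _).symm.trans ((congrArg _ h1).trans ?_)
    rw [← LinearMap.lTensor_comp_apply]
    exact (LinearMap.lTensor_comp_apply A aₗ.toLinearMap
      (jU.toLinearMap ∘ₗ i.toLinearMap) _).symm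
  · have h1 := ambR_map (Z' := ambient Z T) (T := U) j (AlgHom.id k U.carrier) (idr U) (i x)
    rw [hX.right] at h1
    refine (rTensor_assoc_ambR Z T U _).symm.trans ((congrArg _ h1).trans ?_)
    rw [← LinearMap.rTensor_comp_apply]
    exact (LinearMap.rTensor_comp_apply A aₗ.toLinearMap
      (jU.toLinearMap ∘ₗ i.toLinearMap) _).symm
  · have h1 := ambL_map (T' := ambient T U) (AlgHom.id k Z.carrier) j' (idl Z) (i' x)
    rw [hY.left] at h1
    refine Eq.trans h1 ?_
    rw [← LinearMap.lTensor_comp_apply]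
    rfl
  · have h1 := ambR_map (T' := ambient T U) (AlgHom.id k Z.carrier) j' hV.right (i' x)
    rw [hY.right] at h1
    refine Eq.trans h1 ?_
    rw [← LinearMap.rTensor_comp_apply]
    rfl

end Assoc

end BicomodAlg

namespace BicomodAlg

/-! ### The regular bicomodule algebra is a left unit -/

variable (k A) in
/-- The Hopf algebra `A` as a bicomodule algebra over itself. -/
def reg : BicomodAlg k A where
  carrier := A
  lcoact := Bialgebra.comulAlgHom k A
  rcoact := Bialgebra.comulAlgHom k A
  lcoassoc := Coalgebra.coassoc_apply
  lcounit := Coalgebra.rTensor_counit_comul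
  rcoassoc := Coalgebra.coassoc_apply
  rcounit := Coalgebra.lTensor_counit_comul
  bicomod := Coalgebra.coassoc_apply

/-- An algebra as a bicomodule algebra with trivial coactions. -/
def triv (B : Type v) [Ring B] [Algebra k B] : BicomodAlg k A where
  carrier := B
  lcoact := Algebra.TensorProduct.includeRight
  rcoact := Algebra.TensorProduct.includeLeft
  lcoassoc z := by
    change TensorProduct.assoc k A A B (Coalgebra.comul (R := k) (1 : A) ⊗ₜ z) = 1 ⊗ₜ (1 ⊗ₜ z)
    rw [Bialgebra.comul_one]
    rfl
  lcounit z := by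
    change Coalgebra.counit (R := k) (1 : A) ⊗ₜ z = _
    rw [Bialgebra.counit_one]
  rcoassoc z := by
    change (z ⊗ₜ (1 ⊗ₜ 1) : B ⊗[k] (A ⊗[k] A)) = z ⊗ₜ Coalgebra.comul (R := k) (1 : A)
    rw [Bialgebra.comul_one]
    rfl
  rcounit z := by
    change z ⊗ₜ Coalgebra.counit (R := k) (1 : A) = _
    rw [Bialgebra.counit_one]
  bicomod _ := rfl

theorem lid_counit_lcoact (Z : BicomodAlg k A) (z : Z.carrier) :
    TensorProduct.lid k Z.carrier
      (LinearMap.rTensor Z.carrier (Coalgebra.counit : A →ₗ[k] k) (Z.lcoact z)) = z := by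
  rw [Z.lcounit, lid_tmul, one_smul]

theorem lid_counit_comul (M : Type*) [AddCommGroup M] [Module k M] (w : A ⊗[k] M) :
    TensorProduct.lid k (A ⊗[k] M)
      (LinearMap.rTensor (A ⊗[k] M) (Coalgebra.counit : A →ₗ[k] k)
        (TensorProduct.assoc k A A M (LinearMap.rTensor M Coalgebra.comul w))) = w := by
  induction w with
  | zero => simp only [LinearMap.map_zero, LinearEquiv.map_zero]
  | add x y hx hy => simp only [LinearMap.map_add, LinearEquiv.map_add, hx, hy]
  | tmul a z =>
    have h2 := Coalgebra.rTensor_counit_comul (R := k) a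
    rw [LinearMap.rTensor_tmul]
    have e2 : ∀ y : A ⊗[k] A, TensorProduct.lid k (A ⊗[k] M)
        (LinearMap.rTensor (A ⊗[k] M) (Coalgebra.counit : A →ₗ[k] k)
          (TensorProduct.assoc k A A M (y ⊗ₜ z))) =
        TensorProduct.lid k A (LinearMap.rTensor A Coalgebra.counit y) ⊗ₜ z := by
      intro y
      induction y with
      | zero => simp only [LinearMap.map_zero, LinearEquiv.map_zero, zero_tmul]
      | add x y hx hy => simp only [LinearMap.map_add, LinearEquiv.map_add, add_tmul, hx, hy]
      | tmul a b => rfl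
    rw [e2, h2, lid_tmul, one_smul]

/-- The coaction λ is injective, with retraction ε ⊗ id. Coassociativity puts λ(z) in the equalizer;
conversely, applying ε to the first factor of (Δ ⊗ id)(x) = (id ⊗ λ)(x) exhibits x as λ of (ε ⊗
id)(x). -/
theorem isCotensorMap_reg (Z : BicomodAlg k A) : IsCotensorMap (reg k A) Z Z Z.lcoact where
  injective x y h := by
    exact (Z.lid_counit_lcoact x).symm.trans ((congrArg (fun w : A ⊗[k] Z.carrier =>
      TensorProduct.lid k Z.carrier (LinearMap.rTensor Z.carrier Coalgebra.counit w)) h).trans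
        (Z.lid_counit_lcoact y))
  mem_range_iff x := by
    constructor
    · rintro ⟨z, rfl⟩
      exact Z.lcoassoc z
    · intro h
      refine ⟨TensorProduct.lid k Z.carrier
        (LinearMap.rTensor Z.carrier (Coalgebra.counit : A →ₗ[k] k) x), ?_⟩
      have h1 := congrArg (fun w : A ⊗[k] (A ⊗[k] Z.carrier) => TensorProduct.lid k (A ⊗[k] Z.carrier)
        (LinearMap.rTensor (A ⊗[k] Z.carrier) (Coalgebra.counit : A →ₗ[k] k) w)) h
      have h2 : ∀ x : A ⊗[k] Z.carrier, Z.lcoact (TensorProduct.lid k Z.carrier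
          (LinearMap.rTensor Z.carrier (Coalgebra.counit : A →ₗ[k] k) x)) =
          TensorProduct.lid k (A ⊗[k] Z.carrier)
          (LinearMap.rTensor (A ⊗[k] Z.carrier) (Coalgebra.counit : A →ₗ[k] k)
            (LinearMap.lTensor A Z.lcoact.toLinearMap x)) := by
        intro x
        induction x with
        | zero => simp only [LinearMap.map_zero, LinearEquiv.map_zero, algHom_zero]
        | add x y hx hy => simp only [LinearMap.map_add, LinearEquiv.map_add, algHom_add, hx, hy]
        | tmul a z =>
          rw [LinearMap.lTensor_tmul, LinearMap.rTensor_tmul, LinearMap.rTensor_tmul, lid_tmul,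
            lid_tmul]
          exact LinearMap.map_smul Z.lcoact.toLinearMap _ _
      exact (h2 x).trans (h1.symm.trans (lid_counit_comul (A := A) Z.carrier x))
  left z := Z.lcoassoc z
  right z := by
    have h : (TensorProduct.assoc k A Z.carrier A).symm (LinearMap.lTensor A Z.rcoact.toLinearMap
        (Z.lcoact z)) = LinearMap.rTensor A Z.lcoact.toLinearMap (Z.rcoact z) := by
      rw [← Z.bicomod, LinearEquiv.symm_apply_apply]
    exact h

/-! ### Translation maps -/

/-- The opposite of the algebra `Z`. -/
def opp (Z : BicomodAlg k A) : Type v := (Z.carrier)ᵐᵒᵖ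

instance (Z : BicomodAlg k A) : Ring Z.opp := inferInstanceAs (Ring (Z.carrier)ᵐᵒᵖ)

instance (Z : BicomodAlg k A) : Algebra k Z.opp := inferInstanceAs (Algebra k (Z.carrier)ᵐᵒᵖ)

/-- The identification of the modules `Zᵒᵖ` and `Z`. -/
def unop (Z : BicomodAlg k A) : Z.opp ≃ₗ[k] Z.carrier :=
  (MulOpposite.opLinearEquiv k : Z.carrier ≃ₗ[k] (Z.carrier)ᵐᵒᵖ).symm

theorem unop_mul (Z : BicomodAlg k A) (x y : Z.opp) : Z.unop (x * y) = Z.unop y * Z.unop x := rfl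

theorem unop_one (Z : BicomodAlg k A) : Z.unop 1 = 1 := rfl

/-- The right Galois map, with the opposite algebra on the left. -/
def oppGalR (Z : BicomodAlg k A) : Z.opp ⊗[k] Z.carrier →ₗ[k] Z.carrier ⊗[k] A :=
  Z.galR ∘ₗ LinearMap.rTensor Z.carrier Z.unop.toLinearMap

/-- The left Galois map, with the opposite algebra on the right. -/
def oppGalL (Z : BicomodAlg k A) : Z.carrier ⊗[k] Z.opp →ₗ[k] A ⊗[k] Z.carrier :=
  Z.galL ∘ₗ LinearMap.lTensor Z.carrier Z.unop.toLinearMap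

section

variable (Z : BicomodAlg k A)

theorem oppGalR_tmul (x : Z.opp) (y : Z.carrier) :
    Z.oppGalR (x ⊗ₜ y) = (Z.unop x ⊗ₜ 1) * Z.rcoact y := Z.galR_tmul _ _

theorem oppGalL_tmul (x : Z.carrier) (y : Z.opp) :
    Z.oppGalL (x ⊗ₜ y) = Z.lcoact x * (1 ⊗ₜ Z.unop y) := Z.galL_tmul _ _

theorem oppGalR_bijective (h : Function.Bijective Z.galR) : Function.Bijective Z.oppGalR := by
  have : Function.Bijective (LinearMap.rTensor Z.carrier Z.unop.toLinearMap) :=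
    rTensor_bij Z.unop.bijective
  exact h.comp this

theorem oppGalL_bijective (h : Function.Bijective Z.galL) : Function.Bijective Z.oppGalL := by
  have : Function.Bijective (LinearMap.lTensor Z.carrier Z.unop.toLinearMap) :=
    lTensor_bij Z.unop.bijective
  exact h.comp this

/-- Here the opposite algebra matters: κ_r(u · (x ⊗ y)) = (x ⊗ 1) κ_r(u) ρ(y), with x multiplying
from the outside. If κ_r(u) = 1 ⊗ a, this factor commutes with x ⊗ 1 and can be pulled out, so that
a ↦ κ_r⁻¹(1 ⊗ a) is multiplicative. -/
theorem oppGalR_mul {u : Z.opp ⊗[k] Z.carrier} {a : A} (hu : Z.oppGalR u = 1 ⊗ₜ a)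
    (w : Z.opp ⊗[k] Z.carrier) : Z.oppGalR (u * w) = (1 ⊗ₜ a) * Z.oppGalR w := by
  induction w with
  | zero => simp only [LinearMap.map_zero, mul_zero]
  | add x y hx hy => simp only [LinearMap.map_add, mul_add, hx, hy]
  | tmul x y =>
    have h1 : ∀ u, Z.oppGalR (u * (x ⊗ₜ y)) = (Z.unop x ⊗ₜ 1) * Z.oppGalR u * Z.rcoact y := by
      intro u
      induction u with
      | zero => simp only [LinearMap.map_zero, zero_mul, mul_zero]
      | add x y hx hy => simp only [LinearMap.map_add, mul_add, add_mul, hx, hy]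
      | tmul a b =>
        rw [Algebra.TensorProduct.tmul_mul_tmul, oppGalR_tmul, oppGalR_tmul, map_mul Z.rcoact, unop_mul,
          ← mul_assoc, ← mul_assoc, Algebra.TensorProduct.tmul_mul_tmul, mul_one]
    rw [h1, hu, oppGalR_tmul, ← mul_assoc, Algebra.TensorProduct.tmul_mul_tmul,
      Algebra.TensorProduct.tmul_mul_tmul, one_mul, mul_one, one_mul, mul_one]

theorem oppGalL_mul {u : Z.carrier ⊗[k] Z.opp} {a : A} (hu : Z.oppGalL u = a ⊗ₜ 1)
    (w : Z.carrier ⊗[k] Z.opp) : Z.oppGalL (w * u) = Z.oppGalL w * (a ⊗ₜ 1) := by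
  induction w with
  | zero => simp only [LinearMap.map_zero, zero_mul]
  | add x y hx hy => simp only [LinearMap.map_add, add_mul, hx, hy]
  | tmul x y =>
    have h1 : ∀ u, Z.oppGalL ((x ⊗ₜ y) * u) = Z.lcoact x * Z.oppGalL u * (1 ⊗ₜ Z.unop y) := by
      intro u
      induction u with
      | zero => simp only [LinearMap.map_zero, zero_mul, mul_zero]
      | add x y hx hy => simp only [LinearMap.map_add, mul_add, add_mul, hx, hy]
      | tmul a b =>
        rw [Algebra.TensorProduct.tmul_mul_tmul, oppGalL_tmul, oppGalL_tmul, map_mul Z.lcoact, unop_mul,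
          mul_assoc, mul_assoc, mul_assoc, Algebra.TensorProduct.tmul_mul_tmul, mul_one]
    rw [h1, hu, oppGalL_tmul, mul_assoc, mul_assoc, Algebra.TensorProduct.tmul_mul_tmul,
      Algebra.TensorProduct.tmul_mul_tmul, one_mul, mul_one, one_mul, mul_one]

/-- The translation maps `τᵣ : A → Zᵒᵖ ⊗ Z` and `τₗ : A → Z ⊗ Zᵒᵖ` of a biGalois object. -/
structure Translation where
  /-- `τᵣ(a)` is the preimage of `1 ⊗ a` under the right Galois map -/
  r : A →ₐ[k] Z.opp ⊗[k] Z.carrier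
  /-- `τₗ(a)` is the preimage of `a ⊗ 1` under the left Galois map -/
  l : A →ₐ[k] Z.carrier ⊗[k] Z.opp
  galR_r : ∀ a, Z.oppGalR (r a) = 1 ⊗ₜ a
  galL_l : ∀ a, Z.oppGalL (l a) = a ⊗ₜ 1

/-- Inverting the Galois maps on 1 ⊗ A and A ⊗ 1 gives linear maps; they preserve units and products
because the injective Galois maps take the same values on both sides. -/
theorem nonempty_translation (hl : Function.Bijective Z.galL) (hr : Function.Bijective Z.galR) :
    Nonempty Z.Translation := by
  let er := LinearEquiv.ofBijective Z.oppGalR (Z.oppGalR_bijective hr)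
  let el := LinearEquiv.ofBijective Z.oppGalL (Z.oppGalL_bijective hl)
  have er1 : ∀ a, Z.oppGalR (er.symm (1 ⊗ₜ a)) = 1 ⊗ₜ a := fun a => er.apply_symm_apply _
  have el1 : ∀ a, Z.oppGalL (el.symm (a ⊗ₜ 1)) = a ⊗ₜ 1 := fun a => el.apply_symm_apply _
  refine ⟨⟨AlgHom.ofLinearMap (er.symm.toLinearMap ∘ₗ TensorProduct.mk k Z.carrier A 1) ?_ ?_,
    AlgHom.ofLinearMap (el.symm.toLinearMap ∘ₗ (TensorProduct.mk k A Z.carrier).flip 1) ?_ ?_,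
    er1, el1⟩⟩
  · refine (Z.oppGalR_bijective hr).1 ((er1 1).trans ?_)
    rw [Algebra.TensorProduct.one_def, oppGalR_tmul, map_one Z.rcoact, mul_one, unop_one]
  · intro a b
    refine (Z.oppGalR_bijective hr).1 ((er1 (a * b)).trans ((Z.oppGalR_mul (er1 a) _).trans ?_).symm)
    refine (congrArg _ (er1 b)).trans ?_
    rw [Algebra.TensorProduct.tmul_mul_tmul, one_mul]
  · refine (Z.oppGalL_bijective hl).1 ((el1 1).trans ?_)
    rw [Algebra.TensorProduct.one_def, oppGalL_tmul, map_one Z.lcoact, one_mul, unop_one]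
  · intro a b
    refine (Z.oppGalL_bijective hl).1 ((el1 (a * b)).trans ((Z.oppGalL_mul (el1 b) _).trans ?_).symm)
    refine (congrArg (· * _) (el1 a)).trans ?_
    rw [Algebra.TensorProduct.tmul_mul_tmul, one_mul]

/-- The map `o ⊗ z ↦ o z` from `Zᵒᵖ ⊗ Z` to `Z`. -/
def mulR : Z.opp ⊗[k] Z.carrier →ₗ[k] Z.carrier :=
  LinearMap.mul' k Z.carrier ∘ₗ LinearMap.rTensor Z.carrier Z.unop.toLinearMap

/-- The map `z ⊗ o ↦ z o` from `Z ⊗ Zᵒᵖ` to `Z`. -/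
def mulL : Z.carrier ⊗[k] Z.opp →ₗ[k] Z.carrier :=
  LinearMap.mul' k Z.carrier ∘ₗ LinearMap.lTensor Z.carrier Z.unop.toLinearMap

theorem mulR_tmul (x : Z.opp) (y : Z.carrier) : Z.mulR (x ⊗ₜ y) = Z.unop x * y := rfl

theorem mulL_tmul (x : Z.carrier) (y : Z.opp) : Z.mulL (x ⊗ₜ y) = x * Z.unop y := rfl

/-- By counitality of ρ, the Galois map followed by ε is multiplication. Applied to τᵣ(a), this says
that multiplying out a translation map gives ε(a). -/
theorem counit_oppGalR (u : Z.opp ⊗[k] Z.carrier) :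
    LinearMap.lTensor Z.carrier (Coalgebra.counit : A →ₗ[k] k) (Z.oppGalR u) =
      Z.mulR u ⊗ₜ 1 := by
  induction u with
  | zero => simp only [LinearMap.map_zero, zero_tmul]
  | add x y hx hy => simp only [LinearMap.map_add, add_tmul, hx, hy]
  | tmul x y =>
    rw [oppGalR_tmul, mulR_tmul]
    have h : ∀ w : Z.carrier ⊗[k] A, LinearMap.lTensor Z.carrier (Coalgebra.counit : A →ₗ[k] k)
        ((Z.unop x ⊗ₜ 1) * w) = (Z.unop x ⊗ₜ 1) * LinearMap.lTensor Z.carrier Coalgebra.counit w := by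
      intro w
      induction w with
      | zero => simp only [LinearMap.map_zero, mul_zero]
      | add x y hx hy => simp only [LinearMap.map_add, mul_add, hx, hy]
      | tmul a b =>
        simp only [Algebra.TensorProduct.tmul_mul_tmul, LinearMap.lTensor_tmul, one_mul]
    rw [h, Z.rcounit, Algebra.TensorProduct.tmul_mul_tmul, one_mul]

theorem counit_oppGalL (u : Z.carrier ⊗[k] Z.opp) :
    LinearMap.rTensor Z.carrier (Coalgebra.counit : A →ₗ[k] k) (Z.oppGalL u) =
      1 ⊗ₜ Z.mulL u := by
  induction u with
  | zero => simp only [LinearMap.map_zero, tmul_zero]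
  | add x y hx hy => simp only [LinearMap.map_add, tmul_add, hx, hy]
  | tmul x y =>
    rw [oppGalL_tmul, mulL_tmul]
    have h : ∀ w : A ⊗[k] Z.carrier, LinearMap.rTensor Z.carrier (Coalgebra.counit : A →ₗ[k] k)
        (w * (1 ⊗ₜ Z.unop y)) = LinearMap.rTensor Z.carrier Coalgebra.counit w * (1 ⊗ₜ Z.unop y) := by
      intro w
      induction w with
      | zero => simp only [LinearMap.map_zero, zero_mul]
      | add x y hx hy => simp only [LinearMap.map_add, add_mul, hx, hy]
      | tmul a b =>
        simp only [Algebra.TensorProduct.tmul_mul_tmul, LinearMap.rTensor_tmul, mul_one]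
    rw [h, Z.lcounit, Algebra.TensorProduct.tmul_mul_tmul, one_mul]

end

namespace Translation

variable {Z : BicomodAlg k A} (D : Z.Translation)

theorem mulR_r (a : A) : Z.mulR (D.r a) = algebraMap k _ (Coalgebra.counit (R := k) a) := by
  have h := congrArg (TensorProduct.rid k Z.carrier) (Z.counit_oppGalR (D.r a))
  rw [D.galR_r, LinearMap.lTensor_tmul, rid_tmul, rid_tmul, one_smul] at h
  rw [← h, Algebra.algebraMap_eq_smul_one]

theorem mulL_l (a : A) : Z.mulL (D.l a) = algebraMap k _ (Coalgebra.counit (R := k) a) := by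
  have h := congrArg (TensorProduct.lid k Z.carrier) (Z.counit_oppGalL (D.l a))
  rw [D.galL_l, LinearMap.rTensor_tmul, lid_tmul, lid_tmul, one_smul] at h
  rw [← h, Algebra.algebraMap_eq_smul_one]

/-- Composed with κ_r, the map τᵣ is a ↦ 1 ⊗ a, which stays injective after tensoring with any
module because `Z` is faithfully flat. An arbitrary `Q` is needed, since the lemma will be applied
to cokernels. -/
theorem rTensor_r_injective [Module.FaithfullyFlat k Z.carrier] (Q : Type*) [AddCommGroup Q]
    [Module k Q] : Function.Injective (LinearMap.rTensor Q D.r.toLinearMap) := by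
  have h1 : Function.Injective (TensorProduct.assoc k Z.carrier A Q ∘
      (LinearMap.rTensor Q Z.oppGalR ∘ LinearMap.rTensor Q D.r.toLinearMap)) := by
    have e : (TensorProduct.assoc k Z.carrier A Q).toLinearMap ∘ₗ
        LinearMap.rTensor Q Z.oppGalR ∘ₗ LinearMap.rTensor Q D.r.toLinearMap =
        TensorProduct.mk k Z.carrier (A ⊗[k] Q) 1 := by
      refine TensorProduct.ext' fun a q => ?_
      change TensorProduct.assoc k Z.carrier A Q (Z.oppGalR (D.r a) ⊗ₜ q) = _
      rw [D.galR_r]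
      rfl
    have h2 : Function.Injective (TensorProduct.mk k Z.carrier (A ⊗[k] Q) 1) :=
      one_tmul_injective
    rw [← e] at h2
    exact h2
  exact h1.of_comp.of_comp

theorem lTensor_l_injective [Module.FaithfullyFlat k Z.carrier] (Q : Type*) [AddCommGroup Q]
    [Module k Q] : Function.Injective (LinearMap.lTensor Q D.l.toLinearMap) := by
  have h1 : Function.Injective ((TensorProduct.assoc k Q A Z.carrier).symm ∘
      (LinearMap.lTensor Q Z.oppGalL ∘ LinearMap.lTensor Q D.l.toLinearMap)) := by
    have e : (TensorProduct.assoc k Q A Z.carrier).symm.toLinearMap ∘ₗ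
        LinearMap.lTensor Q Z.oppGalL ∘ₗ LinearMap.lTensor Q D.l.toLinearMap =
        (TensorProduct.mk k (Q ⊗[k] A) Z.carrier).flip 1 := by
      refine TensorProduct.ext' fun q a => ?_
      change (TensorProduct.assoc k Q A Z.carrier).symm (q ⊗ₜ Z.oppGalL (D.l a)) = _
      rw [D.galL_l]
      rfl
    have h2 : Function.Injective ((TensorProduct.mk k (Q ⊗[k] A) Z.carrier).flip 1) :=
      tmul_one_injective
    rw [← e] at h2
    exact h2
  exact h1.of_comp.of_comp

end Translation

end BicomodAlg

/-! ### Colinearity of the translation maps and the exchange identity between them -/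

namespace BicomodAlg

namespace Translation

variable {Z : BicomodAlg k A} (D : Z.Translation)

/-- The map τᵣ inherits colinearity from κ_r. For `Z = A` both sides are S(a₁) ⊗ a₂ ⊗ a₃. -/
theorem lTensor_rcoact_r (hr : Function.Bijective Z.galR) (a : A) :
    LinearMap.lTensor Z.opp Z.rcoact.toLinearMap (D.r a) =
      TensorProduct.assoc k Z.opp Z.carrier A
        (LinearMap.rTensor A D.r.toLinearMap (Coalgebra.comul a)) := by
  have b : Function.Bijective (LinearMap.rTensor A Z.oppGalR) :=
    rTensor_bij (Z.oppGalR_bijective hr)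
  refine (TensorProduct.assoc k Z.opp Z.carrier A).symm.injective (b.1 ?_)
  have h1 : ∀ u : Z.opp ⊗[k] Z.carrier, LinearMap.rTensor A Z.oppGalR
      ((TensorProduct.assoc k Z.opp Z.carrier A).symm
        (LinearMap.lTensor Z.opp Z.rcoact.toLinearMap u)) =
      (TensorProduct.assoc k Z.carrier A A).symm
        (LinearMap.lTensor Z.carrier Coalgebra.comul (Z.oppGalR u)) := by
    intro u
    refine Eq.trans ?_ (Z.galR_colinear (LinearMap.rTensor Z.carrier Z.unop.toLinearMap u))
    induction u with
    | zero => simp only [LinearMap.map_zero, LinearEquiv.map_zero]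
    | add x y hx hy => simp only [LinearMap.map_add, LinearEquiv.map_add, hx, hy]
    | tmul o z =>
      simp only [LinearMap.lTensor_tmul, LinearMap.rTensor_tmul, AlgHom.toLinearMap_apply]
      induction Z.rcoact z with
      | zero => simp only [LinearMap.map_zero, LinearEquiv.map_zero, tmul_zero]
      | add x y hx hy => simp only [LinearMap.map_add, LinearEquiv.map_add, tmul_add, hx, hy]
      | tmul a b => rfl
  rw [h1, D.galR_r, LinearEquiv.symm_apply_apply, LinearMap.lTensor_tmul]
  induction Coalgebra.comul (R := k) a with
  | zero => simp only [LinearMap.map_zero, LinearEquiv.map_zero, tmul_zero]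
  | add x y hx hy => simp only [LinearMap.map_add, LinearEquiv.map_add, tmul_add, hx, hy]
  | tmul a b =>
    rw [LinearMap.rTensor_tmul, LinearMap.rTensor_tmul, AlgHom.toLinearMap_apply, D.galR_r]
    rfl

theorem rTensor_lcoact_l (hl : Function.Bijective Z.galL) (a : A) :
    TensorProduct.assoc k A Z.carrier Z.opp
      (LinearMap.rTensor Z.opp Z.lcoact.toLinearMap (D.l a)) =
      LinearMap.lTensor A D.l.toLinearMap (Coalgebra.comul a) := by
  have b : Function.Bijective (LinearMap.lTensor A Z.oppGalL) :=
    lTensor_bij (Z.oppGalL_bijective hl)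
  refine b.1 ?_
  have h1 : ∀ u : Z.carrier ⊗[k] Z.opp, LinearMap.lTensor A Z.oppGalL
      (TensorProduct.assoc k A Z.carrier Z.opp
        (LinearMap.rTensor Z.opp Z.lcoact.toLinearMap u)) =
      TensorProduct.assoc k A A Z.carrier
        (LinearMap.rTensor Z.carrier Coalgebra.comul (Z.oppGalL u)) := by
    intro u
    refine Eq.trans ?_ (Z.galL_colinear (LinearMap.lTensor Z.carrier Z.unop.toLinearMap u))
    induction u with
    | zero => simp only [LinearMap.map_zero, LinearEquiv.map_zero]
    | add x y hx hy => simp only [LinearMap.map_add, LinearEquiv.map_add, hx, hy]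
    | tmul z o =>
      simp only [LinearMap.lTensor_tmul, LinearMap.rTensor_tmul, AlgHom.toLinearMap_apply]
      induction Z.lcoact z with
      | zero => simp only [LinearMap.map_zero, LinearEquiv.map_zero, zero_tmul]
      | add x y hx hy => simp only [LinearMap.map_add, LinearEquiv.map_add, add_tmul, hx, hy]
      | tmul a b => rfl
  rw [h1, D.galL_l, LinearMap.rTensor_tmul]
  induction Coalgebra.comul (R := k) a with
  | zero => simp only [LinearMap.map_zero, LinearEquiv.map_zero, zero_tmul]
  | add x y hx hy => simp only [LinearMap.map_add, LinearEquiv.map_add, add_tmul, hx, hy]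
  | tmul a b =>
    rw [LinearMap.lTensor_tmul, LinearMap.lTensor_tmul, AlgHom.toLinearMap_apply, D.galL_l]
    rfl

/-- The map κ_r sends z₀ τᵣ(z₁) to z₀ ⊗ z₁, which is also κ_r(1 ⊗ z). -/
theorem mul_r_rcoact (hr : Function.Bijective Z.galR) (z : Z.carrier) :
    LinearMap.rTensor Z.carrier Z.mulL ((TensorProduct.assoc k Z.carrier Z.opp Z.carrier).symm
      (LinearMap.lTensor Z.carrier D.r.toLinearMap (Z.rcoact z))) = 1 ⊗ₜ z := by
  refine hr.1 ?_
  rw [galR_tmul, ← Algebra.TensorProduct.one_def, one_mul]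
  induction Z.rcoact z with
  | zero => simp only [LinearMap.map_zero, LinearEquiv.map_zero]
  | add x y hx hy => simp only [LinearMap.map_add, LinearEquiv.map_add, hx, hy]
  | tmul z a =>
    rw [LinearMap.lTensor_tmul, AlgHom.toLinearMap_apply]
    have h1 : ∀ u : Z.opp ⊗[k] Z.carrier, Z.galR (LinearMap.rTensor Z.carrier Z.mulL
        ((TensorProduct.assoc k Z.carrier Z.opp Z.carrier).symm (z ⊗ₜ u))) =
        (z ⊗ₜ 1) * Z.oppGalR u := by
      intro u
      induction u with
      | zero => simp only [LinearMap.map_zero, LinearEquiv.map_zero, tmul_zero, mul_zero]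
      | add x y hx hy =>
        simp only [LinearMap.map_add, LinearEquiv.map_add, tmul_add, mul_add, hx, hy]
      | tmul x y =>
        rw [assoc_symm_tmul, LinearMap.rTensor_tmul, mulL_tmul, galR_tmul, oppGalR_tmul,
          ← mul_assoc, Algebra.TensorProduct.tmul_mul_tmul, one_mul]
    rw [h1, D.galR_r, Algebra.TensorProduct.tmul_mul_tmul, one_mul, mul_one]

/-- The two ways of inserting translation maps, `z₀ ⊗ τᵣ(z₁) = τₗ(z₋₁) ⊗ z₀`. -/
theorem lTensor_r_rcoact (hl : Function.Bijective Z.galL) (hr : Function.Bijective Z.galR)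
    (z : Z.carrier) : LinearMap.lTensor Z.carrier D.r.toLinearMap (Z.rcoact z) =
      TensorProduct.assoc k Z.carrier Z.opp Z.carrier
        (LinearMap.rTensor Z.carrier D.l.toLinearMap (Z.lcoact z)) := by
  -- Apply κ_l to the first two factors. The right-hand side becomes z₋₁ ⊗ 1 ⊗ z₀; the left-hand
  -- side becomes, by the bicomodule axiom, z₋₁ followed by z₀ τᵣ(z₁), and `mul_r_rcoact` identifies
  -- the two.
  have b : Function.Bijective (LinearMap.rTensor Z.carrier Z.oppGalL) :=
    rTensor_bij (Z.oppGalL_bijective hl)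
  refine (TensorProduct.assoc k Z.carrier Z.opp Z.carrier).symm.injective (b.1 ?_)
  rw [LinearEquiv.symm_apply_apply]
  have h1 : ∀ w : A ⊗[k] Z.carrier, LinearMap.rTensor Z.carrier Z.oppGalL
      (LinearMap.rTensor Z.carrier D.l.toLinearMap w) =
      (TensorProduct.assoc k A Z.carrier Z.carrier).symm
        (LinearMap.lTensor A (TensorProduct.mk k Z.carrier Z.carrier 1) w) := by
    intro w
    induction w with
    | zero => simp only [LinearMap.map_zero, LinearEquiv.map_zero]
    | add x y hx hy => simp only [LinearMap.map_add, LinearEquiv.map_add, hx, hy]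
    | tmul a z =>
      rw [LinearMap.rTensor_tmul, LinearMap.rTensor_tmul, AlgHom.toLinearMap_apply, D.galL_l]
      rfl
  have h2 : LinearMap.lTensor A (TensorProduct.mk k Z.carrier Z.carrier 1) (Z.lcoact z) =
      LinearMap.lTensor A (LinearMap.rTensor Z.carrier Z.mulL ∘ₗ
        (TensorProduct.assoc k Z.carrier Z.opp Z.carrier).symm.toLinearMap ∘ₗ
        LinearMap.lTensor Z.carrier D.r.toLinearMap)
        (LinearMap.lTensor A Z.rcoact.toLinearMap (Z.lcoact z)) := by
    rw [← LinearMap.lTensor_comp_apply]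
    congr 2
    exact LinearMap.ext fun z => (D.mul_r_rcoact hr z).symm
  rw [h1, h2, ← Z.bicomod]
  induction Z.rcoact z with
  | zero => simp only [LinearMap.map_zero, LinearEquiv.map_zero]
  | add x y hx hy => simp only [LinearMap.map_add, LinearEquiv.map_add, hx, hy]
  | tmul z a =>
    let F : Z.carrier ⊗[k] (Z.opp ⊗[k] Z.carrier) →ₗ[k] Z.carrier ⊗[k] Z.carrier :=
      LinearMap.rTensor Z.carrier Z.mulL ∘ₗ
        (TensorProduct.assoc k Z.carrier Z.opp Z.carrier).symm.toLinearMap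
    have h3 : ∀ u : Z.opp ⊗[k] Z.carrier, LinearMap.rTensor Z.carrier Z.oppGalL
        ((TensorProduct.assoc k Z.carrier Z.opp Z.carrier).symm (z ⊗ₜ u)) =
        (TensorProduct.assoc k A Z.carrier Z.carrier).symm (LinearMap.lTensor A F
          (TensorProduct.assoc k A Z.carrier (Z.opp ⊗[k] Z.carrier) (Z.lcoact z ⊗ₜ u))) := by
      intro u
      induction u with
      | zero => simp only [LinearMap.map_zero, LinearEquiv.map_zero, tmul_zero]
      | add x y hx hy => simp only [LinearMap.map_add, LinearEquiv.map_add, tmul_add, hx, hy]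
      | tmul x y =>
        rw [assoc_symm_tmul, LinearMap.rTensor_tmul, oppGalL_tmul]
        induction Z.lcoact z with
        | zero => simp only [LinearMap.map_zero, LinearEquiv.map_zero, zero_tmul, zero_mul]
        | add x y hx hy =>
          simp only [LinearMap.map_add, LinearEquiv.map_add, add_tmul, add_mul, hx, hy]
        | tmul b c =>
          rw [Algebra.TensorProduct.tmul_mul_tmul, mul_one]
          rfl
    have h4 : ∀ w : A ⊗[k] Z.carrier, LinearMap.lTensor A (F ∘ₗ
        LinearMap.lTensor Z.carrier D.r.toLinearMap) (TensorProduct.assoc k A Z.carrier A (w ⊗ₜ a)) =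
        LinearMap.lTensor A F
          (TensorProduct.assoc k A Z.carrier (Z.opp ⊗[k] Z.carrier) (w ⊗ₜ D.r a)) := by
      intro w
      induction w with
      | zero => simp only [LinearMap.map_zero, LinearEquiv.map_zero, zero_tmul]
      | add x y hx hy => simp only [LinearMap.map_add, LinearEquiv.map_add, add_tmul, hx, hy]
      | tmul b c => rfl
    rw [LinearMap.lTensor_tmul, LinearMap.rTensor_tmul, AlgHom.toLinearMap_apply,
      AlgHom.toLinearMap_apply, h3, ← h4]
    rfl

/-! ### The inverse as a pullback of `A ⊗ Zᵒᵖ` and `Zᵒᵖ ⊗ A` -/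

/-- The map `τᵣ ⊗ id : A ⊗ Zᵒᵖ → Zᵒᵖ ⊗ Z ⊗ Zᵒᵖ`. -/
def left : A ⊗[k] Z.opp →ₐ[k] Z.opp ⊗[k] (Z.carrier ⊗[k] Z.opp) :=
  (Algebra.TensorProduct.assoc k k k Z.opp Z.carrier Z.opp).toAlgHom.comp
    (Algebra.TensorProduct.map D.r (AlgHom.id k Z.opp))

/-- The map `id ⊗ τₗ : Zᵒᵖ ⊗ A → Zᵒᵖ ⊗ Z ⊗ Zᵒᵖ`. -/
def right : Z.opp ⊗[k] A →ₐ[k] Z.opp ⊗[k] (Z.carrier ⊗[k] Z.opp) :=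
  Algebra.TensorProduct.map (AlgHom.id k Z.opp) D.l

theorem left_tmul (a : A) (o : Z.opp) :
    D.left (a ⊗ₜ o) = TensorProduct.assoc k Z.opp Z.carrier Z.opp (D.r a ⊗ₜ o) := rfl

theorem right_tmul (o : Z.opp) (a : A) : D.right (o ⊗ₜ a) = o ⊗ₜ D.l a := rfl

theorem right_toLinearMap : D.right.toLinearMap = LinearMap.lTensor Z.opp D.l.toLinearMap := rfl

theorem left_add (x y : A ⊗[k] Z.opp) : D.left (x + y) = D.left x + D.left y := map_add _ _ _

theorem left_zero : D.left 0 = 0 := map_zero _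

theorem right_add (x y : Z.opp ⊗[k] A) : D.right (x + y) = D.right x + D.right y := map_add _ _ _

theorem right_zero : D.right 0 = 0 := map_zero _

/-- The map `z ⊗ o ↦ z₀ ⊗ τᵣ(z₁) ⊗ o`. -/
def insert : Z.carrier ⊗[k] Z.opp →ₗ[k] Z.carrier ⊗[k] (Z.opp ⊗[k] (Z.carrier ⊗[k] Z.opp)) :=
  LinearMap.lTensor Z.carrier D.left.toLinearMap ∘ₗ
    (TensorProduct.assoc k Z.carrier A Z.opp).toLinearMap ∘ₗ
      LinearMap.rTensor Z.opp Z.rcoact.toLinearMap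

/-- By the exchange identity, `insert` also sends z ⊗ o to τₗ(z₋₁) ⊗ z₀ ⊗ o: a right translation
placed after z₀ is a left translation placed before it. -/
theorem insert_eq (hl : Function.Bijective Z.galL) (hr : Function.Bijective Z.galR)
    (y : Z.carrier ⊗[k] Z.opp) : D.insert y =
      TensorProduct.assoc k Z.carrier Z.opp (Z.carrier ⊗[k] Z.opp)
        (LinearMap.rTensor (Z.carrier ⊗[k] Z.opp) D.l.toLinearMap
          (TensorProduct.assoc k A Z.carrier Z.opp
            (LinearMap.rTensor Z.opp Z.lcoact.toLinearMap y))) := by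
  induction y with
  | zero => simp only [LinearMap.map_zero, LinearEquiv.map_zero]
  | add x y hx hy => simp only [LinearMap.map_add, LinearEquiv.map_add, hx, hy]
  | tmul z o =>
    have h := congrArg (fun w => LinearMap.lTensor Z.carrier
      ((TensorProduct.assoc k Z.opp Z.carrier Z.opp).toLinearMap ∘ₗ
        (TensorProduct.mk k (Z.opp ⊗[k] Z.carrier) Z.opp).flip o) w) (D.lTensor_r_rcoact hl hr z)
    refine Eq.trans ?_ (h.trans ?_)
    · change LinearMap.lTensor Z.carrier D.left.toLinearMap
        (TensorProduct.assoc k Z.carrier A Z.opp (Z.rcoact z ⊗ₜ o)) = _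
      induction Z.rcoact z with
      | zero => simp only [LinearMap.map_zero, LinearEquiv.map_zero, zero_tmul]
      | add x y hx hy => simp only [LinearMap.map_add, LinearEquiv.map_add, add_tmul, hx, hy]
      | tmul b c => rfl
    · rw [LinearMap.rTensor_tmul, AlgHom.toLinearMap_apply]
      induction Z.lcoact z with
      | zero => simp only [LinearMap.map_zero, LinearEquiv.map_zero, zero_tmul]
      | add x y hx hy => simp only [LinearMap.map_add, LinearEquiv.map_add, add_tmul, hx, hy]
      | tmul b c =>
        rw [LinearMap.rTensor_tmul, assoc_tmul, LinearMap.rTensor_tmul, AlgHom.toLinearMap_apply]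
        induction D.l b with
        | zero => simp only [LinearMap.map_zero, LinearEquiv.map_zero, zero_tmul]
        | add x y hx hy => simp only [LinearMap.map_add, LinearEquiv.map_add, add_tmul, hx, hy]
        | tmul b c => rfl

/-- Inserting on the left and using the colinearity of τₗ gives τₗ(a₁) ⊗ τₗ(a₂), whose last three
factors visibly lie in the image of `right`. -/
theorem insert_l (hl : Function.Bijective Z.galL) (hr : Function.Bijective Z.galR) (a : A) :
    D.insert (D.l a) = LinearMap.lTensor Z.carrier D.right.toLinearMap
      (TensorProduct.assoc k Z.carrier Z.opp A
        (LinearMap.rTensor A D.l.toLinearMap (Coalgebra.comul a))) := by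
  rw [D.insert_eq hl hr, D.rTensor_lcoact_l hl]
  induction Coalgebra.comul (R := k) a with
  | zero => simp only [LinearMap.map_zero, LinearEquiv.map_zero]
  | add x y hx hy => simp only [LinearMap.map_add, LinearEquiv.map_add, hx, hy]
  | tmul b c =>
    rw [LinearMap.lTensor_tmul, LinearMap.rTensor_tmul, LinearMap.rTensor_tmul,
      AlgHom.toLinearMap_apply, AlgHom.toLinearMap_apply]
    induction D.l b with
    | zero => simp only [LinearMap.map_zero, LinearEquiv.map_zero, zero_tmul]
    | add x y hx hy => simp only [LinearMap.map_add, LinearEquiv.map_add, add_tmul, hx, hy]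
    | tmul b c => rfl

/-- The map `o ⊗ a ↦ o ⊗ τₗ(a₁) ⊗ a₂`. -/
def spread : Z.opp ⊗[k] A →ₗ[k] (Z.opp ⊗[k] Z.carrier) ⊗[k] (Z.opp ⊗[k] A) :=
  (TensorProduct.assoc k Z.opp Z.carrier (Z.opp ⊗[k] A)).symm.toLinearMap ∘ₗ
    LinearMap.lTensor Z.opp ((TensorProduct.assoc k Z.carrier Z.opp A).toLinearMap ∘ₗ
      LinearMap.rTensor A D.l.toLinearMap ∘ₗ Coalgebra.comul)

/-- On a ⊗ o both sides are τᵣ(a₁) ⊗ τᵣ(a₂) ⊗ o, by colinearity of τᵣ. Combined with the next lemma,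
where both sides are o ⊗ τₗ(a₁) ⊗ τₗ(a₂), it transports (Δ ⊗ id)(x), for x in the pullback, into the
image of `right`. -/
theorem rTensor_r_left_comul (hr : Function.Bijective Z.galR) (x : A ⊗[k] Z.opp) :
    LinearMap.rTensor _ D.r.toLinearMap (LinearMap.lTensor A D.left.toLinearMap
      (TensorProduct.assoc k A A Z.opp (LinearMap.rTensor Z.opp Coalgebra.comul x))) =
    (TensorProduct.assoc k Z.opp Z.carrier _).symm
      (LinearMap.lTensor Z.opp D.insert (D.left x)) := by
  induction x with
  | zero => simp only [LinearMap.map_zero, LinearEquiv.map_zero, left_zero]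
  | add x y hx hy => simp only [LinearMap.map_add, LinearEquiv.map_add, left_add, hx, hy]
  | tmul a o =>
    let G : Z.carrier ⊗[k] A →ₗ[k] Z.carrier ⊗[k] (Z.opp ⊗[k] (Z.carrier ⊗[k] Z.opp)) :=
      LinearMap.lTensor Z.carrier (D.left.toLinearMap ∘ₗ (TensorProduct.mk k A Z.opp).flip o)
    have h1 : ∀ u : Z.opp ⊗[k] Z.carrier, LinearMap.lTensor Z.opp D.insert
        (TensorProduct.assoc k Z.opp Z.carrier Z.opp (u ⊗ₜ o)) =
        LinearMap.lTensor Z.opp G (LinearMap.lTensor Z.opp Z.rcoact.toLinearMap u) := by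
      intro u
      induction u with
      | zero => simp only [LinearMap.map_zero, LinearEquiv.map_zero, zero_tmul]
      | add x y hx hy => simp only [LinearMap.map_add, LinearEquiv.map_add, add_tmul, hx, hy]
      | tmul x y =>
        rw [assoc_tmul, LinearMap.lTensor_tmul, LinearMap.lTensor_tmul, LinearMap.lTensor_tmul]
        refine congrArg (x ⊗ₜ[k] ·) ?_
        change LinearMap.lTensor Z.carrier D.left.toLinearMap
          (TensorProduct.assoc k Z.carrier A Z.opp (Z.rcoact y ⊗ₜ o)) = G (Z.rcoact y)
        induction Z.rcoact y with
        | zero => simp only [LinearMap.map_zero, LinearEquiv.map_zero, zero_tmul]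
        | add x y hx hy => simp only [LinearMap.map_add, LinearEquiv.map_add, add_tmul, hx, hy]
        | tmul b c => rfl
    rw [left_tmul, h1, D.lTensor_rcoact_r hr, LinearMap.rTensor_tmul]
    induction Coalgebra.comul (R := k) a with
    | zero => simp only [LinearMap.map_zero, LinearEquiv.map_zero, zero_tmul]
    | add x y hx hy => simp only [LinearMap.map_add, LinearEquiv.map_add, add_tmul, hx, hy]
    | tmul b c =>
      rw [assoc_tmul, LinearMap.lTensor_tmul, LinearMap.rTensor_tmul, LinearMap.rTensor_tmul,
        AlgHom.toLinearMap_apply]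
      induction D.r b with
      | zero => simp only [LinearMap.map_zero, LinearEquiv.map_zero, zero_tmul]
      | add x y hx hy => simp only [LinearMap.map_add, LinearEquiv.map_add, add_tmul, hx, hy]
      | tmul b c => rfl

theorem lTensor_insert_right (hl : Function.Bijective Z.galL) (hr : Function.Bijective Z.galR)
    (s : Z.opp ⊗[k] A) : (TensorProduct.assoc k Z.opp Z.carrier _).symm
      (LinearMap.lTensor Z.opp D.insert (D.right s)) =
      LinearMap.lTensor _ D.right.toLinearMap (D.spread s) := by
  induction s with
  | zero => simp only [LinearMap.map_zero, LinearEquiv.map_zero, right_zero]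
  | add x y hx hy => simp only [LinearMap.map_add, LinearEquiv.map_add, right_add, hx, hy]
  | tmul o a =>
    rw [right_tmul, LinearMap.lTensor_tmul, D.insert_l hl hr]
    change _ = LinearMap.lTensor _ D.right.toLinearMap
      ((TensorProduct.assoc k Z.opp Z.carrier (Z.opp ⊗[k] A)).symm (o ⊗ₜ
        TensorProduct.assoc k Z.carrier Z.opp A
          (LinearMap.rTensor A D.l.toLinearMap (Coalgebra.comul a))))
    induction TensorProduct.assoc k Z.carrier Z.opp A
          (LinearMap.rTensor A D.l.toLinearMap (Coalgebra.comul a)) with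
    | zero => simp only [LinearMap.map_zero, LinearEquiv.map_zero, tmul_zero]
    | add x y hx hy => simp only [LinearMap.map_add, LinearEquiv.map_add, tmul_add, hx, hy]
    | tmul b c => rfl

/-- Two bracketings of o ⊗ τₗ(a₁) ⊗ a₂. -/
theorem assoc_spread (s : Z.opp ⊗[k] A) :
    TensorProduct.assoc k Z.opp (Z.carrier ⊗[k] Z.opp) A
      (LinearMap.rTensor A D.right.toLinearMap ((TensorProduct.assoc k Z.opp A A).symm
        (LinearMap.lTensor Z.opp Coalgebra.comul s))) =
    LinearMap.lTensor Z.opp (TensorProduct.assoc k Z.carrier Z.opp A).symm.toLinearMap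
      (TensorProduct.assoc k Z.opp Z.carrier (Z.opp ⊗[k] A) (D.spread s)) := by
  induction s with
  | zero => simp only [LinearMap.map_zero, LinearEquiv.map_zero]
  | add x y hx hy => simp only [LinearMap.map_add, LinearEquiv.map_add, hx, hy]
  | tmul o a =>
    change _ = LinearMap.lTensor Z.opp (TensorProduct.assoc k Z.carrier Z.opp A).symm.toLinearMap
      (TensorProduct.assoc k Z.opp Z.carrier (Z.opp ⊗[k] A)
        ((TensorProduct.assoc k Z.opp Z.carrier (Z.opp ⊗[k] A)).symm (o ⊗ₜ
        TensorProduct.assoc k Z.carrier Z.opp A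
          (LinearMap.rTensor A D.l.toLinearMap (Coalgebra.comul a)))))
    rw [LinearEquiv.apply_symm_apply, LinearMap.lTensor_tmul, LinearMap.lTensor_tmul,
      LinearEquiv.coe_coe, LinearEquiv.symm_apply_apply]
    induction Coalgebra.comul (R := k) a with
    | zero => simp only [LinearMap.map_zero, LinearEquiv.map_zero, tmul_zero]
    | add x y hx hy => simp only [LinearMap.map_add, LinearEquiv.map_add, tmul_add, hx, hy]
    | tmul b c => rfl

end Translation

end BicomodAlg

/-! ### Bicomodule structure on the pullback -/

namespace BicomodAlg

namespace Translation

variable {Z : BicomodAlg k A} (D : Z.Translation)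

/-- The bicomodule algebra `T` is the pullback of `A ⊗ Zᵒᵖ` and `Zᵒᵖ ⊗ A` over
`Zᵒᵖ ⊗ Z ⊗ Zᵒᵖ`, with projections `i` and `θ`. -/
structure IsInverse (T : BicomodAlg k A) (i : T.carrier →ₐ[k] A ⊗[k] Z.opp)
    (θ : T.carrier →ₐ[k] Z.opp ⊗[k] A) : Prop where
  injective : Function.Injective i
  mem_range_iff : ∀ x, x ∈ LinearMap.range i.toLinearMap ↔
    D.left x ∈ LinearMap.range D.right.toLinearMap
  left_eq : ∀ t, D.left (i t) = D.right (θ t)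
  lcoact : ∀ t, LinearMap.lTensor A i.toLinearMap (T.lcoact t) =
    TensorProduct.assoc k A A Z.opp (LinearMap.rTensor Z.opp Coalgebra.comul (i t))
  rcoact : ∀ t, LinearMap.rTensor A θ.toLinearMap (T.rcoact t) =
    (TensorProduct.assoc k Z.opp A A).symm (LinearMap.lTensor Z.opp Coalgebra.comul (θ t))
  mixed : ∀ t, TensorProduct.assoc k A Z.opp A (LinearMap.rTensor A i.toLinearMap (T.rcoact t)) =
    LinearMap.lTensor A θ.toLinearMap (T.lcoact t)

theorem faithfullyFlat_opp [Module.FaithfullyFlat k Z.carrier] : Module.FaithfullyFlat k Z.opp :=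
  faithfullyFlat_congr Z.unop.symm

theorem left_injective [Module.FaithfullyFlat k Z.carrier] : Function.Injective D.left :=
  (TensorProduct.assoc k Z.opp Z.carrier Z.opp).injective.comp (D.rTensor_r_injective Z.opp)

theorem right_injective [Module.FaithfullyFlat k Z.carrier] : Function.Injective D.right :=
  D.lTensor_l_injective Z.opp

theorem rTensor_assoc_left (y : A ⊗[k] (Z.opp ⊗[k] A)) :
    TensorProduct.assoc k Z.opp (Z.carrier ⊗[k] Z.opp) A
      (LinearMap.rTensor A D.left.toLinearMap ((TensorProduct.assoc k A Z.opp A).symm y)) =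
    LinearMap.lTensor Z.opp (TensorProduct.assoc k Z.carrier Z.opp A).symm.toLinearMap
      (TensorProduct.assoc k Z.opp Z.carrier (Z.opp ⊗[k] A)
        (LinearMap.rTensor (Z.opp ⊗[k] A) D.r.toLinearMap y)) := by
  refine LinearMap.congr_fun (f := (TensorProduct.assoc k Z.opp (Z.carrier ⊗[k] Z.opp)
      A).toLinearMap ∘ₗ LinearMap.rTensor A D.left.toLinearMap ∘ₗ
        (TensorProduct.assoc k A Z.opp A).symm.toLinearMap)
    (g := LinearMap.lTensor Z.opp (TensorProduct.assoc k Z.carrier Z.opp A).symm.toLinearMap ∘ₗ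
      (TensorProduct.assoc k Z.opp Z.carrier (Z.opp ⊗[k] A)).toLinearMap ∘ₗ
        LinearMap.rTensor (Z.opp ⊗[k] A) D.r.toLinearMap)
    (TensorProduct.ext_threefold' fun a o b => ?_) y
  change TensorProduct.assoc k Z.opp (Z.carrier ⊗[k] Z.opp) A
      (TensorProduct.assoc k Z.opp Z.carrier Z.opp (D.r a ⊗ₜ o) ⊗ₜ b) =
    LinearMap.lTensor Z.opp (TensorProduct.assoc k Z.carrier Z.opp A).symm.toLinearMap
      (TensorProduct.assoc k Z.opp Z.carrier (Z.opp ⊗[k] A) (D.r a ⊗ₜ (o ⊗ₜ b)))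
  induction D.r a with
  | zero => simp only [LinearMap.map_zero, LinearEquiv.map_zero, zero_tmul]
  | add x y hx hy => simp only [LinearMap.map_add, LinearEquiv.map_add, add_tmul, hx, hy]
  | tmul a b => rfl

/-- The left coaction is Δ on the factor `A` of `A ⊗ Zᵒᵖ`. That it lands in `A ⊗ S` is detected
after τᵣ, which stays injective on cokernels, and there the exchange identity exhibits the element
as a value of `right`. The right coaction is Δ on the factor `A` of `Zᵒᵖ ⊗ A`, but it is constructed
from the left one through the relation `mixed`, which is then available for the compatibility of the
two. -/
theorem exists_inverse_of_injective [Module.Flat k A] [Module.FaithfullyFlat k Z.carrier]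
    (hl : Function.Bijective Z.galL) (hr : Function.Bijective Z.galR) {S : Type v} [Ring S]
    [Algebra k S] (i : S →ₐ[k] A ⊗[k] Z.opp) (hi : Function.Injective i)
    (H : ∀ x, x ∈ LinearMap.range i.toLinearMap ↔ D.left x ∈ LinearMap.range D.right.toLinearMap) :
    ∃ T i θ, D.IsInverse T i θ := by
  have ffo : Module.FaithfullyFlat k Z.opp := faithfullyFlat_opp
  obtain ⟨θ, hθ⟩ : ∃ θ : S →ₐ[k] Z.opp ⊗[k] A, ∀ t, D.right (θ t) = D.left (i t) :=
    exists_algHom_lift (D.left.comp i) D.right D.right_injective fun t => (H (i t)).1 ⟨t, rfl⟩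
  have hθ' : D.right.toLinearMap ∘ₗ θ.toLinearMap = D.left.toLinearMap ∘ₗ i.toLinearMap :=
    LinearMap.ext hθ
  have θinj : Function.Injective θ := fun x y h => hi (D.left_injective
    ((hθ x).symm.trans ((congrArg D.right h).trans (hθ y))))
  -- Both sides come from the single equation `left (i t) = right (θ t)` by applying `insert` to its
  -- last two factors.
  have hrl : ∀ t, LinearMap.rTensor _ D.r.toLinearMap (LinearMap.lTensor A D.left.toLinearMap
      (TensorProduct.assoc k A A Z.opp (LinearMap.rTensor Z.opp Coalgebra.comul (i t)))) =
      LinearMap.lTensor _ D.right.toLinearMap (D.spread (θ t)) := fun t =>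
    (D.rTensor_r_left_comul hr _).trans ((congrArg _ (congrArg _ (hθ t).symm)).trans
      (D.lTensor_insert_right hl hr _))
  -- the left coaction
  have il : Function.Injective (LinearMap.lTensor A i.toLinearMap) := lTensor_inj hi
  have ir : Function.Injective (LinearMap.rTensor A i.toLinearMap) := rTensor_inj hi
  have ml : ∀ t, TensorProduct.assoc k A A Z.opp (LinearMap.rTensor Z.opp Coalgebra.comul (i t)) ∈
      LinearMap.range (LinearMap.lTensor A i.toLinearMap) := fun t =>
    mem_range_lTensor_of_mem_range (f := D.left.toLinearMap) (g := D.right.toLinearMap) H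
      (mem_range_of_rTensor (f := D.r.toLinearMap) (D.rTensor_r_injective _) ⟨_, (hrl t).symm⟩)
  obtain ⟨l, hl2⟩ : ∃ l : S →ₐ[k] A ⊗[k] S, ∀ t, LinearMap.lTensor A i.toLinearMap (l t) =
      TensorProduct.assoc k A A Z.opp (LinearMap.rTensor Z.opp Coalgebra.comul (i t)) :=
    exists_algHom_lift ((ambL (reg k A) (triv Z.opp)).comp i)
      (Algebra.TensorProduct.map (AlgHom.id k A) i) il ml
  -- the right coaction
  have key : ∀ t, LinearMap.rTensor _ D.r.toLinearMap (LinearMap.lTensor A θ.toLinearMap (l t)) =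
      D.spread (θ t) := by
    intro t
    have inj : Function.Injective
        (LinearMap.lTensor (Z.opp ⊗[k] Z.carrier) D.right.toLinearMap) :=
      lTensor_inj D.right_injective
    refine inj ((hrl t).symm.trans ?_).symm
    rw [← hl2, ← LinearMap.lTensor_comp_apply, ← hθ', LinearMap.lTensor_comp_apply]
    rw [← LinearMap.comp_apply, LinearMap.rTensor_comp_lTensor, ← LinearMap.lTensor_comp_rTensor,
      LinearMap.comp_apply]
  -- So `left` of (id ⊗ θ)(l(t)) agrees with `right` of (id ⊗ Δ)(θ(t)): these are the two components
  -- of an element of `S ⊗ A`, which will be r(t).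
  have key2 : ∀ t, LinearMap.rTensor A D.left.toLinearMap ((TensorProduct.assoc k A Z.opp A).symm
      (LinearMap.lTensor A θ.toLinearMap (l t))) =
      LinearMap.rTensor A D.right.toLinearMap ((TensorProduct.assoc k Z.opp A A).symm
        (LinearMap.lTensor Z.opp Coalgebra.comul (θ t))) := fun t => by
    refine (TensorProduct.assoc k Z.opp (Z.carrier ⊗[k] Z.opp) A).injective ?_
    rw [rTensor_assoc_left, key, assoc_spread]
  have mr : ∀ t, (TensorProduct.assoc k A Z.opp A).symm (LinearMap.lTensor A θ.toLinearMap (l t)) ∈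
      LinearMap.range (LinearMap.rTensor A i.toLinearMap) := fun t =>
    mem_range_rTensor_of_mem_range (f := D.left.toLinearMap) (g := D.right.toLinearMap) H
      ⟨_, (key2 t).symm⟩
  obtain ⟨r, hr'⟩ : ∃ r : S →ₐ[k] S ⊗[k] A, ∀ t, LinearMap.rTensor A i.toLinearMap (r t) =
      (TensorProduct.assoc k A Z.opp A).symm (LinearMap.lTensor A θ.toLinearMap (l t)) :=
    exists_algHom_lift ((Algebra.TensorProduct.assoc k k k A Z.opp A).symm.toAlgHom.comp
      ((Algebra.TensorProduct.map (AlgHom.id k A) θ).comp l))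
      (Algebra.TensorProduct.map i (AlgHom.id k A)) ir mr
  have hr2 : ∀ t, TensorProduct.assoc k A Z.opp A (LinearMap.rTensor A i.toLinearMap (r t)) =
      LinearMap.lTensor A θ.toLinearMap (l t) := fun t =>
    (congrArg _ (hr' t)).trans ((TensorProduct.assoc k A Z.opp A).apply_symm_apply _)
  have hr3 : ∀ t, LinearMap.rTensor A θ.toLinearMap (r t) =
      (TensorProduct.assoc k Z.opp A A).symm (LinearMap.lTensor Z.opp Coalgebra.comul (θ t)) := by
    intro t
    have inj : Function.Injective (LinearMap.rTensor A D.right.toLinearMap) :=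
      rTensor_inj D.right_injective
    refine inj ?_
    rw [← key2, ← LinearMap.rTensor_comp_apply, hθ', LinearMap.rTensor_comp_apply, ← hr2,
      LinearEquiv.symm_apply_apply]
  refine ⟨{
    carrier := S
    lcoact := l
    rcoact := r
    lcoassoc := restrict_lcoassoc (B := ambient (reg k A) (triv Z.opp)) hi hl2
    lcounit := restrict_lcounit (B := ambient (reg k A) (triv Z.opp)) hi hl2
    rcoassoc := restrict_rcoassoc (B := ambient (triv Z.opp) (reg k A)) θinj hr3
    rcounit := restrict_rcounit (B := ambient (triv Z.opp) (reg k A)) θinj hr3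
    bicomod := fun t => ?_ }, i, θ, hi, H, fun t => (hθ t).symm, hl2, hr3, hr2⟩
  -- Compatibility of l and r is tested after θ. The relation `mixed` replaces (id ⊗ θ)l by (i ⊗
  -- id)r, coassociativity of r produces Δ on the last factor, and `mixed` is used once more to
  -- return to l.
  have inj1 : Function.Injective (LinearMap.rTensor A θ.toLinearMap) := rTensor_inj θinj
  have inj : Function.Injective (LinearMap.lTensor A (LinearMap.rTensor A θ.toLinearMap)) :=
    lTensor_inj inj1
  refine inj ?_
  let G : S ⊗[k] (A ⊗[k] A) →ₗ[k] A ⊗[k] ((Z.opp ⊗[k] A) ⊗[k] A) :=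
    LinearMap.lTensor A (TensorProduct.assoc k Z.opp A A).symm.toLinearMap ∘ₗ
      (TensorProduct.assoc k A Z.opp (A ⊗[k] A)).toLinearMap ∘ₗ
        LinearMap.rTensor (A ⊗[k] A) i.toLinearMap
  have h1 : ∀ y : S ⊗[k] A, LinearMap.lTensor A (LinearMap.rTensor A θ.toLinearMap)
      (TensorProduct.assoc k A S A (LinearMap.rTensor A l.toLinearMap y)) =
      G (TensorProduct.assoc k S A A (LinearMap.rTensor A r.toLinearMap y)) := by
    intro y
    induction y with
    | zero => simp only [LinearMap.map_zero, LinearEquiv.map_zero]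
    | add x y hx hy => simp only [LinearMap.map_add, LinearEquiv.map_add, hx, hy]
    | tmul s a =>
      have h := congrArg (LinearMap.lTensor A ((TensorProduct.mk k (Z.opp ⊗[k] A) A).flip a))
        (hr2 s)
      rw [LinearMap.rTensor_tmul, LinearMap.rTensor_tmul, AlgHom.toLinearMap_apply,
        AlgHom.toLinearMap_apply]
      refine Eq.trans ?_ (h.symm.trans ?_)
      · induction l s with
        | zero => simp only [LinearMap.map_zero, LinearEquiv.map_zero, zero_tmul]
        | add x y hx hy => simp only [LinearMap.map_add, LinearEquiv.map_add, add_tmul, hx, hy]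
        | tmul b c => rfl
      · induction r s with
        | zero => simp only [LinearMap.map_zero, LinearEquiv.map_zero, zero_tmul]
        | add x y hx hy => simp only [LinearMap.map_add, LinearEquiv.map_add, add_tmul, hx, hy]
        | tmul b c =>
          change _ = LinearMap.lTensor A (TensorProduct.assoc k Z.opp A A).symm.toLinearMap
            (TensorProduct.assoc k A Z.opp (A ⊗[k] A) (i b ⊗ₜ (c ⊗ₜ a)))
          rw [LinearMap.rTensor_tmul, AlgHom.toLinearMap_apply]
          induction i b with
          | zero => simp only [LinearMap.map_zero, LinearEquiv.map_zero, zero_tmul]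
          | add x y hx hy => simp only [LinearMap.map_add, LinearEquiv.map_add, add_tmul, hx, hy]
          | tmul b c => rfl
  have h3 : ∀ y : S ⊗[k] A, G (LinearMap.lTensor S Coalgebra.comul y) =
      LinearMap.lTensor A ((TensorProduct.assoc k Z.opp A A).symm.toLinearMap ∘ₗ
        LinearMap.lTensor Z.opp Coalgebra.comul) (TensorProduct.assoc k A Z.opp A
          (LinearMap.rTensor A i.toLinearMap y)) := by
    intro y
    induction y with
    | zero => simp only [LinearMap.map_zero, LinearEquiv.map_zero]
    | add x y hx hy => simp only [LinearMap.map_add, LinearEquiv.map_add, hx, hy]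
    | tmul s a =>
      change LinearMap.lTensor A (TensorProduct.assoc k Z.opp A A).symm.toLinearMap
            (TensorProduct.assoc k A Z.opp (A ⊗[k] A) (i s ⊗ₜ Coalgebra.comul a)) = _
      rw [LinearMap.rTensor_tmul, AlgHom.toLinearMap_apply]
      induction i s with
      | zero => simp only [LinearMap.map_zero, LinearEquiv.map_zero, zero_tmul]
      | add x y hx hy => simp only [LinearMap.map_add, LinearEquiv.map_add, add_tmul, hx, hy]
      | tmul b c => rfl
  have h2 : LinearMap.rTensor A θ.toLinearMap ∘ₗ r.toLinearMap =
      ((TensorProduct.assoc k Z.opp A A).symm.toLinearMap ∘ₗ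
        LinearMap.lTensor Z.opp Coalgebra.comul) ∘ₗ θ.toLinearMap := LinearMap.ext hr3
  have h4 : LinearMap.lTensor A (((TensorProduct.assoc k Z.opp A A).symm.toLinearMap ∘ₗ
        LinearMap.lTensor Z.opp Coalgebra.comul) ∘ₗ θ.toLinearMap) (l t) =
      LinearMap.lTensor A ((TensorProduct.assoc k Z.opp A A).symm.toLinearMap ∘ₗ
        LinearMap.lTensor Z.opp Coalgebra.comul) (LinearMap.lTensor A θ.toLinearMap (l t)) :=
    LinearMap.lTensor_comp_apply _ _ _ _
  rw [h1, restrict_rcoassoc (B := ambient (triv Z.opp) (reg k A)) θinj hr3, h3,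
    ← LinearMap.lTensor_comp_apply, h2, h4, hr2]

theorem exists_inverse [Module.Flat k A] [Module.FaithfullyFlat k Z.carrier]
    (hl : Function.Bijective Z.galL) (hr : Function.Bijective Z.galR) :
    ∃ T i θ, D.IsInverse T i θ :=
  D.exists_inverse_of_injective hl hr (S := D.right.range.comap D.left)
    (D.right.range.comap D.left).val Subtype.val_injective fun x =>
      ⟨fun ⟨w, hw⟩ => hw ▸ w.2, fun h => ⟨⟨x, h⟩, rfl⟩⟩

end Translation

end BicomodAlg

/-! ### The maps from `A` to `T ⊗ Z` and `Z ⊗ T` -/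

namespace BicomodAlg

namespace Translation

variable {Z : BicomodAlg k A} (D : Z.Translation)

/-- Write τᵣ(a) = x ⊗ y. The left side is τᵣ(a₁) ⊗ τᵣ(a₂) = x ⊗ y₀ ⊗ τᵣ(y₁) by colinearity, and the
right side is x ⊗ τₗ(y₋₁) ⊗ y₀; the exchange identity equates them. Thus a₁ ⊗ τᵣ(a₂) and x ⊗ y₋₁ ⊗
y₀ are compatible components of an element of the pullback tensored with `Z`. -/
theorem rTensor_left_comul (hl : Function.Bijective Z.galL) (hr : Function.Bijective Z.galR)
    (a : A) : LinearMap.rTensor Z.carrier D.left.toLinearMap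
      ((TensorProduct.assoc k A Z.opp Z.carrier).symm
        (LinearMap.lTensor A D.r.toLinearMap (Coalgebra.comul a))) =
    LinearMap.rTensor Z.carrier D.right.toLinearMap
      ((TensorProduct.assoc k Z.opp A Z.carrier).symm
        (LinearMap.lTensor Z.opp Z.lcoact.toLinearMap (D.r a))) := by
  let E : Z.opp ⊗[k] (Z.carrier ⊗[k] (Z.opp ⊗[k] Z.carrier)) →ₗ[k]
      (Z.opp ⊗[k] (Z.carrier ⊗[k] Z.opp)) ⊗[k] Z.carrier :=
    (TensorProduct.assoc k Z.opp (Z.carrier ⊗[k] Z.opp) Z.carrier).symm.toLinearMap ∘ₗ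
      LinearMap.lTensor Z.opp (TensorProduct.assoc k Z.carrier Z.opp Z.carrier).symm.toLinearMap
  have h1 : ∀ y : A ⊗[k] A, LinearMap.rTensor Z.carrier D.left.toLinearMap
      ((TensorProduct.assoc k A Z.opp Z.carrier).symm (LinearMap.lTensor A D.r.toLinearMap y)) =
      E (LinearMap.lTensor Z.opp (LinearMap.lTensor Z.carrier D.r.toLinearMap)
        (TensorProduct.assoc k Z.opp Z.carrier A (LinearMap.rTensor A D.r.toLinearMap y))) := by
    intro y
    induction y with
    | zero => simp only [LinearMap.map_zero, LinearEquiv.map_zero]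
    | add x y hx hy => simp only [LinearMap.map_add, LinearEquiv.map_add, hx, hy]
    | tmul a b =>
      have h2 : ∀ v : Z.opp ⊗[k] Z.carrier, LinearMap.rTensor Z.carrier D.left.toLinearMap
          ((TensorProduct.assoc k A Z.opp Z.carrier).symm (a ⊗ₜ v)) =
          E (TensorProduct.assoc k Z.opp Z.carrier (Z.opp ⊗[k] Z.carrier) (D.r a ⊗ₜ v)) := by
        intro v
        induction v with
        | zero => simp only [LinearMap.map_zero, LinearEquiv.map_zero, tmul_zero]
        | add x y hx hy => simp only [LinearMap.map_add, LinearEquiv.map_add, tmul_add, hx, hy]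
        | tmul o z =>
          rw [assoc_symm_tmul, LinearMap.rTensor_tmul, AlgHom.toLinearMap_apply, left_tmul]
          induction D.r a with
          | zero => simp only [LinearMap.map_zero, LinearEquiv.map_zero, zero_tmul]
          | add x y hx hy => simp only [LinearMap.map_add, LinearEquiv.map_add, add_tmul, hx, hy]
          | tmul b c => rfl
      rw [LinearMap.lTensor_tmul, LinearMap.rTensor_tmul, AlgHom.toLinearMap_apply,
        AlgHom.toLinearMap_apply, h2]
      induction D.r a with
      | zero => simp only [LinearMap.map_zero, LinearEquiv.map_zero, zero_tmul]
      | add x y hx hy => simp only [LinearMap.map_add, LinearEquiv.map_add, add_tmul, hx, hy]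
      | tmul b c => rfl
  have h3 : ∀ u : Z.opp ⊗[k] Z.carrier, LinearMap.rTensor Z.carrier D.right.toLinearMap
      ((TensorProduct.assoc k Z.opp A Z.carrier).symm
        (LinearMap.lTensor Z.opp Z.lcoact.toLinearMap u)) =
      E (LinearMap.lTensor Z.opp (LinearMap.lTensor Z.carrier D.r.toLinearMap)
        (LinearMap.lTensor Z.opp Z.rcoact.toLinearMap u)) := by
    intro u
    induction u with
    | zero => simp only [LinearMap.map_zero, LinearEquiv.map_zero]
    | add x y hx hy => simp only [LinearMap.map_add, LinearEquiv.map_add, hx, hy]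
    | tmul o z =>
      rw [LinearMap.lTensor_tmul, LinearMap.lTensor_tmul, LinearMap.lTensor_tmul,
        AlgHom.toLinearMap_apply, AlgHom.toLinearMap_apply, D.lTensor_r_rcoact hl hr]
      induction Z.lcoact z with
      | zero => simp only [LinearMap.map_zero, LinearEquiv.map_zero, tmul_zero]
      | add x y hx hy => simp only [LinearMap.map_add, LinearEquiv.map_add, tmul_add, hx, hy]
      | tmul b c =>
        change (o ⊗ₜ D.l b) ⊗ₜ c = (TensorProduct.assoc k Z.opp (Z.carrier ⊗[k] Z.opp)
          Z.carrier).symm (o ⊗ₜ (TensorProduct.assoc k Z.carrier Z.opp Z.carrier).symm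
            (TensorProduct.assoc k Z.carrier Z.opp Z.carrier (D.l b ⊗ₜ c)))
        rw [LinearEquiv.symm_apply_apply]
        rfl
  rw [h1, h3, D.lTensor_rcoact_r hr]

namespace IsInverse

variable {D} {T : BicomodAlg k A} {i : T.carrier →ₐ[k] A ⊗[k] Z.opp}
  {θ : T.carrier →ₐ[k] Z.opp ⊗[k] A}



theorem comp_eq (h : D.IsInverse T i θ) : D.right.toLinearMap ∘ₗ θ.toLinearMap = D.left.toLinearMap ∘ₗ i.toLinearMap :=
  LinearMap.ext fun t => (h.left_eq t).symm

theorem injective_right (h : D.IsInverse T i θ) [Module.FaithfullyFlat k Z.carrier] :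
    Function.Injective θ := fun x y e =>
  h.injective (D.left_injective
    ((h.left_eq x).trans ((congrArg D.right e).trans (h.left_eq y).symm)))

/-- Flatness of `Z` makes `T ⊗ Z` the pullback of `A ⊗ Zᵒᵖ ⊗ Z` and `Zᵒᵖ ⊗ A ⊗ Z`, and
`rTensor_left_comul` is the compatibility of the two prescribed components. Both are recorded: the
computations with the coactions use i, membership in the cotensor product uses θ. -/
theorem exists_unit (h : D.IsInverse T i θ)
    [Module.FaithfullyFlat k Z.carrier] (hl : Function.Bijective Z.galL)
    (hr : Function.Bijective Z.galR) : ∃ e : A →ₐ[k] T.carrier ⊗[k] Z.carrier,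
      (∀ a, LinearMap.rTensor Z.carrier i.toLinearMap (e a) =
        (TensorProduct.assoc k A Z.opp Z.carrier).symm
          (LinearMap.lTensor A D.r.toLinearMap (Coalgebra.comul a))) ∧
      ∀ a, LinearMap.rTensor Z.carrier θ.toLinearMap (e a) =
        (TensorProduct.assoc k Z.opp A Z.carrier).symm
          (LinearMap.lTensor Z.opp Z.lcoact.toLinearMap (D.r a)) := by
  have inj : Function.Injective (LinearMap.rTensor Z.carrier i.toLinearMap) :=
    rTensor_inj h.injective
  obtain ⟨e, he⟩ : ∃ e : A →ₐ[k] T.carrier ⊗[k] Z.carrier,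
      ∀ a, LinearMap.rTensor Z.carrier i.toLinearMap (e a) =
        (TensorProduct.assoc k A Z.opp Z.carrier).symm
          (LinearMap.lTensor A D.r.toLinearMap (Coalgebra.comul a)) :=
    exists_algHom_lift ((Algebra.TensorProduct.assoc k k k A Z.opp Z.carrier).symm.toAlgHom.comp
      ((Algebra.TensorProduct.map (AlgHom.id k A) D.r).comp (Bialgebra.comulAlgHom k A)))
      (Algebra.TensorProduct.map i (AlgHom.id k Z.carrier)) inj fun a =>
        mem_range_rTensor_of_mem_range (f := D.left.toLinearMap) (g := D.right.toLinearMap)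
          h.mem_range_iff ⟨_, (D.rTensor_left_comul hl hr a).symm⟩
  refine ⟨e, he, fun a => ?_⟩
  have inj : Function.Injective (LinearMap.rTensor Z.carrier D.right.toLinearMap) :=
    rTensor_inj D.right_injective
  refine inj ?_
  rw [← D.rTensor_left_comul hl hr, ← he, ← LinearMap.rTensor_comp_apply, h.comp_eq,
    LinearMap.rTensor_comp_apply]

/-- For τₗ(a) = x ⊗ y the components are ρ(x) ⊗ y and τₗ(a₁) ⊗ a₂; their compatibility is
`insert_l`. -/
theorem exists_counit (h : D.IsInverse T i θ)
    [Module.FaithfullyFlat k Z.carrier] (hl : Function.Bijective Z.galL)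
    (hr : Function.Bijective Z.galR) : ∃ f : A →ₐ[k] Z.carrier ⊗[k] T.carrier,
      (∀ a, LinearMap.lTensor Z.carrier i.toLinearMap (f a) =
        TensorProduct.assoc k Z.carrier A Z.opp
          (LinearMap.rTensor Z.opp Z.rcoact.toLinearMap (D.l a))) ∧
      ∀ a, LinearMap.lTensor Z.carrier θ.toLinearMap (f a) =
        TensorProduct.assoc k Z.carrier Z.opp A
          (LinearMap.rTensor A D.l.toLinearMap (Coalgebra.comul a)) := by
  have inj : Function.Injective (LinearMap.lTensor Z.carrier i.toLinearMap) :=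
    lTensor_inj h.injective
  obtain ⟨f, hf⟩ : ∃ f : A →ₐ[k] Z.carrier ⊗[k] T.carrier,
      ∀ a, LinearMap.lTensor Z.carrier i.toLinearMap (f a) =
        TensorProduct.assoc k Z.carrier A Z.opp
          (LinearMap.rTensor Z.opp Z.rcoact.toLinearMap (D.l a)) :=
    exists_algHom_lift ((Algebra.TensorProduct.assoc k k k Z.carrier A Z.opp).toAlgHom.comp
      ((Algebra.TensorProduct.map Z.rcoact (AlgHom.id k Z.opp)).comp D.l))
      (Algebra.TensorProduct.map (AlgHom.id k Z.carrier) i) inj fun a =>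
        mem_range_lTensor_of_mem_range (f := D.left.toLinearMap) (g := D.right.toLinearMap)
          h.mem_range_iff ⟨_, (D.insert_l hl hr a).symm⟩
  refine ⟨f, hf, fun a => ?_⟩
  have inj : Function.Injective (LinearMap.lTensor Z.carrier D.right.toLinearMap) :=
    lTensor_inj D.right_injective
  refine inj (Eq.trans ?_ (D.insert_l hl hr a))
  change _ = LinearMap.lTensor Z.carrier D.left.toLinearMap (TensorProduct.assoc k Z.carrier A Z.opp
    (LinearMap.rTensor Z.opp Z.rcoact.toLinearMap (D.l a)))
  rw [← hf, ← LinearMap.lTensor_comp_apply, ← LinearMap.lTensor_comp_apply, h.comp_eq]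

end IsInverse

end Translation

end BicomodAlg

/-! ### The isomorphisms `T ⊗ Z ≃ A ⊗ Z` and `Z ⊗ T ≃ Z ⊗ A` -/

namespace BicomodAlg

/-- The maps φ and `actR` are linear for right multiplication on the last factor, ψ and `actL` for
left multiplication on the first. The relations between them therefore need checking only where that
factor is 1. -/
theorem phi_mul {Z T : BicomodAlg k A} {W : Type v} [Ring W] [Algebra k W]
    (j : W →ₐ[k] Z.carrier ⊗[k] T.carrier) (x : W ⊗[k] T.carrier) (t : T.carrier) :
    phi j (x * (1 ⊗ₜ t)) = phi j x * (1 ⊗ₜ t) := by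
  induction x with
  | zero => simp only [LinearMap.map_zero, zero_mul]
  | add x y hx hy => simp only [LinearMap.map_add, add_mul, hx, hy]
  | tmul w s =>
    rw [Algebra.TensorProduct.tmul_mul_tmul, mul_one, phi_tmul, phi_tmul, mul_assoc,
      Algebra.TensorProduct.tmul_mul_tmul, one_mul]

theorem psi_mul {Z T : BicomodAlg k A} {W : Type v} [Ring W] [Algebra k W]
    (j : W →ₐ[k] Z.carrier ⊗[k] T.carrier) (z : Z.carrier) (x : Z.carrier ⊗[k] W) :
    psi j ((z ⊗ₜ 1) * x) = (z ⊗ₜ 1) * psi j x := by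
  induction x with
  | zero => simp only [LinearMap.map_zero, mul_zero]
  | add x y hx hy => simp only [LinearMap.map_add, mul_add, hx, hy]
  | tmul s w =>
    rw [Algebra.TensorProduct.tmul_mul_tmul, one_mul, psi_tmul, psi_tmul, ← mul_assoc,
      Algebra.TensorProduct.tmul_mul_tmul, one_mul]

/-- For `i : T → A ⊗ Zᵒᵖ`, the map `t ⊗ z ↦ i(t) z` from `T ⊗ Z` to `A ⊗ Z`. -/
def actR {Z T : BicomodAlg k A} (i : T.carrier →ₐ[k] A ⊗[k] Z.opp) :
    T.carrier ⊗[k] Z.carrier →ₗ[k] A ⊗[k] Z.carrier :=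
  LinearMap.lTensor A Z.mulR ∘ₗ (TensorProduct.assoc k A Z.opp Z.carrier).toLinearMap ∘ₗ
    LinearMap.rTensor Z.carrier i.toLinearMap

/-- For `θ : T → Zᵒᵖ ⊗ A`, the map `z ⊗ t ↦ z θ(t)` from `Z ⊗ T` to `Z ⊗ A`. -/
def actL {Z T : BicomodAlg k A} (θ : T.carrier →ₐ[k] Z.opp ⊗[k] A) :
    Z.carrier ⊗[k] T.carrier →ₗ[k] Z.carrier ⊗[k] A :=
  LinearMap.rTensor A Z.mulL ∘ₗ (TensorProduct.assoc k Z.carrier Z.opp A).symm.toLinearMap ∘ₗ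
    LinearMap.lTensor Z.carrier θ.toLinearMap

section

variable {Z T : BicomodAlg k A} (i : T.carrier →ₐ[k] A ⊗[k] Z.opp)
  (θ : T.carrier →ₐ[k] Z.opp ⊗[k] A)

theorem actR_tmul (t : T.carrier) (z : Z.carrier) : actR i (t ⊗ₜ z) =
    LinearMap.lTensor A Z.mulR (TensorProduct.assoc k A Z.opp Z.carrier (i t ⊗ₜ z)) := rfl

theorem actL_tmul (z : Z.carrier) (t : T.carrier) : actL θ (z ⊗ₜ t) =
    LinearMap.rTensor A Z.mulL ((TensorProduct.assoc k Z.carrier Z.opp A).symm (z ⊗ₜ θ t)) := rfl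

theorem actR_mul (x : T.carrier ⊗[k] Z.carrier) (z : Z.carrier) :
    actR i (x * (1 ⊗ₜ z)) = actR i x * (1 ⊗ₜ z) := by
  induction x with
  | zero => simp only [LinearMap.map_zero, zero_mul]
  | add x y hx hy => simp only [LinearMap.map_add, add_mul, hx, hy]
  | tmul t y =>
    rw [Algebra.TensorProduct.tmul_mul_tmul, mul_one, actR_tmul, actR_tmul]
    induction i t with
    | zero => simp only [LinearMap.map_zero, LinearEquiv.map_zero, zero_tmul, zero_mul]
    | add x y hx hy =>
      simp only [LinearMap.map_add, LinearEquiv.map_add, add_tmul, add_mul, hx, hy]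
    | tmul a o =>
      rw [assoc_tmul, assoc_tmul, LinearMap.lTensor_tmul, LinearMap.lTensor_tmul, mulR_tmul,
        mulR_tmul, Algebra.TensorProduct.tmul_mul_tmul, mul_one, mul_assoc]

theorem actL_mul (z : Z.carrier) (x : Z.carrier ⊗[k] T.carrier) :
    actL θ ((z ⊗ₜ 1) * x) = (z ⊗ₜ 1) * actL θ x := by
  induction x with
  | zero => simp only [LinearMap.map_zero, mul_zero]
  | add x y hx hy => simp only [LinearMap.map_add, mul_add, hx, hy]
  | tmul y t =>
    rw [Algebra.TensorProduct.tmul_mul_tmul, one_mul, actL_tmul, actL_tmul]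
    induction θ t with
    | zero => simp only [LinearMap.map_zero, LinearEquiv.map_zero, tmul_zero, mul_zero]
    | add x y hx hy =>
      simp only [LinearMap.map_add, LinearEquiv.map_add, tmul_add, mul_add, hx, hy]
    | tmul o a =>
      rw [assoc_symm_tmul, assoc_symm_tmul, LinearMap.rTensor_tmul, LinearMap.rTensor_tmul,
        mulL_tmul, mulL_tmul, Algebra.TensorProduct.tmul_mul_tmul, one_mul, mul_assoc]

end

namespace Translation

variable {Z : BicomodAlg k A} (D : Z.Translation)

theorem mulR_comp_r :
    Z.mulR ∘ₗ D.r.toLinearMap = Algebra.linearMap k Z.carrier ∘ₗ Coalgebra.counit :=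
  LinearMap.ext D.mulR_r

theorem mulL_comp_l :
    Z.mulL ∘ₗ D.l.toLinearMap = Algebra.linearMap k Z.carrier ∘ₗ Coalgebra.counit :=
  LinearMap.ext D.mulL_l

theorem lTensor_mulR_r (a : A) :
    LinearMap.lTensor A Z.mulR (LinearMap.lTensor A D.r.toLinearMap (Coalgebra.comul a)) =
      a ⊗ₜ 1 := by
  rw [← LinearMap.lTensor_comp_apply, D.mulR_comp_r, LinearMap.lTensor_comp_apply,
    Coalgebra.lTensor_counit_comul, LinearMap.lTensor_tmul, Algebra.linearMap_apply, map_one]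

theorem rTensor_mulL_l (a : A) :
    LinearMap.rTensor A Z.mulL (LinearMap.rTensor A D.l.toLinearMap (Coalgebra.comul a)) =
      1 ⊗ₜ a := by
  rw [← LinearMap.rTensor_comp_apply, D.mulL_comp_l, LinearMap.rTensor_comp_apply,
    Coalgebra.rTensor_counit_comul, LinearMap.rTensor_tmul, Algebra.linearMap_apply, map_one]

namespace IsInverse

variable {D} {T : BicomodAlg k A} {i : T.carrier →ₐ[k] A ⊗[k] Z.opp}
  {θ : T.carrier →ₐ[k] Z.opp ⊗[k] A}

/-- Through i the element e(a) is a₁ ⊗ τᵣ(a₂), and multiplying out τᵣ leaves a₁ ε(a₂) = a. -/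
theorem actR_phi {e : A →ₐ[k] T.carrier ⊗[k] Z.carrier}
    (he : ∀ a, LinearMap.rTensor Z.carrier i.toLinearMap (e a) =
        (TensorProduct.assoc k A Z.opp Z.carrier).symm
          (LinearMap.lTensor A D.r.toLinearMap (Coalgebra.comul a)))
    (x : A ⊗[k] Z.carrier) : actR i (phi e x) = x := by
  induction x with
  | zero => simp only [LinearMap.map_zero]
  | add x y hx hy => simp only [LinearMap.map_add, hx, hy]
  | tmul a z =>
    rw [phi_tmul, actR_mul]
    change LinearMap.lTensor A Z.mulR (TensorProduct.assoc k A Z.opp Z.carrier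
      (LinearMap.rTensor Z.carrier i.toLinearMap (e a))) * _ = _
    rw [he, LinearEquiv.apply_symm_apply, D.lTensor_mulR_r, Algebra.TensorProduct.tmul_mul_tmul,
      mul_one, one_mul]

theorem actL_psi {f : A →ₐ[k] Z.carrier ⊗[k] T.carrier}
    (hf : ∀ a, LinearMap.lTensor Z.carrier θ.toLinearMap (f a) =
        TensorProduct.assoc k Z.carrier Z.opp A
          (LinearMap.rTensor A D.l.toLinearMap (Coalgebra.comul a)))
    (x : Z.carrier ⊗[k] A) : actL θ (psi f x) = x := by
  induction x with
  | zero => simp only [LinearMap.map_zero]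
  | add x y hx hy => simp only [LinearMap.map_add, hx, hy]
  | tmul z a =>
    rw [psi_tmul, actL_mul]
    change _ * LinearMap.rTensor A Z.mulL ((TensorProduct.assoc k Z.carrier Z.opp A).symm
      (LinearMap.lTensor Z.carrier θ.toLinearMap (f a))) = _
    rw [hf, LinearEquiv.symm_apply_apply, D.rTensor_mulL_l, Algebra.TensorProduct.tmul_mul_tmul,
      mul_one, one_mul]

/-- Compare after the injective map i. With i(t) = a ⊗ o, the composite sends t ⊗ 1 to a₁ ⊗ τᵣ(a₂)
o, that is, to `left` applied to the last two factors of (Δ ⊗ id)(i(t)), followed by multiplication.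
As `left ∘ i = right ∘ θ`, what is multiplied out is a value of τₗ, which becomes ε. The relation
`mixed` moves this ε onto the right coaction of `T`, and counitality returns i(t) ⊗ 1. -/
theorem phi_actR (h : D.IsInverse T i θ) [Module.Flat k Z.carrier]
    {e : A →ₐ[k] T.carrier ⊗[k] Z.carrier}
    (he : ∀ a, LinearMap.rTensor Z.carrier i.toLinearMap (e a) =
        (TensorProduct.assoc k A Z.opp Z.carrier).symm
          (LinearMap.lTensor A D.r.toLinearMap (Coalgebra.comul a)))
    (x : T.carrier ⊗[k] Z.carrier) : phi e (actR i x) = x := by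
  induction x with
  | zero => simp only [LinearMap.map_zero]
  | add x y hx hy => simp only [LinearMap.map_add, hx, hy]
  | tmul t z =>
    have inj : Function.Injective (LinearMap.rTensor Z.carrier i.toLinearMap) :=
      rTensor_inj h.injective
    have h1 : ∀ x : A ⊗[k] Z.opp, LinearMap.rTensor Z.carrier i.toLinearMap (phi e
        (LinearMap.lTensor A Z.mulR (TensorProduct.assoc k A Z.opp Z.carrier (x ⊗ₜ 1)))) =
        (TensorProduct.assoc k A Z.opp Z.carrier).symm
          (LinearMap.lTensor A (LinearMap.lTensor Z.opp Z.mulL ∘ₗ D.left.toLinearMap)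
            (TensorProduct.assoc k A A Z.opp (LinearMap.rTensor Z.opp Coalgebra.comul x))) := by
      intro x
      induction x with
      | zero => simp only [LinearMap.map_zero, LinearEquiv.map_zero, zero_tmul]
      | add x y hx hy => simp only [LinearMap.map_add, LinearEquiv.map_add, add_tmul, hx, hy]
      | tmul a o =>
        have h2 : ∀ y : T.carrier ⊗[k] Z.carrier, LinearMap.rTensor Z.carrier i.toLinearMap
            (y * (1 ⊗ₜ Z.unop o)) =
            LinearMap.rTensor Z.carrier i.toLinearMap y * (1 ⊗ₜ Z.unop o) := by
          intro y
          have := map_mul (Algebra.TensorProduct.map i (AlgHom.id k Z.carrier)) y (1 ⊗ₜ Z.unop o)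
          refine this.trans (congrArg _ ?_)
          rw [Algebra.TensorProduct.map_tmul, map_one, AlgHom.id_apply]
        rw [assoc_tmul, LinearMap.lTensor_tmul, mulR_tmul, mul_one, phi_tmul, h2, he,
          LinearMap.rTensor_tmul]
        induction Coalgebra.comul (R := k) a with
        | zero => simp only [LinearMap.map_zero, LinearEquiv.map_zero, zero_tmul, zero_mul]
        | add x y hx hy =>
          simp only [LinearMap.map_add, LinearEquiv.map_add, add_tmul, add_mul, hx, hy]
        | tmul b c =>
          rw [assoc_tmul, LinearMap.lTensor_tmul, LinearMap.lTensor_tmul, LinearMap.comp_apply,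
            AlgHom.toLinearMap_apply, AlgHom.toLinearMap_apply, left_tmul]
          induction D.r c with
          | zero =>
            simp only [LinearMap.map_zero, LinearEquiv.map_zero, tmul_zero, zero_tmul, zero_mul]
          | add x y hx hy =>
            simp only [LinearMap.map_add, LinearEquiv.map_add, tmul_add, add_tmul, add_mul, hx, hy]
          | tmul x y =>
            rw [assoc_symm_tmul, assoc_tmul, LinearMap.lTensor_tmul, assoc_symm_tmul, mulL_tmul,
              Algebra.TensorProduct.tmul_mul_tmul, mul_one]
    have h3 : (LinearMap.lTensor Z.opp Z.mulL ∘ₗ D.left.toLinearMap) ∘ₗ i.toLinearMap =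
        LinearMap.lTensor Z.opp (Algebra.linearMap k Z.carrier ∘ₗ Coalgebra.counit) ∘ₗ
          θ.toLinearMap := by
      rw [LinearMap.comp_assoc, ← h.comp_eq, right_toLinearMap, ← LinearMap.comp_assoc,
        ← LinearMap.lTensor_comp, D.mulL_comp_l]
    have h4 : ∀ y : T.carrier ⊗[k] A, LinearMap.lTensor A (LinearMap.lTensor Z.opp
        (Algebra.linearMap k Z.carrier ∘ₗ Coalgebra.counit))
          (TensorProduct.assoc k A Z.opp A (LinearMap.rTensor A i.toLinearMap y)) =
        TensorProduct.assoc k A Z.opp Z.carrier (TensorProduct.map i.toLinearMap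
          (Algebra.linearMap k Z.carrier) (LinearMap.lTensor T.carrier Coalgebra.counit y)) := by
      intro y
      induction y with
      | zero => simp only [LinearMap.map_zero, LinearEquiv.map_zero]
      | add x y hx hy => simp only [LinearMap.map_add, LinearEquiv.map_add, hx, hy]
      | tmul s a =>
        rw [LinearMap.rTensor_tmul, LinearMap.lTensor_tmul, map_tmul, AlgHom.toLinearMap_apply]
        induction i s with
        | zero => simp only [LinearMap.map_zero, LinearEquiv.map_zero, zero_tmul]
        | add x y hx hy => simp only [LinearMap.map_add, LinearEquiv.map_add, add_tmul, hx, hy]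
        | tmul x y => rfl
    have h5 : phi e (actR i (t ⊗ₜ 1)) = t ⊗ₜ 1 := by
      refine inj ?_
      rw [actR_tmul, h1, ← h.lcoact, ← LinearMap.lTensor_comp_apply, h3,
        LinearMap.lTensor_comp_apply, ← h.mixed, h4, T.rcounit, LinearEquiv.symm_apply_apply,
        map_tmul, Algebra.linearMap_apply, map_one, LinearMap.rTensor_tmul]
    have h6 : (t ⊗ₜ z : T.carrier ⊗[k] Z.carrier) = (t ⊗ₜ 1) * (1 ⊗ₜ z) := by
      rw [Algebra.TensorProduct.tmul_mul_tmul, mul_one, one_mul]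
    rw [h6, actR_mul, phi_mul, h5]

/-- Mirror image of `phi_actR`: compare after θ, whose injectivity comes from that of `left` and i.
The computation replaces a value of `right` by one of `left`, multiplies out τᵣ, and ends with the
counit of the left coaction of `T`. -/
theorem psi_actL (h : D.IsInverse T i θ) [Module.FaithfullyFlat k Z.carrier]
    {f : A →ₐ[k] Z.carrier ⊗[k] T.carrier}
    (hf : ∀ a, LinearMap.lTensor Z.carrier θ.toLinearMap (f a) =
        TensorProduct.assoc k Z.carrier Z.opp A
          (LinearMap.rTensor A D.l.toLinearMap (Coalgebra.comul a)))
    (x : Z.carrier ⊗[k] T.carrier) : psi f (actL θ x) = x := by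
  induction x with
  | zero => simp only [LinearMap.map_zero]
  | add x y hx hy => simp only [LinearMap.map_add, hx, hy]
  | tmul z t =>
    have inj : Function.Injective (LinearMap.lTensor Z.carrier θ.toLinearMap) :=
      lTensor_inj h.injective_right
    have h1 : ∀ x : Z.opp ⊗[k] A, LinearMap.lTensor Z.carrier θ.toLinearMap (psi f
        (LinearMap.rTensor A Z.mulL ((TensorProduct.assoc k Z.carrier Z.opp A).symm (1 ⊗ₜ x)))) =
        TensorProduct.assoc k Z.carrier Z.opp A
          (LinearMap.rTensor A (LinearMap.rTensor Z.opp Z.mulR ∘ₗ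
            (TensorProduct.assoc k Z.opp Z.carrier Z.opp).symm.toLinearMap ∘ₗ D.right.toLinearMap)
            ((TensorProduct.assoc k Z.opp A A).symm
              (LinearMap.lTensor Z.opp Coalgebra.comul x))) := by
      intro x
      induction x with
      | zero => simp only [LinearMap.map_zero, LinearEquiv.map_zero, tmul_zero]
      | add x y hx hy => simp only [LinearMap.map_add, LinearEquiv.map_add, tmul_add, hx, hy]
      | tmul o a =>
        have h2 : ∀ y : Z.carrier ⊗[k] T.carrier, LinearMap.lTensor Z.carrier θ.toLinearMap
            ((Z.unop o ⊗ₜ 1) * y) =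
            (Z.unop o ⊗ₜ 1) * LinearMap.lTensor Z.carrier θ.toLinearMap y := by
          intro y
          have := map_mul (Algebra.TensorProduct.map (AlgHom.id k Z.carrier) θ) (Z.unop o ⊗ₜ 1) y
          refine this.trans (congrArg (· * _) ?_)
          rw [Algebra.TensorProduct.map_tmul, map_one, AlgHom.id_apply]
        rw [assoc_symm_tmul, LinearMap.rTensor_tmul, mulL_tmul, one_mul, psi_tmul, h2, hf,
          LinearMap.lTensor_tmul]
        induction Coalgebra.comul (R := k) a with
        | zero => simp only [LinearMap.map_zero, LinearEquiv.map_zero, tmul_zero, mul_zero]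
        | add x y hx hy =>
          simp only [LinearMap.map_add, LinearEquiv.map_add, tmul_add, mul_add, hx, hy]
        | tmul b c =>
          rw [assoc_symm_tmul, LinearMap.rTensor_tmul, LinearMap.rTensor_tmul,
            LinearMap.comp_apply, LinearMap.comp_apply, AlgHom.toLinearMap_apply,
            AlgHom.toLinearMap_apply, right_tmul]
          induction D.l b with
          | zero =>
            simp only [LinearMap.map_zero, LinearEquiv.map_zero, tmul_zero, zero_tmul, mul_zero]
          | add x y hx hy =>
            simp only [LinearMap.map_add, LinearEquiv.map_add, tmul_add, add_tmul, mul_add, hx, hy]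
          | tmul x y =>
            rw [assoc_tmul, LinearEquiv.coe_coe, assoc_symm_tmul, LinearMap.rTensor_tmul,
              assoc_tmul, mulR_tmul, Algebra.TensorProduct.tmul_mul_tmul, one_mul]
    have h3 : (LinearMap.rTensor Z.opp Z.mulR ∘ₗ
        (TensorProduct.assoc k Z.opp Z.carrier Z.opp).symm.toLinearMap ∘ₗ
          D.right.toLinearMap) ∘ₗ θ.toLinearMap =
        LinearMap.rTensor Z.opp (Algebra.linearMap k Z.carrier ∘ₗ Coalgebra.counit) ∘ₗ
          i.toLinearMap := by
      have e : LinearMap.rTensor Z.opp Z.mulR ∘ₗ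
          (TensorProduct.assoc k Z.opp Z.carrier Z.opp).symm.toLinearMap ∘ₗ D.left.toLinearMap =
          LinearMap.rTensor Z.opp (Algebra.linearMap k Z.carrier ∘ₗ Coalgebra.counit) := by
        rw [← D.mulR_comp_r]
        refine TensorProduct.ext' fun a o => ?_
        change LinearMap.rTensor Z.opp Z.mulR ((TensorProduct.assoc k Z.opp Z.carrier Z.opp).symm
          (TensorProduct.assoc k Z.opp Z.carrier Z.opp (D.r a ⊗ₜ o))) = _
        rw [LinearEquiv.symm_apply_apply]
        rfl
      rw [← e, LinearMap.comp_assoc, LinearMap.comp_assoc, h.comp_eq, LinearMap.comp_assoc,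
        LinearMap.comp_assoc]
    have h4 : ∀ y : A ⊗[k] T.carrier, LinearMap.rTensor A (LinearMap.rTensor Z.opp
        (Algebra.linearMap k Z.carrier ∘ₗ Coalgebra.counit))
          ((TensorProduct.assoc k A Z.opp A).symm (LinearMap.lTensor A θ.toLinearMap y)) =
        (TensorProduct.assoc k Z.carrier Z.opp A).symm (TensorProduct.map
          (Algebra.linearMap k Z.carrier) θ.toLinearMap
            (LinearMap.rTensor T.carrier Coalgebra.counit y)) := by
      intro y
      induction y with
      | zero => simp only [LinearMap.map_zero, LinearEquiv.map_zero]
      | add x y hx hy => simp only [LinearMap.map_add, LinearEquiv.map_add, hx, hy]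
      | tmul a s =>
        rw [LinearMap.lTensor_tmul, LinearMap.rTensor_tmul, map_tmul, AlgHom.toLinearMap_apply]
        induction θ s with
        | zero => simp only [LinearMap.map_zero, LinearEquiv.map_zero, tmul_zero]
        | add x y hx hy => simp only [LinearMap.map_add, LinearEquiv.map_add, tmul_add, hx, hy]
        | tmul x y => rfl
    have h5 : psi f (actL θ (1 ⊗ₜ t)) = 1 ⊗ₜ t := by
      refine inj ?_
      have h7 : LinearMap.rTensor A i.toLinearMap (T.rcoact t) =
          (TensorProduct.assoc k A Z.opp A).symm (LinearMap.lTensor A θ.toLinearMap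
            (T.lcoact t)) := by
        rw [← h.mixed, LinearEquiv.symm_apply_apply]
      rw [actL_tmul, h1, ← h.rcoact, ← LinearMap.rTensor_comp_apply, h3,
        LinearMap.rTensor_comp_apply, h7, h4, T.lcounit, LinearEquiv.apply_symm_apply,
        map_tmul, Algebra.linearMap_apply, map_one, LinearMap.lTensor_tmul]
    have h6 : (z ⊗ₜ t : Z.carrier ⊗[k] T.carrier) = (z ⊗ₜ 1) * (1 ⊗ₜ t) := by
      rw [Algebra.TensorProduct.tmul_mul_tmul, mul_one, one_mul]
    rw [h6, actL_mul, psi_mul, h5]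

end IsInverse

end Translation

end BicomodAlg

/-! ### The Galois maps of a Hopf algebra -/

variable (k A) in
/-- The left Galois map `a ⊗ b ↦ a₁ ⊗ a₂ b` of `A`. -/
def hopfGalL : A ⊗[k] A →ₗ[k] A ⊗[k] A :=
  LinearMap.lTensor A (LinearMap.mul' k A) ∘ₗ (TensorProduct.assoc k A A A).toLinearMap ∘ₗ
    LinearMap.rTensor A Coalgebra.comul

variable (k A) in
/-- The right Galois map `a ⊗ b ↦ a b₁ ⊗ b₂` of `A`. -/
def hopfGalR : A ⊗[k] A →ₗ[k] A ⊗[k] A :=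
  LinearMap.rTensor A (LinearMap.mul' k A) ∘ₗ (TensorProduct.assoc k A A A).symm.toLinearMap ∘ₗ
    LinearMap.lTensor A Coalgebra.comul

/-- The map `f ↦ (a ⊗ b ↦ a₁ ⊗ f(a₂) b)`. -/
def shearL (f : A →ₗ[k] A) : A ⊗[k] A →ₗ[k] A ⊗[k] A :=
  LinearMap.lTensor A (LinearMap.mul' k A ∘ₗ LinearMap.rTensor A f) ∘ₗ
    (TensorProduct.assoc k A A A).toLinearMap ∘ₗ LinearMap.rTensor A Coalgebra.comul

/-- The map `f ↦ (a ⊗ b ↦ a f(b₁) ⊗ b₂)`. -/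
def shearR (f : A →ₗ[k] A) : A ⊗[k] A →ₗ[k] A ⊗[k] A :=
  LinearMap.rTensor A (LinearMap.mul' k A ∘ₗ LinearMap.lTensor A f) ∘ₗ
    (TensorProduct.assoc k A A A).symm.toLinearMap ∘ₗ LinearMap.lTensor A Coalgebra.comul

/-- By coassociativity, composing shears amounts to convolving: a ⊗ b goes to a₁ ⊗ f(a₂) g(a₃) b.
The Galois map is the shear of the identity, so the shear of the antipode inverts it. For `shearR`
the order of the factors is reversed. -/
theorem shearL_shearL (f g : A →ₗ[k] A) : shearL f ∘ₗ shearL g =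
    shearL (LinearMap.mul' k A ∘ₗ TensorProduct.map f g ∘ₗ Coalgebra.comul) := by
  refine TensorProduct.ext' fun a b => ?_
  let G : A ⊗[k] (A ⊗[k] A) →ₗ[k] A ⊗[k] A :=
    LinearMap.lTensor A (LinearMap.mul' k A ∘ₗ
      TensorProduct.map f (LinearMap.mulRight k b ∘ₗ g))
  have h1 : ∀ y : A ⊗[k] A, shearL f (LinearMap.lTensor A (LinearMap.mul' k A ∘ₗ
      LinearMap.rTensor A g) (TensorProduct.assoc k A A A (y ⊗ₜ b))) =
      G (TensorProduct.assoc k A A A (LinearMap.rTensor A Coalgebra.comul y)) := by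
    intro y
    induction y with
    | zero => simp only [LinearMap.map_zero, LinearEquiv.map_zero, zero_tmul]
    | add x y hx hy => simp only [LinearMap.map_add, LinearEquiv.map_add, add_tmul, hx, hy]
    | tmul x y =>
      change LinearMap.lTensor A (LinearMap.mul' k A ∘ₗ LinearMap.rTensor A f)
        (TensorProduct.assoc k A A A (Coalgebra.comul x ⊗ₜ (g y * b))) =
        G (TensorProduct.assoc k A A A (Coalgebra.comul x ⊗ₜ y))
      induction Coalgebra.comul (R := k) x with
      | zero => simp only [LinearMap.map_zero, LinearEquiv.map_zero, zero_tmul]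
      | add x y hx hy => simp only [LinearMap.map_add, LinearEquiv.map_add, add_tmul, hx, hy]
      | tmul c d => rfl
  have h2 : ∀ y : A ⊗[k] A, G (LinearMap.lTensor A Coalgebra.comul y) =
      LinearMap.lTensor A (LinearMap.mul' k A ∘ₗ LinearMap.rTensor A
        (LinearMap.mul' k A ∘ₗ TensorProduct.map f g ∘ₗ Coalgebra.comul))
          (TensorProduct.assoc k A A A (y ⊗ₜ b)) := by
    intro y
    induction y with
    | zero => simp only [LinearMap.map_zero, LinearEquiv.map_zero, zero_tmul]
    | add x y hx hy => simp only [LinearMap.map_add, LinearEquiv.map_add, add_tmul, hx, hy]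
    | tmul x y =>
      refine congrArg (x ⊗ₜ[k] ·) ?_
      change LinearMap.mul' k A (TensorProduct.map f (LinearMap.mulRight k b ∘ₗ g)
        (Coalgebra.comul y)) = LinearMap.mul' k A (TensorProduct.map f g (Coalgebra.comul y)) * b
      induction Coalgebra.comul (R := k) y with
      | zero => simp only [LinearMap.map_zero, zero_mul]
      | add x y hx hy => simp only [LinearMap.map_add, add_mul, hx, hy]
      | tmul c d => exact (mul_assoc _ _ _).symm
  refine (h1 (Coalgebra.comul a)).trans ?_
  rw [Coalgebra.coassoc_apply, h2]
  rfl

theorem shearR_shearR (f g : A →ₗ[k] A) : shearR f ∘ₗ shearR g =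
    shearR (LinearMap.mul' k A ∘ₗ TensorProduct.map g f ∘ₗ Coalgebra.comul) := by
  refine TensorProduct.ext' fun b a => ?_
  let G : (A ⊗[k] A) ⊗[k] A →ₗ[k] A ⊗[k] A :=
    LinearMap.rTensor A (LinearMap.mul' k A ∘ₗ
      TensorProduct.map (LinearMap.mulLeft k b ∘ₗ g) f)
  have h1 : ∀ y : A ⊗[k] A, shearR f (LinearMap.rTensor A (LinearMap.mul' k A ∘ₗ
      LinearMap.lTensor A g) ((TensorProduct.assoc k A A A).symm (b ⊗ₜ y))) =
      G ((TensorProduct.assoc k A A A).symm (LinearMap.lTensor A Coalgebra.comul y)) := by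
    intro y
    induction y with
    | zero => simp only [LinearMap.map_zero, LinearEquiv.map_zero, tmul_zero]
    | add x y hx hy => simp only [LinearMap.map_add, LinearEquiv.map_add, tmul_add, hx, hy]
    | tmul x y =>
      change LinearMap.rTensor A (LinearMap.mul' k A ∘ₗ LinearMap.lTensor A f)
        ((TensorProduct.assoc k A A A).symm ((b * g x) ⊗ₜ Coalgebra.comul y)) =
        G ((TensorProduct.assoc k A A A).symm (x ⊗ₜ Coalgebra.comul y))
      induction Coalgebra.comul (R := k) y with
      | zero => simp only [LinearMap.map_zero, LinearEquiv.map_zero, tmul_zero]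
      | add x y hx hy => simp only [LinearMap.map_add, LinearEquiv.map_add, tmul_add, hx, hy]
      | tmul c d => rfl
  have h2 : ∀ y : A ⊗[k] A, G (LinearMap.rTensor A Coalgebra.comul y) =
      LinearMap.rTensor A (LinearMap.mul' k A ∘ₗ LinearMap.lTensor A
        (LinearMap.mul' k A ∘ₗ TensorProduct.map g f ∘ₗ Coalgebra.comul))
          ((TensorProduct.assoc k A A A).symm (b ⊗ₜ y)) := by
    intro y
    induction y with
    | zero => simp only [LinearMap.map_zero, LinearEquiv.map_zero, tmul_zero]
    | add x y hx hy => simp only [LinearMap.map_add, LinearEquiv.map_add, tmul_add, hx, hy]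
    | tmul x y =>
      refine congrArg (· ⊗ₜ[k] y) ?_
      change LinearMap.mul' k A (TensorProduct.map (LinearMap.mulLeft k b ∘ₗ g) f
        (Coalgebra.comul x)) = b * LinearMap.mul' k A (TensorProduct.map g f (Coalgebra.comul x))
      induction Coalgebra.comul (R := k) x with
      | zero => simp only [LinearMap.map_zero, mul_zero]
      | add x y hx hy => simp only [LinearMap.map_add, mul_add, hx, hy]
      | tmul c d => exact mul_assoc _ _ _
  refine (h1 (Coalgebra.comul a)).trans ?_
  rw [Coalgebra.coassoc_symm_apply, h2]
  rfl

theorem shearL_counit : shearL (Algebra.linearMap k A ∘ₗ Coalgebra.counit) = LinearMap.id := by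
  refine TensorProduct.ext' fun a b => ?_
  have h1 : ∀ y : A ⊗[k] A, LinearMap.lTensor A (LinearMap.mul' k A ∘ₗ LinearMap.rTensor A
      (Algebra.linearMap k A ∘ₗ Coalgebra.counit)) (TensorProduct.assoc k A A A (y ⊗ₜ b)) =
      TensorProduct.rid k A (LinearMap.lTensor A Coalgebra.counit y) ⊗ₜ b := by
    intro y
    induction y with
    | zero => simp only [LinearMap.map_zero, LinearEquiv.map_zero, zero_tmul]
    | add x y hx hy => simp only [LinearMap.map_add, LinearEquiv.map_add, add_tmul, hx, hy]
    | tmul x y =>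
      simp [smul_tmul, ← Algebra.smul_def]
  refine (h1 (Coalgebra.comul a)).trans ?_
  rw [Coalgebra.lTensor_counit_comul, rid_tmul, one_smul]
  rfl

theorem shearR_counit : shearR (Algebra.linearMap k A ∘ₗ Coalgebra.counit) = LinearMap.id := by
  refine TensorProduct.ext' fun b a => ?_
  have h1 : ∀ y : A ⊗[k] A, LinearMap.rTensor A (LinearMap.mul' k A ∘ₗ LinearMap.lTensor A
      (Algebra.linearMap k A ∘ₗ Coalgebra.counit))
        ((TensorProduct.assoc k A A A).symm (b ⊗ₜ y)) =
      b ⊗ₜ TensorProduct.lid k A (LinearMap.rTensor A Coalgebra.counit y) := by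
    intro y
    induction y with
    | zero => simp only [LinearMap.map_zero, LinearEquiv.map_zero, tmul_zero]
    | add x y hx hy => simp only [LinearMap.map_add, LinearEquiv.map_add, tmul_add, hx, hy]
    | tmul x y =>
      simp [← Algebra.commutes, ← Algebra.smul_def, smul_tmul]
  refine (h1 (Coalgebra.comul a)).trans ?_
  rw [Coalgebra.rTensor_counit_comul, lid_tmul, one_smul]
  rfl

variable (k A) in
theorem hopfGalL_bijective : Function.Bijective (hopfGalL k A) := by
  have e : hopfGalL k A = shearL LinearMap.id := by
    rw [shearL, LinearMap.rTensor_id, LinearMap.comp_id]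
    rfl
  have h1 : hopfGalL k A ∘ₗ shearL (HopfAlgebra.antipode k) = LinearMap.id := by
    rw [e, shearL_shearL, ← shearL_counit, ← HopfAlgebra.mul_antipode_lTensor_comul]
    rfl
  have h2 : shearL (HopfAlgebra.antipode k) ∘ₗ hopfGalL k A = LinearMap.id := by
    rw [e, shearL_shearL, ← shearL_counit, ← HopfAlgebra.mul_antipode_rTensor_comul]
    rfl
  exact Function.bijective_iff_has_inverse.2
    ⟨shearL (HopfAlgebra.antipode k), LinearMap.congr_fun h2, LinearMap.congr_fun h1⟩

variable (k A) in
theorem hopfGalR_bijective : Function.Bijective (hopfGalR k A) := by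
  have e : hopfGalR k A = shearR LinearMap.id := by
    rw [shearR, LinearMap.lTensor_id, LinearMap.comp_id]
    rfl
  have h1 : hopfGalR k A ∘ₗ shearR (HopfAlgebra.antipode k) = LinearMap.id := by
    rw [e, shearR_shearR, ← shearR_counit, ← HopfAlgebra.mul_antipode_rTensor_comul]
    rfl
  have h2 : shearR (HopfAlgebra.antipode k) ∘ₗ hopfGalR k A = LinearMap.id := by
    rw [e, shearR_shearR, ← shearR_counit, ← HopfAlgebra.mul_antipode_lTensor_comul]
    rfl
  exact Function.bijective_iff_has_inverse.2
    ⟨shearR (HopfAlgebra.antipode k), LinearMap.congr_fun h2, LinearMap.congr_fun h1⟩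

variable (k A) in
-- The counit splits the unit `k → A`.
theorem faithfullyFlat_hopf [Module.Flat k A] : Module.FaithfullyFlat k A :=
  faithfullyFlat_of_retract (Algebra.linearMap k A) Coalgebra.counit
    (LinearMap.ext fun r => by simp)

/-! ### Bijectivity of the Galois maps of the inverse object -/

namespace BicomodAlg

namespace Translation

namespace IsInverse

variable {Z : BicomodAlg k A} {D : Z.Translation} {T : BicomodAlg k A}
  {i : T.carrier →ₐ[k] A ⊗[k] Z.opp} {θ : T.carrier →ₐ[k] Z.opp ⊗[k] A}

/-- After tensoring with `Z` and trading `T ⊗ Z` for `A ⊗ Z` twice, κ_l of `T` becomes the Galois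
map of `A`. Indeed, if i(t) = a ⊗ o and i(s) = b ⊗ o', both composites send t ⊗ s ⊗ z to a₁ ⊗ a₂b ⊗
o'oz: the order o'o comes from the opposite product on one side, and on the other from letting t act
on z before s. -/
theorem galL_bijective (h : D.IsInverse T i θ) [Module.FaithfullyFlat k Z.carrier]
    (hR : Function.Bijective (actR i)) : Function.Bijective T.galL := by
  refine bijective_of_rTensor (M := Z.carrier) ?_
  have b1 : Function.Bijective (LinearMap.lTensor A (actR i)) := lTensor_bij hR
  have b2 : Function.Bijective (LinearMap.lTensor T.carrier (actR i)) := lTensor_bij hR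
  have b3 : Function.Bijective (LinearMap.rTensor Z.carrier (hopfGalL k A)) :=
    rTensor_bij (hopfGalL_bijective k A)
  have e : LinearMap.lTensor A (actR i) ∘ₗ (TensorProduct.assoc k A T.carrier Z.carrier).toLinearMap
      ∘ₗ LinearMap.rTensor Z.carrier T.galL =
      (TensorProduct.assoc k A A Z.carrier).toLinearMap ∘ₗ
      LinearMap.rTensor Z.carrier (hopfGalL k A) ∘ₗ
      (TensorProduct.assoc k A A Z.carrier).symm.toLinearMap ∘ₗ
      LinearMap.lTensor A (actR i) ∘ₗ
      (TensorProduct.leftComm k T.carrier A Z.carrier).toLinearMap ∘ₗ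
      LinearMap.lTensor T.carrier (actR i) ∘ₗ
      (TensorProduct.leftComm k T.carrier T.carrier Z.carrier).toLinearMap ∘ₗ
      (TensorProduct.assoc k T.carrier T.carrier Z.carrier).toLinearMap := by
    refine TensorProduct.ext_threefold fun t s z => ?_
    change LinearMap.lTensor A (actR i) (TensorProduct.assoc k A T.carrier Z.carrier
      (T.galL (t ⊗ₜ s) ⊗ₜ z)) = TensorProduct.assoc k A A Z.carrier
      (LinearMap.rTensor Z.carrier (hopfGalL k A) ((TensorProduct.assoc k A A Z.carrier).symm
        (LinearMap.lTensor A (actR i) (TensorProduct.leftComm k T.carrier A Z.carrier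
          (s ⊗ₜ actR i (t ⊗ₜ z))))))
    let m : (A ⊗[k] Z.opp) →ₗ[k] A ⊗[k] Z.carrier :=
      LinearMap.lTensor A Z.mulR ∘ₗ (TensorProduct.assoc k A Z.opp Z.carrier).toLinearMap ∘ₗ
        (TensorProduct.mk k (A ⊗[k] Z.opp) Z.carrier).flip z
    have h1 : ∀ y : A ⊗[k] T.carrier, LinearMap.lTensor A (actR i)
        (TensorProduct.assoc k A T.carrier Z.carrier ((y * (1 ⊗ₜ s)) ⊗ₜ z)) =
        LinearMap.lTensor A (m ∘ₗ LinearMap.mulRight k (i s))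
          (LinearMap.lTensor A i.toLinearMap y) := by
      intro y
      induction y with
      | zero => simp only [LinearMap.map_zero, LinearEquiv.map_zero, zero_tmul, zero_mul]
      | add x y hx hy =>
        simp only [LinearMap.map_add, LinearEquiv.map_add, add_tmul, add_mul, hx, hy]
      | tmul a t =>
        rw [Algebra.TensorProduct.tmul_mul_tmul, mul_one, assoc_tmul, LinearMap.lTensor_tmul,
          LinearMap.lTensor_tmul, LinearMap.lTensor_tmul, actR_tmul, map_mul]
        rfl
    rw [galL_tmul, h1, h.lcoact, actR_tmul]
    induction i t with
    | zero => simp only [LinearMap.map_zero, LinearEquiv.map_zero, zero_tmul, tmul_zero]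
    | add x y hx hy =>
      simp only [LinearMap.map_add, LinearEquiv.map_add, add_tmul, tmul_add, hx, hy]
    | tmul a o =>
      change _ = TensorProduct.assoc k A A Z.carrier
        (LinearMap.rTensor Z.carrier (hopfGalL k A) ((TensorProduct.assoc k A A Z.carrier).symm
          (a ⊗ₜ LinearMap.lTensor A Z.mulR (TensorProduct.assoc k A Z.opp Z.carrier
            (i s ⊗ₜ (Z.unop o * z))))))
      induction i s with
      | zero => simp only [LinearMap.map_zero, LinearEquiv.map_zero, zero_tmul, tmul_zero,
          LinearMap.mulRight_zero_eq_zero, LinearMap.comp_zero, LinearMap.lTensor_zero,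
          LinearMap.zero_apply]
      | add x y hx hy =>
        simp only [LinearMap.map_add, LinearEquiv.map_add, add_tmul, tmul_add, ← hx, ← hy]
        have : LinearMap.mulRight k (x + y) = LinearMap.mulRight k x + LinearMap.mulRight k y :=
          LinearMap.ext fun w => mul_add w x y
        rw [this, LinearMap.comp_add, LinearMap.lTensor_add, LinearMap.add_apply]
      | tmul b o' =>
        change _ = TensorProduct.assoc k A A Z.carrier (LinearMap.lTensor A (LinearMap.mul' k A)
          (TensorProduct.assoc k A A A (Coalgebra.comul a ⊗ₜ b)) ⊗ₜ (Z.unop o' * (Z.unop o * z)))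
        rw [LinearMap.rTensor_tmul]
        induction Coalgebra.comul (R := k) a with
        | zero => simp only [LinearMap.map_zero, LinearEquiv.map_zero, zero_tmul]
        | add x y hx hy => simp only [LinearMap.map_add, LinearEquiv.map_add, add_tmul, hx, hy]
        | tmul c d =>
          change c ⊗ₜ LinearMap.lTensor A Z.mulR (TensorProduct.assoc k A Z.opp Z.carrier
            (((d ⊗ₜ o) * (b ⊗ₜ o')) ⊗ₜ z)) = c ⊗ₜ ((d * b) ⊗ₜ (Z.unop o' * (Z.unop o * z)))
          rw [Algebra.TensorProduct.tmul_mul_tmul, assoc_tmul, LinearMap.lTensor_tmul, mulR_tmul,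
            unop_mul, mul_assoc]
  have b : Function.Bijective (LinearMap.lTensor A (actR i) ∘ₗ
      (TensorProduct.assoc k A T.carrier Z.carrier).toLinearMap ∘ₗ
        LinearMap.rTensor Z.carrier T.galL) := by
    rw [e]
    exact (TensorProduct.assoc k A A Z.carrier).bijective.comp (b3.comp
      ((TensorProduct.assoc k A A Z.carrier).symm.bijective.comp (b1.comp
        ((TensorProduct.leftComm k T.carrier A Z.carrier).bijective.comp (b2.comp
          ((TensorProduct.leftComm k T.carrier T.carrier Z.carrier).bijective.comp
            (TensorProduct.assoc k T.carrier T.carrier Z.carrier).bijective))))))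
  exact (Function.Bijective.of_comp_iff'
    (TensorProduct.assoc k A T.carrier Z.carrier).bijective _).1
    ((Function.Bijective.of_comp_iff' b1 _).1 b)

/-- The same argument through θ: for θ(t) = o ⊗ a and θ(s) = o' ⊗ b, both composites send z ⊗ s ⊗ t
to zoo' ⊗ ba₁ ⊗ a₂. -/
theorem galR_bijective (h : D.IsInverse T i θ) [Module.FaithfullyFlat k Z.carrier]
    (hL : Function.Bijective (actL θ)) : Function.Bijective T.galR := by
  refine bijective_of_lTensor (M := Z.carrier) ?_
  have b1 : Function.Bijective (LinearMap.rTensor A (actL θ)) := rTensor_bij hL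
  have b2 : Function.Bijective (LinearMap.rTensor T.carrier (actL θ)) := rTensor_bij hL
  have b3 : Function.Bijective (LinearMap.lTensor Z.carrier (hopfGalR k A)) :=
    lTensor_bij (hopfGalR_bijective k A)
  have e : LinearMap.rTensor A (actL θ) ∘ₗ
      (TensorProduct.assoc k Z.carrier T.carrier A).symm.toLinearMap ∘ₗ
      LinearMap.lTensor Z.carrier T.galR =
      (TensorProduct.assoc k Z.carrier A A).symm.toLinearMap ∘ₗ
      LinearMap.lTensor Z.carrier (hopfGalR k A) ∘ₗ
      (TensorProduct.assoc k Z.carrier A A).toLinearMap ∘ₗ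
      LinearMap.rTensor A (actL θ) ∘ₗ
      (TensorProduct.rightComm k Z.carrier A T.carrier).toLinearMap ∘ₗ
      LinearMap.rTensor T.carrier (actL θ) ∘ₗ
      (TensorProduct.rightComm k Z.carrier T.carrier T.carrier).toLinearMap ∘ₗ
      (TensorProduct.assoc k Z.carrier T.carrier T.carrier).symm.toLinearMap := by
    refine TensorProduct.ext_threefold' fun z s t => ?_
    change LinearMap.rTensor A (actL θ) ((TensorProduct.assoc k Z.carrier T.carrier A).symm
      (z ⊗ₜ T.galR (s ⊗ₜ t))) = (TensorProduct.assoc k Z.carrier A A).symm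
      (LinearMap.lTensor Z.carrier (hopfGalR k A) (TensorProduct.assoc k Z.carrier A A
        (LinearMap.rTensor A (actL θ) (TensorProduct.rightComm k Z.carrier A T.carrier
          (actL θ (z ⊗ₜ t) ⊗ₜ s)))))
    let m : (Z.opp ⊗[k] A) →ₗ[k] Z.carrier ⊗[k] A :=
      LinearMap.rTensor A Z.mulL ∘ₗ (TensorProduct.assoc k Z.carrier Z.opp A).symm.toLinearMap ∘ₗ
        TensorProduct.mk k Z.carrier (Z.opp ⊗[k] A) z
    have h1 : ∀ y : T.carrier ⊗[k] A, LinearMap.rTensor A (actL θ)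
        ((TensorProduct.assoc k Z.carrier T.carrier A).symm (z ⊗ₜ ((s ⊗ₜ 1) * y))) =
        LinearMap.rTensor A (m ∘ₗ LinearMap.mulLeft k (θ s))
          (LinearMap.rTensor A θ.toLinearMap y) := by
      intro y
      induction y with
      | zero => simp only [LinearMap.map_zero, LinearEquiv.map_zero, tmul_zero, mul_zero]
      | add x y hx hy =>
        simp only [LinearMap.map_add, LinearEquiv.map_add, tmul_add, mul_add, hx, hy]
      | tmul t a =>
        rw [Algebra.TensorProduct.tmul_mul_tmul, one_mul, assoc_symm_tmul, LinearMap.rTensor_tmul,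
          LinearMap.rTensor_tmul, LinearMap.rTensor_tmul, actL_tmul, map_mul]
        rfl
    rw [galR_tmul, h1, h.rcoact, actL_tmul]
    induction θ t with
    | zero => simp only [LinearMap.map_zero, LinearEquiv.map_zero, zero_tmul, tmul_zero]
    | add x y hx hy =>
      simp only [LinearMap.map_add, LinearEquiv.map_add, add_tmul, tmul_add, hx, hy]
    | tmul o a =>
      change _ = (TensorProduct.assoc k Z.carrier A A).symm
        (LinearMap.lTensor Z.carrier (hopfGalR k A) (TensorProduct.assoc k Z.carrier A A
          (LinearMap.rTensor A Z.mulL ((TensorProduct.assoc k Z.carrier Z.opp A).symm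
            ((z * Z.unop o) ⊗ₜ θ s)) ⊗ₜ a)))
      induction θ s with
      | zero => simp only [LinearMap.map_zero, LinearEquiv.map_zero, zero_tmul, tmul_zero,
          LinearMap.mulLeft_zero_eq_zero, LinearMap.comp_zero, LinearMap.rTensor_zero,
          LinearMap.zero_apply]
      | add x y hx hy =>
        simp only [LinearMap.map_add, LinearEquiv.map_add, add_tmul, tmul_add, ← hx, ← hy]
        have : LinearMap.mulLeft k (x + y) = LinearMap.mulLeft k x + LinearMap.mulLeft k y :=
          LinearMap.ext fun w => add_mul x y w
        rw [this, LinearMap.comp_add, LinearMap.rTensor_add, LinearMap.add_apply]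
      | tmul o' b =>
        change _ = (TensorProduct.assoc k Z.carrier A A).symm ((z * Z.unop o * Z.unop o') ⊗ₜ
          LinearMap.rTensor A (LinearMap.mul' k A)
            ((TensorProduct.assoc k A A A).symm (b ⊗ₜ Coalgebra.comul a)))
        rw [LinearMap.lTensor_tmul]
        induction Coalgebra.comul (R := k) a with
        | zero => simp only [LinearMap.map_zero, LinearEquiv.map_zero, tmul_zero]
        | add x y hx hy => simp only [LinearMap.map_add, LinearEquiv.map_add, tmul_add, hx, hy]
        | tmul c d =>
          change LinearMap.rTensor A Z.mulL ((TensorProduct.assoc k Z.carrier Z.opp A).symm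
            (z ⊗ₜ ((o' ⊗ₜ b) * (o ⊗ₜ c)))) ⊗ₜ d = ((z * Z.unop o * Z.unop o') ⊗ₜ (b * c)) ⊗ₜ d
          rw [Algebra.TensorProduct.tmul_mul_tmul, assoc_symm_tmul, LinearMap.rTensor_tmul,
            mulL_tmul, unop_mul, mul_assoc]
  have b : Function.Bijective (LinearMap.rTensor A (actL θ) ∘ₗ
      (TensorProduct.assoc k Z.carrier T.carrier A).symm.toLinearMap ∘ₗ
        LinearMap.lTensor Z.carrier T.galR) := by
    rw [e]
    exact (TensorProduct.assoc k Z.carrier A A).symm.bijective.comp (b3.comp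
      ((TensorProduct.assoc k Z.carrier A A).bijective.comp (b1.comp
        ((TensorProduct.rightComm k Z.carrier A T.carrier).bijective.comp (b2.comp
          ((TensorProduct.rightComm k Z.carrier T.carrier T.carrier).bijective.comp
            (TensorProduct.assoc k Z.carrier T.carrier T.carrier).symm.bijective))))))
  exact (Function.Bijective.of_comp_iff'
    (TensorProduct.assoc k Z.carrier T.carrier A).symm.bijective _).1
    ((Function.Bijective.of_comp_iff' b1 _).1 b)

end IsInverse

end Translation

end BicomodAlg

/-! ### Identification of `A` with `T □ Z` -/

namespace BicomodAlg

namespace Translation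

namespace IsInverse

variable {Z : BicomodAlg k A} {D : Z.Translation} {T : BicomodAlg k A}
  {i : T.carrier →ₐ[k] A ⊗[k] Z.opp} {θ : T.carrier →ₐ[k] Z.opp ⊗[k] A}

/-- Through i the left coaction of `T` is Δ, and both sides become a₁ ⊗ a₂ ⊗ τᵣ(a₃). -/
theorem ambL_unit (h : D.IsInverse T i θ) [Module.Flat k A] [Module.Flat k Z.carrier]
    {e : A →ₐ[k] T.carrier ⊗[k] Z.carrier}
    (he : ∀ a, LinearMap.rTensor Z.carrier i.toLinearMap (e a) =
        (TensorProduct.assoc k A Z.opp Z.carrier).symm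
          (LinearMap.lTensor A D.r.toLinearMap (Coalgebra.comul a))) (a : A) :
    ambL T Z (e a) = LinearMap.lTensor A e.toLinearMap (Coalgebra.comul a) := by
  have inj1 : Function.Injective (LinearMap.rTensor Z.carrier i.toLinearMap) :=
    rTensor_inj h.injective
  have inj : Function.Injective
      (LinearMap.lTensor A (LinearMap.rTensor Z.carrier i.toLinearMap)) := lTensor_inj inj1
  refine inj ?_
  have h1 : ∀ x : T.carrier ⊗[k] Z.carrier,
      LinearMap.lTensor A (LinearMap.rTensor Z.carrier i.toLinearMap) (ambL T Z x) =
      TensorProduct.assoc k A (A ⊗[k] Z.opp) Z.carrier (LinearMap.rTensor Z.carrier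
        ((TensorProduct.assoc k A A Z.opp).toLinearMap ∘ₗ LinearMap.rTensor Z.opp Coalgebra.comul)
          (LinearMap.rTensor Z.carrier i.toLinearMap x)) := by
    intro x
    induction x with
    | zero => simp only [LinearMap.map_zero, LinearEquiv.map_zero, algHom_zero]
    | add x y hx hy => simp only [LinearMap.map_add, LinearEquiv.map_add, algHom_add, hx, hy]
    | tmul t z =>
      rw [ambL_tmul, LinearMap.rTensor_tmul, LinearMap.rTensor_tmul, LinearMap.comp_apply,
        AlgHom.toLinearMap_apply, LinearEquiv.coe_coe, ← h.lcoact]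
      induction T.lcoact t with
      | zero => simp only [LinearMap.map_zero, LinearEquiv.map_zero, zero_tmul]
      | add x y hx hy => simp only [LinearMap.map_add, LinearEquiv.map_add, add_tmul, hx, hy]
      | tmul b c => rfl
  have h2 : ∀ y : A ⊗[k] A, TensorProduct.assoc k A (A ⊗[k] Z.opp) Z.carrier
      (LinearMap.rTensor Z.carrier
        ((TensorProduct.assoc k A A Z.opp).toLinearMap ∘ₗ LinearMap.rTensor Z.opp Coalgebra.comul)
          ((TensorProduct.assoc k A Z.opp Z.carrier).symm
            (LinearMap.lTensor A D.r.toLinearMap y))) =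
      LinearMap.lTensor A ((TensorProduct.assoc k A Z.opp Z.carrier).symm.toLinearMap ∘ₗ
        LinearMap.lTensor A D.r.toLinearMap)
          (TensorProduct.assoc k A A A (LinearMap.rTensor A Coalgebra.comul y)) := by
    intro y
    induction y with
    | zero => simp only [LinearMap.map_zero, LinearEquiv.map_zero]
    | add x y hx hy => simp only [LinearMap.map_add, LinearEquiv.map_add, hx, hy]
    | tmul b c =>
      have h3 : ∀ u : Z.opp ⊗[k] Z.carrier, TensorProduct.assoc k A (A ⊗[k] Z.opp) Z.carrier
          (LinearMap.rTensor Z.carrier ((TensorProduct.assoc k A A Z.opp).toLinearMap ∘ₗ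
            LinearMap.rTensor Z.opp Coalgebra.comul)
              ((TensorProduct.assoc k A Z.opp Z.carrier).symm (b ⊗ₜ u))) =
          LinearMap.lTensor A (TensorProduct.assoc k A Z.opp Z.carrier).symm.toLinearMap
            (TensorProduct.assoc k A A (Z.opp ⊗[k] Z.carrier) (Coalgebra.comul b ⊗ₜ u)) := by
        intro u
        induction u with
        | zero => simp only [LinearMap.map_zero, LinearEquiv.map_zero, tmul_zero]
        | add x y hx hy => simp only [LinearMap.map_add, LinearEquiv.map_add, tmul_add, hx, hy]
        | tmul o z =>
          rw [assoc_symm_tmul, LinearMap.rTensor_tmul, LinearMap.comp_apply,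
            LinearMap.rTensor_tmul]
          induction Coalgebra.comul (R := k) b with
          | zero => simp only [LinearMap.map_zero, LinearEquiv.map_zero, zero_tmul]
          | add x y hx hy => simp only [LinearMap.map_add, LinearEquiv.map_add, add_tmul, hx, hy]
          | tmul b c => rfl
      rw [LinearMap.lTensor_tmul, LinearMap.rTensor_tmul, AlgHom.toLinearMap_apply, h3]
      induction Coalgebra.comul (R := k) b with
      | zero => simp only [LinearMap.map_zero, LinearEquiv.map_zero, zero_tmul]
      | add x y hx hy => simp only [LinearMap.map_add, LinearEquiv.map_add, add_tmul, hx, hy]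
      | tmul b c => rfl
  have h4 : LinearMap.rTensor Z.carrier i.toLinearMap ∘ₗ e.toLinearMap =
      ((TensorProduct.assoc k A Z.opp Z.carrier).symm.toLinearMap ∘ₗ
        LinearMap.lTensor A D.r.toLinearMap) ∘ₗ Coalgebra.comul := LinearMap.ext he
  rw [h1, he, h2, Coalgebra.coassoc_apply, ← LinearMap.lTensor_comp_apply,
    ← LinearMap.lTensor_comp_apply, h4]

/-- Through i both sides become a₁ ⊗ τᵣ(a₂) ⊗ a₃, by colinearity of τᵣ. -/
theorem ambR_unit (h : D.IsInverse T i θ) [Module.Flat k A] [Module.Flat k Z.carrier]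
    (hr : Function.Bijective Z.galR) {e : A →ₐ[k] T.carrier ⊗[k] Z.carrier}
    (he : ∀ a, LinearMap.rTensor Z.carrier i.toLinearMap (e a) =
        (TensorProduct.assoc k A Z.opp Z.carrier).symm
          (LinearMap.lTensor A D.r.toLinearMap (Coalgebra.comul a))) (a : A) :
    ambR T Z (e a) = LinearMap.rTensor A e.toLinearMap (Coalgebra.comul a) := by
  have inj1 : Function.Injective (LinearMap.rTensor Z.carrier i.toLinearMap) :=
    rTensor_inj h.injective
  have inj : Function.Injective
      (LinearMap.rTensor A (LinearMap.rTensor Z.carrier i.toLinearMap)) := rTensor_inj inj1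
  refine inj ?_
  have h1 : ∀ x : T.carrier ⊗[k] Z.carrier,
      LinearMap.rTensor A (LinearMap.rTensor Z.carrier i.toLinearMap) (ambR T Z x) =
      (TensorProduct.assoc k (A ⊗[k] Z.opp) Z.carrier A).symm (LinearMap.lTensor (A ⊗[k] Z.opp)
        Z.rcoact.toLinearMap (LinearMap.rTensor Z.carrier i.toLinearMap x)) := by
    intro x
    induction x with
    | zero => simp only [LinearMap.map_zero, LinearEquiv.map_zero, algHom_zero]
    | add x y hx hy => simp only [LinearMap.map_add, LinearEquiv.map_add, algHom_add, hx, hy]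
    | tmul t z =>
      rw [ambR_tmul, LinearMap.rTensor_tmul, LinearMap.lTensor_tmul, AlgHom.toLinearMap_apply,
        AlgHom.toLinearMap_apply]
      induction Z.rcoact z with
      | zero => simp only [LinearMap.map_zero, LinearEquiv.map_zero, tmul_zero]
      | add x y hx hy => simp only [LinearMap.map_add, LinearEquiv.map_add, tmul_add, hx, hy]
      | tmul b c => rfl
  let F : A ⊗[k] (Z.opp ⊗[k] (Z.carrier ⊗[k] A)) →ₗ[k] ((A ⊗[k] Z.opp) ⊗[k] Z.carrier) ⊗[k] A :=
    (TensorProduct.assoc k (A ⊗[k] Z.opp) Z.carrier A).symm.toLinearMap ∘ₗ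
      (TensorProduct.assoc k A Z.opp (Z.carrier ⊗[k] A)).symm.toLinearMap
  have h2 : ∀ y : A ⊗[k] (Z.opp ⊗[k] Z.carrier),
      (TensorProduct.assoc k (A ⊗[k] Z.opp) Z.carrier A).symm
        (LinearMap.lTensor (A ⊗[k] Z.opp) Z.rcoact.toLinearMap
          ((TensorProduct.assoc k A Z.opp Z.carrier).symm y)) =
      F (LinearMap.lTensor A (LinearMap.lTensor Z.opp Z.rcoact.toLinearMap) y) := fun y =>
    LinearMap.congr_fun (f := (TensorProduct.assoc k (A ⊗[k] Z.opp) Z.carrier A).symm.toLinearMap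
      ∘ₗ LinearMap.lTensor (A ⊗[k] Z.opp) Z.rcoact.toLinearMap ∘ₗ
          (TensorProduct.assoc k A Z.opp Z.carrier).symm.toLinearMap)
      (g := F ∘ₗ LinearMap.lTensor A (LinearMap.lTensor Z.opp Z.rcoact.toLinearMap))
      (TensorProduct.ext_threefold' fun _ _ _ => rfl) y
  have h3 : LinearMap.lTensor Z.opp Z.rcoact.toLinearMap ∘ₗ D.r.toLinearMap =
      ((TensorProduct.assoc k Z.opp Z.carrier A).toLinearMap ∘ₗ
        LinearMap.rTensor A D.r.toLinearMap) ∘ₗ Coalgebra.comul :=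
    LinearMap.ext (D.lTensor_rcoact_r hr)
  have h4 : LinearMap.rTensor Z.carrier i.toLinearMap ∘ₗ e.toLinearMap =
      ((TensorProduct.assoc k A Z.opp Z.carrier).symm.toLinearMap ∘ₗ
        LinearMap.lTensor A D.r.toLinearMap) ∘ₗ Coalgebra.comul := LinearMap.ext he
  have h5 : ∀ y : (A ⊗[k] A) ⊗[k] A, F (LinearMap.lTensor A
      ((TensorProduct.assoc k Z.opp Z.carrier A).toLinearMap ∘ₗ
        LinearMap.rTensor A D.r.toLinearMap) (TensorProduct.assoc k A A A y)) =
      LinearMap.rTensor A ((TensorProduct.assoc k A Z.opp Z.carrier).symm.toLinearMap ∘ₗ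
        LinearMap.lTensor A D.r.toLinearMap) y := by
    intro y
    refine LinearMap.congr_fun (f := F ∘ₗ (LinearMap.lTensor A
      ((TensorProduct.assoc k Z.opp Z.carrier A).toLinearMap ∘ₗ
        LinearMap.rTensor A D.r.toLinearMap)) ∘ₗ (TensorProduct.assoc k A A A).toLinearMap)
      (TensorProduct.ext_threefold fun a b c => ?_) y
    change F (a ⊗ₜ TensorProduct.assoc k Z.opp Z.carrier A (D.r b ⊗ₜ c)) =
      (TensorProduct.assoc k A Z.opp Z.carrier).symm (a ⊗ₜ D.r b) ⊗ₜ c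
    induction D.r b with
    | zero => simp only [LinearMap.map_zero, LinearEquiv.map_zero, zero_tmul, tmul_zero]
    | add x y hx hy =>
      simp only [LinearMap.map_add, LinearEquiv.map_add, add_tmul, tmul_add, hx, hy]
    | tmul b c => rfl
  rw [h1, he, h2, ← LinearMap.lTensor_comp_apply, h3, LinearMap.lTensor_comp_apply,
    ← Coalgebra.coassoc_apply, h5, ← LinearMap.rTensor_comp_apply, ← LinearMap.rTensor_comp_apply,
    h4]

/-- Here θ is the convenient component, because through it the right coaction of `T` is Δ. With
τᵣ(a) = x ⊗ y both sides become x ⊗ y₋₂ ⊗ y₋₁ ⊗ y₀, by coassociativity of λ. -/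
theorem cot_unit (h : D.IsInverse T i θ) [Module.Flat k A] [Module.FaithfullyFlat k Z.carrier]
    {e : A →ₐ[k] T.carrier ⊗[k] Z.carrier}
    (he : ∀ a, LinearMap.rTensor Z.carrier θ.toLinearMap (e a) =
        (TensorProduct.assoc k Z.opp A Z.carrier).symm
          (LinearMap.lTensor Z.opp Z.lcoact.toLinearMap (D.r a))) (a : A) :
    cotR T Z (e a) = cotL T Z (e a) := by
  have inj : Function.Injective (LinearMap.rTensor (A ⊗[k] Z.carrier) θ.toLinearMap) :=
    rTensor_inj h.injective_right
  refine inj ?_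
  have h1 : ∀ x : T.carrier ⊗[k] Z.carrier,
      LinearMap.rTensor (A ⊗[k] Z.carrier) θ.toLinearMap (cotR T Z x) =
      TensorProduct.assoc k (Z.opp ⊗[k] A) A Z.carrier (LinearMap.rTensor Z.carrier
        ((TensorProduct.assoc k Z.opp A A).symm.toLinearMap ∘ₗ
          LinearMap.lTensor Z.opp Coalgebra.comul)
            (LinearMap.rTensor Z.carrier θ.toLinearMap x)) := by
    intro x
    induction x with
    | zero => simp only [LinearMap.map_zero, LinearEquiv.map_zero, algHom_zero]
    | add x y hx hy => simp only [LinearMap.map_add, LinearEquiv.map_add, algHom_add, hx, hy]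
    | tmul t z =>
      rw [cotR_tmul, LinearMap.rTensor_tmul, LinearMap.rTensor_tmul, LinearMap.comp_apply,
        AlgHom.toLinearMap_apply, LinearEquiv.coe_coe, ← h.rcoact]
      induction T.rcoact t with
      | zero => simp only [LinearMap.map_zero, LinearEquiv.map_zero, zero_tmul]
      | add x y hx hy => simp only [LinearMap.map_add, LinearEquiv.map_add, add_tmul, hx, hy]
      | tmul b c => rfl
  have h2 : ∀ x : T.carrier ⊗[k] Z.carrier,
      LinearMap.rTensor (A ⊗[k] Z.carrier) θ.toLinearMap (cotL T Z x) =
      LinearMap.lTensor (Z.opp ⊗[k] A) Z.lcoact.toLinearMap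
        (LinearMap.rTensor Z.carrier θ.toLinearMap x) := by
    intro x
    induction x with
    | zero => simp only [LinearMap.map_zero, algHom_zero]
    | add x y hx hy => simp only [LinearMap.map_add, algHom_add, hx, hy]
    | tmul t z => rfl
  rw [h1, h2, he]
  induction D.r a with
  | zero => simp only [LinearMap.map_zero, LinearEquiv.map_zero]
  | add x y hx hy => simp only [LinearMap.map_add, LinearEquiv.map_add, hx, hy]
  | tmul o z =>
    have h3 : ∀ w : A ⊗[k] Z.carrier, TensorProduct.assoc k (Z.opp ⊗[k] A) A Z.carrier
        (LinearMap.rTensor Z.carrier ((TensorProduct.assoc k Z.opp A A).symm.toLinearMap ∘ₗ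
          LinearMap.lTensor Z.opp Coalgebra.comul)
            ((TensorProduct.assoc k Z.opp A Z.carrier).symm (o ⊗ₜ w))) =
        (TensorProduct.assoc k Z.opp A (A ⊗[k] Z.carrier)).symm
          (o ⊗ₜ TensorProduct.assoc k A A Z.carrier
            (LinearMap.rTensor Z.carrier Coalgebra.comul w)) := by
      intro w
      induction w with
      | zero => simp only [LinearMap.map_zero, LinearEquiv.map_zero, tmul_zero]
      | add x y hx hy => simp only [LinearMap.map_add, LinearEquiv.map_add, tmul_add, hx, hy]
      | tmul b c =>
        rw [assoc_symm_tmul, LinearMap.rTensor_tmul, LinearMap.rTensor_tmul, LinearMap.comp_apply,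
          LinearMap.lTensor_tmul]
        induction Coalgebra.comul (R := k) b with
        | zero => simp only [LinearMap.map_zero, LinearEquiv.map_zero, zero_tmul, tmul_zero]
        | add x y hx hy =>
          simp only [LinearMap.map_add, LinearEquiv.map_add, add_tmul, tmul_add, hx, hy]
        | tmul b c => rfl
    have h4 : ∀ w : A ⊗[k] Z.carrier, LinearMap.lTensor (Z.opp ⊗[k] A) Z.lcoact.toLinearMap
        ((TensorProduct.assoc k Z.opp A Z.carrier).symm (o ⊗ₜ w)) =
        (TensorProduct.assoc k Z.opp A (A ⊗[k] Z.carrier)).symm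
          (o ⊗ₜ LinearMap.lTensor A Z.lcoact.toLinearMap w) := by
      intro w
      induction w with
      | zero => simp only [LinearMap.map_zero, LinearEquiv.map_zero, tmul_zero]
      | add x y hx hy => simp only [LinearMap.map_add, LinearEquiv.map_add, tmul_add, hx, hy]
      | tmul b c => rfl
    rw [LinearMap.lTensor_tmul, AlgHom.toLinearMap_apply, h3, h4, Z.lcoassoc]

/-- By `cot_unit` the map e factors through `T □ Z`. Tensored with `Z`, both `A` and `T □ Z` are
identified by φ with `T ⊗ Z`, the first with inverse `actR` and the second because `Z` is Galois. So
`A → T □ Z` is bijective after tensoring with `Z`, hence bijective. -/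
theorem isCotensorMap_unit (h : D.IsInverse T i θ) [Module.Flat k A]
    [Module.FaithfullyFlat k Z.carrier] (hl : Function.Bijective Z.galL)
    (hr : Function.Bijective Z.galR) {e : A →ₐ[k] T.carrier ⊗[k] Z.carrier}
    (he : ∀ a, LinearMap.rTensor Z.carrier i.toLinearMap (e a) =
        (TensorProduct.assoc k A Z.opp Z.carrier).symm
          (LinearMap.lTensor A D.r.toLinearMap (Coalgebra.comul a)))
    (he' : ∀ a, LinearMap.rTensor Z.carrier θ.toLinearMap (e a) =
        (TensorProduct.assoc k Z.opp A Z.carrier).symm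
          (LinearMap.lTensor Z.opp Z.lcoact.toLinearMap (D.r a))) :
    IsCotensorMap T Z (reg k A) e where
  injective x y hxy := by
    have h1 : ∀ a, phi e (a ⊗ₜ[k] (1 : Z.carrier)) = e a := fun a => by
      rw [phi_tmul, ← Algebra.TensorProduct.one_def, mul_one]
    have h2 : Function.Injective ((TensorProduct.mk k A Z.carrier).flip 1) := tmul_one_injective
    refine h2 ((actR_phi he _).symm.trans ((congrArg (actR i) ?_).trans (actR_phi he _)))
    exact (h1 x).trans (Eq.trans hxy (h1 y).symm)
  mem_range_iff x := by
    refine ⟨fun ⟨a, ha⟩ => ha ▸ h.cot_unit he' a, fun hx => ?_⟩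
    obtain ⟨W, j, hj⟩ := exists_cotensor_structure T Z
    obtain ⟨l, hl'⟩ := exists_algHom_lift e j hj.injective fun a =>
      (hj.mem_range_iff _).2 (h.cot_unit he' a)
    have b1 : Function.Bijective (phi j) := phi_bijective hj hl
    have b2 : Function.Bijective (phi e) := Function.bijective_iff_has_inverse.2
      ⟨actR i, actR_phi he, h.phi_actR he⟩
    have b3 : Function.Bijective (phi j ∘ₗ LinearMap.rTensor Z.carrier l.toLinearMap) := by
      have : phi j ∘ₗ LinearMap.rTensor Z.carrier l.toLinearMap = phi e :=
        TensorProduct.ext' fun a z => congrArg (· * _) (hl' a)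
      rwa [this]
    have b4 : Function.Bijective l.toLinearMap :=
      bijective_of_rTensor (M := Z.carrier) ((Function.Bijective.of_comp_iff' b1 _).1 b3)
    obtain ⟨w, hw⟩ := (hj.mem_range_iff x).2 hx
    obtain ⟨a, rfl⟩ := b4.2 w
    exact ⟨a, (hl' a).symm.trans hw⟩
  left := h.ambL_unit he
  right := h.ambR_unit hr he

end IsInverse

end Translation

/-- Every faithfully flat biGalois object has a left inverse for the cotensor product. -/
theorem exists_left_inverse [Nontrivial k] [Module.Flat k A] {Z : BicomodAlg k A}
    (hZ : Z.IsBiGalois ∧ Module.FaithfullyFlat k Z.carrier) :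
    ∃ T : BicomodAlg k A, (T.IsBiGalois ∧ Module.FaithfullyFlat k T.carrier) ∧
      ∃ e, IsCotensorMap T Z (reg k A) e := by
  have := hZ.2
  have ffA : Module.FaithfullyFlat k A := faithfullyFlat_hopf k A
  have hl := hZ.1.left_galois
  have hr := hZ.1.right_galois
  obtain ⟨D⟩ := Z.nonempty_translation hl hr
  obtain ⟨T, i, θ, h⟩ := D.exists_inverse hl hr
  obtain ⟨e, he, he'⟩ := h.exists_unit hl hr
  obtain ⟨f, -, hf⟩ := h.exists_counit hl hr
  have bR : Function.Bijective (actR i) := Function.bijective_iff_has_inverse.2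
    ⟨phi e, h.phi_actR he, Translation.IsInverse.actR_phi he⟩
  have bL : Function.Bijective (actL θ) := Function.bijective_iff_has_inverse.2
    ⟨psi f, h.psi_actL hf, Translation.IsInverse.actL_psi hf⟩
  -- Faithful flatness of `T` comes from `Z ⊗ T ≃ Z ⊗ A` by cancelling `Z`; it is needed before the
  -- coinvariants of `T` can be controlled.
  have ff : Module.FaithfullyFlat k (Z.carrier ⊗[k] T.carrier) := by
    have : Module.FaithfullyFlat k (Z.carrier ⊗[k] A) := faithfullyFlat_tensor
    exact faithfullyFlat_congr (LinearEquiv.ofBijective _ bL).symm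
  have ffT : Module.FaithfullyFlat k T.carrier := faithfullyFlat_of_tensor (M := Z.carrier)
  exact ⟨T, ⟨isBiGalois_of_bijective T (h.galL_bijective bR) (h.galR_bijective bL), ffT⟩, e,
    h.isCotensorMap_unit hl hr he he'⟩

end BicomodAlg

/-! ### The biGalois objects attached to lazy cocycles -/

section

variable {C : Type*} [Ring C] [Algebra k C] [Coalgebra k C]

/-- The map `c ↦ f(c₁) c₂`. -/
def slideL (f : WithConv (C →ₗ[k] k)) : C →ₗ[k] C := (sc C f * toConv LinearMap.id).ofConv

/-- The map `c ↦ c₁ f(c₂)`. -/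
def slideR (f : WithConv (C →ₗ[k] k)) : C →ₗ[k] C := (toConv LinearMap.id * sc C f).ofConv

theorem toConv_comp_slideL {B : Type*} [Ring B] [Algebra k B] (h : C →ₗ[k] B)
    (f : WithConv (C →ₗ[k] k)) : toConv (h ∘ₗ slideL f) = sc B f * toConv h :=
  comp_sc_mul h f (toConv LinearMap.id)

theorem toConv_comp_slideR {B : Type*} [Ring B] [Algebra k B] (h : C →ₗ[k] B)
    (f : WithConv (C →ₗ[k] k)) : toConv (h ∘ₗ slideR f) = toConv h * sc B f :=
  comp_mul_sc h f (toConv LinearMap.id)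

/-- Composition of left slides reverses the convolution product: the composite is c ↦ g(c₁) f(c₂)
c₃. -/
theorem slideL_slideL {f g : WithConv (C →ₗ[k] k)} (h : g * f = 1) (c : C) :
    slideL f (slideL g c) = c := by
  have h1 : toConv (slideL f ∘ₗ slideL g) = toConv LinearMap.id := by
    rw [toConv_comp_slideL, slideL, toConv_ofConv, ← mul_assoc, ← map_mul, h, map_one, one_mul]
  exact LinearMap.congr_fun (congrArg WithConv.ofConv h1) c

theorem slideR_slideR {f g : WithConv (C →ₗ[k] k)} (h : f * g = 1) (c : C) :
    slideR f (slideR g c) = c := by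
  have h1 : toConv (slideR f ∘ₗ slideR g) = toConv LinearMap.id := by
    rw [toConv_comp_slideR, slideR, toConv_ofConv, mul_assoc, ← map_mul, h, map_one, mul_one]
  exact LinearMap.congr_fun (congrArg WithConv.ofConv h1) c

theorem slideL_bijective (f : InvForm k C) :
    Function.Bijective (slideL (f : WithConv (C →ₗ[k] k))) :=
  Function.bijective_iff_has_inverse.2 ⟨slideL ((f⁻¹ : InvForm k C) : WithConv (C →ₗ[k] k)),
    slideL_slideL f.mul_inv, slideL_slideL f.inv_mul⟩

theorem slideR_bijective (f : InvForm k C) :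
    Function.Bijective (slideR (f : WithConv (C →ₗ[k] k))) :=
  Function.bijective_iff_has_inverse.2 ⟨slideR ((f⁻¹ : InvForm k C) : WithConv (C →ₗ[k] k)),
    slideR_slideR f.inv_mul, slideR_slideR f.mul_inv⟩

end

/-- Rewrites a ⊗ b ↦ a₁ ⊗ g(a₂ ⊗ b) as a convolution product over `A ⊗ A`, so that twisting the
product by σ becomes multiplication by σ in a convolution algebra. -/
theorem legs_left {B : Type*} [Ring B] [Algebra k B] (g : A ⊗[k] A →ₗ[k] B) :
    toConv (LinearMap.lTensor A g ∘ₗ (TensorProduct.assoc k A A A).toLinearMap ∘ₗ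
      LinearMap.rTensor A Coalgebra.comul) =
    push Algebra.TensorProduct.includeLeft (pull (fst k A A) (idm k A)) *
      push Algebra.TensorProduct.includeRight (toConv g) := by
  have h := map_comp_comul (pull (fst k A A) (idm k A)).ofConv g
  rw [toConv_ofConv] at h
  refine Eq.trans (conv_ext fun a b => ?_) h
  change LinearMap.lTensor A g (TensorProduct.assoc k A A A (Coalgebra.comul a ⊗ₜ b)) =
    TensorProduct.map (fst k A A).toLinearMap g (Coalgebra.comul (R := k) (a ⊗ₜ[k] b))
  rw [TensorProduct.comul_tmul]
  induction Coalgebra.comul (R := k) a with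
  | zero => simp only [LinearMap.map_zero, LinearEquiv.map_zero, zero_tmul]
  | add x y hx hy => simp only [LinearMap.map_add, LinearEquiv.map_add, add_tmul, hx, hy]
  | tmul c d =>
    have h1 : ∀ y : A ⊗[k] A, TensorProduct.map (fst k A A).toLinearMap g
        (AlgebraTensorModule.tensorTensorTensorComm k k k k A A A A ((c ⊗ₜ d) ⊗ₜ y)) =
        c ⊗ₜ g (d ⊗ₜ TensorProduct.lid k A (LinearMap.rTensor A Coalgebra.counit y)) := by
      intro y
      induction y with
      | zero => simp only [LinearMap.map_zero, LinearEquiv.map_zero, tmul_zero]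
      | add x y hx hy => simp only [LinearMap.map_add, LinearEquiv.map_add, tmul_add, hx, hy]
      | tmul x y => simp [smul_tmul]
    rw [h1, Coalgebra.rTensor_counit_comul, lid_tmul, one_smul]
    rfl

theorem legs_right {B : Type*} [Ring B] [Algebra k B] (g : A ⊗[k] A →ₗ[k] B) :
    toConv (LinearMap.rTensor A g ∘ₗ (TensorProduct.assoc k A A A).symm.toLinearMap ∘ₗ
      LinearMap.lTensor A Coalgebra.comul) =
    push Algebra.TensorProduct.includeLeft (toConv g) *
      push Algebra.TensorProduct.includeRight (pull (snd k A A) (idm k A)) := by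
  have h := map_comp_comul g (pull (snd k A A) (idm k A)).ofConv
  rw [toConv_ofConv] at h
  refine Eq.trans (conv_ext fun a b => ?_) h
  change LinearMap.rTensor A g ((TensorProduct.assoc k A A A).symm (a ⊗ₜ Coalgebra.comul b)) =
    TensorProduct.map g (snd k A A).toLinearMap (Coalgebra.comul (R := k) (a ⊗ₜ[k] b))
  rw [TensorProduct.comul_tmul]
  induction Coalgebra.comul (R := k) b with
  | zero => simp only [LinearMap.map_zero, LinearEquiv.map_zero, tmul_zero]
  | add x y hx hy => simp only [LinearMap.map_add, LinearEquiv.map_add, tmul_add, hx, hy]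
  | tmul c d =>
    have h1 : ∀ y : A ⊗[k] A, TensorProduct.map g (snd k A A).toLinearMap
        (AlgebraTensorModule.tensorTensorTensorComm k k k k A A A A (y ⊗ₜ (c ⊗ₜ d))) =
        g (TensorProduct.rid k A (LinearMap.lTensor A Coalgebra.counit y) ⊗ₜ c) ⊗ₜ d := by
      intro y
      induction y with
      | zero => simp only [LinearMap.map_zero, LinearEquiv.map_zero, zero_tmul]
      | add x y hx hy => simp only [LinearMap.map_add, LinearEquiv.map_add, add_tmul, hx, hy]
      | tmul x y => simp [smul_tmul]
    rw [h1, Coalgebra.lTensor_counit_comul, rid_tmul, one_smul]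
    rfl

/-- Twisting changes the Galois map of `A` by an invertible slide only. For κ_l the factor σ stands
between a₁ and the product, and laziness moves it to the right end, where it becomes a slide. For
κ_r, in the next lemma, it stands at the left end from the start and laziness is not used. -/
theorem lTensor_twMul {σ : InvForm k (A ⊗[k] A)} (h : IsLazy2 σ) :
    LinearMap.lTensor A (twMul σ) ∘ₗ (TensorProduct.assoc k A A A).toLinearMap ∘ₗ
      LinearMap.rTensor A Coalgebra.comul =
    hopfGalL k A ∘ₗ slideR (σ : WithConv (A ⊗[k] A →ₗ[k] k)) := by
  have h1 : toConv (hopfGalL k A) = _ := legs_left (LinearMap.mul' k A)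
  have h2 : toConv (twMul σ) = mulm k A * sc A (σ : WithConv (A ⊗[k] A →ₗ[k] k)) := h
  refine WithConv.toConv_injective ?_
  rw [toConv_comp_slideR, h1, legs_left, h2, map_mul, push_sc, mul_assoc]
  rfl

theorem rTensor_twMul (σ : InvForm k (A ⊗[k] A)) :
    LinearMap.rTensor A (twMul σ) ∘ₗ (TensorProduct.assoc k A A A).symm.toLinearMap ∘ₗ
      LinearMap.lTensor A Coalgebra.comul =
    hopfGalR k A ∘ₗ slideL (σ : WithConv (A ⊗[k] A →ₗ[k] k)) := by
  have h1 : toConv (hopfGalR k A) = _ := legs_right (LinearMap.mul' k A)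
  have h2 : toConv (twMul σ) = sc A (σ : WithConv (A ⊗[k] A →ₗ[k] k)) * mulm k A := rfl
  refine WithConv.toConv_injective ?_
  rw [toConv_comp_slideL, h1, legs_right, h2, map_mul, push_sc, mul_assoc]
  rfl

namespace BicomodAlg

theorem galL_twisted (σ : Z2L k A) (α : A ≃ₐc[k] A) (a b : A) :
    (twisted σ α).galL (toTw σ a ⊗ₜ toTw σ b) =
      TensorProduct.map (α : A →ₗc[k] A).toLinearMap (toTw σ).toLinearMap
        (hopfGalL k A (slideR (σ.1 : WithConv (A ⊗[k] A →ₗ[k] k)) (a ⊗ₜ b))) := by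
  have h := LinearMap.congr_fun (lTensor_twMul (σ := σ.1) σ.2.1.2) (a ⊗ₜ b)
  have key : ∀ y : A ⊗[k] A,
      (TensorProduct.map (α : A →ₗc[k] A).toLinearMap (toTw σ).toLinearMap y) *
        ((1 : A) ⊗ₜ[k] toTw σ b) =
      TensorProduct.map (α : A →ₗc[k] A).toLinearMap (toTw σ).toLinearMap
        (LinearMap.lTensor A (twMul σ.1) (TensorProduct.assoc k A A A (y ⊗ₜ b))) := by
    intro y
    induction y with
    | zero => simp only [LinearMap.map_zero, LinearEquiv.map_zero, zero_tmul, zero_mul]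
    | add x y hx hy =>
      simp only [LinearMap.map_add, LinearEquiv.map_add, add_tmul, add_mul, hx, hy]
    | tmul c d =>
      rw [map_tmul, Algebra.TensorProduct.tmul_mul_tmul, mul_one]
      rfl
  exact ((twisted σ α).galL_tmul _ _).trans ((congrArg
    (fun w : A ⊗[k] Tw σ => w * (1 ⊗ₜ toTw σ b)) (twLeftAut_toTw σ α a)).trans ((key _).trans
      (congrArg (TensorProduct.map (α : A →ₗc[k] A).toLinearMap (toTw σ).toLinearMap) h)))

theorem galR_twisted (σ : Z2L k A) (α : A ≃ₐc[k] A) (a b : A) :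
    (twisted σ α).galR (toTw σ a ⊗ₜ toTw σ b) =
      LinearMap.rTensor A (toTw σ).toLinearMap
        (hopfGalR k A (slideL (σ.1 : WithConv (A ⊗[k] A →ₗ[k] k)) (a ⊗ₜ b))) := by
  have h := LinearMap.congr_fun (rTensor_twMul σ.1) (a ⊗ₜ b)
  have key : ∀ y : A ⊗[k] A, (toTw σ a ⊗ₜ[k] (1 : A)) * LinearMap.rTensor A (toTw σ).toLinearMap y =
      LinearMap.rTensor A (toTw σ).toLinearMap (LinearMap.rTensor A (twMul σ.1)
        ((TensorProduct.assoc k A A A).symm (a ⊗ₜ y))) := by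
    intro y
    induction y with
    | zero => simp only [LinearMap.map_zero, LinearEquiv.map_zero, tmul_zero, mul_zero]
    | add x y hx hy =>
      simp only [LinearMap.map_add, LinearEquiv.map_add, tmul_add, mul_add, hx, hy]
    | tmul c d =>
      rw [LinearMap.rTensor_tmul, Algebra.TensorProduct.tmul_mul_tmul, one_mul]
      rfl
  exact ((twisted σ α).galR_tmul _ _).trans ((congrArg
    (fun w : Tw σ ⊗[k] A => (toTw σ a ⊗ₜ 1) * w) (twRight_toTw σ b)).trans ((key _).trans
      (congrArg (LinearMap.rTensor A (toTw σ).toLinearMap) h)))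

/-- Up to linear isomorphisms, the Galois maps of `^αA(σ)` are those of `A` preceded by the
bijective slides along σ, and the module is `A` itself. -/
theorem twisted_isBiGalois [Nontrivial k] [Module.Flat k A] (σ : Z2L k A) (α : A ≃ₐc[k] A) :
    (twisted σ α).IsBiGalois ∧ Module.FaithfullyFlat k (twisted σ α).carrier := by
  have ffA : Module.FaithfullyFlat k A := faithfullyFlat_hopf k A
  have ff : Module.FaithfullyFlat k (twisted σ α).carrier := ffA
  let E := TensorProduct.congr (toTw σ) (toTw σ)
  refine ⟨isBiGalois_of_bijective _ ?_ ?_, ff⟩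
  · let F := TensorProduct.congr α.toLinearEquiv (toTw σ)
    have h : (twisted σ α).galL ∘ₗ E.toLinearMap = F.toLinearMap ∘ₗ hopfGalL k A ∘ₗ
        slideR (σ.1 : WithConv (A ⊗[k] A →ₗ[k] k)) :=
      TensorProduct.ext' fun a b => galL_twisted σ α a b
    have b : Function.Bijective (F.toLinearMap ∘ₗ hopfGalL k A ∘ₗ
        slideR (σ.1 : WithConv (A ⊗[k] A →ₗ[k] k))) :=
      F.bijective.comp ((hopfGalL_bijective k A).comp (slideR_bijective σ.1))
    rw [← h] at b
    exact (Function.Bijective.of_comp_iff _ E.bijective).1 b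
  · let F := LinearEquiv.rTensor A (toTw σ)
    have h : (twisted σ α).galR ∘ₗ E.toLinearMap = F.toLinearMap ∘ₗ hopfGalR k A ∘ₗ
        slideL (σ.1 : WithConv (A ⊗[k] A →ₗ[k] k)) :=
      TensorProduct.ext' fun a b => galR_twisted σ α a b
    have b : Function.Bijective (F.toLinearMap ∘ₗ hopfGalR k A ∘ₗ
        slideL (σ.1 : WithConv (A ⊗[k] A →ₗ[k] k))) :=
      F.bijective.comp ((hopfGalR_bijective k A).comp (slideL_bijective σ.1))
    rw [← h] at b
    exact (Function.Bijective.of_comp_iff _ E.bijective).1 b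

variable (k A) in
-- Allows the object for σ = 1 and α = 1, rather than `reg`, to represent the unit of the group, so
-- that the unit is itself a value of Υ.
theorem iso_twisted_one_reg : Iso (twisted (1 : Z2L k A) 1) (reg k A) := by
  have h : twMul (1 : InvForm k (A ⊗[k] A)) = LinearMap.mul' k A := by
    rw [twMul, Units.val_one, map_one, one_mul]
    rfl
  refine ⟨AlgEquiv.ofLinearEquiv (toTw (1 : Z2L k A)).symm rfl fun x y => ?_, fun x => ?_,
    fun x => ?_⟩
  · exact LinearMap.congr_fun h ((toTw (1 : Z2L k A)).symm x ⊗ₜ (toTw (1 : Z2L k A)).symm y)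
  · have h1 := twLeftAut_toTw (1 : Z2L k A) 1 ((toTw (1 : Z2L k A)).symm x)
    refine Eq.trans ?_ (congrArg (LinearMap.lTensor A (toTw (1 : Z2L k A)).symm.toLinearMap)
      h1).symm
    change Coalgebra.comul ((toTw (1 : Z2L k A)).symm x) = _
    induction Coalgebra.comul (R := k) ((toTw (1 : Z2L k A)).symm x) with
    | zero => simp only [LinearMap.map_zero]
    | add x y hx hy => rw [LinearMap.map_add, LinearMap.map_add, ← hx, ← hy]
    | tmul c d => rfl
  · have h1 := twRight_toTw (1 : Z2L k A) ((toTw (1 : Z2L k A)).symm x)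
    refine Eq.trans ?_ (congrArg (LinearMap.rTensor A (toTw (1 : Z2L k A)).symm.toLinearMap)
      h1).symm
    change Coalgebra.comul ((toTw (1 : Z2L k A)).symm x) = _
    induction Coalgebra.comul (R := k) ((toTw (1 : Z2L k A)).symm x) with
    | zero => simp only [LinearMap.map_zero]
    | add x y hx hy => rw [LinearMap.map_add, LinearMap.map_add, ← hx, ← hy]
    | tmul c d => rfl

end BicomodAlg

/-! ### The group `BiGal(A)` -/

namespace BiGal

open BicomodAlg

/-- The biGalois object `^αA(σ)`. -/
def tw [Nontrivial k] [Module.Flat k A] (σ : Z2L k A) (α : A ≃ₐc[k] A) : BiGalObj k A :=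
  ⟨twisted σ α, twisted_isBiGalois σ α⟩

theorem mk_eq_mk {Z T : BiGalObj k A} : mk Z = mk T ↔ Iso Z.1 T.1 := Quotient.eq

theorem exists_cotensor [Nontrivial k] [Module.Flat k A] (Z T : BiGalObj k A) :
    ∃ (U : BiGalObj k A), ∃ j, IsCotensorMap Z.1 T.1 U.1 j := by
  obtain ⟨W, j, hj⟩ := exists_cotensor_structure Z.1 T.1
  exact ⟨⟨W, isBiGalois_of_isCotensorMap hj Z.2 T.2⟩, j, hj⟩

/-- A biGalois object isomorphic to `Z □_A T`. -/
def cot [Nontrivial k] [Module.Flat k A] (Z T : BiGalObj k A) : BiGalObj k A :=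
  (exists_cotensor Z T).choose

theorem cot_spec [Nontrivial k] [Module.Flat k A] (Z T : BiGalObj k A) :
    ∃ j, IsCotensorMap Z.1 T.1 (cot Z T).1 j :=
  (exists_cotensor Z T).choose_spec

/-- The product of classes given by the cotensor product. -/
def mul [Nontrivial k] [Module.Flat k A] : BiGal k A → BiGal k A → BiGal k A :=
  Quotient.map₂ cot fun Z Z' hZ T T' hT => by
    obtain ⟨j, hj⟩ := cot_spec Z T
    obtain ⟨j', hj'⟩ := cot_spec Z' T'
    obtain ⟨i, hi⟩ := hj.map hZ hT
    exact hi.iso hj'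

theorem mul_mk_eq_iff [Nontrivial k] [Module.Flat k A] {Z T U : BiGalObj k A} :
    mul (mk Z) (mk T) = mk U ↔ ∃ j, IsCotensorMap Z.1 T.1 U.1 j := by
  change mk (cot Z T) = mk U ↔ _
  obtain ⟨j, hj⟩ := cot_spec Z T
  rw [mk_eq_mk]
  exact ⟨fun h => hj.comp_iso h.symm, fun ⟨i, hi⟩ => hj.iso hi⟩

variable (k A) in
-- A left unit and left inverses suffice for a group. The value of the unit is recorded because the
-- kernel of Υ refers to it.
theorem exists_group [Nontrivial k] [Module.Flat k A] :
    ∃ G : Group (BiGal k A), IsCotensorGroup k A G ∧ G.one = mk (tw 1 1) := by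
  have h1 : ∀ a : BiGal k A, mul (mk (tw 1 1)) a = a := by
    intro a
    induction a using Quotient.ind with
    | _ Z =>
      exact mul_mk_eq_iff.2
        ((isCotensorMap_reg Z.1).map (iso_twisted_one_reg k A).symm (.refl _))
  have h2 : ∀ a b c : BiGal k A, mul (mul a b) c = mul a (mul b c) := by
    intro a b c
    induction a using Quotient.ind with
    | _ Z =>
    induction b using Quotient.ind with
    | _ T =>
    induction c using Quotient.ind with
    | _ U =>
      obtain ⟨j, hj⟩ := cot_spec Z T
      obtain ⟨j', hj'⟩ := cot_spec T U
      obtain ⟨i, hi⟩ := cot_spec (cot Z T) U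
      obtain ⟨i', hi'⟩ := cot_spec Z (cot T U)
      have := Z.2.2
      have := U.2.2
      exact mk_eq_mk.2 (hj.assoc hj' hi hi')
  have h3 : ∀ a : BiGal k A, ∃ b, mul b a = mk (tw 1 1) := by
    intro a
    induction a using Quotient.ind with
    | _ Z =>
      obtain ⟨T, hT, e, he⟩ := exists_left_inverse Z.2
      exact ⟨mk ⟨T, hT⟩, mul_mk_eq_iff.2 (he.comp_iso (iso_twisted_one_reg k A))⟩
  choose inv hinv using h3
  let : Mul (BiGal k A) := ⟨mul⟩
  let : One (BiGal k A) := ⟨mk (tw 1 1)⟩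
  let : Inv (BiGal k A) := ⟨inv⟩
  exact ⟨Group.ofLeftAxioms h2 h1 hinv, fun Z T U => mul_mk_eq_iff.trans isCotensor_iff.symm, rfl⟩

end BiGal

/-! ### Cotensor products of the objects attached to lazy cocycles -/

theorem pull_sq_twMul (σ : InvForm k (A ⊗[k] A)) (β : A ≃ₐc[k] A) :
    pull (sq β) (toConv (twMul σ)) = sc A (gets σ β : WithConv (A ⊗[k] A →ₗ[k] k)) *
      push (β : A →ₐ[k] A) (mulm k A) := by
  have h : pull (sq β) (mulm k A) = push (β : A →ₐ[k] A) (mulm k A) :=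
    conv_ext fun a b => (map_mul β a b).symm
  rw [twMul, toConv_ofConv, map_mul, pull_sc, h]
  rfl

/-- The source of the multiplicativity of a ↦ β(a₁) ⊗ a₂. On the left the four convolution factors
are σ ← β, ω, the first leg β(ab) and the second leg ab; on the right ω stands between the two legs.
Laziness of ω lets it pass the first leg. -/
theorem map_comul_twMul (σ : InvForm k (A ⊗[k] A)) {ω : InvForm k (A ⊗[k] A)} (hω : IsLazy2 ω)
    (β : A ≃ₐc[k] A) (x : A ⊗[k] A) :
    Algebra.TensorProduct.map (β : A →ₐ[k] A) (AlgHom.id k A)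
      (Coalgebra.comul (R := k) (twMul (gets σ β * ω) x)) =
    TensorProduct.map (twMul σ ∘ₗ (sq β).toLinearMap) (twMul ω) (Coalgebra.comul (R := k) x) := by
  have h0 : Commute (sc A (ω : WithConv (A ⊗[k] A →ₗ[k] k))) (mulm k A) := hω
  have h1 := (h0.map (push (β : A →ₐ[k] A))).map
    (push (Algebra.TensorProduct.includeLeft : A →ₐ[k] A ⊗[k] A))
  rw [push_sc, push_sc] at h1
  have h2 := congrArg (push (Algebra.TensorProduct.map (β : A →ₐ[k] A) (AlgHom.id k A)))
    (comul_comp_twMul (gets σ β * ω))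
  have h3 := map_comp_comul (twMul σ ∘ₗ (sq β).toLinearMap) (twMul ω)
  have h4 : toConv (twMul σ ∘ₗ (sq β).toLinearMap) = _ := pull_sq_twMul σ β
  have h5 : push (Algebra.TensorProduct.map (β : A →ₐ[k] A) (AlgHom.id k A))
      (push Algebra.TensorProduct.includeLeft (mulm k A)) =
      push Algebra.TensorProduct.includeLeft (push (β : A →ₐ[k] A) (mulm k A)) := by
    refine conv_ext fun a b => ?_
    simp
  have h6 : push (Algebra.TensorProduct.map (β : A →ₐ[k] A) (AlgHom.id k A))
      (push Algebra.TensorProduct.includeRight (mulm k A)) =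
      push Algebra.TensorProduct.includeRight (mulm k A) := by
    refine conv_ext fun a b => ?_
    simp
  have h7 : toConv (twMul ω) = sc A (ω : WithConv (A ⊗[k] A →ₗ[k] k)) * mulm k A := rfl
  rw [map_mul, map_mul, push_sc, h5, h6, Units.val_mul, map_mul] at h2
  rw [h4, h7, map_mul, map_mul, push_sc, push_sc] at h3
  have h := h2.trans (Eq.trans ?_ h3.symm)
  · exact congrArg (fun g : WithConv (A ⊗[k] A →ₗ[k] A ⊗[k] A) => g x) h
  · simp only [mul_assoc]
    rw [← mul_assoc (sc (A ⊗[k] A) (ω : WithConv (A ⊗[k] A →ₗ[k] k))), h1.eq, mul_assoc]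

namespace BicomodAlg

variable (σ ω : Z2L k A) (α β : A ≃ₐc[k] A)

/-- The isomorphism `A ⊗ A(ω) ≃ A(σ) ⊗ A(ω)`. -/
def rTw : A ⊗[k] Tw ω ≃ₗ[k] Tw σ ⊗[k] Tw ω := LinearEquiv.rTensor (Tw ω) (toTw σ)

/-- The map `a ↦ β(a₁) ⊗ a₂`. -/
def twCotensorLin : Tw (getsZ β σ * ω) →ₗ[k] Tw σ ⊗[k] Tw ω :=
  (rTw σ ω).toLinearMap ∘ₗ (twLeftAut ω β).toLinearMap ∘ₗ
    ((toTw (getsZ β σ * ω)).symm.trans (toTw ω)).toLinearMap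

theorem twCotensorLin_toTw (a : A) : twCotensorLin σ ω β (toTw (getsZ β σ * ω) a) =
    TensorProduct.map (toTw σ).toLinearMap (toTw ω).toLinearMap
      (Algebra.TensorProduct.map (β : A →ₐ[k] A) (AlgHom.id k A) (Coalgebra.comul (R := k) a)) := by
  refine (congrArg (rTw σ ω) (twLeftAut_toTw ω β a)).trans ?_
  induction Coalgebra.comul (R := k) a with
  | zero => simp only [map_zero]
  | add x y hx hy => simp only [map_add, hx, hy]
  | tmul x y => rfl

theorem map_mul_map (x y : A ⊗[k] A) :
    TensorProduct.map (toTw σ).toLinearMap (toTw ω).toLinearMap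
      (Algebra.TensorProduct.map (β : A →ₐ[k] A) (AlgHom.id k A) x) *
    TensorProduct.map (toTw σ).toLinearMap (toTw ω).toLinearMap
      (Algebra.TensorProduct.map (β : A →ₐ[k] A) (AlgHom.id k A) y) =
    TensorProduct.map (toTw σ).toLinearMap (toTw ω).toLinearMap
      (TensorProduct.map (twMul σ.1 ∘ₗ (sq β).toLinearMap) (twMul ω.1)
        (AlgebraTensorModule.tensorTensorTensorComm k k k k A A A A (x ⊗ₜ y))) := by
  induction x with
  | zero => simp only [map_zero, zero_tmul, zero_mul]
  | add x x' hx hx' =>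
    simp only [map_add, add_tmul, add_mul, hx, hx']
  | tmul a b =>
    induction y with
    | zero => simp only [map_zero, tmul_zero, mul_zero]
    | add y y' hy hy' =>
      simp only [map_add, tmul_add, mul_add, hy, hy']
    | tmul c d => exact Algebra.TensorProduct.tmul_mul_tmul _ _ _ _

theorem twCotensorLin_mul (a b : A) :
    twCotensorLin σ ω β (toTw (getsZ β σ * ω) (twMul (getsZ β σ * ω).1 (a ⊗ₜ b))) =
      twCotensorLin σ ω β (toTw (getsZ β σ * ω) a) *
        twCotensorLin σ ω β (toTw (getsZ β σ * ω) b) := by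
  have h : Algebra.TensorProduct.map (β : A →ₐ[k] A) (AlgHom.id k A)
      (Coalgebra.comul (R := k) (twMul (getsZ β σ * ω).1 (a ⊗ₜ[k] b))) = _ :=
    map_comul_twMul σ.1 ω.2.1.2 β (a ⊗ₜ b)
  rw [twCotensorLin_toTw, twCotensorLin_toTw, twCotensorLin_toTw, map_mul_map,
    ← TensorProduct.comul_tmul, h]

theorem twCotensorLin_one : twCotensorLin σ ω β (toTw (getsZ β σ * ω) 1) = 1 := by
  rw [twCotensorLin_toTw, Bialgebra.comul_one, map_one]
  rfl

/-- The algebra map `a ↦ β(a₁) ⊗ a₂` that identifies `^{αβ}A((σ ← β) * ω)` with the cotensor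
product of `^αA(σ)` and `^βA(ω)`. -/
def twCotensor : Tw (getsZ β σ * ω) →ₐ[k] Tw σ ⊗[k] Tw ω :=
  AlgHom.ofLinearMap (twCotensorLin σ ω β) (twCotensorLin_one σ ω β)
    (fun x y => twCotensorLin_mul σ ω β ((toTw (getsZ β σ * ω)).symm x)
      ((toTw (getsZ β σ * ω)).symm y))

/-- The right coaction of `^αA(σ)` is that of `A`, so the equalizer condition for a cotensor product
with `^αA(σ)` on the left is the one with `A` on the left. The automorphism α enters only through
the outer left coaction, in `ambL_rTw`. -/
theorem cotR_rTw (y : A ⊗[k] Tw ω) :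
    cotR (twisted σ α) (twisted ω β) (rTw σ ω y) =
      LinearMap.rTensor (A ⊗[k] Tw ω) (toTw σ).toLinearMap
        (cotR (reg k A) (twisted ω β) y) := by
  have h : (((cotR (twisted σ α) (twisted ω β)).toLinearMap :
      Tw σ ⊗[k] Tw ω →ₗ[k] Tw σ ⊗[k] (A ⊗[k] Tw ω)) ∘ₗ (rTw σ ω).toLinearMap) =
      LinearMap.rTensor (A ⊗[k] Tw ω) (toTw σ).toLinearMap ∘ₗ (((cotR (reg k A) (twisted ω β)).toLinearMap :
        A ⊗[k] Tw ω →ₗ[k] A ⊗[k] (A ⊗[k] Tw ω))) := by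
    refine TensorProduct.ext' fun a t => ?_
    have key : ∀ y : A ⊗[k] A, TensorProduct.assoc k (Tw σ) A (Tw ω)
        (LinearMap.rTensor A (toTw σ).toLinearMap y ⊗ₜ t) =
        LinearMap.rTensor (A ⊗[k] Tw ω) (toTw σ).toLinearMap
          (TensorProduct.assoc k A A (Tw ω) (y ⊗ₜ t)) := by
      intro y
      induction y with
      | zero => simp only [LinearMap.map_zero, LinearEquiv.map_zero, zero_tmul]
      | add x y hx hy => simp only [LinearMap.map_add, LinearEquiv.map_add, add_tmul, hx, hy]
      | tmul c d => rfl
    exact key (Coalgebra.comul a)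
  exact LinearMap.congr_fun h y

theorem cotL_rTw (y : A ⊗[k] Tw ω) :
    cotL (twisted σ α) (twisted ω β) (rTw σ ω y) =
      LinearMap.rTensor (A ⊗[k] Tw ω) (toTw σ).toLinearMap
        (cotL (reg k A) (twisted ω β) y) := by
  have h : (((cotL (twisted σ α) (twisted ω β)).toLinearMap :
      Tw σ ⊗[k] Tw ω →ₗ[k] Tw σ ⊗[k] (A ⊗[k] Tw ω)) ∘ₗ (rTw σ ω).toLinearMap) =
      LinearMap.rTensor (A ⊗[k] Tw ω) (toTw σ).toLinearMap ∘ₗ (((cotL (reg k A) (twisted ω β)).toLinearMap :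
        A ⊗[k] Tw ω →ₗ[k] A ⊗[k] (A ⊗[k] Tw ω))) := by
    refine TensorProduct.ext' fun a t => ?_
    rfl
  exact LinearMap.congr_fun h y

theorem ambL_rTw (y : A ⊗[k] Tw ω) :
    ambL (twisted σ α) (twisted ω β) (rTw σ ω y) =
      TensorProduct.map (α : A →ₗc[k] A).toLinearMap (rTw σ ω).toLinearMap
        (ambL (reg k A) (twisted ω β) y) := by
  have h : (((ambL (twisted σ α) (twisted ω β)).toLinearMap :
      Tw σ ⊗[k] Tw ω →ₗ[k] A ⊗[k] (Tw σ ⊗[k] Tw ω)) ∘ₗ (rTw σ ω).toLinearMap) =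
      TensorProduct.map (α : A →ₗc[k] A).toLinearMap (rTw σ ω).toLinearMap ∘ₗ (((ambL (reg k A) (twisted ω β)).toLinearMap :
        A ⊗[k] Tw ω →ₗ[k] A ⊗[k] (A ⊗[k] Tw ω))) := by
    refine TensorProduct.ext' fun a t => ?_
    have key : ∀ y : A ⊗[k] A, TensorProduct.assoc k A (Tw σ) (Tw ω)
        (TensorProduct.map (α : A →ₗc[k] A).toLinearMap (toTw σ).toLinearMap y ⊗ₜ t) =
        TensorProduct.map (α : A →ₗc[k] A).toLinearMap (rTw σ ω).toLinearMap
          (TensorProduct.assoc k A A (Tw ω) (y ⊗ₜ t)) := by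
      intro y
      induction y with
      | zero => simp only [LinearMap.map_zero, LinearEquiv.map_zero, zero_tmul]
      | add x y hx hy => simp only [LinearMap.map_add, LinearEquiv.map_add, add_tmul, hx, hy]
      | tmul c d => rfl
    exact (congrArg (fun w : A ⊗[k] Tw σ => TensorProduct.assoc k A (Tw σ) (Tw ω) (w ⊗ₜ t))
      (twLeftAut_toTw σ α a)).trans (key (Coalgebra.comul a))
  exact LinearMap.congr_fun h y

theorem ambR_rTw (y : A ⊗[k] Tw ω) :
    ambR (twisted σ α) (twisted ω β) (rTw σ ω y) =
      LinearMap.rTensor A (rTw σ ω).toLinearMap (ambR (reg k A) (twisted ω β) y) := by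
  have h : (((ambR (twisted σ α) (twisted ω β)).toLinearMap :
      Tw σ ⊗[k] Tw ω →ₗ[k] (Tw σ ⊗[k] Tw ω) ⊗[k] A) ∘ₗ (rTw σ ω).toLinearMap) =
      LinearMap.rTensor A (rTw σ ω).toLinearMap ∘ₗ (((ambR (reg k A) (twisted ω β)).toLinearMap :
        A ⊗[k] Tw ω →ₗ[k] (A ⊗[k] Tw ω) ⊗[k] A)) := by
    refine TensorProduct.ext' fun a t => ?_
    have key : ∀ y : Tw ω ⊗[k] A, (TensorProduct.assoc k (Tw σ) (Tw ω) A).symm (toTw σ a ⊗ₜ y) =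
        LinearMap.rTensor A (rTw σ ω).toLinearMap
          ((TensorProduct.assoc k A (Tw ω) A).symm (a ⊗ₜ y)) := by
      intro y
      induction y with
      | zero => simp only [LinearMap.map_zero, LinearEquiv.map_zero, tmul_zero]
      | add x y hx hy => simp only [LinearMap.map_add, LinearEquiv.map_add, tmul_add, hx, hy]
      | tmul c d => rfl
    exact key (twRight ω t)
  exact LinearMap.congr_fun h y

/-- Coassociativity of the left coaction of `^βA(ω)` yields β(a₁) ⊗ β(a₂) ⊗ a₃, and applying α to
the first factor produces the automorphism αβ. -/
theorem ambL_twCotensorLin (a : A) :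
    (ambL (twisted σ α) (twisted ω β) (twCotensorLin σ ω β (toTw (getsZ β σ * ω) a)) :
      A ⊗[k] (Tw σ ⊗[k] Tw ω)) = LinearMap.lTensor A (twCotensorLin σ ω β)
        (twLeftAut (getsZ β σ * ω) (α * β) (toTw (getsZ β σ * ω) a)) := by
  have h1 : (ambL (reg k A) (twisted ω β) (twLeftAut ω β (toTw ω a)) :
      A ⊗[k] (A ⊗[k] Tw ω)) = LinearMap.lTensor A (twLeftAut ω β).toLinearMap
        (twLeftAut ω β (toTw ω a)) := (isCotensorMap_reg (twisted ω β)).left (toTw ω a)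
  have key : ∀ y : A ⊗[k] A, TensorProduct.map (α : A →ₗc[k] A).toLinearMap
      (rTw σ ω).toLinearMap (LinearMap.lTensor A (twLeftAut ω β).toLinearMap
        (TensorProduct.map (β : A →ₗc[k] A).toLinearMap (toTw ω).toLinearMap y)) =
      LinearMap.lTensor A (twCotensorLin σ ω β) (TensorProduct.map
        ((α * β : A ≃ₐc[k] A) : A →ₗc[k] A).toLinearMap
          (toTw (getsZ β σ * ω)).toLinearMap y) := by
    intro y
    induction y with
    | zero => simp only [LinearMap.map_zero]
    | add x y hx hy => simp only [LinearMap.map_add, hx, hy]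
    | tmul c d => rfl
  have h2 : (ambL (twisted σ α) (twisted ω β) (twCotensorLin σ ω β (toTw (getsZ β σ * ω) a)) :
      A ⊗[k] (Tw σ ⊗[k] Tw ω)) = TensorProduct.map (α : A →ₗc[k] A).toLinearMap
        (rTw σ ω).toLinearMap (ambL (reg k A) (twisted ω β) (twLeftAut ω β (toTw ω a))) :=
    ambL_rTw σ ω α β (twLeftAut ω β (toTw ω a))
  have h3 := congrArg (TensorProduct.map (α : A →ₗc[k] A).toLinearMap (rTw σ ω).toLinearMap) h1
  have h4 := congrArg (fun y : A ⊗[k] Tw ω => TensorProduct.map (α : A →ₗc[k] A).toLinearMap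
    (rTw σ ω).toLinearMap (LinearMap.lTensor A (twLeftAut ω β).toLinearMap y))
      (twLeftAut_toTw ω β a)
  have h5 := congrArg (LinearMap.lTensor A (twCotensorLin σ ω β))
    (twLeftAut_toTw (getsZ β σ * ω) (α * β) a)
  exact h2.trans (h3.trans (h4.trans ((key _).trans h5.symm)))

theorem ambR_twCotensorLin (a : A) :
    (ambR (twisted σ α) (twisted ω β) (twCotensorLin σ ω β (toTw (getsZ β σ * ω) a)) :
      (Tw σ ⊗[k] Tw ω) ⊗[k] A) = LinearMap.rTensor A (twCotensorLin σ ω β)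
        (twRight (getsZ β σ * ω) (toTw (getsZ β σ * ω) a)) := by
  have h1 : (ambR (reg k A) (twisted ω β) (twLeftAut ω β (toTw ω a)) :
      (A ⊗[k] Tw ω) ⊗[k] A) = LinearMap.rTensor A (twLeftAut ω β).toLinearMap
        (twRight ω (toTw ω a)) := (isCotensorMap_reg (twisted ω β)).right (toTw ω a)
  have key : ∀ y : A ⊗[k] A, LinearMap.rTensor A (rTw σ ω).toLinearMap
      (LinearMap.rTensor A (twLeftAut ω β).toLinearMap
        (LinearMap.rTensor A (toTw ω).toLinearMap y)) =
      LinearMap.rTensor A (twCotensorLin σ ω β)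
        (LinearMap.rTensor A (toTw (getsZ β σ * ω)).toLinearMap y) := by
    intro y
    induction y with
    | zero => simp only [LinearMap.map_zero]
    | add x y hx hy => simp only [LinearMap.map_add, hx, hy]
    | tmul c d => rfl
  have h2 : (ambR (twisted σ α) (twisted ω β) (twCotensorLin σ ω β (toTw (getsZ β σ * ω) a)) :
      (Tw σ ⊗[k] Tw ω) ⊗[k] A) = LinearMap.rTensor A
        (rTw σ ω).toLinearMap (ambR (reg k A) (twisted ω β) (twLeftAut ω β (toTw ω a))) :=
    ambR_rTw σ ω α β (twLeftAut ω β (toTw ω a))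
  have h3 := congrArg (LinearMap.rTensor A (rTw σ ω).toLinearMap) h1
  exact h2.trans (h3.trans (key (Coalgebra.comul a)))

/-- As a linear map `twCotensor` is the left coaction of `^βA(ω)` with `A` relabelled as `A(σ)`.
Injectivity and the description of the image are therefore those of the unit law
`isCotensorMap_reg`. -/
theorem isCotensorMap_twCotensor : IsCotensorMap (twisted σ α) (twisted ω β)
    (twisted (getsZ β σ * ω) (α * β)) (twCotensor σ ω β) where
  injective := by
    have h := (rTw σ ω).injective.comp ((isCotensorMap_reg (twisted ω β)).injective.comp
      ((toTw (getsZ β σ * ω)).symm.trans (toTw ω)).injective)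
    exact h
  mem_range_iff x := by
    obtain ⟨y, rfl⟩ := (rTw σ ω).surjective x
    have h1 : rTw σ ω y ∈ LinearMap.range (twCotensor σ ω β).toLinearMap ↔
        y ∈ LinearMap.range (twLeftAut ω β).toLinearMap :=
      ⟨fun ⟨w, hw⟩ => ⟨(toTw ω) ((toTw (getsZ β σ * ω)).symm w), (rTw σ ω).injective hw⟩,
        fun ⟨w, hw⟩ => ⟨(toTw (getsZ β σ * ω)) ((toTw ω).symm w), congrArg (rTw σ ω) hw⟩⟩
    have h2 : Function.Injective
        (LinearMap.rTensor (A ⊗[k] Tw ω) (toTw σ).toLinearMap) :=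
      (LinearEquiv.rTensor (A ⊗[k] Tw ω) (toTw σ)).injective
    refine h1.trans (((isCotensorMap_reg (twisted ω β)).mem_range_iff y).trans ⟨fun h => ?_,
      fun h => h2 ?_⟩)
    · exact (cotR_rTw σ ω α β y).trans ((congrArg _ h).trans (cotL_rTw σ ω α β y).symm)
    · exact (cotR_rTw σ ω α β y).symm.trans (h.trans (cotL_rTw σ ω α β y))
  left w := ambL_twCotensorLin σ ω α β ((toTw (getsZ β σ * ω)).symm w)
  right w := ambR_twCotensorLin σ ω α β ((toTw (getsZ β σ * ω)).symm w)

end BicomodAlg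

/-! ### Isomorphisms between the objects attached to lazy cocycles -/

theorem toConv_comul : toConv (Coalgebra.comul : A →ₗ[k] A ⊗[k] A) =
    push Algebra.TensorProduct.includeLeft (idm k A) *
      push Algebra.TensorProduct.includeRight (idm k A) := by
  rw [idm, ← map_comp_comul, TensorProduct.map_id, LinearMap.id_comp]

theorem comul_slideL (γ : WithConv (A →ₗ[k] k)) (a : A) :
    Coalgebra.comul (R := k) (slideL γ a) =
      LinearMap.rTensor A (slideL γ) (Coalgebra.comul (R := k) a) := by
  have h1 := toConv_comp_slideL (Coalgebra.comul : A →ₗ[k] A ⊗[k] A) γ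
  have h2 := map_comp_comul (slideL γ) (LinearMap.id : A →ₗ[k] A)
  rw [toConv_comul] at h1
  rw [slideL, toConv_ofConv, map_mul, push_sc, mul_assoc] at h2
  exact congrArg (fun g : WithConv (A →ₗ[k] A ⊗[k] A) => g a) (h1.trans h2.symm)

theorem counit_comp_slideL (γ : WithConv (A →ₗ[k] k)) :
    toConv ((Coalgebra.counit : A →ₗ[k] k) ∘ₗ slideL γ) = γ := by
  rw [toConv_comp_slideL]
  exact mul_one γ

/-- Apply ε to the first factor of Δ(f(a)) = f(a₁) ⊗ a₂: a right colinear endomorphism of `A` is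
determined by its composite with ε. -/
theorem eq_slideL {f : A →ₗ[k] A} (h : ∀ a, Coalgebra.comul (R := k) (f a) =
    LinearMap.rTensor A f (Coalgebra.comul (R := k) a)) :
    f = slideL (toConv ((Coalgebra.counit : A →ₗ[k] k) ∘ₗ f)) := by
  have h1 : (slideL (toConv ((Coalgebra.counit : A →ₗ[k] k) ∘ₗ f)) : A →ₗ[k] A) =
      (TensorProduct.lid k A).toLinearMap ∘ₗ LinearMap.rTensor A
        ((Coalgebra.counit : A →ₗ[k] k) ∘ₗ f) ∘ₗ Coalgebra.comul := by
    refine LinearMap.ext fun a => ?_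
    rw [slideL]
    refine (LinearMap.convMul_apply _ _ a).trans ?_
    change _ = TensorProduct.lid k A (LinearMap.rTensor A
      ((Coalgebra.counit : A →ₗ[k] k) ∘ₗ f) (Coalgebra.comul a))
    induction Coalgebra.comul (R := k) a with
    | zero => simp only [LinearMap.map_zero, LinearEquiv.map_zero]
    | add x y hx hy => simp only [LinearMap.map_add, LinearEquiv.map_add, hx, hy]
    | tmul x y => simp [Algebra.smul_def]
  rw [h1]
  refine LinearMap.ext fun a => ?_
  change _ = TensorProduct.lid k A (LinearMap.rTensor A
    ((Coalgebra.counit : A →ₗ[k] k) ∘ₗ f) (Coalgebra.comul a))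
  rw [LinearMap.rTensor_comp_apply, ← h, Coalgebra.rTensor_counit_comul, lid_tmul, one_smul]

/-- Followed by ε, the product of `A` becomes the unit of the convolution algebra, so the form can
be recovered. -/
theorem sc_mul_mulm_injective {f g : WithConv (A ⊗[k] A →ₗ[k] k)}
    (h : sc A f * mulm k A = sc A g * mulm k A) : f = g := by
  have h1 := congrArg (push (Bialgebra.counitAlgHom k A)) h
  have h2 : push (Bialgebra.counitAlgHom k A) (mulm k A) = 1 :=
    congrArg toConv (mulC k A).counit_comp
  rw [map_mul, map_mul, push_sc, push_sc, h2, mul_one, mul_one] at h1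
  exact h1

/-- Writing m for the product of `A`, the slide of a σ-product is σ * (γ ∘ m) * m, and the ω-product
of two slides is (γ ⊗ γ) * ω * m. Cancelling m leaves σ * (γ ∘ m) = (γ ⊗ γ) * ω. As ω is lazy it
commutes with γ ∘ m, so dividing by the latter gives ∂γ * ω. -/
theorem slideL_twMul_iff {γ : InvForm k A} {σ ω : InvForm k (A ⊗[k] A)} (hω : IsLazy2 ω) :
    (∀ a b, slideL (γ : WithConv (A →ₗ[k] k)) (twMul σ (a ⊗ₜ b)) =
      twMul ω (slideL (γ : WithConv (A →ₗ[k] k)) a ⊗ₜ slideL (γ : WithConv (A →ₗ[k] k)) b)) ↔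
      σ = del γ * ω := by
  have h1 : toConv (slideL (γ : WithConv (A →ₗ[k] k)) ∘ₗ twMul σ) =
      sc A (σ * upull (mulC k A) γ : InvForm k _).1 * mulm k A := by
    have e : toConv (slideL (γ : WithConv (A →ₗ[k] k)) ∘ₗ (mulm k A).ofConv) =
        pull (mulC k A) (sc A (γ : WithConv (A →ₗ[k] k)) * idm k A) := rfl
    rw [twMul, comp_sc_mul, Units.val_mul, map_mul, mul_assoc, e, map_mul]
    rfl
  have h2 : toConv (twMul ω ∘ₗ TensorProduct.map (slideL (γ : WithConv (A →ₗ[k] k)))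
      (slideL (γ : WithConv (A →ₗ[k] k)))) =
      sc A (upull (fst k A A) γ * upull (snd k A A) γ * ω : InvForm k _).1 * mulm k A := by
    have e1 := map_sc_mul_left (γ : WithConv (A →ₗ[k] k)) (idm k A)
      (slideL (γ : WithConv (A →ₗ[k] k)))
    have e2 := map_sc_mul_right (γ : WithConv (A →ₗ[k] k)) (LinearMap.id : A →ₗ[k] A) (idm k A)
    have e3 : toConv (TensorProduct.map (LinearMap.id : A →ₗ[k] A) (idm k A).ofConv) =
        toConv LinearMap.id := congrArg toConv TensorProduct.map_id
    have e4 : TensorProduct.map (slideL (γ : WithConv (A →ₗ[k] k)))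
        (slideL (γ : WithConv (A →ₗ[k] k))) = _ := congrArg ofConv (e1.trans (congrArg _ e2))
    rw [e4, comp_sc_mul, comp_sc_mul, e3, Units.val_mul, Units.val_mul, map_mul, map_mul, mul_assoc,
      mul_assoc]
    rfl
  have h3 : (∀ a b, slideL (γ : WithConv (A →ₗ[k] k)) (twMul σ (a ⊗ₜ b)) =
      twMul ω (slideL (γ : WithConv (A →ₗ[k] k)) a ⊗ₜ slideL (γ : WithConv (A →ₗ[k] k)) b)) ↔
      toConv (slideL (γ : WithConv (A →ₗ[k] k)) ∘ₗ twMul σ) =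
      toConv (twMul ω ∘ₗ TensorProduct.map (slideL (γ : WithConv (A →ₗ[k] k)))
      (slideL (γ : WithConv (A →ₗ[k] k)))) :=
    ⟨fun h => conv_ext h, fun h a b =>
      congrArg (fun g : WithConv (A ⊗[k] A →ₗ[k] A) => g (a ⊗ₜ b)) h⟩
  have h4 : upull (fst k A A) γ * upull (snd k A A) γ * ω =
      del γ * ω * upull (mulC k A) γ := by
    rw [mul_assoc (del γ), (hω.commute_mulC γ).eq, del, map_inv]
    group
  rw [h3, h1, h2]
  refine ⟨fun h => ?_, fun h => ?_⟩
  · have h5 := Units.ext (sc_mul_mulm_injective h)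
    rw [h4] at h5
    exact mul_right_cancel h5
  · rw [h, h4]

/-- The condition reads γ(a₁) β(a₂) ⊗ a₃ = α(a₁) γ(a₂) ⊗ a₃. Removing the last factor by ε loses
nothing, since it can be multiplied back in. What remains is γ * β = α * γ, that is, α = γ * β * γ⁻¹
= β ∘ ad(γ⁻¹). -/
theorem comul_slideL_iff {γ : InvForm k A} {α β : A ≃ₐc[k] A} :
    (∀ a, TensorProduct.map (β : A →ₗc[k] A).toLinearMap LinearMap.id
        (Coalgebra.comul (R := k) (slideL (γ : WithConv (A →ₗ[k] k)) a)) =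
      TensorProduct.map (α : A →ₗc[k] A).toLinearMap (slideL (γ : WithConv (A →ₗ[k] k)))
        (Coalgebra.comul (R := k) a)) ↔
      (α : A →ₗc[k] A).toLinearMap = (β : A →ₗc[k] A).toLinearMap ∘ₗ ad γ⁻¹ := by
  let a' : WithConv (A →ₗ[k] A) := toConv (α : A →ₗc[k] A).toLinearMap
  let b' : WithConv (A →ₗ[k] A) := toConv (β : A →ₗc[k] A).toLinearMap
  have h1 := toConv_comp_slideL ((TensorProduct.map (β : A →ₗc[k] A).toLinearMap
    (LinearMap.id : A →ₗ[k] A)) ∘ₗ Coalgebra.comul) (γ : WithConv (A →ₗ[k] k))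
  rw [map_comp_comul] at h1
  have h2 := map_comp_comul (α : A →ₗc[k] A).toLinearMap (slideL (γ : WithConv (A →ₗ[k] k)))
  rw [slideL, toConv_ofConv, map_mul, push_sc] at h2
  have h3 : (∀ a, TensorProduct.map (β : A →ₗc[k] A).toLinearMap LinearMap.id
        (Coalgebra.comul (R := k) (slideL (γ : WithConv (A →ₗ[k] k)) a)) =
      TensorProduct.map (α : A →ₗc[k] A).toLinearMap (slideL (γ : WithConv (A →ₗ[k] k)))
        (Coalgebra.comul (R := k) a)) ↔
      sc (A ⊗[k] A) (γ : WithConv (A →ₗ[k] k)) *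
        (push Algebra.TensorProduct.includeLeft b' *
          push Algebra.TensorProduct.includeRight (idm k A)) =
      push Algebra.TensorProduct.includeLeft a' *
        (sc (A ⊗[k] A) (γ : WithConv (A →ₗ[k] k)) *
          push Algebra.TensorProduct.includeRight (idm k A)) :=
    ⟨fun h => h1.symm.trans ((WithConv.ext (LinearMap.ext h)).trans h2),
      fun h a => congrArg (fun g : WithConv (A →ₗ[k] A ⊗[k] A) => g a)
        (h1.trans (h.trans h2.symm))⟩
  have h4 : (sc A (γ : WithConv (A →ₗ[k] k)) * b' = a' * sc A (γ : WithConv (A →ₗ[k] k))) ↔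
      (α : A →ₗc[k] A).toLinearMap = (β : A →ₗc[k] A).toLinearMap ∘ₗ ad γ⁻¹ := by
    have e : toConv ((β : A →ₗc[k] A).toLinearMap ∘ₗ ad γ⁻¹) =
        sc A (γ : WithConv (A →ₗ[k] k)) * b' *
          (((Units.map (sc A) γ)⁻¹ : (WithConv (A →ₗ[k] A))ˣ) : WithConv (A →ₗ[k] A)) := by
      rw [comp_ad, inv_inv]
      rfl
    refine Iff.trans ?_ toConv_injective.eq_iff
    rw [e, Units.eq_mul_inv_iff_mul_eq]
    exact eq_comm
  rw [h3, ← h4]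
  refine ⟨fun h => ?_, fun h => ?_⟩
  -- The algebra map id ⊗ ε, which removes the last factor.
  · let ρ : A ⊗[k] A →ₐ[k] A := (Algebra.TensorProduct.rid k k A).toAlgHom.comp
      (Algebra.TensorProduct.map (AlgHom.id k A) (Bialgebra.counitAlgHom k A))
    have e1 : ∀ g : WithConv (A →ₗ[k] A), push ρ (push Algebra.TensorProduct.includeLeft g) = g :=
      fun g => WithConv.ext (LinearMap.ext fun a => by
        change ρ (g a ⊗ₜ 1) = g a
        simp [ρ])
    have e2 : push ρ (push Algebra.TensorProduct.includeRight (idm k A)) = 1 :=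
      WithConv.ext (LinearMap.ext fun a => by
        change ρ (1 ⊗ₜ a) = algebraMap k A (Coalgebra.counit a)
        simp [ρ, Algebra.smul_def])
    have h5 := congrArg (push ρ) h
    simp only [map_mul, push_sc, e1, e2, mul_one] at h5
    exact h5
  · have h5 := congrArg (push (Algebra.TensorProduct.includeLeft : A →ₐ[k] A ⊗[k] A)) h
    rw [map_mul, map_mul, push_sc] at h5
    rw [← mul_assoc, h5, mul_assoc]

section

variable {σ ω : Z2L k A} (F : Tw σ →ₗ[k] Tw ω) {f : A →ₗ[k] A}

/-- This lemma and the two after it remove the identifications of `A` with `A(σ)` and `A(ω)`: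
colinearity and multiplicativity of F become conditions on the endomorphism f of `A`, ready for the
criteria on slides. -/
theorem twRight_comm_iff (hF : ∀ a, F (toTw σ a) = toTw ω (f a)) :
    (∀ a, twRight ω (F (toTw σ a)) = LinearMap.rTensor A F (twRight σ (toTw σ a))) ↔
      ∀ a, Coalgebra.comul (R := k) (f a) = LinearMap.rTensor A f (Coalgebra.comul (R := k) a) := by
  have h : F ∘ₗ (toTw σ).toLinearMap = (toTw ω).toLinearMap ∘ₗ f := LinearMap.ext hF
  have inj : Function.Injective (LinearMap.rTensor A (toTw ω).toLinearMap) :=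
    (LinearEquiv.rTensor A (toTw ω)).injective
  refine forall_congr' fun a => ?_
  rw [hF, twRight_toTw, twRight_toTw, ← LinearMap.rTensor_comp_apply, h,
    LinearMap.rTensor_comp_apply]
  exact inj.eq_iff

theorem twLeftAut_comm_iff (hF : ∀ a, F (toTw σ a) = toTw ω (f a)) (α β : A ≃ₐc[k] A) :
    (∀ a, twLeftAut ω β (F (toTw σ a)) = LinearMap.lTensor A F (twLeftAut σ α (toTw σ a))) ↔
      ∀ a, TensorProduct.map (β : A →ₗc[k] A).toLinearMap LinearMap.id
          (Coalgebra.comul (R := k) (f a)) =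
        TensorProduct.map (α : A →ₗc[k] A).toLinearMap f (Coalgebra.comul (R := k) a) := by
  have inj : Function.Injective (LinearMap.lTensor A (toTw ω).toLinearMap) :=
    (LinearEquiv.lTensor A (toTw ω)).injective
  have h1 : TensorProduct.map (β : A →ₗc[k] A).toLinearMap (toTw ω).toLinearMap =
      LinearMap.lTensor A (toTw ω).toLinearMap ∘ₗ
        TensorProduct.map (β : A →ₗc[k] A).toLinearMap LinearMap.id :=
    TensorProduct.ext' fun _ _ => rfl
  have h2 : LinearMap.lTensor A F ∘ₗ
      TensorProduct.map (α : A →ₗc[k] A).toLinearMap (toTw σ).toLinearMap =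
      LinearMap.lTensor A (toTw ω).toLinearMap ∘ₗ
        TensorProduct.map (α : A →ₗc[k] A).toLinearMap f :=
    TensorProduct.ext' fun a b => congrArg (fun t => α a ⊗ₜ[k] t) (hF b)
  refine forall_congr' fun a => ?_
  have l1 : twLeftAut ω β (F (toTw σ a)) = LinearMap.lTensor A (toTw ω).toLinearMap
      (TensorProduct.map (β : A →ₗc[k] A).toLinearMap LinearMap.id
        (Coalgebra.comul (R := k) (f a))) :=
    (congrArg (twLeftAut ω β) (hF a)).trans
      ((twLeftAut_toTw ω β (f a)).trans (LinearMap.congr_fun h1 _))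
  have l2 : LinearMap.lTensor A F (twLeftAut σ α (toTw σ a)) =
      LinearMap.lTensor A (toTw ω).toLinearMap
        (TensorProduct.map (α : A →ₗc[k] A).toLinearMap f (Coalgebra.comul (R := k) a)) :=
    (congrArg (LinearMap.lTensor A F) (twLeftAut_toTw σ α a)).trans (LinearMap.congr_fun h2 _)
  exact ⟨fun h => inj (l1.symm.trans (h.trans l2)), fun h =>
    l1.trans ((congrArg (LinearMap.lTensor A (toTw ω).toLinearMap) h).trans l2.symm)⟩

theorem tw_map_mul_iff (hF : ∀ a, F (toTw σ a) = toTw ω (f a)) :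
    (∀ a b, F (toTw σ a * toTw σ b) = F (toTw σ a) * F (toTw σ b)) ↔
      ∀ a b, f (twMul σ.1 (a ⊗ₜ b)) = twMul ω.1 (f a ⊗ₜ f b) := by
  refine forall₂_congr fun a b => ?_
  rw [toTw_mul, hF, hF, hF, toTw_mul]
  exact (toTw ω).injective.eq_iff

theorem exists_eq_slideL {σ ω : Z2L k A} (e : Tw σ ≃ₐ[k] Tw ω)
    (hr : ∀ z, twRight ω (e z) = LinearMap.rTensor A e.toLinearMap (twRight σ z)) :
    ∃ γ : WithConv (A →ₗ[k] k), ∀ a, e (toTw σ a) = toTw ω (slideL γ a) := by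
  let f : A →ₗ[k] A := (toTw ω).symm.toLinearMap ∘ₗ e.toLinearMap ∘ₗ (toTw σ).toLinearMap
  have hf : ∀ a, e.toLinearMap (toTw σ a) = toTw ω (f a) := fun a => rfl
  have h1 := eq_slideL ((twRight_comm_iff e.toLinearMap hf).1 fun a => hr (toTw σ a))
  exact ⟨_, fun a => (hf a).trans (congrArg (toTw ω) (LinearMap.congr_fun h1 a))⟩

end

theorem slideL_one {γ : InvForm k A} (h : γ ∈ Reg1 k A) :
    slideL (γ : WithConv (A →ₗ[k] k)) (1 : A) = 1 := by
  have h1 : (γ : WithConv (A →ₗ[k] k)) 1 = 1 := h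
  rw [slideL]
  refine (LinearMap.convMul_apply _ _ _).trans ?_
  rw [Bialgebra.comul_one, Algebra.TensorProduct.one_def]
  simp [h1]

namespace BicomodAlg

variable {σ ω : Z2L k A} {α β : A ≃ₐc[k] A}

/-- The isomorphism is a ↦ γ(a₁) a₂; the normalization γ(1) = 1 makes it unital. -/
theorem iso_twisted_of_eq {γ : InvForm k A} (h : γ ∈ Reg1 k A)
    (hα : (α : A →ₗc[k] A).toLinearMap = (β : A →ₗc[k] A).toLinearMap ∘ₗ ad γ⁻¹)
    (hσ : σ.1 = del γ * ω.1) : Iso (twisted σ α) (twisted ω β) := by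
  let g := LinearEquiv.ofBijective _ (slideL_bijective γ)
  let F : Tw σ ≃ₗ[k] Tw ω := ((toTw σ).symm.trans g).trans (toTw ω)
  have hF : ∀ a, F.toLinearMap (toTw σ a) = toTw ω (slideL (γ : WithConv (A →ₗ[k] k)) a) :=
    fun a => rfl
  have h1 := (tw_map_mul_iff F.toLinearMap hF).2 ((slideL_twMul_iff ω.2.1.2).2 hσ)
  have h2 := (twRight_comm_iff F.toLinearMap hF).2 (comul_slideL _)
  have h3 := (twLeftAut_comm_iff F.toLinearMap hF α β).2 (comul_slideL_iff.2 hα)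
  have h0 : F 1 = 1 := (hF 1).trans (congrArg (toTw ω) (slideL_one h))
  let e : Tw σ ≃ₐ[k] Tw ω := AlgEquiv.ofLinearEquiv F h0 fun x y =>
    h1 ((toTw σ).symm x) ((toTw σ).symm y)
  exact ⟨e, fun z => h3 ((toTw σ).symm z), fun z => h2 ((toTw σ).symm z)⟩

/-- Right colinearity makes both the isomorphism and its inverse slides, along forms g and g'. These
are inverse to each other for convolution, so g is an invertible form γ; the two criteria on slides
then translate left colinearity and multiplicativity into the two equations. -/
theorem exists_of_iso_twisted (h : Iso (twisted σ α) (twisted ω β)) : ∃ γ ∈ Reg1 k A,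
    (α : A →ₗc[k] A).toLinearMap = (β : A →ₗc[k] A).toLinearMap ∘ₗ ad γ⁻¹ ∧
      σ.1 = del γ * ω.1 := by
  obtain ⟨e, hl, hr⟩ : ∃ e : Tw σ ≃ₐ[k] Tw ω,
    (∀ z, twLeftAut ω β (e z) = LinearMap.lTensor A e.toLinearMap (twLeftAut σ α z)) ∧
    (∀ z, twRight ω (e z) = LinearMap.rTensor A e.toLinearMap (twRight σ z)) := h
  have hr' : ∀ z, twRight σ (e.symm z) =
      LinearMap.rTensor A e.symm.toLinearMap (twRight ω z) := by
    intro z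
    have he : e.symm.toLinearMap ∘ₗ e.toLinearMap = LinearMap.id :=
      LinearMap.ext e.symm_apply_apply
    have h1 := hr (e.symm z)
    rw [e.apply_symm_apply] at h1
    rw [h1, ← LinearMap.rTensor_comp_apply, he, LinearMap.rTensor_id]
    rfl
  obtain ⟨g, hg⟩ := exists_eq_slideL e hr
  obtain ⟨g', hg'⟩ := exists_eq_slideL e.symm hr'
  -- Composing slides multiplies the forms, and ε recovers a form from its slide.
  have inv : ∀ (g g' : WithConv (A →ₗ[k] k)), (∀ a, slideL g' (slideL g a) = a) →
      g * g' = 1 := by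
    intro g g' h
    have h1 : toConv (slideL g' ∘ₗ slideL g) = toConv (LinearMap.id : A →ₗ[k] A) :=
      WithConv.ext (LinearMap.ext h)
    rw [toConv_comp_slideL, slideL, toConv_ofConv, ← mul_assoc, ← map_mul] at h1
    have h2 : toConv ((Coalgebra.counit : A →ₗ[k] k) ∘ₗ slideL (g * g')) = toConv
        ((Coalgebra.counit : A →ₗ[k] k) ∘ₗ LinearMap.id) :=
      congrArg (fun f : WithConv (A →ₗ[k] A) => toConv (Coalgebra.counit ∘ₗ f.ofConv)) h1
    rw [counit_comp_slideL] at h2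
    exact h2
  let γ : InvForm k A := ⟨g, g',
    inv g g' fun a => (toTw σ).injective ((hg' _).symm.trans
      ((congrArg e.symm (hg a).symm).trans (e.symm_apply_apply _))),
    inv g' g fun a => (toTw ω).injective ((hg _).symm.trans
      ((congrArg e (hg' a).symm).trans (e.apply_symm_apply _)))⟩
  have hF : ∀ a, e.toLinearMap (toTw σ a) =
      toTw ω (slideL (γ : WithConv (A →ₗ[k] k)) a) := hg
  refine ⟨γ, ?_, comul_slideL_iff.1 ((twLeftAut_comm_iff e.toLinearMap hF α β).1 fun a => hl _),
    (slideL_twMul_iff ω.2.1.2).1 ((tw_map_mul_iff e.toLinearMap hF).1 fun a b => map_mul e _ _)⟩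
  have h1 : slideL g (1 : A) = 1 := (toTw ω).injective ((hg 1).symm.trans (map_one e))
  have h2 := congrArg (fun f : WithConv (A →ₗ[k] k) => f 1) (counit_comp_slideL g)
  change g 1 = 1
  refine h2.symm.trans ?_
  change Coalgebra.counit (slideL g (1 : A)) = 1
  rw [h1, Bialgebra.counit_one]

end BicomodAlg

/-! ### The morphisms of the exact sequence -/

theorem ad_eq_id_iff {μ : InvForm k A} : ad μ = LinearMap.id ↔ IsLazy1 μ := by
  have h : toConv (ad μ) = (((Units.map (sc A) μ)⁻¹ : (WithConv (A →ₗ[k] A))ˣ) :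
      WithConv (A →ₗ[k] A)) * (idm k A * sc A (μ : WithConv (A →ₗ[k] k))) := by
    rw [ad, toConv_ofConv, mul_assoc]
    rfl
  rw [← toConv_injective.eq_iff, h, Units.inv_mul_eq_iff_eq_mul]
  exact eq_comm

theorem ad_comp_ad_inv (γ : InvForm k A) : ad γ ∘ₗ ad γ⁻¹ = LinearMap.id := by
  rw [← ad_mul, mul_inv_cancel, ad_one]

theorem algUnit_mem_Reg1 (φ : A →ₐ[k] k) : algUnit φ ∈ Reg1 k A := map_one φ

theorem del_algUnit (φ : A →ₐ[k] k) : del (algUnit φ) = 1 := by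
  have h : upull (fst k A A) (algUnit φ) * upull (snd k A A) (algUnit φ) =
      upull (mulC k A) (algUnit φ) := by
    refine Units.ext (conv_ext fun a b => ?_)
    rw [Units.val_mul, val_upull, val_upull, fst_mul_snd]
    change φ a * φ b = φ (mulC k A (a ⊗ₜ b))
    rw [mulC_tmul, map_mul]
  rw [del, h, map_inv, mul_inv_cancel]

theorem upull_ad (γ : InvForm k A) {θ : InvForm k A} (h : IsLazy2 (del θ)) :
    upull (adEquiv θ h : A →ₗc[k] A) γ = θ⁻¹ * γ * θ :=
  Units.ext (comp_ad (γ : WithConv (A →ₗ[k] k)).ofConv θ)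

/-- Multiplicativity of ι in the cohomological component, valid already for cocycles. One has ∂(μ) ←
α = ∂(μ ∘ α) and γ⁻¹ ∘ ad(θ) = θ⁻¹ * γ⁻¹ * θ, and ∂ respects a product whose right factor has lazy
coboundary; multiplying by θ⁻¹ on the right leaves θ⁻¹ * γ⁻¹ = (γ * θ)⁻¹. -/
theorem getsZ_delAL (γ θ : RegAL k A) :
    getsZ (adHom k A θ) (delAL γ⁻¹) * delAL θ⁻¹ = delAL (γ * θ)⁻¹ := by
  refine Subtype.ext ?_
  change gets (del (γ⁻¹ : RegAL k A).1) (adEquiv θ.1 θ.2.2.2) * del (θ⁻¹ : RegAL k A).1 =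
    del ((γ * θ)⁻¹ : RegAL k A).1
  rw [gets_del, upull_ad, ← del_mul_of_lazy _ (θ⁻¹).2.2.2, Subgroup.coe_inv, Subgroup.coe_inv,
    Subgroup.coe_inv, Subgroup.coe_mul]
  congr 1
  group

variable (k A) in
/-- The morphism `γ ↦ (ad(γ), ∂(γ⁻¹))`. -/
def iotaAL : RegAL k A →* CoOutH2L k A :=
  MonoidHom.mk' (fun γ => ⟨QuotientGroup.mk (adHom k A γ), QuotientGroup.mk (delAL γ⁻¹)⟩)
    fun γ θ => CoOutH2L.ext (congrArg QuotientGroup.mk (map_mul (adHom k A) γ θ))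
      (congrArg QuotientGroup.mk (getsZ_delAL γ θ)).symm

/-- If ad(γ) = ad(φ) for an algebra map φ, then φ * γ⁻¹ is lazy, because its ad is the identity.
Since ∂φ = 1, its coboundary is ∂(γ⁻¹), which is therefore trivial in cohomology, and ι descends to
the quotient. -/
theorem delAL_inv_mem_B2L {γ : RegAL k A} (h : adHom k A γ ∈ CoInn k A) :
    delAL γ⁻¹ ∈ B2L k A := by
  obtain ⟨φ, hφ⟩ := mem_CoInn_iff.1 h
  have h1 : ad γ.1 = ad (algUnit φ) := hφ
  refine ⟨algUnit φ * (γ⁻¹ : RegAL k A).1,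
    ⟨mul_mem (algUnit_mem_Reg1 φ) (γ⁻¹).2.1, ad_eq_id_iff.1 ?_⟩, ?_⟩
  · rw [ad_mul, ← h1, Subgroup.coe_inv, ad_comp_ad_inv]
  · rw [del_mul_of_lazy _ (γ⁻¹).2.2.2, del_algUnit, one_mul]
    rfl

variable (k A) in
/-- The morphism `ι : CoOut⁻(A) → CoOut(A) ⋉ H²_L(A)`. -/
def iota : CoOutMinus k A →* CoOutH2L k A :=
  QuotientGroup.lift _ (iotaAL k A) fun _ h => CoOutH2L.ext
    ((QuotientGroup.eq_one_iff _).2 h) ((QuotientGroup.eq_one_iff _).2 (delAL_inv_mem_B2L h))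

variable (k A) in
-- The component in `CoOut(A)` suffices: the subgroup divided out is the full preimage of `CoInn(A)`
-- under ad.
theorem iota_injective : Function.Injective (iota k A) := by
  refine (injective_iff_map_eq_one _).2 fun x h => ?_
  induction x using QuotientGroup.induction_on with
  | H γ =>
    have h1 : (QuotientGroup.mk (adHom k A γ) : CoOut k A) = 1 := congrArg CoOutH2L.out h
    have h2 : adHom k A γ ∈ CoInn k A := (QuotientGroup.eq_one_iff _).1 h1
    exact (QuotientGroup.eq_one_iff γ).2 h2

/-- Slide along the algebra map φ that defines f: its coboundary is trivial, so the cocycle does not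
change, and ad(φ⁻¹) cancels f. -/
theorem iso_twisted_mul_CoInn (σ : Z2L k A) (α : A ≃ₐc[k] A) {f : A ≃ₐc[k] A}
    (hf : f ∈ CoInn k A) : BicomodAlg.Iso (twisted σ α) (twisted σ (α * f)) := by
  obtain ⟨φ, hφ⟩ := mem_CoInn_iff.1 hf
  refine BicomodAlg.iso_twisted_of_eq (algUnit_mem_Reg1 φ) ?_ ?_
  · have h : ((α * f : A ≃ₐc[k] A) : A →ₗc[k] A).toLinearMap =
        (α : A →ₗc[k] A).toLinearMap ∘ₗ ad (algUnit φ) := by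
      rw [← hφ]
      rfl
    rw [h, LinearMap.comp_assoc, ad_comp_ad_inv, LinearMap.comp_id]
  · rw [del_algUnit, one_mul]

/-- Slide along the lazy μ with ω = ∂μ: its ad is the identity, so the automorphism does not change,
and ∂μ commutes with the lazy σ, which brings it to the left as the criterion requires. -/
theorem iso_twisted_mul_B2L (σ : Z2L k A) (α : A ≃ₐc[k] A) {ω : Z2L k A} (hω : ω ∈ B2L k A) :
    BicomodAlg.Iso (twisted (σ * ω) α) (twisted σ α) := by
  obtain ⟨μ, hμ, h⟩ := hω
  refine BicomodAlg.iso_twisted_of_eq hμ.1 ?_ ?_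
  · rw [ad_eq_id_iff.2 (inv_mem hμ).2, LinearMap.comp_id]
  · rw [Subgroup.coe_mul, h, (commute_del hμ.2 σ.2.1.2).eq]

section

variable [Nontrivial k] [Module.Flat k A]

/-- The map `Υ : CoOut(A) ⋉ H²_L(A) → BiGal(A)`. -/
def upsilon (x : CoOutH2L k A) : BiGal k A :=
  Quotient.liftOn₂' x.out x.coh (fun α σ => BiGal.mk (BiGal.tw σ α)) (by
    intro α σ β ω hα hσ
    have h1 := iso_twisted_mul_CoInn σ α (QuotientGroup.leftRel_apply.1 hα)
    have h2 := iso_twisted_mul_B2L σ β (QuotientGroup.leftRel_apply.1 hσ)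
    rw [mul_inv_cancel_left] at h1 h2
    exact BiGal.mk_eq_mk.2 (h1.trans h2.symm))

theorem upsilon_mul {G : Group (BiGal k A)} (hG : IsCotensorGroup k A G) (x y : CoOutH2L k A) :
    upsilon (x * y) = G.mul (upsilon x) (upsilon y) := by
  obtain ⟨α, σ⟩ := x
  obtain ⟨β, ω⟩ := y
  induction α using QuotientGroup.induction_on with
  | H α =>
  induction σ using QuotientGroup.induction_on with
  | H σ =>
  induction β using QuotientGroup.induction_on with
  | H β =>
  induction ω using QuotientGroup.induction_on with
  | H ω =>
    exact ((hG (BiGal.tw σ α) (BiGal.tw ω β) (BiGal.tw (getsZ β σ * ω) (α * β))).2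
      (BicomodAlg.isCotensor_iff.2 ⟨_, BicomodAlg.isCotensorMap_twCotensor σ ω α β⟩)).symm

/-- For comparison with the trivial object the criterion reads α = ad(γ⁻¹) and σ = ∂γ; passing to
the inverse of γ puts it in the form of ι. The equalities hold for α and σ themselves and not merely
for their classes. -/
theorem mk_tw_eq_one_iff (σ : Z2L k A) (α : A ≃ₐc[k] A) :
    BiGal.mk (BiGal.tw σ α) = BiGal.mk (BiGal.tw 1 1) ↔
      ∃ γ : RegAL k A, adHom k A γ = α ∧ delAL γ⁻¹ = σ := by
  have h1 : ∀ f : A →ₗ[k] A, ((1 : A ≃ₐc[k] A) : A →ₗc[k] A).toLinearMap ∘ₗ f = f :=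
    fun _ => rfl
  rw [BiGal.mk_eq_mk]
  constructor
  · intro h
    obtain ⟨γ, hγ, hα, hσ⟩ := BicomodAlg.exists_of_iso_twisted h
    rw [OneMemClass.coe_one, mul_one] at hσ
    -- Almost laziness is automatic, since ∂γ is the lazy cocycle σ.
    have hm : γ ∈ RegAL k A := ⟨hγ, by rw [← hσ]; exact σ.2.1⟩
    refine ⟨⟨γ, hm⟩⁻¹, BialgEquiv.ext fun a => (LinearMap.congr_fun hα a).symm, ?_⟩
    rw [inv_inv]
    exact Subtype.ext hσ.symm
  · rintro ⟨γ, rfl, rfl⟩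
    refine BicomodAlg.iso_twisted_of_eq (γ := (γ⁻¹ : RegAL k A).1) (γ⁻¹).2.1 ?_ ?_
    · rw [h1, Subgroup.coe_inv, inv_inv]
      rfl
    · rw [OneMemClass.coe_one, mul_one]
      rfl

theorem upsilon_eq_one_iff (x : CoOutH2L k A) :
    upsilon x = BiGal.mk (BiGal.tw 1 1) ↔ x ∈ (iota k A).range := by
  obtain ⟨α, σ⟩ := x
  constructor
  · intro h
    induction α using QuotientGroup.induction_on with
    | H α =>
    induction σ using QuotientGroup.induction_on with
    | H σ =>
      obtain ⟨γ, rfl, rfl⟩ := (mk_tw_eq_one_iff σ α).1 h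
      exact ⟨QuotientGroup.mk γ, rfl⟩
  · rintro ⟨y, hy⟩
    rw [← hy]
    induction y using QuotientGroup.induction_on with
    | H γ => exact (mk_tw_eq_one_iff _ _).2 ⟨γ, rfl, rfl⟩

end

end LazyCoh

end

theorem theorem3p14 {k : Type*} {A : Type*} [CommRing k] [Nontrivial k] [Ring A]
    [HopfAlgebra k A] [Module.Flat k A] :
    ∃ G : Group (BiGal k A), IsCotensorGroup k A G ∧
      ∃ (ι : CoOutMinus k A →* CoOutH2L k A) (Υ : CoOutH2L k A →* BiGal k A),
        (∀ γ : RegAL k A, ι (QuotientGroup.mk γ) =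
          ⟨QuotientGroup.mk (adHom k A γ), QuotientGroup.mk (delAL γ⁻¹)⟩) ∧
        (∀ (α : A ≃ₐc[k] A) (σ : Z2L k A),
          ∃ h : (twisted σ α).IsBiGalois ∧ Module.FaithfullyFlat k (twisted σ α).carrier,
            Υ ⟨QuotientGroup.mk α, QuotientGroup.mk σ⟩ = BiGal.mk ⟨twisted σ α, h⟩) ∧
        Function.Injective ι ∧ ι.range = Υ.ker := by
  obtain ⟨G, hG, h1⟩ := BiGal.exists_group k A
  exact ⟨G, hG, iota k A, MonoidHom.mk' upsilon (upsilon_mul hG), fun γ => rfl,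
    fun α σ => ⟨BicomodAlg.twisted_isBiGalois σ α, rfl⟩, iota_injective k A,
    Subgroup.ext fun x => (upsilon_eq_one_iff x).symm.trans (by
      -- Membership in the kernel is equality with the unit of `G`, which is the class of the object
      -- for σ = 1 and α = 1.
      rw [← h1]
      rfl)⟩
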